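/- **Setting.** Let $B_n$ ($n\ge 1$) be the braid group with standard generators $\sigma_1,\dots,\sigma_{n-1}$, let $w:B_n\to\mathbb Z$, $\sigma_k\mapsto 1$, be the writhe, $R=\mathbb Z[\lambda^{\pm1},\mu^{\pm1}]$. Positive stabilization sends $B\in B_n$ to $B\sigma_n\in B_{n+1}$ (equivalently, up to conjugation, to $B\sigma_0$ with strands numbered $0,\dots,n$). A transverse knot or link is an equivalence class of braids modulo conjugation and positive stabilization and destabilization. Let $\mathcal A_n$ be the tensor algebra over $R[U,V]$ on $a_{ij}$, $1\le i\ne j\le n$. Let $\phi:B_n\to\mathrm{Aut}(\mathcal A_n)$, $B\mapsto\phi_B$, be the homomorphism for which $\phi_{\sigma_k}$ sends, for $i,j\ne k,k+1$, $a_{ki}\mapsto -a_{k+1,i}-a_{k+1,k}a_{ki}$, $a_{ik}\mapsto -a_{i,k+1}-a_{ik}a_{k,k+1}$, $a_{k+1,i}\mapsto a_{ki}$, $a_{i,k+1}\mapsto a_{ik}$, $a_{k,k+1}\mapsto a_{k+1,k}$, $a_{k+1,k}\mapsto a_{k,k+1}$, $a_{ij}\mapsto a_{ij}$. Adding an $(n+1)$-st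 strand to $B$ gives an automorphism $\phi_B^{\mathrm{ext}}$ of $\mathcal A_{n+1}$; define $n\times n$ matrices $\Phi^L_B,\Phi^R_B$ over $\mathcal A_n$ by $\phi_B^{\mathrm{ext}}(a_{i,n+1})=\sum_{\ell}(\Phi^L_B)_{i\ell}a_{\ell,n+1}$ and $\phi_B^{\mathrm{ext}}(a_{n+1,i})=\sum_{\ell}a_{n+1,\ell}(\Phi^R_B)_{\ell i}$. Put $\Lambda_B=\mathrm{diag}(\lambda\mu^{-w(B)},1,\dots,1)$. The transverse complex $CT^-_*(B)$ is the tensor algebra over $R[U,V]$ on $a_{ij}$ ($i\neq j$) of degree $0$, $b_{ij}$ ($i\ne j$), $c_{ij},d_{ij}$ of degree $1$, and $e_{ij},f_{ij}$ of degree $2$ ($1\le i,j\le n$). Let $\mathbf A=(a_{ij})$ with $a_{ii}=-2$, $\mathbf B=(b_{ij})$ with $b_{ii}=0$, and $\mathbf C,\mathbf D,\mathbf E,\mathbf F$ the matrices of the other generators. Let $\hat{\mathbf A}_{ij}$ be $a_{ij}$, $-1-\mu U$, $\mu Ua_{ij}$ and $\check{\mathbf A}_{ij}$ be $Va_{ij}$,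 $-V-\mu$, $\mu a_{ij}$ for $i>j$, $i=j$, $i<j$ respectively, and let $\hat{\mathbf B}_{ij}$ be $b_{ij},0,\mu Ub_{ij}$ and $\check{\mathbf B}_{ij}$ be $Vb_{ij},0,\mu b_{ij}$ likewise. The differential $\partial^-(B)$ obeys the signed Leibniz rule and $$\partial^-\mathbf A=0,\quad \partial^-\mathbf B=\mathbf A-\Lambda_B\,\phi_B(\mathbf A)\,\Lambda_B^{-1},\quad \partial^-\mathbf C=\hat{\mathbf A}-\Lambda_B\Phi^L_B\check{\mathbf A},\quad \partial^-\mathbf D=\check{\mathbf A}-\hat{\mathbf A}\Phi^R_B\Lambda_B^{-1},$$ $$\partial^-\mathbf E=\hat{\mathbf B}-\mathbf C-\Lambda_B\Phi^L_B\mathbf D,\quad \partial^-\mathbf F=\check{\mathbf B}-\mathbf D-\mathbf C\Phi^R_B\Lambda_B^{-1}.$$ The framed knot DGA of the closure of $B$ (with framing $0$) is the DGA over $R$ with generators and degrees as above, $\Phi^L_B,\Phi^R_B,\phi_B$ formed over $R$, and, with $A_{ij}$ equal to $a_{ij},-1-\mu,\mu a_{ij}$ and $B_{ij}$ equal to $b_{ij},0,\mu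 b_{ij}$ for $i>j$, $i=j$, $i<j$: $\partial A=0$, $\partial B=A-\Lambda_B\phi_B(A)\Lambda_B^{-1}$, $\partial C=A-\Lambda_B\Phi^L_BA$, $\partial D=A-A\Phi^R_B\Lambda_B^{-1}$, $\partial E=B-D-C\Phi^R_B\Lambda_B^{-1}$, $\partial F=B-C-\Lambda_B\Phi^L_BD$ (here $A,B,C,D,E,F$ are matrices of generators). For finitely generated semifree DGAs over a commutative ring $\mathcal R$: an elementary automorphism sends one generator $x$ to $\alpha x+v$, with $\alpha\in\mathcal R^\times$ and $v$ of degree $|x|$ not involving $x$, and fixes the other generators; a tame isomorphism is a composition of elementary automorphisms followed by a degree-preserving bijection of generators that intertwines the differentials; a stabilization adds generators $e_1,e_2$ with $|e_1|=|e_2|+1$, $\partial e_1=e_2$, $\partial e_2=0$; two DGAs are stable tame isomorphic if they become tamely isomorphic after some number of stabilizations of each. **Theorem 1.2.** Let $B$ be a braid whose closure is a knot (has one component). 1. $(CT^-_*(B),\partial^-(B))$ is a differential graded algebra over $R[U,V]$: $\partial^-(B)$ lowers degree by one and squares to zero. 2. If $\tilde B$ is a conjugate of $B$ or a positive stabilization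 of $B$, then $(CT^-_*(B),\partial^-(B))$ and $(CT^-_*(\tilde B),\partial^-(\tilde B))$ are stable tame isomorphic. 3. If $B'$ is any braid that represents the same transverse knot as $B$, then $(CT^-_*(B),\partial^-(B))$ and $(CT^-_*(B'),\partial^-(B'))$ are stable tame isomorphic, and their homologies $HT^-_*(B)$ and $HT^-_*(B')$ are isomorphic as graded $R[U,V]$-algebras. 4. Setting $U=V=1$ in $(CT^-_*(B),\partial^-(B))$ yields the framed knot DGA of the closure of $B$, under the correspondence of generators $a_{ij}\mapsto a_{ij}$, $b_{ij}\mapsto b_{ij}$, $c_{ij}\mapsto c_{ij}$, $d_{ij}\mapsto d_{ij}$, $e_{ij}\mapsto f_{ij}$, $f_{ij}\mapsto e_{ij}$. -/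

import Mathlib

namespace TransverseHomology

noncomputable section

/-- The data of a finitely generated semifree unital noncommutative differential graded algebra
over `𝓡`: a finite set of generators, their degrees, and the values of the differential on the
generators. The underlying algebra is the free (tensor) algebra on the generators. The conditions
that the differential lowers degree by one and squares to zero are the predicate `IsDGA`. -/
structure PreDGA (𝓡 : Type) [CommRing 𝓡] where
  gen : Type
  finite : Finite gen
  deg : gen → ℤ
  dGen : gen → FreeAlgebra 𝓡 gen

namespace PreDGA

section

variable {𝓡 : Type} [CommRing 𝓡]

/-- The underlying algebra. -/
abbrev Alg (S : PreDGA 𝓡) : Type := FreeAlgebra 𝓡 S.gen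

/-- The generators as elements of the algebra. -/
abbrev var (S : PreDGA 𝓡) (x : S.gen) : S.Alg := FreeAlgebra.ι 𝓡 x

/-- The sign automorphism: `w ↦ (-1)^|w| w` on words `w`. -/
def sgn (S : PreDGA 𝓡) : S.Alg →ₐ[𝓡] S.Alg :=
  FreeAlgebra.lift 𝓡 fun x => ((S.deg x).negOnePow : ℤ) • S.var x

/-- Auxiliary algebra map `w ↦ [[(-1)^|w| w, ∂w], [0, w]]`; its multiplicativity is the signed
Leibniz rule. -/
def dAux (S : PreDGA 𝓡) : S.Alg →ₐ[𝓡] Matrix (Fin 2) (Fin 2) S.Alg :=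
  FreeAlgebra.lift 𝓡 fun x => !![S.sgn (S.var x), S.dGen x; 0, S.var x]

/-- The differential: the unique linear map with the prescribed values on generators that
satisfies the signed Leibniz rule, see `d_var` and `d_mul`. -/
def d (S : PreDGA 𝓡) : S.Alg →ₗ[𝓡] S.Alg :=
  Matrix.entryLinearMap 𝓡 S.Alg 0 1 ∘ₗ S.dAux.toLinearMap

theorem d_var (S : PreDGA 𝓡) (x : S.gen) : S.d (S.var x) = S.dGen x := by
  simp [d, dAux]

theorem dAux_entries (S : PreDGA 𝓡) (w : S.Alg) :
    S.dAux w 0 0 = S.sgn w ∧ S.dAux w 1 0 = 0 ∧ S.dAux w 1 1 = w := by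
  induction w using FreeAlgebra.induction with
  | grade0 r => simp [Matrix.algebraMap_matrix_apply]
  | grade1 x => simp [dAux]
  | mul u v hu hv => simp [Matrix.mul_apply, Fin.sum_univ_two, hu, hv]
  | add u v hu hv => simp [hu, hv]

theorem d_mul (S : PreDGA 𝓡) (u v : S.Alg) :
    S.d (u * v) = S.d u * v + S.sgn u * S.d v := by
  have hu := S.dAux_entries u
  have hv := S.dAux_entries v
  simp [d, Matrix.mul_apply, Fin.sum_univ_two, hu, hv, add_comm]

theorem d_algebraMap (S : PreDGA 𝓡) (r : 𝓡) : S.d (algebraMap 𝓡 S.Alg r) = 0 := by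
  simp [d, Matrix.algebraMap_matrix_apply]

/-- The elements of degree `k`: linear combinations of words of total degree `k`. -/
def homogeneous (S : PreDGA 𝓡) (k : ℤ) : Submodule 𝓡 S.Alg :=
  Submodule.span 𝓡 {w | ∃ l : List S.gen, (l.map S.deg).sum = k ∧ (l.map S.var).prod = w}

/-- `S` is a differential graded algebra: `∂` has degree `-1` and `∂² = 0`. -/
def IsDGA (S : PreDGA 𝓡) : Prop :=
  (∀ k, ∀ w ∈ S.homogeneous k, S.d w ∈ S.homogeneous (k - 1)) ∧ ∀ w, S.d (S.d w) = 0

/-- The subalgebra of cycles. -/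
def cycles (S : PreDGA 𝓡) : Subalgebra 𝓡 S.Alg where
  carrier := {w | S.d w = 0}
  mul_mem' := fun {u v} hu hv => by
    change _ = 0 at hu hv
    change _ = 0
    simp [d_mul, hu, hv]
  add_mem' := fun {u v} hu hv => by
    change _ = 0 at hu hv
    change _ = 0
    simp [hu, hv]
  algebraMap_mem' := fun r => S.d_algebraMap r

/-- The homology algebra: the algebra of cycles modulo boundaries. (For a DGA the boundaries
form a two-sided ideal of the algebra of cycles, and this is the quotient by that ideal.) -/
abbrev Homology (S : PreDGA 𝓡) : Type :=
  RingQuot fun x y : S.cycles => ∃ w : S.Alg, S.d w = (x : S.Alg) - (y : S.Alg)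

/-- The degree `k` part of the homology: the classes of the cycles of degree `k`. -/
def homologyDegree (S : PreDGA 𝓡) (k : ℤ) : Submodule 𝓡 S.Homology :=
  ((S.homogeneous k).comap S.cycles.val.toLinearMap).map
    (RingQuot.mkAlgHom 𝓡
      fun x y : S.cycles => ∃ w : S.Alg, S.d w = (x : S.Alg) - (y : S.Alg)).toLinearMap

/-- The homologies are isomorphic as graded `𝓡`-algebras. -/
def HomologyIso (S T : PreDGA 𝓡) : Prop :=
  ∃ f : S.Homology ≃ₐ[𝓡] T.Homology,
    ∀ k, (S.homologyDegree k).map f.toLinearMap = T.homologyDegree k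

/-- Elementary automorphisms: `x ↦ α x + v` for one generator `x`, with `α` a unit of `𝓡` and `v`
an element not involving `x`, of the same degree as `x`; all other generators are fixed. -/
def IsElementary (S : PreDGA 𝓡) (g : S.Alg ≃ₐ[𝓡] S.Alg) : Prop :=
  ∃ (x : S.gen) (α : 𝓡ˣ) (v : S.Alg),
    v ∈ Algebra.adjoin 𝓡 (S.var '' {y | y ≠ x}) ∧ v ∈ S.homogeneous (S.deg x) ∧
    g (S.var x) = (α : 𝓡) • S.var x + v ∧ ∀ y, y ≠ x → g (S.var y) = S.var y

/-- The algebra map induced by a map of generators. -/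
def relabel {S T : PreDGA 𝓡} (e : S.gen → T.gen) : S.Alg →ₐ[𝓡] T.Alg :=
  FreeAlgebra.lift 𝓡 fun x => T.var (e x)

/-- `S` and `T` are tamely isomorphic: there is a composition of elementary automorphisms of `S`
followed by a degree preserving bijection of the generators that intertwines the differentials. -/
def TameIso (S T : PreDGA 𝓡) : Prop :=
  ∃ g ∈ Submonoid.closure {g : S.Alg ≃ₐ[𝓡] S.Alg | S.IsElementary g},
    ∃ e : S.gen ≃ T.gen, (∀ x, T.deg (e x) = S.deg x) ∧
      ∀ w, relabel (T := T) e (g (S.d w)) = T.d (relabel (T := T) e (g w))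

/-- The stabilization with two new generators `e₁ = Sum.inr 0` of degree `k + 1` and
`e₂ = Sum.inr 1` of degree `k`, and `∂ e₁ = e₂`, `∂ e₂ = 0`. -/
def stabilize (S : PreDGA 𝓡) (k : ℤ) : PreDGA 𝓡 where
  gen := S.gen ⊕ Fin 2
  finite := haveI := S.finite; inferInstance
  deg := Sum.elim S.deg ![k + 1, k]
  dGen := Sum.elim
    (fun x => FreeAlgebra.lift 𝓡 (fun y => FreeAlgebra.ι 𝓡 (Sum.inl y)) (S.dGen x))
    ![FreeAlgebra.ι 𝓡 (Sum.inr 1), 0]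

/-- Iterated stabilization, with a list of degrees. -/
def stabilizeList (S : PreDGA 𝓡) : List ℤ → PreDGA 𝓡
  | [] => S
  | k :: l => (S.stabilize k).stabilizeList l

/-- Stable tame isomorphism: tame isomorphism after some number of stabilizations of each. -/
def StableTameIso (S T : PreDGA 𝓡) : Prop :=
  ∃ l l' : List ℤ, TameIso (S.stabilizeList l) (T.stabilizeList l')

/-- The bijection `e` of the generators preserves degrees and intertwines the differentials. -/
def IsRelabelling (S T : PreDGA 𝓡) (e : S.gen ≃ T.gen) : Prop :=
  (∀ x, T.deg (e x) = S.deg x) ∧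
    ∀ w, relabel (T := T) e (S.d w) = T.d (relabel (T := T) e w)

/-- Extension of scalars along a ring homomorphism `f`: same generators and degrees, and `f` is
applied to the coefficients of the differentials of the generators. -/
def baseChange {𝓢 : Type} [CommRing 𝓢] (S : PreDGA 𝓡) (f : 𝓡 →+* 𝓢) : PreDGA 𝓢 where
  gen := S.gen
  finite := S.finite
  deg := S.deg
  dGen := fun x =>
    letI : Algebra 𝓡 𝓢 := f.toAlgebra
    FreeAlgebra.lift 𝓡 (fun y => FreeAlgebra.ι 𝓢 y) (S.dGen x)

end

end PreDGA


/-- Ordered pairs of distinct elements of `I`. -/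
abbrev OffDiag (I : Type) : Type := {p : I × I // p.1 ≠ p.2}

/-- The tensor algebra `𝓐_I` over `𝓡` on the variables `a_ij`, `i ≠ j` in `I`. -/
abbrev CordAlg (𝓡 : Type) [CommRing 𝓡] (I : Type) : Type := FreeAlgebra 𝓡 (OffDiag I)

section Cord

variable (𝓡 : Type) [CommRing 𝓡] {I J : Type} [DecidableEq I] [DecidableEq J]

/-- The variables `a_ij` for `i ≠ j`, with the convention `a_ii = -2`. -/
def av (i j : I) : CordAlg 𝓡 I :=
  if h : i ≠ j then FreeAlgebra.ι 𝓡 ⟨(i, j), h⟩ else -2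

/-- Image of `a_ij` (`i ≠ j`) under the automorphism of a positive crossing of the strands
`p = k` and `q = k + 1`. -/
def crossVal (p q i j : I) : CordAlg 𝓡 I :=
  if i = p then
    if j = q then av 𝓡 q p else -av 𝓡 q j - av 𝓡 q p * av 𝓡 p j
  else if i = q then
    if j = p then av 𝓡 p q else av 𝓡 p j
  else if j = p then -av 𝓡 i q - av 𝓡 i p * av 𝓡 p q
  else if j = q then av 𝓡 i p
  else av 𝓡 i j

/-- Image of `a_ij` (`i ≠ j`) under the inverse automorphism. -/
def crossInvVal (p q i j : I) : CordAlg 𝓡 I :=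
  if i = q then
    if j = p then av 𝓡 p q else -av 𝓡 p j - av 𝓡 p q * av 𝓡 q j
  else if i = p then
    if j = q then av 𝓡 q p else av 𝓡 q j
  else if j = q then -av 𝓡 i p - av 𝓡 i q * av 𝓡 q p
  else if j = p then av 𝓡 i q
  else av 𝓡 i j

def crossHom (p q : I) : CordAlg 𝓡 I →ₐ[𝓡] CordAlg 𝓡 I :=
  FreeAlgebra.lift 𝓡 fun x => crossVal 𝓡 p q x.1.1 x.1.2

def crossInvHom (p q : I) : CordAlg 𝓡 I →ₐ[𝓡] CordAlg 𝓡 I :=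
  FreeAlgebra.lift 𝓡 fun x => crossInvVal 𝓡 p q x.1.1 x.1.2

theorem crossHom_av (p q : I) {i j : I} (h : i ≠ j) :
    crossHom 𝓡 p q (av 𝓡 i j) = crossVal 𝓡 p q i j := by
  simp [crossHom, av, h]

theorem crossInvHom_av (p q : I) {i j : I} (h : i ≠ j) :
    crossInvHom 𝓡 p q (av 𝓡 i j) = crossInvVal 𝓡 p q i j := by
  simp [crossInvHom, av, h]

theorem cordAlg_hom_ext {B : Type} [Ring B] [Algebra 𝓡 B] {f g : CordAlg 𝓡 I →ₐ[𝓡] B}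
    (h : ∀ i j, i ≠ j → f (av 𝓡 i j) = g (av 𝓡 i j)) : f = g := by
  apply FreeAlgebra.hom_ext
  funext x
  have := h x.1.1 x.1.2 x.2
  simpa [av, x.2] using this

theorem crossInv_cross {p q : I} (hpq : p ≠ q) :
    (crossInvHom 𝓡 p q).comp (crossHom 𝓡 p q) = AlgHom.id 𝓡 _ := by
  apply cordAlg_hom_ext
  intro i j hij
  rw [AlgHom.comp_apply, crossHom_av 𝓡 p q hij]
  by_cases h1 : i = p <;> by_cases h2 : i = q <;> by_cases h3 : j = p <;> by_cases h4 : j = q <;>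
    simp_all [crossVal, crossInvHom_av, crossInvVal, Ne.symm]

theorem cross_crossInv {p q : I} (hpq : p ≠ q) :
    (crossHom 𝓡 p q).comp (crossInvHom 𝓡 p q) = AlgHom.id 𝓡 _ := by
  apply cordAlg_hom_ext
  intro i j hij
  rw [AlgHom.comp_apply, crossInvHom_av 𝓡 p q hij]
  by_cases h1 : i = p <;> by_cases h2 : i = q <;> by_cases h3 : j = p <;> by_cases h4 : j = q <;>
    simp_all [crossVal, crossHom_av, crossInvVal, Ne.symm]


/-- The automorphism of `𝓐_I` given by a positive crossing of the strands `p = k`, `q = k + 1`. -/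
def crossAut {p q : I} (hpq : p ≠ q) : CordAlg 𝓡 I ≃ₐ[𝓡] CordAlg 𝓡 I :=
  AlgEquiv.ofAlgHom (crossHom 𝓡 p q) (crossInvHom 𝓡 p q)
    (cross_crossInv 𝓡 hpq) (crossInv_cross 𝓡 hpq)

theorem cross_comm {p q r s : I} (hpq : p ≠ q) (hrs : r ≠ s) (hpr : p ≠ r) (hps : p ≠ s)
    (hqr : q ≠ r) (hqs : q ≠ s) :
    (crossHom 𝓡 p q).comp (crossHom 𝓡 r s) = (crossHom 𝓡 r s).comp (crossHom 𝓡 p q) := by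
  apply cordAlg_hom_ext
  intro i j hij
  rw [AlgHom.comp_apply, AlgHom.comp_apply, crossHom_av 𝓡 r s hij, crossHom_av 𝓡 p q hij]
  have e : ∀ x : I, x = p ∨ x = q ∨ x = r ∨ x = s ∨ (x ≠ p ∧ x ≠ q ∧ x ≠ r ∧ x ≠ s) := by
    intro x; tauto
  rcases e i with rfl | rfl | rfl | rfl | ⟨_, _, _, _⟩ <;>
  rcases e j with rfl | rfl | rfl | rfl | ⟨_, _, _, _⟩ <;>
    simp_all [crossVal, crossHom_av, Ne.symm] <;> try noncomm_ring

theorem cross_braid {p q r : I} (hpq : p ≠ q) (hqr : q ≠ r) (hpr : p ≠ r) :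
    (crossHom 𝓡 p q).comp ((crossHom 𝓡 q r).comp (crossHom 𝓡 p q)) =
      (crossHom 𝓡 q r).comp ((crossHom 𝓡 p q).comp (crossHom 𝓡 q r)) := by
  apply cordAlg_hom_ext
  intro i j hij
  simp only [AlgHom.comp_apply]
  rw [crossHom_av 𝓡 q r hij, crossHom_av 𝓡 p q hij]
  have e : ∀ x : I, x = p ∨ x = q ∨ x = r ∨ (x ≠ p ∧ x ≠ q ∧ x ≠ r) := by
    intro x; tauto
  rcases e i with rfl | rfl | rfl | ⟨_, _, _⟩ <;>
  rcases e j with rfl | rfl | rfl | ⟨_, _, _⟩ <;>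
    simp_all [crossVal, crossHom_av, Ne.symm] <;> try noncomm_ring

end Cord

/-- Artin's relations among the generators `σ_1, …, σ_m` (indexed by `Fin m`). -/
def braidRels (m : ℕ) : Set (FreeGroup (Fin m)) :=
  {r | ∃ i j : Fin m, (i : ℕ) + 2 ≤ j ∧
      r = FreeGroup.of i * FreeGroup.of j * (FreeGroup.of j * FreeGroup.of i)⁻¹} ∪
  {r | ∃ i j : Fin m, (i : ℕ) + 1 = j ∧
      r = FreeGroup.of i * FreeGroup.of j * FreeGroup.of i *
        (FreeGroup.of j * FreeGroup.of i * FreeGroup.of j)⁻¹}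

/-- The braid group `B_n` on `n = m + 1 ≥ 1` strands; the strands are numbered by `Fin (m + 1)`
and the generator `k : Fin m` crosses the strands `k.castSucc` and `k.succ`. -/
abbrev BraidGroup (m : ℕ) : Type := PresentedGroup (braidRels m)

/-- The standard generators. -/
abbrev sigma {m : ℕ} (k : Fin m) : BraidGroup m := PresentedGroup.of k

/-- Homomorphisms out of the braid group. -/
def braidLift {m : ℕ} {G : Type} [Group G] (f : Fin m → G)
    (h₁ : ∀ i j : Fin m, (i : ℕ) + 2 ≤ j → f i * f j = f j * f i)
    (h₂ : ∀ i j : Fin m, (i : ℕ) + 1 = j → f i * f j * f i = f j * f i * f j) :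
    BraidGroup m →* G :=
  PresentedGroup.toGroup (f := f) (by
    rintro r (⟨i, j, hij, rfl⟩ | ⟨i, j, hij, rfl⟩)
    · simpa [mul_inv_eq_one, ← mul_assoc] using congrArg (· * (f j * f i)⁻¹) (h₁ i j hij)
    · simpa [mul_inv_eq_one, ← mul_assoc] using
        congrArg (· * (f j * f i * f j)⁻¹) (h₂ i j hij))

theorem braidLift_sigma {m : ℕ} {G : Type} [Group G] (f : Fin m → G) (h₁ h₂) (k : Fin m) :
    braidLift f h₁ h₂ (sigma k) = f k :=
  PresentedGroup.toGroup.of _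

theorem sigma_comm {m : ℕ} (i j : Fin m) (h : (i : ℕ) + 2 ≤ j) :
    sigma i * sigma j = sigma j * sigma i :=
  PresentedGroup.mk_eq_mk_of_mul_inv_mem (Or.inl ⟨i, j, h, rfl⟩)

theorem sigma_braid {m : ℕ} (i j : Fin m) (h : (i : ℕ) + 1 = j) :
    sigma i * sigma j * sigma i = sigma j * sigma i * sigma j :=
  PresentedGroup.mk_eq_mk_of_mul_inv_mem (Or.inr ⟨i, j, h, rfl⟩)

/-- The writhe (algebraic crossing number). -/
def writheHom (m : ℕ) : BraidGroup m →* Multiplicative ℤ :=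
  braidLift (fun _ => Multiplicative.ofAdd 1) (fun _ _ _ => rfl) (fun _ _ _ => rfl)

def writhe {m : ℕ} (B : BraidGroup m) : ℤ := Multiplicative.toAdd (writheHom m B)

/-- The permutation of the strands. -/
def braidPerm (m : ℕ) : BraidGroup m →* Equiv.Perm (Fin (m + 1)) :=
  braidLift (fun k => Equiv.swap k.castSucc k.succ)
    (fun i j h => by
      refine (Equiv.Perm.disjoint_swap_swap ?_).commute.eq
      simp [Fin.ext_iff]
      omega)
    (fun i j h => by
      have e : j.castSucc = i.succ := by simp [Fin.ext_iff]; omega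
      rw [e]
      have h1 : i.castSucc ≠ i.succ := by simp [Fin.ext_iff]
      have h2 : i.succ ≠ j.succ := by simp [Fin.ext_iff]; omega
      have h3 : i.castSucc ≠ j.succ := by simp [Fin.ext_iff]; omega
      rw [Equiv.swap_mul_swap_mul_swap h1 h3, Equiv.swap_comm i.castSucc i.succ,
        Equiv.swap_comm i.succ j.succ, Equiv.swap_mul_swap_mul_swap h2.symm h3.symm,
        Equiv.swap_comm])

/-- The closure of the braid is a one-component link: the permutation is transitive. -/
def ClosureIsKnot {m : ℕ} (B : BraidGroup m) : Prop :=
  ∀ i j : Fin (m + 1), (braidPerm m B).SameCycle i j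

/-- The inclusion `B_n → B_{n+1}` that adds a strand after the last one. -/
def addStrandRight (m : ℕ) : BraidGroup m →* BraidGroup (m + 1) :=
  braidLift (fun k => sigma k.castSucc) (fun i j h => sigma_comm _ _ (by simpa using h))
    (fun i j h => sigma_braid _ _ (by simpa using h))

/-- The inclusion `B_n → B_{n+1}` that adds a strand before the first one. -/
def addStrandLeft (m : ℕ) : BraidGroup m →* BraidGroup (m + 1) :=
  braidLift (fun k => sigma k.succ) (fun i j h => sigma_comm _ _ (by simp; omega))
    (fun i j h => sigma_braid _ _ (by simp; omega))

/-- The homomorphism `B ↦ φ_B` from the braid group to the automorphisms of `𝓐_n`. -/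
def braidAut (𝓡 : Type) [CommRing 𝓡] (m : ℕ) :
    BraidGroup m →* (CordAlg 𝓡 (Fin (m + 1)) ≃ₐ[𝓡] CordAlg 𝓡 (Fin (m + 1))) :=
  braidLift (fun k => crossAut 𝓡 (p := k.castSucc) (q := k.succ) Fin.castSucc_lt_succ.ne)
    (fun i j h => by
      apply AlgEquiv.coe_toAlgHom_injective
      apply cross_comm <;> simp [Fin.ext_iff] <;> omega)
    (fun i j h => by
      apply AlgEquiv.coe_toAlgHom_injective
      have e : j.castSucc = i.succ := by simp [Fin.ext_iff]; omega
      have := cross_braid 𝓡 (p := i.castSucc) (q := i.succ) (r := j.succ)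
        (by simp [Fin.ext_iff]) (by simp [Fin.ext_iff]; omega) (by simp [Fin.ext_iff]; omega)
      rw [← e] at this
      simp only [crossAut]
      simp only [← e]
      exact this)

/-- The inclusion `𝓐_n → 𝓐_{n+1}` for a strand added after the last one. -/
def cordIncl (𝓡 : Type) [CommRing 𝓡] (m : ℕ) :
    CordAlg 𝓡 (Fin (m + 1)) →ₐ[𝓡] CordAlg 𝓡 (Fin (m + 2)) :=
  FreeAlgebra.lift 𝓡 fun x => av 𝓡 x.1.1.castSucc x.1.2.castSucc

/-- The automorphism `φ_B^ext` of `𝓐_{n+1}`. -/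
def braidAutExt (𝓡 : Type) [CommRing 𝓡] {m : ℕ} (B : BraidGroup m) :
    CordAlg 𝓡 (Fin (m + 2)) ≃ₐ[𝓡] CordAlg 𝓡 (Fin (m + 2)) :=
  braidAut 𝓡 (m + 1) (addStrandRight m B)


section Ext

variable (𝓡 : Type) [CommRing 𝓡] {m : ℕ}

theorem cordIncl_av (i j : Fin (m + 1)) :
    cordIncl 𝓡 m (av 𝓡 i j) = av 𝓡 i.castSucc j.castSucc := by
  by_cases h : i = j
  · subst h; simp [av, map_ofNat]
  · have : av 𝓡 i j = FreeAlgebra.ι 𝓡 ⟨(i, j), h⟩ := by simp [av, h]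
    rw [this]; simp [cordIncl]

/-- `c ↦ ∑ c_ℓ a_{ℓ,n+1}`. -/
def leftComb (c : Fin (m + 1) → CordAlg 𝓡 (Fin (m + 1))) : CordAlg 𝓡 (Fin (m + 2)) :=
  ∑ l, cordIncl 𝓡 m (c l) * av 𝓡 l.castSucc (Fin.last (m + 1))

/-- `c ↦ ∑ a_{n+1,ℓ} c_ℓ`. -/
def rightComb (c : Fin (m + 1) → CordAlg 𝓡 (Fin (m + 1))) : CordAlg 𝓡 (Fin (m + 2)) :=
  ∑ l, av 𝓡 (Fin.last (m + 1)) l.castSucc * cordIncl 𝓡 m (c l)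

theorem leftComb_add (c c' : Fin (m + 1) → CordAlg 𝓡 (Fin (m + 1))) :
    leftComb 𝓡 (c + c') = leftComb 𝓡 c + leftComb 𝓡 c' := by
  simp [leftComb, add_mul, Finset.sum_add_distrib]

theorem rightComb_add (c c' : Fin (m + 1) → CordAlg 𝓡 (Fin (m + 1))) :
    rightComb 𝓡 (c + c') = rightComb 𝓡 c + rightComb 𝓡 c' := by
  simp [rightComb, mul_add, Finset.sum_add_distrib]

theorem leftComb_mul (x : CordAlg 𝓡 (Fin (m + 1))) (c : Fin (m + 1) → CordAlg 𝓡 (Fin (m + 1))) :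
    leftComb 𝓡 (fun l => x * c l) = cordIncl 𝓡 m x * leftComb 𝓡 c := by
  simp [leftComb, Finset.mul_sum, mul_assoc]

theorem rightComb_mul (x : CordAlg 𝓡 (Fin (m + 1))) (c : Fin (m + 1) → CordAlg 𝓡 (Fin (m + 1))) :
    rightComb 𝓡 (fun l => c l * x) = rightComb 𝓡 c * cordIncl 𝓡 m x := by
  simp [rightComb, Finset.sum_mul, mul_assoc]

theorem leftComb_single (i : Fin (m + 1)) :
    leftComb 𝓡 (Pi.single i 1) = av 𝓡 i.castSucc (Fin.last (m + 1)) := by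
  rw [leftComb, Finset.sum_eq_single i] <;> simp +contextual

theorem rightComb_single (i : Fin (m + 1)) :
    rightComb 𝓡 (Pi.single i 1) = av 𝓡 (Fin.last (m + 1)) i.castSucc := by
  rw [rightComb, Finset.sum_eq_single i] <;> simp +contextual

def leftSub (m : ℕ) : AddSubmonoid (CordAlg 𝓡 (Fin (m + 2))) where
  carrier := Set.range (leftComb 𝓡 (m := m))
  zero_mem' := ⟨0, by simp [leftComb]⟩
  add_mem' := by
    rintro _ _ ⟨c, rfl⟩ ⟨c', rfl⟩
    exact ⟨c + c', leftComb_add 𝓡 c c'⟩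

def rightSub (m : ℕ) : AddSubmonoid (CordAlg 𝓡 (Fin (m + 2))) where
  carrier := Set.range (rightComb 𝓡 (m := m))
  zero_mem' := ⟨0, by simp [rightComb]⟩
  add_mem' := by
    rintro _ _ ⟨c, rfl⟩ ⟨c', rfl⟩
    exact ⟨c + c', rightComb_add 𝓡 c c'⟩

theorem leftSub_av (i : Fin (m + 1)) : av 𝓡 i.castSucc (Fin.last (m + 1)) ∈ leftSub 𝓡 m :=
  ⟨_, leftComb_single 𝓡 i⟩

theorem rightSub_av (i : Fin (m + 1)) : av 𝓡 (Fin.last (m + 1)) i.castSucc ∈ rightSub 𝓡 m :=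
  ⟨_, rightComb_single 𝓡 i⟩

theorem leftSub_mul {x y : CordAlg 𝓡 (Fin (m + 2))} (hx : x ∈ (cordIncl 𝓡 m).range)
    (hy : y ∈ leftSub 𝓡 m) : x * y ∈ leftSub 𝓡 m := by
  obtain ⟨x, rfl⟩ := hx
  obtain ⟨c, rfl⟩ := hy
  exact ⟨_, leftComb_mul 𝓡 x c⟩

theorem rightSub_mul {x y : CordAlg 𝓡 (Fin (m + 2))} (hx : x ∈ (cordIncl 𝓡 m).range)
    (hy : y ∈ rightSub 𝓡 m) : y * x ∈ rightSub 𝓡 m := by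
  obtain ⟨x, rfl⟩ := hx
  obtain ⟨c, rfl⟩ := hy
  exact ⟨_, rightComb_mul 𝓡 x c⟩

theorem leftSub_neg {y : CordAlg 𝓡 (Fin (m + 2))} (hy : y ∈ leftSub 𝓡 m) :
    -y ∈ leftSub 𝓡 m := by
  have := leftSub_mul 𝓡 (x := -1) (neg_mem (one_mem _)) hy
  simpa using this

theorem rightSub_neg {y : CordAlg 𝓡 (Fin (m + 2))} (hy : y ∈ rightSub 𝓡 m) :
    -y ∈ rightSub 𝓡 m := by
  have := rightSub_mul 𝓡 (x := -1) (neg_mem (one_mem _)) hy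
  simpa using this

theorem av_mem_range (i j : Fin (m + 1)) :
    av 𝓡 i.castSucc j.castSucc ∈ (cordIncl 𝓡 m).range :=
  ⟨_, cordIncl_av 𝓡 i j⟩

/-- Automorphisms of `𝓐_{n+1}` that respect the subalgebra `𝓐_n` and the expansions that
define `Φ^L` and `Φ^R`. -/
def Respects (g : CordAlg 𝓡 (Fin (m + 2)) →ₐ[𝓡] CordAlg 𝓡 (Fin (m + 2))) : Prop :=
  (∀ x, g (cordIncl 𝓡 m x) ∈ (cordIncl 𝓡 m).range) ∧
  (∀ i : Fin (m + 1), g (av 𝓡 i.castSucc (Fin.last (m + 1))) ∈ leftSub 𝓡 m) ∧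
  (∀ i : Fin (m + 1), g (av 𝓡 (Fin.last (m + 1)) i.castSucc) ∈ rightSub 𝓡 m)

theorem Respects.comp {g h : CordAlg 𝓡 (Fin (m + 2)) →ₐ[𝓡] CordAlg 𝓡 (Fin (m + 2))}
    (hg : Respects 𝓡 g) (hh : Respects 𝓡 h) : Respects 𝓡 (g.comp h) := by
  refine ⟨fun x => ?_, fun i => ?_, fun i => ?_⟩
  · obtain ⟨y, hy⟩ := hh.1 x
    rw [AlgHom.comp_apply, ← hy]
    exact hg.1 y
  · obtain ⟨c, hc⟩ := hh.2.1 i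
    rw [AlgHom.comp_apply, ← hc, leftComb, map_sum]
    refine sum_mem fun l _ => ?_
    rw [map_mul]
    exact leftSub_mul 𝓡 (hg.1 _) (hg.2.1 l)
  · obtain ⟨c, hc⟩ := hh.2.2 i
    rw [AlgHom.comp_apply, ← hc, rightComb, map_sum]
    refine sum_mem fun l _ => ?_
    rw [map_mul]
    exact rightSub_mul 𝓡 (hg.1 _) (hg.2.2 l)

theorem respects_id : Respects 𝓡 (AlgHom.id 𝓡 (CordAlg 𝓡 (Fin (m + 2)))) :=
  ⟨fun x => ⟨x, rfl⟩, leftSub_av 𝓡, rightSub_av 𝓡⟩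

theorem respects_of_av {g : CordAlg 𝓡 (Fin (m + 2)) →ₐ[𝓡] CordAlg 𝓡 (Fin (m + 2))}
    (h : ∀ i j : Fin (m + 1), i ≠ j → g (av 𝓡 i.castSucc j.castSucc) ∈ (cordIncl 𝓡 m).range) :
    ∀ x, g (cordIncl 𝓡 m x) ∈ (cordIncl 𝓡 m).range := by
  intro x
  induction x using FreeAlgebra.induction with
  | grade0 r =>
    rw [AlgHom.commutes, AlgHom.commutes]
    exact Subalgebra.algebraMap_mem _ r
  | grade1 x =>
    have := h x.1.1 x.1.2 x.2
    rw [← cordIncl_av] at this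
    simpa [av, x.2] using this
  | mul u v hu hv => rw [map_mul, map_mul]; exact mul_mem hu hv
  | add u v hu hv => rw [map_add, map_add]; exact add_mem hu hv

theorem respects_cross (p q : Fin (m + 1)) :
    Respects 𝓡 (crossHom 𝓡 p.castSucc q.castSucc) := by
  refine ⟨respects_of_av 𝓡 fun i j hij => ?_, fun i => ?_, fun i => ?_⟩
  · rw [crossHom_av _ _ _ (by simpa using hij), crossVal]
    split_ifs <;> first
      | exact av_mem_range 𝓡 _ _
      | exact sub_mem (neg_mem (av_mem_range 𝓡 _ _))
          (mul_mem (av_mem_range 𝓡 _ _) (av_mem_range 𝓡 _ _))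
  · have hl : ∀ r : Fin (m + 1), Fin.last (m + 1) ≠ r.castSucc :=
      fun r => (Fin.castSucc_lt_last r).ne'
    rw [crossHom_av _ _ _ (hl i).symm, crossVal]
    simp only [hl, if_false]
    split_ifs
    · rw [sub_eq_add_neg]
      exact add_mem (leftSub_neg 𝓡 (leftSub_av 𝓡 _))
        (leftSub_neg 𝓡 (leftSub_mul 𝓡 (av_mem_range 𝓡 _ _) (leftSub_av 𝓡 _)))
    · exact leftSub_av 𝓡 _
    · exact leftSub_av 𝓡 _
  · have hl : ∀ r : Fin (m + 1), Fin.last (m + 1) ≠ r.castSucc :=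
      fun r => (Fin.castSucc_lt_last r).ne'
    rw [crossHom_av _ _ _ (hl i), crossVal]
    simp only [hl, if_false]
    split_ifs
    · rw [sub_eq_add_neg]
      exact add_mem (rightSub_neg 𝓡 (rightSub_av 𝓡 _))
        (rightSub_neg 𝓡 (rightSub_mul 𝓡 (av_mem_range 𝓡 _ _) (rightSub_av 𝓡 _)))
    · exact rightSub_av 𝓡 _
    · exact rightSub_av 𝓡 _

theorem respects_crossInv (p q : Fin (m + 1)) :
    Respects 𝓡 (crossInvHom 𝓡 p.castSucc q.castSucc) := by
  refine ⟨respects_of_av 𝓡 fun i j hij => ?_, fun i => ?_, fun i => ?_⟩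
  · rw [crossInvHom_av _ _ _ (by simpa using hij), crossInvVal]
    split_ifs <;> first
      | exact av_mem_range 𝓡 _ _
      | exact sub_mem (neg_mem (av_mem_range 𝓡 _ _))
          (mul_mem (av_mem_range 𝓡 _ _) (av_mem_range 𝓡 _ _))
  · have hl : ∀ r : Fin (m + 1), Fin.last (m + 1) ≠ r.castSucc :=
      fun r => (Fin.castSucc_lt_last r).ne'
    rw [crossInvHom_av _ _ _ (hl i).symm, crossInvVal]
    simp only [hl, if_false]
    split_ifs
    · rw [sub_eq_add_neg]
      exact add_mem (leftSub_neg 𝓡 (leftSub_av 𝓡 _))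
        (leftSub_neg 𝓡 (leftSub_mul 𝓡 (av_mem_range 𝓡 _ _) (leftSub_av 𝓡 _)))
    · exact leftSub_av 𝓡 _
    · exact leftSub_av 𝓡 _
  · have hl : ∀ r : Fin (m + 1), Fin.last (m + 1) ≠ r.castSucc :=
      fun r => (Fin.castSucc_lt_last r).ne'
    rw [crossInvHom_av _ _ _ (hl i), crossInvVal]
    simp only [hl, if_false]
    split_ifs
    · rw [sub_eq_add_neg]
      exact add_mem (rightSub_neg 𝓡 (rightSub_av 𝓡 _))
        (rightSub_neg 𝓡 (rightSub_mul 𝓡 (av_mem_range 𝓡 _ _) (rightSub_av 𝓡 _)))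
    · exact rightSub_av 𝓡 _
    · exact rightSub_av 𝓡 _

theorem respects_braid (B : BraidGroup m) :
    Respects 𝓡 (braidAutExt 𝓡 B : CordAlg 𝓡 (Fin (m + 2)) →ₐ[𝓡] CordAlg 𝓡 (Fin (m + 2))) := by
  let H : Subgroup (BraidGroup m) :=
    { carrier := {B | Respects 𝓡 (braidAutExt 𝓡 B).toAlgHom ∧
        Respects 𝓡 (braidAutExt 𝓡 B⁻¹).toAlgHom}
      one_mem' := by
        have e : braidAutExt 𝓡 (1 : BraidGroup m) = 1 := by simp [braidAutExt]
        have e' : braidAutExt 𝓡 ((1 : BraidGroup m)⁻¹) = 1 := by simp [braidAutExt]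
        refine ⟨?_, ?_⟩
        · rw [e]; exact respects_id 𝓡
        · rw [e']; exact respects_id 𝓡
      mul_mem' := by
        intro a b ha hb
        have e : braidAutExt 𝓡 (a * b) = braidAutExt 𝓡 a * braidAutExt 𝓡 b := by
          simp [braidAutExt]
        have e' : braidAutExt 𝓡 ((a * b)⁻¹) = braidAutExt 𝓡 b⁻¹ * braidAutExt 𝓡 a⁻¹ := by
          simp [braidAutExt]
        refine ⟨?_, ?_⟩
        · rw [e]; exact ha.1.comp 𝓡 hb.1
        · rw [e']; exact hb.2.comp 𝓡 ha.2
      inv_mem' := by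
        intro a ha
        exact ⟨ha.2, by rw [inv_inv]; exact ha.1⟩ }
  refine (PresentedGroup.generated_by _ H (fun k => ?_) B).1
  have e : braidAutExt 𝓡 (sigma k) =
      crossAut 𝓡 (p := k.castSucc.castSucc) (q := k.castSucc.succ) Fin.castSucc_lt_succ.ne := by
    rw [braidAutExt, addStrandRight, braidLift_sigma, braidAut, braidLift_sigma]
  have e' : braidAutExt 𝓡 (sigma k)⁻¹ = (braidAutExt 𝓡 (sigma k)).symm := by
    rw [braidAutExt, map_inv, map_inv]; rfl
  refine ⟨?_, ?_⟩
  · change Respects 𝓡 (braidAutExt 𝓡 (sigma k)).toAlgHom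
    rw [e]; exact respects_cross 𝓡 k.castSucc k.succ
  · change Respects 𝓡 (braidAutExt 𝓡 (sigma k)⁻¹).toAlgHom
    rw [e', e]; exact respects_crossInv 𝓡 k.castSucc k.succ

/-- Auxiliary algebra map that reads off the coefficient of `a_{ℓ,n+1}` or `a_{n+1,ℓ}`. -/
def probe (l : Fin (m + 1)) :
    CordAlg 𝓡 (Fin (m + 2)) →ₐ[𝓡] Matrix (Fin 2) (Fin 2) (CordAlg 𝓡 (Fin (m + 1))) :=
  FreeAlgebra.lift 𝓡 fun x =>
    Fin.lastCases (motive := fun _ => Matrix (Fin 2) (Fin 2) (CordAlg 𝓡 (Fin (m + 1))))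
      (if x.1.2 = l.castSucc then !![0, 1; 0, 0] else 0)
      (fun i => Fin.lastCases (motive := fun _ => Matrix (Fin 2) (Fin 2) (CordAlg 𝓡 (Fin (m + 1))))
        (if i = l then !![0, 1; 0, 0] else 0)
        (fun j => !![av 𝓡 i j, 0; 0, av 𝓡 i j]) x.1.2) x.1.1

theorem probe_incl (l : Fin (m + 1)) (x : CordAlg 𝓡 (Fin (m + 1))) :
    probe 𝓡 l (cordIncl 𝓡 m x) = !![x, 0; 0, x] := by
  induction x using FreeAlgebra.induction with
  | grade0 r =>
    rw [AlgHom.commutes, AlgHom.commutes]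
    ext i j
    fin_cases i <;> fin_cases j <;> simp [Matrix.algebraMap_matrix_apply]
  | grade1 x =>
    obtain ⟨⟨i, j⟩, h⟩ := x
    have h' : i.castSucc ≠ j.castSucc := by simpa using h
    have h0 : i ≠ j := h
    simp [cordIncl, probe, av, h0]
  | mul u v hu hv => rw [map_mul, map_mul, hu, hv]; simp
  | add u v hu hv => rw [map_add, map_add, hu, hv]; simp

theorem probe_left (l : Fin (m + 1)) (c : Fin (m + 1) → CordAlg 𝓡 (Fin (m + 1))) :
    probe 𝓡 l (leftComb 𝓡 c) 0 1 = c l := by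
  have h : ∀ k : Fin (m + 1), probe 𝓡 l (av 𝓡 k.castSucc (Fin.last (m + 1))) =
      if k = l then !![0, 1; 0, 0] else 0 := by
    intro k
    simp [probe, av, (Fin.castSucc_lt_last k).ne]
  simp only [leftComb, map_sum, map_mul, probe_incl, h, Matrix.sum_apply]
  rw [Finset.sum_eq_single l]
  · simp
  · intro k _ hk; simp [hk]
  · simp

theorem probe_right (l : Fin (m + 1)) (c : Fin (m + 1) → CordAlg 𝓡 (Fin (m + 1))) :
    probe 𝓡 l (rightComb 𝓡 c) 0 1 = c l := by
  have h : ∀ k : Fin (m + 1), probe 𝓡 l (av 𝓡 (Fin.last (m + 1)) k.castSucc) =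
      if k = l then !![0, 1; 0, 0] else 0 := by
    intro k
    simp [probe, av, (Fin.castSucc_lt_last k).ne']
  simp only [rightComb, map_sum, map_mul, probe_incl, h, Matrix.sum_apply]
  rw [Finset.sum_eq_single l]
  · simp
  · intro k _ hk; simp [hk]
  · simp

theorem existsUnique_PhiL (B : BraidGroup m) :
    ∃! M : Matrix (Fin (m + 1)) (Fin (m + 1)) (CordAlg 𝓡 (Fin (m + 1))),
      ∀ i, braidAutExt 𝓡 B (av 𝓡 i.castSucc (Fin.last (m + 1))) =
        ∑ l, cordIncl 𝓡 m (M i l) * av 𝓡 l.castSucc (Fin.last (m + 1)) := by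
  choose c hc using (respects_braid 𝓡 B).2.1
  refine ⟨Matrix.of c, fun i => (hc i).symm, fun M hM => ?_⟩
  ext i l
  have h : leftComb 𝓡 (M i) = leftComb 𝓡 (c i) := (hM i).symm.trans (hc i).symm
  rw [← probe_left 𝓡 l (M i), h, probe_left]
  rfl

theorem existsUnique_PhiR (B : BraidGroup m) :
    ∃! M : Matrix (Fin (m + 1)) (Fin (m + 1)) (CordAlg 𝓡 (Fin (m + 1))),
      ∀ i, braidAutExt 𝓡 B (av 𝓡 (Fin.last (m + 1)) i.castSucc) =
        ∑ l, av 𝓡 (Fin.last (m + 1)) l.castSucc * cordIncl 𝓡 m (M l i) := by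
  choose c hc using (respects_braid 𝓡 B).2.2
  refine ⟨Matrix.of fun l i => c i l, fun i => (hc i).symm, fun M hM => ?_⟩
  ext l i
  have h : rightComb 𝓡 (fun l => M l i) = rightComb 𝓡 (c i) := (hM i).symm.trans (hc i).symm
  rw [← probe_right 𝓡 l (fun l => M l i), h, probe_right]
  rfl

/-- The matrix `Φ^L_B`: `φ_B^ext(a_{i,n+1}) = ∑_ℓ (Φ^L_B)_{iℓ} a_{ℓ,n+1}`. -/
def PhiL (B : BraidGroup m) : Matrix (Fin (m + 1)) (Fin (m + 1)) (CordAlg 𝓡 (Fin (m + 1))) :=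
  (existsUnique_PhiL 𝓡 B).choose

/-- The matrix `Φ^R_B`: `φ_B^ext(a_{n+1,i}) = ∑_ℓ a_{n+1,ℓ} (Φ^R_B)_{ℓi}`. -/
def PhiR (B : BraidGroup m) : Matrix (Fin (m + 1)) (Fin (m + 1)) (CordAlg 𝓡 (Fin (m + 1))) :=
  (existsUnique_PhiR 𝓡 B).choose

end Ext


/-- Generators of the transverse DGA; `a` and `b` are indexed by pairs of distinct indices. -/
inductive TGen (I : Type) : Type
  | a (i j : I) (h : i ≠ j)
  | b (i j : I) (h : i ≠ j)
  | c (i j : I)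
  | d (i j : I)
  | e (i j : I)
  | f (i j : I)

theorem TGen.finite (I : Type) [Finite I] : Finite (TGen I) := by
  let g : TGen I → Fin 6 × I × I := fun x =>
    match x with
    | .a i j _ => (0, i, j)
    | .b i j _ => (1, i, j)
    | .c i j => (2, i, j)
    | .d i j => (3, i, j)
    | .e i j => (4, i, j)
    | .f i j => (5, i, j)
  refine Finite.of_injective g ?_
  rintro (_ | _ | _ | _ | _ | _) (_ | _ | _ | _ | _ | _) <;> simp [g]

/-- Degrees of the generators. -/
def TGen.deg {I : Type} : TGen I → ℤ
  | .a _ _ _ => 0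
  | .b _ _ _ => 1
  | .c _ _ => 1
  | .d _ _ => 1
  | .e _ _ => 2
  | .f _ _ => 2

/-- The bijection of the generators that exchanges `e_ij` and `f_ij`. -/
def TGen.swapEF (I : Type) : TGen I ≃ TGen I where
  toFun
    | .a i j h => .a i j h
    | .b i j h => .b i j h
    | .c i j => .c i j
    | .d i j => .d i j
    | .e i j => .f i j
    | .f i j => .e i j
  invFun
    | .a i j h => .a i j h
    | .b i j h => .b i j h
    | .c i j => .c i j
    | .d i j => .d i j
    | .e i j => .f i j
    | .f i j => .e i j
  left_inv := by rintro (_ | _ | _ | _ | _ | _) <;> rfl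
  right_inv := by rintro (_ | _ | _ | _ | _ | _) <;> rfl

section Transverse

variable {𝓡 : Type} [CommRing 𝓡] {m : ℕ}

/-- Multiply the entries of `M` below the diagonal by `x` and those above the diagonal by `y`,
and replace the diagonal entries by the scalar `δ`. -/
def triMatrix {𝓐 : Type} [Ring 𝓐] [Algebra 𝓡 𝓐] (x δ y : 𝓡)
    (M : Matrix (Fin (m + 1)) (Fin (m + 1)) 𝓐) : Matrix (Fin (m + 1)) (Fin (m + 1)) 𝓐 :=
  Matrix.of fun i j => if j < i then x • M i j else if i = j then algebraMap 𝓡 𝓐 δ else y • M i j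

/-- The matrix `𝐀 = (a_ij)`, with diagonal entries `-2`, over `𝓐_n`. -/
def cordMatrix (𝓡 : Type) [CommRing 𝓡] (m : ℕ) :
    Matrix (Fin (m + 1)) (Fin (m + 1)) (CordAlg 𝓡 (Fin (m + 1))) :=
  Matrix.of fun i j => av 𝓡 i j

/-- The tensor algebra on all the generators. -/
abbrev TAlg (𝓡 : Type) [CommRing 𝓡] (m : ℕ) : Type := FreeAlgebra 𝓡 (TGen (Fin (m + 1)))

/-- The inclusion of `𝓐_n` into the tensor algebra on all the generators. -/
def cordToT (𝓡 : Type) [CommRing 𝓡] (m : ℕ) : CordAlg 𝓡 (Fin (m + 1)) →ₐ[𝓡] TAlg 𝓡 m :=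
  FreeAlgebra.lift 𝓡 fun x => FreeAlgebra.ι 𝓡 (TGen.a x.1.1 x.1.2 x.2)

/-- The matrix `𝐁 = (b_ij)`, with diagonal entries `0`. -/
def bMatrix (𝓡 : Type) [CommRing 𝓡] (m : ℕ) : Matrix (Fin (m + 1)) (Fin (m + 1)) (TAlg 𝓡 m) :=
  Matrix.of fun i j => if h : i ≠ j then FreeAlgebra.ι 𝓡 (TGen.b i j h) else 0

/-- The matrix `𝐂 = (c_ij)`. -/
def cMatrix (𝓡 : Type) [CommRing 𝓡] (m : ℕ) : Matrix (Fin (m + 1)) (Fin (m + 1)) (TAlg 𝓡 m) :=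
  Matrix.of fun i j => FreeAlgebra.ι 𝓡 (TGen.c i j)

/-- The matrix `𝐃 = (d_ij)`. -/
def dMatrix (𝓡 : Type) [CommRing 𝓡] (m : ℕ) : Matrix (Fin (m + 1)) (Fin (m + 1)) (TAlg 𝓡 m) :=
  Matrix.of fun i j => FreeAlgebra.ι 𝓡 (TGen.d i j)

/-- The diagonal matrix `diag(u, 1, …, 1)`. -/
def cornerMatrix (m : ℕ) (u : 𝓡ˣ) : Matrix (Fin (m + 1)) (Fin (m + 1)) (TAlg 𝓡 m) :=
  Matrix.diagonal fun i => if i = 0 then algebraMap 𝓡 (TAlg 𝓡 m) (u : 𝓡) else 1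

/-- The transverse DGA of the braid `B`, for units `lam`, `mu` and elements `U`, `V` of the
coefficient ring. Here `Λ_B = diag(λ μ^{-w(B)}, 1, …, 1)`, and `Li` is the inverse of `Λ_B`. -/
def transverseDGA (lam mu : 𝓡ˣ) (U V : 𝓡) (B : BraidGroup m) : PreDGA 𝓡 where
  gen := TGen (Fin (m + 1))
  finite := TGen.finite _
  deg := TGen.deg
  dGen :=
    let L := cornerMatrix m (lam * mu ^ (-writhe B))
    let Li := cornerMatrix m (lam * mu ^ (-writhe B))⁻¹
    let PL := (PhiL 𝓡 B).map (cordToT 𝓡 m)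
    let PR := (PhiR 𝓡 B).map (cordToT 𝓡 m)
    let A := (cordMatrix 𝓡 m).map (cordToT 𝓡 m)
    let phiA := ((cordMatrix 𝓡 m).map (braidAut 𝓡 m B)).map (cordToT 𝓡 m)
    let Ahat := triMatrix (1 : 𝓡) (-1 - mu * U) (mu * U) A
    let Acheck := triMatrix V (-V - mu) (mu : 𝓡) A
    let Bhat := triMatrix (1 : 𝓡) 0 (mu * U) (bMatrix 𝓡 m)
    let Bcheck := triMatrix V 0 (mu : 𝓡) (bMatrix 𝓡 m)
    let C := cMatrix 𝓡 m
    let D := dMatrix 𝓡 m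
    fun
      | .a _ _ _ => 0
      | .b i j _ => (A - L * phiA * Li) i j
      | .c i j => (Ahat - L * PL * Acheck) i j
      | .d i j => (Acheck - Ahat * PR * Li) i j
      | .e i j => (Bhat - C - L * PL * D) i j
      | .f i j => (Bcheck - D - C * PR * Li) i j

/-- The framed knot DGA of the closure of `B` (with framing `0`), for units `lam`, `mu` of the
coefficient ring. With `A_ij = a_ij, -1 - μ, μ a_ij` and `B_ij = b_ij, 0, μ b_ij` for `i > j`,
`i = j`, `i < j` respectively, the differential is
`∂A = 0`, `∂B = A - Λ φ_B(A) Λ⁻¹`, `∂C = A - Λ Φ^L A`, `∂D = A - A Φ^R Λ⁻¹`,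
`∂E = B - D - C Φ^R Λ⁻¹`, `∂F = B - C - Λ Φ^L D`. -/
def framedDGA (lam mu : 𝓡ˣ) (B : BraidGroup m) : PreDGA 𝓡 where
  gen := TGen (Fin (m + 1))
  finite := TGen.finite _
  deg := TGen.deg
  dGen :=
    let L := cornerMatrix m (lam * mu ^ (-writhe B))
    let Li := cornerMatrix m (lam * mu ^ (-writhe B))⁻¹
    let PL := (PhiL 𝓡 B).map (cordToT 𝓡 m)
    let PR := (PhiR 𝓡 B).map (cordToT 𝓡 m)
    let A₀ := triMatrix (1 : 𝓡) (-1 - mu) (mu : 𝓡) (cordMatrix 𝓡 m)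
    let A := A₀.map (cordToT 𝓡 m)
    let phiA := (A₀.map (braidAut 𝓡 m B)).map (cordToT 𝓡 m)
    let Bm := triMatrix (1 : 𝓡) 0 (mu : 𝓡) (bMatrix 𝓡 m)
    let C := cMatrix 𝓡 m
    let D := dMatrix 𝓡 m
    fun
      | .a _ _ _ => 0
      | .b i j _ =>
          if j < i then (A - L * phiA * Li) i j
          else ((mu⁻¹ : 𝓡ˣ) : 𝓡) • (A - L * phiA * Li) i j
      | .c i j => (A - L * PL * A) i j
      | .d i j => (A - A * PR * Li) i j
      | .e i j => (Bm - D - C * PR * Li) i j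
      | .f i j => (Bm - C - L * PL * D) i j

end Transverse

/-- The ring `R = ℤ[λ^{±1}, μ^{±1}]`, as Laurent polynomials in `μ` over Laurent polynomials
in `λ`. -/
abbrev BaseRing : Type := LaurentPolynomial (LaurentPolynomial ℤ)

/-- The Laurent variable as a unit. -/
def laurentUnit (A : Type) [CommRing A] : (LaurentPolynomial A)ˣ where
  val := LaurentPolynomial.T 1
  inv := LaurentPolynomial.T (-1)
  val_inv := by rw [← LaurentPolynomial.T_add]; simp
  inv_val := by rw [← LaurentPolynomial.T_add]; simp

def lamR : BaseRingˣ := Units.map (LaurentPolynomial.C : _ →+* BaseRing) (laurentUnit ℤ)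

def muR : BaseRingˣ := laurentUnit (LaurentPolynomial ℤ)

/-- The ring `R[U, V]`. -/
abbrev BaseRingUV : Type := MvPolynomial (Fin 2) BaseRing

def lamUV : BaseRingUVˣ := Units.map (MvPolynomial.C : BaseRing →+* BaseRingUV) lamR

def muUV : BaseRingUVˣ := Units.map (MvPolynomial.C : BaseRing →+* BaseRingUV) muR

/-- The homomorphism `R[U, V] → R` with `U, V ↦ 1`. -/
def evalUVOne : BaseRingUV →+* BaseRing := MvPolynomial.eval fun _ => 1

/-- The transverse DGA `(CT⁻_*(B), ∂⁻(B))` over `R[U, V]`. -/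
def CTminus {m : ℕ} (B : BraidGroup m) : PreDGA BaseRingUV :=
  transverseDGA lamUV muUV (MvPolynomial.X 0) (MvPolynomial.X 1) B

/-- The framed knot DGA over `R`. -/
def CCframed {m : ℕ} (B : BraidGroup m) : PreDGA BaseRing := framedDGA lamR muR B

/-- Positive stabilization `B ↦ B σ_n`, with a new last strand. -/
def posStabRight {m : ℕ} (B : BraidGroup m) : BraidGroup (m + 1) :=
  addStrandRight m B * sigma (Fin.last m)

/-- Positive stabilization `B ↦ B σ_0`, with a new strand `0` before the strands `1, …, n`. -/
def posStabLeft {m : ℕ} (B : BraidGroup m) : BraidGroup (m + 1) :=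
  addStrandLeft m B * sigma 0

/-- Braid conjugation and positive braid stabilization. -/
inductive TransverseMove : (Σ m, BraidGroup m) → (Σ m, BraidGroup m) → Prop
  | conj {m : ℕ} (B g : BraidGroup m) : TransverseMove ⟨m, B⟩ ⟨m, g * B * g⁻¹⟩
  | stabRight {m : ℕ} (B : BraidGroup m) : TransverseMove ⟨m, B⟩ ⟨m + 1, posStabRight B⟩
  | stabLeft {m : ℕ} (B : BraidGroup m) : TransverseMove ⟨m, B⟩ ⟨m + 1, posStabLeft B⟩

/-- Transverse links: equivalence classes of braids modulo conjugation and positive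
stabilization and destabilization. -/
def TransverseLink : Type := Quot TransverseMove

/-- The transverse link underlying a braid. -/
def transverseLink {m : ℕ} (B : BraidGroup m) : TransverseLink := Quot.mk _ ⟨m, B⟩

end

end TransverseHomology

/-! Everything rests on one matrix identity. Write 𝐀 as the sum of its lower and upper triangular
parts, each with diagonal entries -1. Each part X satisfies φ_B(X) = Φ^L_B X Φ^R_B: this is a
computation for a single crossing, and it passes to products and inverses by the chain rules
`PhiL_mul` and `PhiR_mul`. As 𝐀̂ and 𝐀̌ are linear combinations of the two parts, they transform in
the same way (`triMatrix_braid`), and then ∂² = 0 on 𝐄 and 𝐅 is a short cancellation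
(`twistedDGA_isDGA`).

For the invariance, Λ_B is replaced by an arbitrary diagonal matrix Λ of units (`braidTwist`). Every
word in the entry (i, j) of Φ^L_B leads from the strand B(i) to the strand j. Hence rescaling the
generators with indices ij by s_i s_j⁻¹ trades Λ for another diagonal matrix, and a unit can be slid
along a cycle of the permutation of B (`braidTwist_move`). If the closure is a knot, it does not
matter which strand carries the unit λμ^{-w}.

Both moves are realized by explicit chain maps that are triangular for a suitable ranking of the
generators, up to a bijection of the generators; such maps are tame
(`PreDGA.tameIso_of_triangular`). For conjugation by g, the automorphism φ_g is lifted to all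
generators (`conjVal`) with the help of the twisted derivation a_ij ↦ b_ij, whose boundary is id -
φ. The lift is triangular when g is one crossing, and general g are composed of these.

For the stabilization B ↦ Bσ_0 the images of the old generators are written down (`stabOld`), and
the remaining generators of the larger DGA are arranged in pairs in which the boundary of one is a
unit times the other plus terms of lower rank (`StabData.pair_leading`). The map produces a factor
μ⁻¹ on the old first strand; sliding it to the new strand accounts for the growth of the writhe by
one. Stabilization at the other end is conjugate to this one by a half twist
(`halfTwist_posStabRight`).

Homology survives because a stabilization retracts onto the original DGA by an explicit homotopy
(`PreDGA.stabHomotopy_d`). Finally, for U = V = 1 both 𝐀̂ and 𝐀̌ become the matrix A of the framed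
knot DGA, and the formulas for 𝐄 and 𝐅 turn into those of the framed DGA with the two names
exchanged. -/

namespace TransverseHomology

noncomputable section

namespace PreDGA

variable {𝓡 : Type} [CommRing 𝓡]

/-! ### Degrees and signs in a semifree algebra. -/

section Homogeneous

variable (S : PreDGA 𝓡)

theorem var_mem_homogeneous (x : S.gen) : S.var x ∈ S.homogeneous (S.deg x) :=
  Submodule.subset_span ⟨[x], by simp, by simp⟩

theorem one_mem_homogeneous : (1 : S.Alg) ∈ S.homogeneous 0 :=
  Submodule.subset_span ⟨[], by simp, by simp⟩

theorem algebraMap_mem_homogeneous (r : 𝓡) : algebraMap 𝓡 S.Alg r ∈ S.homogeneous 0 := by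
  rw [Algebra.algebraMap_eq_smul_one]
  exact Submodule.smul_mem _ _ S.one_mem_homogeneous

theorem mul_mem_homogeneous {k l : ℤ} {u v : S.Alg} (hu : u ∈ S.homogeneous k)
    (hv : v ∈ S.homogeneous l) : u * v ∈ S.homogeneous (k + l) := by
  have := Submodule.mul_mem_mul hu hv
  rw [homogeneous, homogeneous, Submodule.span_mul_span] at this
  refine Submodule.span_mono ?_ this
  rintro _ ⟨_, ⟨l₁, rfl, rfl⟩, _, ⟨l₂, rfl, rfl⟩, rfl⟩
  exact ⟨l₁ ++ l₂, by simp, by simp⟩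

theorem mul_mem_homogeneous' {k l j : ℤ} {u v : S.Alg} (hu : u ∈ S.homogeneous k)
    (hv : v ∈ S.homogeneous l) (h : k + l = j) : u * v ∈ S.homogeneous j :=
  h ▸ S.mul_mem_homogeneous hu hv

theorem list_prod_mem_homogeneous (l : List S.gen) :
    (l.map S.var).prod ∈ S.homogeneous (l.map S.deg).sum :=
  Submodule.subset_span ⟨l, rfl, rfl⟩

/-- Algebra maps that preserve the degrees of the generators preserve degrees. -/
theorem map_mem_homogeneous {S T : PreDGA 𝓡} (F : S.Alg →ₐ[𝓡] T.Alg)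
    (hF : ∀ x, F (S.var x) ∈ T.homogeneous (S.deg x)) {k : ℤ} {w : S.Alg}
    (hw : w ∈ S.homogeneous k) : F w ∈ T.homogeneous k := by
  induction hw using Submodule.span_induction with
  | mem w hw =>
    obtain ⟨l, rfl, rfl⟩ := hw
    induction l with
    | nil => simpa using T.one_mem_homogeneous
    | cons x l ih => simpa using T.mul_mem_homogeneous (hF x) ih
  | zero => simp
  | add u v _ _ hu hv => rw [map_add]; exact add_mem hu hv
  | smul r u _ hu => rw [map_smul]; exact Submodule.smul_mem _ _ hu

@[simp]
theorem sgn_var (x : S.gen) : S.sgn (S.var x) = ((S.deg x).negOnePow : ℤ) • S.var x := by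
  simp [sgn]

theorem sgn_of_mem {k : ℤ} {w : S.Alg} (hw : w ∈ S.homogeneous k) :
    S.sgn w = (k.negOnePow : ℤ) • w := by
  induction hw using Submodule.span_induction with
  | mem w hw =>
    obtain ⟨l, rfl, rfl⟩ := hw
    induction l with
    | nil => simp
    | cons x l ih =>
      simp only [List.map_cons, List.prod_cons, map_mul, List.sum_cons, Int.negOnePow_add]
      rw [ih, sgn_var, smul_mul_assoc, mul_smul_comm, smul_smul, Units.val_mul]
  | zero => simp
  | add u v _ _ hu hv => rw [map_add, hu, hv, smul_add]
  | smul r u _ hu => rw [map_smul, hu, smul_comm]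

theorem sgn_eq_self {w : S.Alg} (hw : w ∈ S.homogeneous 0) : S.sgn w = w := by
  simp [S.sgn_of_mem hw]

theorem sgn_eq_neg {w : S.Alg} (hw : w ∈ S.homogeneous 1) : S.sgn w = -w := by
  simp [S.sgn_of_mem hw]

theorem sgn_sgn (w : S.Alg) : S.sgn (S.sgn w) = w := by
  have : S.sgn.comp S.sgn = AlgHom.id 𝓡 _ := by
    apply FreeAlgebra.hom_ext
    funext x
    have h := Int.units_mul_self (S.deg x).negOnePow
    have h' : ((S.deg x).negOnePow : ℤ) * ((S.deg x).negOnePow : ℤ) = 1 := by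
      rw [← Units.val_mul, h, Units.val_one]
    change S.sgn (S.sgn (S.var x)) = S.var x
    rw [sgn_var, map_zsmul, sgn_var, smul_smul, h', one_smul]
  exact DFunLike.congr_fun this w

theorem d_mul_of_zero {u v : S.Alg} (hu : u ∈ S.homogeneous 0) :
    S.d (u * v) = S.d u * v + u * S.d v := by
  rw [d_mul, S.sgn_eq_self hu]

theorem d_mul_of_one {u v : S.Alg} (hu : u ∈ S.homogeneous 1) :
    S.d (u * v) = S.d u * v - u * S.d v := by
  rw [d_mul, S.sgn_eq_neg hu, neg_mul, sub_eq_add_neg]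

end Homogeneous

/-! ### Chain maps and the DGA axioms, checked on generators. -/

section ChainMap

variable {S T : PreDGA 𝓡}

theorem map_sgn (F : S.Alg →ₐ[𝓡] T.Alg)
    (hF : ∀ x, F (S.var x) ∈ T.homogeneous (S.deg x)) (w : S.Alg) :
    F (S.sgn w) = T.sgn (F w) := by
  have : F.comp S.sgn = T.sgn.comp F := by
    apply FreeAlgebra.hom_ext
    funext x
    change F (S.sgn (S.var x)) = T.sgn (F (S.var x))
    rw [sgn_var, T.sgn_of_mem (hF x), map_zsmul]
  exact DFunLike.congr_fun this w

/-- Degree preserving algebra maps that intertwine the differentials of the generators are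
chain maps. -/
theorem map_d (F : S.Alg →ₐ[𝓡] T.Alg)
    (hF : ∀ x, F (S.var x) ∈ T.homogeneous (S.deg x))
    (hd : ∀ x, F (S.dGen x) = T.d (F (S.var x))) (w : S.Alg) :
    F (S.d w) = T.d (F w) := by
  induction w using FreeAlgebra.induction with
  | grade0 r => rw [d_algebraMap, AlgHom.commutes, d_algebraMap, map_zero]
  | grade1 x => rw [← hd x]; exact congrArg F (S.d_var x)
  | mul u v hu hv => rw [d_mul, map_mul, d_mul, map_add, map_mul, map_mul, hu, hv, map_sgn F hF]
  | add u v hu hv => simp [hu, hv]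

theorem d_mem_homogeneous (h : ∀ x, S.dGen x ∈ S.homogeneous (S.deg x - 1)) {k : ℤ} {w : S.Alg}
    (hw : w ∈ S.homogeneous k) : S.d w ∈ S.homogeneous (k - 1) := by
  induction hw using Submodule.span_induction with
  | mem w hw =>
    obtain ⟨l, rfl, rfl⟩ := hw
    induction l with
    | nil => simpa using (by simpa using S.d_algebraMap 1 : S.d 1 = 0) ▸ Submodule.zero_mem _
    | cons x l ih =>
      rw [List.map_cons, List.map_cons, List.prod_cons, d_mul, List.sum_cons, d_var, sgn_var]
      refine add_mem (S.mul_mem_homogeneous' (h x) (S.list_prod_mem_homogeneous l) (by ring)) ?_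
      rw [smul_mul_assoc]
      exact zsmul_mem (S.mul_mem_homogeneous' (S.var_mem_homogeneous x) ih (by ring)) _
  | zero => simp
  | add u v _ _ hu hv => rw [map_add]; exact add_mem hu hv
  | smul r u _ hu => rw [map_smul]; exact Submodule.smul_mem _ _ hu

/-- An operator of odd degree changes the parity of words. The relation is needed to cancel the
mixed terms when `∂²` is applied to a product. -/
theorem sgn_d (h : ∀ x, S.dGen x ∈ S.homogeneous (S.deg x - 1)) (w : S.Alg) :
    S.sgn (S.d w) = -S.d (S.sgn w) := by
  induction w using FreeAlgebra.induction with
  | grade0 r => rw [d_algebraMap, AlgHom.commutes, d_algebraMap]; simp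
  | grade1 x =>
    change S.sgn (S.d (S.var x)) = -S.d (S.sgn (S.var x))
    rw [d_var, S.sgn_of_mem (h x), sgn_var, map_zsmul, d_var, Int.negOnePow_sub]
    simp
  | mul u v hu hv =>
    rw [d_mul, map_add, map_mul, map_mul, hu, hv, map_mul, d_mul, sgn_sgn]
    noncomm_ring
  | add u v hu hv => simp [hu, hv]; abel

/-- The conditions for a DGA may be checked on generators. -/
theorem isDGA_of_gen (h : ∀ x, S.dGen x ∈ S.homogeneous (S.deg x - 1))
    (h' : ∀ x, S.d (S.dGen x) = 0) : S.IsDGA := by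
  refine ⟨fun k w hw => d_mem_homogeneous h hw, fun w => ?_⟩
  induction w using FreeAlgebra.induction with
  | grade0 r => rw [d_algebraMap, map_zero]
  | grade1 x => rw [← h' x]; exact congrArg S.d (S.d_var x)
  | mul u v hu hv =>
    -- The two mixed terms `sgn (d u) * d v` and `d (sgn u) * d v` are opposite by `sgn_d`; the
    -- other two contain `d (d u)` or `d (d v)`.
    rw [d_mul, map_add, d_mul, d_mul, hu, hv, sgn_d h]
    noncomm_ring
  | add u v hu hv => simp [hu, hv]

theorem isRelabelling_of_gen {S T : PreDGA 𝓡} (e : S.gen ≃ T.gen)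
    (hdeg : ∀ x, T.deg (e x) = S.deg x)
    (hd : ∀ x, relabel (T := T) e (S.dGen x) = T.dGen (e x)) : IsRelabelling S T e := by
  have hv : ∀ x, relabel (S := S) (T := T) e (S.var x) = T.var (e x) := fun x => by
    simp [relabel]
  refine ⟨hdeg, fun w => map_d _ (fun x => ?_) (fun x => ?_) w⟩
  · rw [hv, ← hdeg x]; exact T.var_mem_homogeneous _
  · rw [hv, hd, d_var]

end ChainMap

/-! ### Tame isomorphisms and the triangularity criterion. -/

section Tame

variable {S T W : PreDGA 𝓡}

@[simp]
theorem relabel_var (e : S.gen → T.gen) (x : S.gen) :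
    relabel (S := S) (T := T) e (S.var x) = T.var (e x) := by
  simp [relabel]

theorem relabel_relabel (e : S.gen → T.gen) (e' : T.gen → W.gen) (w : S.Alg) :
    relabel (S := T) (T := W) e' (relabel (S := S) (T := T) e w) =
      relabel (S := S) (T := W) (fun x => e' (e x)) w := by
  have : (relabel (S := T) (T := W) e').comp (relabel (S := S) (T := T) e) =
      relabel (S := S) (T := W) (fun x => e' (e x)) := by
    apply FreeAlgebra.hom_ext
    funext x
    simp [relabel]
  exact DFunLike.congr_fun this w

theorem relabel_id (w : S.Alg) : relabel (S := S) (T := S) (fun x => x) w = w := by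
  have : relabel (S := S) (T := S) (fun x => x) = AlgHom.id 𝓡 _ := by
    apply FreeAlgebra.hom_ext
    funext x
    simp [relabel]
  exact DFunLike.congr_fun this w

/-- The algebra isomorphism induced by a bijection of generators. -/
def relabelEquiv (S T : PreDGA 𝓡) (e : S.gen ≃ T.gen) : S.Alg ≃ₐ[𝓡] T.Alg :=
  AlgEquiv.ofAlgHom (relabel e) (relabel e.symm)
    (by apply FreeAlgebra.hom_ext; funext x; simp [relabel])
    (by apply FreeAlgebra.hom_ext; funext x; simp [relabel])

theorem relabelEquiv_apply (e : S.gen ≃ T.gen) (w : S.Alg) :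
    relabelEquiv S T e w = relabel (T := T) e w := rfl

theorem relabelEquiv_symm_apply (e : S.gen ≃ T.gen) (w : T.Alg) :
    (relabelEquiv S T e).symm w = relabel (T := S) e.symm w := rfl

/-- The group of tame automorphisms, as a submonoid. -/
abbrev tameAut (S : PreDGA 𝓡) : Submonoid (S.Alg ≃ₐ[𝓡] S.Alg) :=
  Submonoid.closure {g | S.IsElementary g}

/-- An algebra map that fixes the generators in a set fixes the subalgebra they generate. -/
theorem eq_of_mem_adjoin {A : Type} [Ring A] [Algebra 𝓡 A] (F G : S.Alg →ₐ[𝓡] A) {Y : Set S.gen}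
    (h : ∀ y ∈ Y, F (S.var y) = G (S.var y)) {w : S.Alg}
    (hw : w ∈ Algebra.adjoin 𝓡 (S.var '' Y)) : F w = G w := by
  induction hw using Algebra.adjoin_induction with
  | mem w hw => obtain ⟨y, hy, rfl⟩ := hw; exact h y hy
  | algebraMap r => simp
  | add u v _ _ hu hv => simp [hu, hv]
  | mul u v _ _ hu hv => simp [hu, hv]

theorem relabel_mem_adjoin (e : S.gen → T.gen) {Y : Set S.gen} {Z : Set T.gen}
    (h : ∀ y ∈ Y, e y ∈ Z) {w : S.Alg}
    (hw : w ∈ Algebra.adjoin 𝓡 (S.var '' Y)) :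
    relabel (T := T) e w ∈ Algebra.adjoin 𝓡 (T.var '' Z) := by
  induction hw using Algebra.adjoin_induction with
  | mem w hw =>
    obtain ⟨y, hy, rfl⟩ := hw
    rw [relabel_var]
    exact Algebra.subset_adjoin ⟨_, h y hy, rfl⟩
  | algebraMap r => rw [AlgHom.commutes]; exact Subalgebra.algebraMap_mem _ _
  | add u v _ _ hu hv => rw [map_add]; exact add_mem hu hv
  | mul u v _ _ hu hv => rw [map_mul]; exact mul_mem hu hv

/-- As `v` does not involve `x`, it is fixed by `g`, so `g x = α x + v` can be solved for `x`: the
inverse sends `x` to `α⁻¹ x - α⁻¹ v`. -/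
theorem IsElementary.symm {g : S.Alg ≃ₐ[𝓡] S.Alg} (hg : S.IsElementary g) :
    S.IsElementary g.symm := by
  obtain ⟨x, α, v, hv, hv', hx, hy⟩ := hg
  have gv : g v = v :=
    eq_of_mem_adjoin (g : S.Alg →ₐ[𝓡] S.Alg) (AlgHom.id 𝓡 _) (fun y h => hy y h) hv
  refine ⟨x, α⁻¹, -((α⁻¹ : 𝓡ˣ) : 𝓡) • v, Subalgebra.smul_mem _ hv _, Submodule.smul_mem _ _ hv',
    ?_, fun y h => ?_⟩
  · rw [AlgEquiv.symm_apply_eq, map_add, map_smul, map_smul, hx, gv, smul_add, smul_smul]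
    simp
  · rw [AlgEquiv.symm_apply_eq, hy y h]

theorem tameAut_symm {g : S.Alg ≃ₐ[𝓡] S.Alg} (hg : g ∈ S.tameAut) : g.symm ∈ S.tameAut := by
  induction hg using Submonoid.closure_induction with
  | mem g hg => exact Submonoid.subset_closure (IsElementary.symm hg)
  | one => exact one_mem _
  | mul g h _ _ hg hh =>
    have : (g * h).symm = h.symm * g.symm := mul_inv_rev g h
    rw [this]
    exact mul_mem hh hg

/-- A tame isomorphism has its bijection of generators at the end. To compose or invert such maps,
the bijection must be commuted past elementary automorphisms, which stay elementary under renaming.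
-/
theorem tameAut_relabel (e : S.gen ≃ T.gen) (hdeg : ∀ x, T.deg (e x) = S.deg x)
    {g : S.Alg ≃ₐ[𝓡] S.Alg} (hg : g ∈ S.tameAut) :
    ((relabelEquiv S T e).symm.trans g).trans (relabelEquiv S T e) ∈ T.tameAut := by
  induction hg using Submonoid.closure_induction with
  | mem g hg =>
    refine Submonoid.subset_closure ?_
    obtain ⟨x, α, v, hv, hv', hx, hy⟩ := hg
    refine ⟨e x, α, relabel (T := T) e v, ?_, ?_, ?_, fun y h => ?_⟩
    · exact relabel_mem_adjoin e (fun y hy => by simpa using hy) hv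
    · rw [hdeg]
      refine map_mem_homogeneous _ (fun x => ?_) hv'
      rw [relabel_var, ← hdeg]
      exact T.var_mem_homogeneous _
    · simp only [AlgEquiv.trans_apply, relabelEquiv_symm_apply, relabel_var, Equiv.symm_apply_apply,
        hx, relabelEquiv_apply, map_add, map_smul]
    · have h' : e.symm y ≠ x := fun h0 => h (by rw [← h0, Equiv.apply_symm_apply])
      simp only [AlgEquiv.trans_apply, relabelEquiv_symm_apply, relabel_var, hy _ h',
        relabelEquiv_apply, Equiv.apply_symm_apply]
  | one =>
    have : ((relabelEquiv S T e).symm.trans 1).trans (relabelEquiv S T e) = 1 := by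
      ext x; simp
    rw [this]; exact one_mem _
  | mul g h _ _ hg hh =>
    have : ((relabelEquiv S T e).symm.trans (g * h)).trans (relabelEquiv S T e) =
      (((relabelEquiv S T e).symm.trans g).trans (relabelEquiv S T e)) *
      (((relabelEquiv S T e).symm.trans h).trans (relabelEquiv S T e)) := by
      ext x; simp
    rw [this]; exact mul_mem hg hh

/-- A tame isomorphism of the underlying graded algebras. -/
def IsTame (F : S.Alg ≃ₐ[𝓡] T.Alg) : Prop :=
  ∃ g ∈ S.tameAut, ∃ e : S.gen ≃ T.gen, (∀ x, T.deg (e x) = S.deg x) ∧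
    F = g.trans (relabelEquiv S T e)

theorem tameIso_iff : TameIso S T ↔
    ∃ F : S.Alg ≃ₐ[𝓡] T.Alg, IsTame F ∧ ∀ w, F (S.d w) = T.d (F w) := by
  constructor
  · rintro ⟨g, hg, e, he, h⟩
    exact ⟨_, ⟨g, hg, e, he, rfl⟩, h⟩
  · rintro ⟨_, ⟨g, hg, e, he, rfl⟩, h⟩
    exact ⟨g, hg, e, he, h⟩

theorem isTame_refl : IsTame (AlgEquiv.refl : S.Alg ≃ₐ[𝓡] S.Alg) :=
  ⟨1, one_mem _, Equiv.refl _, fun _ => rfl, by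
    ext x; exact (relabel_id (S := S) x).symm⟩

theorem IsTame.trans {F : S.Alg ≃ₐ[𝓡] T.Alg} {G : T.Alg ≃ₐ[𝓡] W.Alg} (hF : IsTame F)
    (hG : IsTame G) : IsTame (F.trans G) := by
  obtain ⟨g, hg, e, he, rfl⟩ := hF
  obtain ⟨g', hg', e', he', rfl⟩ := hG
  have he2 : ∀ x, S.deg (e.symm x) = T.deg x := fun x => by rw [← he, Equiv.apply_symm_apply]
  -- The automorphism `g'` of `T` is carried back to `S`, so that all elementary factors precede the
  -- composite bijection.
  have := tameAut_relabel (T := S) e.symm he2 hg'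
  refine ⟨_, mul_mem this hg, e.trans e', fun x => by simp [he, he'], ?_⟩
  ext x
  change relabel (T := W) e' (g' (relabel (T := T) e (g x))) =
    relabel (T := W) (fun y => e' (e y))
      (relabel (T := S) e.symm (g' (relabel (T := T) e.symm.symm (g x))))
  rw [relabel_relabel]
  simp

theorem IsTame.symm {F : S.Alg ≃ₐ[𝓡] T.Alg} (hF : IsTame F) : IsTame F.symm := by
  obtain ⟨g, hg, e, he, rfl⟩ := hF
  have he2 : ∀ x, S.deg (e.symm x) = T.deg x := fun x => by rw [← he, Equiv.apply_symm_apply]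
  refine ⟨_, tameAut_relabel e he (tameAut_symm hg), e.symm, he2, ?_⟩
  ext x
  change g.symm (relabel (T := S) e.symm x) =
    relabel (T := S) e.symm (relabel (T := T) e (g.symm (relabel (T := S) e.symm x)))
  rw [relabel_relabel]
  simpa using (relabel_id (S := S) _).symm

theorem IsTame.mem_homogeneous {F : S.Alg ≃ₐ[𝓡] T.Alg} (hF : IsTame F) {k : ℤ} {w : S.Alg}
    (hw : w ∈ S.homogeneous k) : F w ∈ T.homogeneous k := by
  obtain ⟨g, hg, e, he, rfl⟩ := hF
  have h1 : ∀ {k : ℤ} {w : S.Alg}, w ∈ S.homogeneous k → g w ∈ S.homogeneous k := by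
    induction hg using Submonoid.closure_induction with
    | mem g hg =>
      obtain ⟨x, α, v, hv, hv', hx, hy⟩ := hg
      intro k w hw
      refine map_mem_homogeneous (g : S.Alg →ₐ[𝓡] S.Alg) (fun y => ?_) hw
      change g _ ∈ _
      by_cases h : y = x
      · subst h
        rw [hx]
        exact add_mem (Submodule.smul_mem _ _ (S.var_mem_homogeneous _)) hv'
      · rw [hy y h]; exact S.var_mem_homogeneous _
    | one => exact fun h => h
    | mul g h _ _ hg hh => exact fun h' => hg (hh h')
  refine map_mem_homogeneous (relabel e) (fun x => ?_) (h1 hw)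
  rw [relabel_var, ← he]
  exact T.var_mem_homogeneous _

theorem TameIso.refl (S : PreDGA 𝓡) : TameIso S S :=
  tameIso_iff.2 ⟨_, isTame_refl, fun _ => rfl⟩

theorem TameIso.symm (h : TameIso S T) : TameIso T S := by
  obtain ⟨F, hF, h⟩ := tameIso_iff.1 h
  refine tameIso_iff.2 ⟨_, hF.symm, fun w => ?_⟩
  rw [AlgEquiv.symm_apply_eq, h, AlgEquiv.apply_symm_apply]

theorem TameIso.trans (h : TameIso S T) (h' : TameIso T W) : TameIso S W := by
  obtain ⟨F, hF, h⟩ := tameIso_iff.1 h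
  obtain ⟨G, hG, h'⟩ := tameIso_iff.1 h'
  refine tameIso_iff.2 ⟨_, hF.trans hG, fun w => ?_⟩
  simp [h, h']

theorem IsRelabelling.tameIso {e : S.gen ≃ T.gen} (h : IsRelabelling S T e) : TameIso S T :=
  tameIso_iff.2 ⟨relabelEquiv S T e, ⟨1, one_mem _, e, h.1, rfl⟩, h.2⟩

/-- The homogeneous elements of degree `k` in the generators of rank below `N`. -/
def low (S : PreDGA 𝓡) (ρ : S.gen → ℕ) (N : ℕ) (k : ℤ) : Submodule 𝓡 S.Alg :=
  S.homogeneous k ⊓ (Algebra.adjoin 𝓡 (S.var '' {y | ρ y < N})).toSubmodule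

theorem var_mem_low {ρ : S.gen → ℕ} {N : ℕ} {k : ℤ} (x : S.gen) (h : ρ x < N)
    (hk : S.deg x = k) : S.var x ∈ S.low ρ N k :=
  ⟨hk ▸ S.var_mem_homogeneous x, Algebra.subset_adjoin ⟨x, h, rfl⟩⟩

theorem algebraMap_mem_low {ρ : S.gen → ℕ} {N : ℕ} (r : 𝓡) :
    algebraMap 𝓡 S.Alg r ∈ S.low ρ N 0 :=
  ⟨S.algebraMap_mem_homogeneous r, Subalgebra.algebraMap_mem _ r⟩

theorem mul_mem_low {ρ : S.gen → ℕ} {N : ℕ} {k l j : ℤ} {u v : S.Alg}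
    (hu : u ∈ S.low ρ N k) (hv : v ∈ S.low ρ N l) (h : k + l = j) : u * v ∈ S.low ρ N j :=
  ⟨S.mul_mem_homogeneous' hu.1 hv.1 h, mul_mem (S := Subalgebra 𝓡 S.Alg) hu.2 hv.2⟩

theorem low_mono {ρ : S.gen → ℕ} {N M : ℕ} {k : ℤ} (h : N ≤ M) : S.low ρ N k ≤ S.low ρ M k :=
  inf_le_inf_left _ (Algebra.adjoin_mono (Set.image_mono fun _ hy => lt_of_lt_of_le hy h))

/-- Two endomorphisms are prescribed on generators, the second by solving for `x`. Both fix `v`,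
because `v` avoids `x`, and this makes them mutually inverse. -/
theorem exists_elementary (x : S.gen) (α : 𝓡ˣ) (v : S.Alg)
    (hv : v ∈ Algebra.adjoin 𝓡 (S.var '' {y | y ≠ x})) (hv' : v ∈ S.homogeneous (S.deg x)) :
    ∃ g : S.Alg ≃ₐ[𝓡] S.Alg, S.IsElementary g ∧ g (S.var x) = (α : 𝓡) • S.var x + v ∧
      ∀ y, y ≠ x → g (S.var y) = S.var y := by
  classical
  let f : S.Alg →ₐ[𝓡] S.Alg := FreeAlgebra.lift 𝓡 (Function.update S.var x ((α : 𝓡) • S.var x + v))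
  let f' : S.Alg →ₐ[𝓡] S.Alg := FreeAlgebra.lift 𝓡
    (Function.update S.var x (((α⁻¹ : 𝓡ˣ) : 𝓡) • S.var x - ((α⁻¹ : 𝓡ˣ) : 𝓡) • v))
  have fx : f (S.var x) = (α : 𝓡) • S.var x + v := by simp [f]
  have fy : ∀ y, y ≠ x → f (S.var y) = S.var y := fun y hy => by simp [f, hy]
  have fx' : f' (S.var x) = ((α⁻¹ : 𝓡ˣ) : 𝓡) • S.var x - ((α⁻¹ : 𝓡ˣ) : 𝓡) • v := by simp [f']
  have fy' : ∀ y, y ≠ x → f' (S.var y) = S.var y := fun y hy => by simp [f', hy]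
  have fv : f v = v := eq_of_mem_adjoin f (AlgHom.id 𝓡 _) fy hv
  have fv' : f' v = v := eq_of_mem_adjoin f' (AlgHom.id 𝓡 _) fy' hv
  have h1 : f.comp f' = AlgHom.id 𝓡 _ := by
    apply FreeAlgebra.hom_ext
    funext y
    change f (f' (S.var y)) = S.var y
    by_cases h : y = x
    · subst h
      rw [fx', map_sub, map_smul, map_smul, fx, fv, smul_add, smul_smul]
      simp
    · rw [fy' y h, fy y h]
  have h2 : f'.comp f = AlgHom.id 𝓡 _ := by
    apply FreeAlgebra.hom_ext
    funext y
    change f' (f (S.var y)) = S.var y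
    by_cases h : y = x
    · subst h
      rw [fx, map_add, map_smul, fx', fv', smul_sub, smul_smul, smul_smul]
      simp
    · rw [fy y h, fy' y h]
  exact ⟨AlgEquiv.ofAlgHom f f' h1 h2, ⟨x, α, v, hv, hv', fx, fy⟩, fx, fy⟩

/-- Triangular automorphisms are tame. -/
theorem exists_tameAut_of_triangular (ρ : S.gen → ℕ) (α : S.gen → 𝓡ˣ) (v : S.gen → S.Alg)
    (hv : ∀ x, v x ∈ S.low ρ (ρ x) (S.deg x)) :
    ∃ g ∈ S.tameAut, ∀ x, g (S.var x) = (α x : 𝓡) • S.var x + v x := by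
  classical
  have := S.finite
  have := Fintype.ofFinite S.gen
  have key : ∀ s : Finset S.gen, ∃ g ∈ S.tameAut, (∀ x ∈ s, g (S.var x) = (α x : 𝓡) • S.var x + v x) ∧
      ∀ x ∉ s, g (S.var x) = S.var x := by
    intro s
    -- The generators are inserted in the order of increasing rank. The correction `v y` of an
    -- earlier generator uses only ranks below `ρ y ≤ ρ x`, so it does not involve the new `x` and
    -- is untouched by the new elementary factor.
    induction s using Finset.induction_on_max_value ρ with
    | empty => exact ⟨1, one_mem _, by simp, fun x _ => rfl⟩
    | insert x s hx hmax ih =>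
      obtain ⟨g, hg, h1, h2⟩ := ih
      have sub : ∀ {w : S.Alg} {N : ℕ} {k : ℤ}, N ≤ ρ x → w ∈ S.low ρ N k →
          w ∈ Algebra.adjoin 𝓡 (S.var '' {y | y ≠ x}) := by
        intro w N k hN hw
        have h0 : {y | ρ y < N} ⊆ {y | y ≠ x} := by
          rintro y (hy : ρ y < N) rfl
          omega
        exact Algebra.adjoin_mono (Set.image_mono h0) hw.2
      obtain ⟨e, he, ex, ey⟩ := exists_elementary x (α x) (v x) (sub le_rfl (hv x)) (hv x).1
      refine ⟨e * g, mul_mem (Submonoid.subset_closure he) hg, fun y hy => ?_, fun y hy => ?_⟩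
      · rw [AlgEquiv.mul_apply]
        rw [Finset.mem_insert] at hy
        rcases hy with rfl | hy
        · rw [h2 _ hx, ex]
        · have hyx : y ≠ x := fun h => hx (h ▸ hy)
          rw [h1 y hy, map_add, map_smul, ey y hyx]
          congr 1
          exact eq_of_mem_adjoin (e : S.Alg →ₐ[𝓡] S.Alg) (AlgHom.id 𝓡 _) ey (sub (hmax y hy) (hv y))
      · rw [Finset.mem_insert, not_or] at hy
        rw [AlgEquiv.mul_apply, h2 y hy.2, ey y hy.1]
  obtain ⟨g, hg, h, _⟩ := key Finset.univ
  exact ⟨g, hg, fun x => h x (Finset.mem_univ x)⟩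

/-- A chain map that is triangular up to a bijection of the generators is a tame isomorphism. -/
theorem tameIso_of_triangular (e : S.gen ≃ T.gen) (hdeg : ∀ x, T.deg (e x) = S.deg x)
    (ρ : T.gen → ℕ) (f : S.gen → T.Alg) (α : S.gen → 𝓡ˣ)
    (hf : ∀ x, f x - (α x : 𝓡) • T.var (e x) ∈ T.low ρ (ρ (e x)) (S.deg x))
    (hd : ∀ x, FreeAlgebra.lift 𝓡 f (S.dGen x) = T.d (f x)) : TameIso S T := by
  have hv : ∀ y, f (e.symm y) - (α (e.symm y) : 𝓡) • T.var y ∈ T.low ρ (ρ y) (T.deg y) := by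
    intro y
    have := hf (e.symm y)
    rwa [← hdeg, Equiv.apply_symm_apply] at this
  obtain ⟨g, hg, h⟩ := exists_tameAut_of_triangular ρ (fun y => α (e.symm y)) _ hv
  -- Here the bijection comes first and the automorphism of `T` second. The correction chosen for
  -- the generator `e x` is `f x - α x • e x`, so the composite takes `x` to `f x`.
  have hF : ∀ w, ((relabelEquiv S T e).trans g) w = FreeAlgebra.lift 𝓡 f w := by
    intro w
    have : ((relabelEquiv S T e).trans g : S.Alg →ₐ[𝓡] T.Alg) = FreeAlgebra.lift 𝓡 f := by
      apply FreeAlgebra.hom_ext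
      funext x
      change g (relabel (T := T) e (S.var x)) = FreeAlgebra.lift 𝓡 f (S.var x)
      rw [relabel_var, h]
      simp
    exact DFunLike.congr_fun this w
  have hrel : IsTame (relabelEquiv S T e) := ⟨1, one_mem _, e, hdeg, rfl⟩
  have hgt : IsTame g := ⟨g, hg, Equiv.refl _, fun _ => rfl, by
    ext x; exact (relabel_id (S := T) (g x)).symm⟩
  have ht := hrel.trans hgt
  refine tameIso_iff.2 ⟨_, ht, fun w => ?_⟩
  refine map_d (((relabelEquiv S T e).trans g : S.Alg ≃ₐ[𝓡] T.Alg) : S.Alg →ₐ[𝓡] T.Alg)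
    (fun x => ht.mem_homogeneous (S.var_mem_homogeneous x)) (fun x => ?_) w
  refine (hF _).trans ((hd x).trans (congrArg T.d ?_))
  exact ((hF (S.var x)).trans (by simp)).symm

end Tame

end PreDGA

end

end TransverseHomology
namespace TransverseHomology

noncomputable section

namespace PreDGA

variable {𝓡 : Type} [CommRing 𝓡]

/-! ### Stabilizations by finite families of cancelling pairs; stable tame isomorphism is an
equivalence relation. -/

section Stab

variable {S T W : PreDGA 𝓡}

/-- Stabilization by a finite family of cancelling pairs. -/
abbrev stab (S : PreDGA 𝓡) (K : Type) [Finite K] (δ : K → ℤ) : PreDGA 𝓡 where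
  gen := S.gen ⊕ (K ⊕ K)
  finite := haveI := S.finite; inferInstance
  deg := Sum.elim S.deg (Sum.elim (fun k => δ k + 1) δ)
  dGen := Sum.elim
    (fun x => FreeAlgebra.lift 𝓡 (fun y => FreeAlgebra.ι 𝓡 (Sum.inl y)) (S.dGen x))
    (Sum.elim (fun k => FreeAlgebra.ι 𝓡 (Sum.inr (Sum.inr k))) fun _ => 0)

variable {K L : Type} [Finite K] [Finite L] (δ : K → ℤ) (ε : L → ℤ)

/-- The inclusion of a DGA into a stabilization. -/
abbrev stabIncl (S : PreDGA 𝓡) : S.Alg →ₐ[𝓡] (S.stab K δ).Alg :=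
  relabel (S := S) (T := S.stab K δ) Sum.inl

theorem stab_dGen_inl (x : S.gen) : (S.stab K δ).dGen (Sum.inl x) = stabIncl δ S (S.dGen x) := rfl

theorem stab_dGen_left (k : K) :
    (S.stab K δ).dGen (Sum.inr (Sum.inl k)) = (S.stab K δ).var (Sum.inr (Sum.inr k)) := rfl

theorem stab_dGen_right (k : K) : (S.stab K δ).dGen (Sum.inr (Sum.inr k)) = 0 := rfl

theorem stabIncl_mem_homogeneous {k : ℤ} {w : S.Alg} (hw : w ∈ S.homogeneous k) :
    stabIncl δ S w ∈ (S.stab K δ).homogeneous k :=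
  map_mem_homogeneous _ (fun x => by
    rw [relabel_var]; exact (S.stab K δ).var_mem_homogeneous (Sum.inl x)) hw

theorem stabIncl_d (w : S.Alg) : stabIncl δ S (S.d w) = (S.stab K δ).d (stabIncl δ S w) :=
  map_d _ (fun x => stabIncl_mem_homogeneous δ (S.var_mem_homogeneous x))
    (fun x => by rw [relabel_var, d_var]; rfl) w

/-- An elementary automorphism extends by the same formula, with the new generators fixed. This is
what makes stabilization compatible with tame isomorphism. -/
theorem tameAut_stab {g : S.Alg ≃ₐ[𝓡] S.Alg} (hg : g ∈ S.tameAut) :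
    ∃ g' ∈ (S.stab K δ).tameAut, (∀ w, g' (stabIncl δ S w) = stabIncl δ S (g w)) ∧
      ∀ k, g' ((S.stab K δ).var (Sum.inr k)) = (S.stab K δ).var (Sum.inr k) := by
  induction hg using Submonoid.closure_induction with
  | mem g hg =>
    obtain ⟨x, α, v, hv, hv', hx, hy⟩ := hg
    obtain ⟨g', hg', hx', hy'⟩ := exists_elementary (S := S.stab K δ) (Sum.inl x) α
      (stabIncl δ S v) (relabel_mem_adjoin _ (fun y hy => by simpa using hy) hv)
      (stabIncl_mem_homogeneous δ hv')
    refine ⟨g', Submonoid.subset_closure hg', fun w => ?_, fun k => hy' _ (by simp)⟩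
    have : (g' : (S.stab K δ).Alg →ₐ[𝓡] (S.stab K δ).Alg).comp (stabIncl δ S) =
        (stabIncl δ S).comp (g : S.Alg →ₐ[𝓡] S.Alg) := by
      apply FreeAlgebra.hom_ext
      funext y
      change g' (stabIncl δ S (S.var y)) = stabIncl δ S (g (S.var y))
      rw [relabel_var]
      by_cases h : y = x
      · subst h; rw [hx', hx, map_add, map_smul, relabel_var]
      · rw [hy y h, relabel_var, hy' _ (by simpa using h)]
    exact DFunLike.congr_fun this w
  | one => exact ⟨1, one_mem _, fun _ => rfl, fun _ => rfl⟩
  | mul g h _ _ hg hh =>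
    obtain ⟨g', hg', h1, h2⟩ := hg
    obtain ⟨h', hh', h3, h4⟩ := hh
    refine ⟨g' * h', mul_mem hg' hh', fun w => ?_, fun k => ?_⟩
    · simp only [AlgEquiv.mul_apply, h1, h3]
    · simp only [AlgEquiv.mul_apply, h2, h4]

theorem TameIso.stab (h : TameIso S T) : TameIso (S.stab K δ) (T.stab K δ) := by
  obtain ⟨g, hg, e, he, h⟩ := h
  obtain ⟨g', hg', h1, h2⟩ := tameAut_stab (K := K) δ hg
  let e' : (S.stab K δ).gen ≃ (T.stab K δ).gen := Equiv.sumCongr e (Equiv.refl _)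
  have hdeg : ∀ x, (T.stab K δ).deg (e' x) = (S.stab K δ).deg x := by
    rintro (x | k | k)
    · exact he x
    · rfl
    · rfl
  have hF : IsTame (g'.trans (relabelEquiv (S.stab K δ) (T.stab K δ) e')) :=
    ⟨g', hg', e', hdeg, rfl⟩
  have hcomm : ∀ w, relabel (S := S.stab K δ) (T := T.stab K δ) e' (stabIncl δ S w) =
      stabIncl δ T (relabel (T := T) e w) := fun w => by
    rw [relabel_relabel, relabel_relabel]; rfl
  refine tameIso_iff.2 ⟨_, hF, map_d (g'.trans (relabelEquiv (S.stab K δ) (T.stab K δ) e') :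
    (S.stab K δ).Alg →ₐ[𝓡] (T.stab K δ).Alg)
    (fun x => hF.mem_homogeneous ((S.stab K δ).var_mem_homogeneous x)) ?_⟩
  rintro (x | k | k)
  · change relabel _ (g' (stabIncl δ S (S.dGen x))) =
      (T.stab K δ).d (relabel _ (g' ((S.stab K δ).var (Sum.inl x))))
    have hx : (S.stab K δ).var (Sum.inl x) = stabIncl δ S (S.var x) := by rw [relabel_var]
    rw [hx, h1, h1, hcomm, hcomm, ← stabIncl_d, ← h, d_var]
  · change relabel _ (g' ((S.stab K δ).var (Sum.inr (Sum.inr k)))) =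
      (T.stab K δ).d (relabel _ (g' ((S.stab K δ).var (Sum.inr (Sum.inl k)))))
    rw [h2, h2, relabel_var, relabel_var]
    exact (d_var (T.stab K δ) (Sum.inr (Sum.inl k))).symm
  · change relabel _ (g' 0) =
      (T.stab K δ).d (relabel _ (g' ((S.stab K δ).var (Sum.inr (Sum.inr k)))))
    rw [h2, relabel_var, map_zero, map_zero]
    exact (d_var (T.stab K δ) (Sum.inr (Sum.inr k))).symm

theorem stab_stab_tameIso :
    TameIso ((S.stab K δ).stab L ε) (S.stab (K ⊕ L) (Sum.elim δ ε)) := by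
  let e : (S.gen ⊕ (K ⊕ K)) ⊕ (L ⊕ L) ≃ S.gen ⊕ ((K ⊕ L) ⊕ (K ⊕ L)) :=
    (Equiv.sumAssoc _ _ _).trans (Equiv.sumCongr (Equiv.refl _) (Equiv.sumSumSumComm K K L L))
  refine (isRelabelling_of_gen (S := (S.stab K δ).stab L ε) (T := S.stab (K ⊕ L) (Sum.elim δ ε))
    e ?_ ?_).tameIso
  · rintro ((x | k | k) | l | l) <;> rfl
  · rintro ((x | k | k) | l | l)
    · change relabel _ (stabIncl ε _ (stabIncl δ S (S.dGen x))) = stabIncl _ S (S.dGen x)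
      rw [relabel_relabel, relabel_relabel]; rfl
    · change relabel _ (stabIncl ε _ ((S.stab K δ).var (Sum.inr (Sum.inr k)))) = _
      rw [relabel_var, relabel_var]; rfl
    · change relabel _ (stabIncl ε _ 0) = _
      rw [map_zero, map_zero]; rfl
    · exact (relabel_var _ _).trans rfl
    · exact map_zero _

theorem stab_congr_tameIso (e : K ≃ L) (h : ∀ k, ε (e k) = δ k) :
    TameIso (S.stab K δ) (S.stab L ε) := by
  refine (isRelabelling_of_gen (S := S.stab K δ) (T := S.stab L ε)
    (Equiv.sumCongr (Equiv.refl _) (Equiv.sumCongr e e)) ?_ ?_).tameIso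
  · rintro (x | k | k)
    · rfl
    · exact congrArg (· + 1) (h k)
    · exact h k
  · rintro (x | k | k)
    · change relabel _ (stabIncl δ S (S.dGen x)) = stabIncl _ S (S.dGen x)
      rw [relabel_relabel]; rfl
    · exact (relabel_var _ _).trans rfl
    · exact map_zero _

theorem stab_empty_tameIso (δ : Fin 0 → ℤ) : TameIso S (S.stab (Fin 0) δ) := by
  refine (isRelabelling_of_gen (S := S) (T := S.stab (Fin 0) δ)
    (Equiv.sumEmpty S.gen (Fin 0 ⊕ Fin 0)).symm (fun x => rfl) (fun x => rfl)).tameIso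

theorem stabilize_tameIso (k : ℤ) : TameIso (S.stabilize k) (S.stab (Fin 1) fun _ => k) := by
  let e : (S.stabilize k).gen ≃ (S.stab (Fin 1) fun _ => k).gen :=
    Equiv.sumCongr (Equiv.refl _) (finSumFinEquiv (m := 1) (n := 1)).symm
  refine (isRelabelling_of_gen (S := S.stabilize k) (T := S.stab (Fin 1) fun _ => k) e ?_ ?_).tameIso
  · rintro (x | i)
    · rfl
    · fin_cases i <;> rfl
  · rintro (x | i)
    · exact relabel_relabel (S := S) (T := S.stabilize k) (W := S.stab (Fin 1) fun _ => k)
        Sum.inl e (S.dGen x)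
    · fin_cases i
      · exact (relabel_var (S := S.stabilize k) (T := S.stab (Fin 1) fun _ => k) e (Sum.inr 1)).trans rfl
      · exact map_zero _

theorem stabilizeList_tameIso (l : List ℤ) :
    TameIso (S.stabilizeList l) (S.stab (Fin l.length) l.get) := by
  induction l generalizing S with
  | nil => exact stab_empty_tameIso _
  | cons k l ih =>
    refine (ih (S := S.stabilize k)).trans (((stabilize_tameIso k).stab l.get).trans
      ((stab_stab_tameIso _ _).trans
        (stab_congr_tameIso _ _ ((finSumFinEquiv).trans (finCongr (Nat.add_comm 1 l.length))) ?_)))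
    rintro (i | i)
    · have : i = 0 := Subsingleton.elim _ _
      subst this
      rfl
    · have : (finSumFinEquiv.trans (finCongr (Nat.add_comm 1 l.length))) (Sum.inr i : Fin 1 ⊕ _) =
        i.succ := by
        ext; simp
      rw [this]; rfl

/-- Indexed families of pairs can be added and permuted by bijections of the index types, which is
cumbersome for successive stabilizations along a list. -/
theorem stableTameIso_iff : StableTameIso S T ↔ ∃ (p q : ℕ) (δ : Fin p → ℤ) (ε : Fin q → ℤ),
    TameIso (S.stab (Fin p) δ) (T.stab (Fin q) ε) := by
  constructor
  · rintro ⟨l, l', h⟩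
    exact ⟨_, _, _, _, (stabilizeList_tameIso l).symm.trans (h.trans (stabilizeList_tameIso l'))⟩
  · rintro ⟨p, q, δ, ε, h⟩
    have key : ∀ (U : PreDGA 𝓡) (p : ℕ) (δ : Fin p → ℤ),
        TameIso (U.stabilizeList (List.ofFn δ)) (U.stab (Fin p) δ) := fun U p δ =>
      (stabilizeList_tameIso (List.ofFn δ)).trans
        (stab_congr_tameIso _ _ (finCongr (List.length_ofFn (f := δ))) fun k => by simp; rfl)
    exact ⟨_, _, (key S p δ).trans (h.trans (key T q ε).symm)⟩

theorem stableTameIso_of_stab (h : TameIso (S.stab K δ) (T.stab L ε)) : StableTameIso S T := by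
  obtain ⟨p, ⟨e⟩⟩ := Finite.exists_equiv_fin K
  obtain ⟨q, ⟨e'⟩⟩ := Finite.exists_equiv_fin L
  refine stableTameIso_iff.2 ⟨p, q, fun i => δ (e.symm i), fun i => ε (e'.symm i), ?_⟩
  exact (stab_congr_tameIso _ _ e.symm fun _ => rfl).trans
    (h.trans (stab_congr_tameIso _ _ e' fun _ => by simp))

theorem stableTameIso_of_stab_left (h : TameIso (S.stab K δ) T) : StableTameIso S T :=
  stableTameIso_of_stab δ ![] (h.trans (stab_empty_tameIso _))

theorem TameIso.stableTameIso (h : TameIso S T) : StableTameIso S T := ⟨[], [], h⟩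

theorem StableTameIso.refl (S : PreDGA 𝓡) : StableTameIso S S := (TameIso.refl S).stableTameIso

theorem StableTameIso.symm (h : StableTameIso S T) : StableTameIso T S :=
  let ⟨l, l', h⟩ := h
  ⟨l', l, h.symm⟩

theorem StableTameIso.trans (h : StableTameIso S T) (h' : StableTameIso T W) :
    StableTameIso S W := by
  obtain ⟨p, q, δ, ε, h⟩ := stableTameIso_iff.1 h
  obtain ⟨p', q', δ', ε', h'⟩ := stableTameIso_iff.1 h'
  -- The middle DGA is stabilized by `ε` and `δ'` together. Each given isomorphism is stabilized by
  -- the family of the other, and the two copies of the middle DGA differ by the order of the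
  -- families.
  refine stableTameIso_of_stab (Sum.elim δ δ') (Sum.elim ε' ε) ?_
  refine (stab_stab_tameIso δ δ').symm.trans ((h.stab δ').trans ((stab_stab_tameIso ε δ').trans ?_))
  refine TameIso.trans ?_ ((stab_stab_tameIso δ' ε).symm.trans
    ((h'.stab ε).trans (stab_stab_tameIso ε' ε)))
  exact stab_congr_tameIso _ _ (Equiv.sumComm _ _) (by rintro (i | i) <;> rfl)

end Stab

/-! ### Homology is unchanged by stable tame isomorphism. -/

section HomologyMap

variable {S T W : PreDGA 𝓡}

theorem HomologyIso.symm (h : HomologyIso S T) : HomologyIso T S := by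
  obtain ⟨f, hf⟩ := h
  refine ⟨f.symm, fun k => ?_⟩
  rw [← hf k, ← Submodule.map_comp]
  have : f.symm.toLinearMap ∘ₗ f.toLinearMap = LinearMap.id := by ext x; simp
  rw [this, Submodule.map_id]

theorem HomologyIso.trans (h : HomologyIso S T) (h' : HomologyIso T W) : HomologyIso S W := by
  obtain ⟨f, hf⟩ := h
  obtain ⟨g, hg⟩ := h'
  refine ⟨f.trans g, fun k => ?_⟩
  rw [← hg k, ← hf k, ← Submodule.map_comp]
  rfl

/-- The map of the algebras of cycles induced by a chain map. -/
def cyclesMap (F : S.Alg →ₐ[𝓡] T.Alg) (hF : ∀ w, F (S.d w) = T.d (F w)) : S.cycles →ₐ[𝓡] T.cycles :=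
  (F.comp S.cycles.val).codRestrict T.cycles fun x => by
    change T.d (F x) = 0
    have hx : S.d x = 0 := x.2
    rw [← hF, hx, map_zero]

/-- The homology class of a cycle. -/
abbrev homologyClass (S : PreDGA 𝓡) : S.cycles →ₐ[𝓡] S.Homology :=
  RingQuot.mkAlgHom 𝓡 fun x y : S.cycles => ∃ w : S.Alg, S.d w = (x : S.Alg) - (y : S.Alg)

theorem homologyClass_eq {x y : S.cycles} {w : S.Alg} (h : S.d w = (x : S.Alg) - (y : S.Alg)) :
    S.homologyClass x = S.homologyClass y :=
  RingQuot.mkAlgHom_rel 𝓡 ⟨w, h⟩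

/-- The map of the homology algebras induced by a chain map. -/
def homologyMap (F : S.Alg →ₐ[𝓡] T.Alg) (hF : ∀ w, F (S.d w) = T.d (F w)) :
    S.Homology →ₐ[𝓡] T.Homology :=
  RingQuot.liftAlgHom 𝓡 ⟨T.homologyClass.comp (cyclesMap F hF), by
    rintro x y ⟨w, hw⟩
    refine homologyClass_eq (w := F w) ?_
    change _ = F x - F y
    rw [← hF, hw, map_sub]⟩

theorem homologyMap_class (F : S.Alg →ₐ[𝓡] T.Alg) (hF : ∀ w, F (S.d w) = T.d (F w))
    (x : S.cycles) : homologyMap F hF (S.homologyClass x) = T.homologyClass (cyclesMap F hF x) := by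
  simp [homologyMap]

theorem homologyMap_mem (F : S.Alg →ₐ[𝓡] T.Alg) (hF : ∀ w, F (S.d w) = T.d (F w))
    (hdeg : ∀ x, F (S.var x) ∈ T.homogeneous (S.deg x)) {k : ℤ} {z : S.Homology}
    (hz : z ∈ S.homologyDegree k) : homologyMap F hF z ∈ T.homologyDegree k := by
  obtain ⟨x, hx, rfl⟩ := hz
  exact ⟨cyclesMap F hF x, map_mem_homogeneous F hdeg hx, (homologyMap_class F hF x).symm⟩

/-- Every class is represented by a cycle, so it is enough that `G ∘ F` moves cycles by boundaries;
no homotopy on all of `S` is required. -/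
theorem homologyMap_homologyMap (F : S.Alg →ₐ[𝓡] T.Alg) (G : T.Alg →ₐ[𝓡] S.Alg)
    (hF : ∀ w, F (S.d w) = T.d (F w)) (hG : ∀ w, G (T.d w) = S.d (G w))
    (h : ∀ x, S.d x = 0 → ∃ w, S.d w = G (F x) - x) (z : S.Homology) :
    homologyMap G hG (homologyMap F hF z) = z := by
  obtain ⟨x, rfl⟩ := RingQuot.mkAlgHom_surjective 𝓡 _ z
  obtain ⟨w, hw⟩ := h x x.2
  refine (congrArg _ (homologyMap_class F hF x)).trans ((homologyMap_class G hG _).trans ?_)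
  exact homologyClass_eq hw

theorem homologyIso_of_homotopy (F : S.Alg →ₐ[𝓡] T.Alg) (G : T.Alg →ₐ[𝓡] S.Alg)
    (hF : ∀ w, F (S.d w) = T.d (F w)) (hG : ∀ w, G (T.d w) = S.d (G w))
    (hFdeg : ∀ x, F (S.var x) ∈ T.homogeneous (S.deg x))
    (hGdeg : ∀ x, G (T.var x) ∈ S.homogeneous (T.deg x))
    (h : ∀ x, S.d x = 0 → ∃ w, S.d w = G (F x) - x)
    (h' : ∀ x, T.d x = 0 → ∃ w, T.d w = F (G x) - x) : HomologyIso S T := by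
  have h1 := homologyMap_homologyMap F G hF hG h
  have h2 := homologyMap_homologyMap G F hG hF h'
  refine ⟨AlgEquiv.ofAlgHom (homologyMap F hF) (homologyMap G hG) (AlgHom.ext h2) (AlgHom.ext h1),
    fun k => le_antisymm ?_ fun z hz => ?_⟩
  · rintro _ ⟨z, hz, rfl⟩
    exact homologyMap_mem F hF hFdeg hz
  · exact ⟨_, homologyMap_mem G hG hGdeg hz, h2 z⟩

theorem TameIso.homologyIso (h : TameIso S T) : HomologyIso S T := by
  obtain ⟨F, hF, h⟩ := tameIso_iff.1 h
  obtain ⟨F', hF', h'⟩ : ∃ G : T.Alg ≃ₐ[𝓡] S.Alg, IsTame G ∧ G = F.symm := ⟨_, hF.symm, rfl⟩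
  refine homologyIso_of_homotopy (F : S.Alg →ₐ[𝓡] T.Alg) (F' : T.Alg →ₐ[𝓡] S.Alg) h (fun w => ?_)
    (fun x => hF.mem_homogeneous (S.var_mem_homogeneous x))
    (fun x => hF'.mem_homogeneous (T.var_mem_homogeneous x)) (fun x _ => ⟨0, ?_⟩)
    (fun x _ => ⟨0, ?_⟩)
  · subst h'
    change F.symm _ = S.d (F.symm _)
    rw [AlgEquiv.symm_apply_eq, h, AlgEquiv.apply_symm_apply]
  · subst h'
    change _ = F.symm (F x) - x
    simp
  · subst h'
    change _ = F (F.symm x) - x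
    simp

variable {K : Type} [Finite K] (δ : K → ℤ)

/-- The projection of a stabilization that kills the new generators. -/
def stabProj (S : PreDGA 𝓡) : (S.stab K δ).Alg →ₐ[𝓡] S.Alg :=
  FreeAlgebra.lift 𝓡 (Sum.elim S.var fun _ => 0)

theorem stabProj_inl (x : S.gen) : stabProj δ S ((S.stab K δ).var (Sum.inl x)) = S.var x := by
  simp [stabProj]

theorem stabProj_inr (x : K ⊕ K) : stabProj δ S ((S.stab K δ).var (Sum.inr x)) = 0 := by
  simp [stabProj]

theorem stabProj_incl (w : S.Alg) : stabProj δ S (stabIncl δ S w) = w := by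
  have : (stabProj δ S).comp (stabIncl δ S) = AlgHom.id 𝓡 _ := by
    apply FreeAlgebra.hom_ext
    funext x
    simp [stabProj, relabel]
  exact DFunLike.congr_fun this w

theorem stabProj_deg (x : (S.stab K δ).gen) :
    stabProj δ S ((S.stab K δ).var x) ∈ S.homogeneous ((S.stab K δ).deg x) := by
  rcases x with x | x
  · rw [stabProj_inl]; exact S.var_mem_homogeneous x
  · rw [stabProj_inr]; exact Submodule.zero_mem _

theorem stabProj_d (w : (S.stab K δ).Alg) :
    stabProj δ S ((S.stab K δ).d w) = S.d (stabProj δ S w) := by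
  refine map_d _ (stabProj_deg δ) ?_ w
  rintro (x | k | k)
  · rw [stab_dGen_inl, stabProj_incl, stabProj_inl, d_var]
  · rw [stab_dGen_left, stabProj_inr, stabProj_inr, map_zero]
  · rw [stab_dGen_right, stabProj_inr, map_zero, map_zero]

/-- The algebra map `w ↦ [[ι π (±w), h w], [0, w]]` that encodes the contracting homotopy `h`. -/
def stabHomotopyAux (S : PreDGA 𝓡) :
    (S.stab K δ).Alg →ₐ[𝓡] Matrix (Fin 2) (Fin 2) (S.stab K δ).Alg :=
  FreeAlgebra.lift 𝓡 fun x =>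
    !![(S.stab K δ).sgn (stabIncl δ S (stabProj δ S ((S.stab K δ).var x))),
      Sum.elim (fun _ => 0) (Sum.elim (fun _ => 0) fun k => (S.stab K δ).var (Sum.inr (Sum.inl k))) x;
      0, (S.stab K δ).var x]

/-- The contracting homotopy of a stabilization onto the original DGA. -/
def stabHomotopy (S : PreDGA 𝓡) : (S.stab K δ).Alg →ₗ[𝓡] (S.stab K δ).Alg :=
  Matrix.entryLinearMap 𝓡 (S.stab K δ).Alg 0 1 ∘ₗ (stabHomotopyAux δ S).toLinearMap

theorem stabHomotopyAux_entries (w : (S.stab K δ).Alg) :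
    stabHomotopyAux δ S w 0 0 = (S.stab K δ).sgn (stabIncl δ S (stabProj δ S w)) ∧
      stabHomotopyAux δ S w 1 0 = 0 ∧ stabHomotopyAux δ S w 1 1 = w := by
  induction w using FreeAlgebra.induction with
  | grade0 r => simp only [AlgHom.commutes]; simp [Matrix.algebraMap_matrix_apply]
  | grade1 x => simp [stabHomotopyAux]
  | mul u v hu hv => simp [Matrix.mul_apply, Fin.sum_univ_two, hu, hv]
  | add u v hu hv => simp [hu, hv]

/-- This is the upper right entry of a product of upper triangular matrices. The homotopy `h` is a
derivation between the signed projection on the left and the identity on the right; with this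
asymmetry `∂h + h∂` is the difference of the identity and the projection on products too. -/
theorem stabHomotopy_mul (u v : (S.stab K δ).Alg) :
    stabHomotopy δ S (u * v) = stabHomotopy δ S u * v +
      (S.stab K δ).sgn (stabIncl δ S (stabProj δ S u)) * stabHomotopy δ S v := by
  have hu := stabHomotopyAux_entries δ u
  have hv := stabHomotopyAux_entries δ v
  change (stabHomotopyAux δ S (u * v)) 0 1 = stabHomotopyAux δ S u 0 1 * v +
    (S.stab K δ).sgn (stabIncl δ S (stabProj δ S u)) * stabHomotopyAux δ S v 0 1
  rw [map_mul, Matrix.mul_apply, Fin.sum_univ_two, hu.1, hv.2.2, add_comm]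

theorem stabHomotopy_algebraMap (r : 𝓡) : stabHomotopy δ S (algebraMap 𝓡 _ r) = 0 := by
  change (stabHomotopyAux δ S (algebraMap 𝓡 _ r)) 0 1 = 0
  rw [AlgHom.commutes]
  simp [Matrix.algebraMap_matrix_apply]

theorem stabHomotopy_inl (x : S.gen) :
    stabHomotopy δ S ((S.stab K δ).var (Sum.inl x)) = 0 := by
  simp [stabHomotopy, stabHomotopyAux]

theorem stabHomotopy_left (k : K) :
    stabHomotopy δ S ((S.stab K δ).var (Sum.inr (Sum.inl k))) = 0 := by
  simp [stabHomotopy, stabHomotopyAux]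

theorem stabHomotopy_right (k : K) :
    stabHomotopy δ S ((S.stab K δ).var (Sum.inr (Sum.inr k))) =
      (S.stab K δ).var (Sum.inr (Sum.inl k)) := by
  simp [stabHomotopy, stabHomotopyAux]

theorem stab_sgn_incl_proj_sgn (w : (S.stab K δ).Alg) :
    (S.stab K δ).sgn (stabIncl δ S (stabProj δ S ((S.stab K δ).sgn w))) =
      stabIncl δ S (stabProj δ S w) := by
  have h2 := map_sgn (stabIncl δ S)
    (fun x => stabIncl_mem_homogeneous δ (S.var_mem_homogeneous x)) (stabProj δ S w)
  rw [map_sgn (stabProj δ S) (stabProj_deg δ) w, h2, sgn_sgn]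

/-- The homotopy raises degrees by one, so like the differential it anticommutes with the sign
automorphism. -/
theorem stabHomotopy_sgn (w : (S.stab K δ).Alg) :
    stabHomotopy δ S ((S.stab K δ).sgn w) = -(S.stab K δ).sgn (stabHomotopy δ S w) := by
  induction w using FreeAlgebra.induction with
  | grade0 r =>
    rw [AlgHom.commutes, stabHomotopy_algebraMap, map_zero, neg_zero]
  | grade1 x =>
    change stabHomotopy δ S ((S.stab K δ).sgn ((S.stab K δ).var x)) =
      -(S.stab K δ).sgn (stabHomotopy δ S ((S.stab K δ).var x))
    rw [sgn_var, map_zsmul]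
    rcases x with x | k | k
    · rw [stabHomotopy_inl, smul_zero, map_zero, neg_zero]
    · rw [stabHomotopy_left, smul_zero, map_zero, neg_zero]
    · rw [stabHomotopy_right, sgn_var]
      change _ = -(((δ k + 1).negOnePow : ℤ) • _)
      rw [Int.negOnePow_add]
      simp
  | mul u v hu hv =>
    rw [map_mul, stabHomotopy_mul, hu, hv, stabHomotopy_mul, map_add, map_mul, map_mul,
      stab_sgn_incl_proj_sgn, sgn_sgn]
    noncomm_ring
  | add u v hu hv => simp only [map_add, hu, hv]; abel

theorem stabHomotopy_incl (w : S.Alg) : stabHomotopy δ S (stabIncl δ S w) = 0 := by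
  induction w using FreeAlgebra.induction with
  | grade0 r => rw [AlgHom.commutes, stabHomotopy_algebraMap]
  | grade1 x =>
    change stabHomotopy δ S (stabIncl δ S (S.var x)) = 0
    rw [relabel_var, stabHomotopy_inl]
  | mul u v hu hv => rw [map_mul, stabHomotopy_mul, hu, hv]; simp
  | add u v hu hv => rw [map_add, map_add, hu, hv, add_zero]

theorem stab_dGen_mem (h : ∀ x, S.dGen x ∈ S.homogeneous (S.deg x - 1)) (x : (S.stab K δ).gen) :
    (S.stab K δ).dGen x ∈ (S.stab K δ).homogeneous ((S.stab K δ).deg x - 1) := by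
  rcases x with x | k | k
  · exact stabIncl_mem_homogeneous δ (h x)
  · have := (S.stab K δ).var_mem_homogeneous (Sum.inr (Sum.inr k))
    rw [stab_dGen_left]
    simpa [stab] using this
  · exact Submodule.zero_mem _

/-- On generators, `h` sends the lower member of each pair to the upper one and kills everything
else, and the identity is immediate. Both sides obey `D(uv) = D(u) v + ιπ(u) D(v)`, where `ιπ` is
the projection onto the original DGA, so the identity extends to all words. -/
theorem stabHomotopy_d (h : ∀ x, S.dGen x ∈ S.homogeneous (S.deg x - 1)) (w : (S.stab K δ).Alg) :
    (S.stab K δ).d (stabHomotopy δ S w) + stabHomotopy δ S ((S.stab K δ).d w) =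
      w - stabIncl δ S (stabProj δ S w) := by
  have hd := stab_dGen_mem δ h
  induction w using FreeAlgebra.induction with
  | grade0 r =>
    rw [stabHomotopy_algebraMap, d_algebraMap, AlgHom.commutes, AlgHom.commutes, sub_self, map_zero,
      map_zero, zero_add]
  | grade1 x =>
    change (S.stab K δ).d (stabHomotopy δ S ((S.stab K δ).var x)) +
      stabHomotopy δ S ((S.stab K δ).d ((S.stab K δ).var x)) = (S.stab K δ).var x -
        stabIncl δ S (stabProj δ S ((S.stab K δ).var x))
    rw [d_var]
    rcases x with x | k | k
    · rw [stab_dGen_inl, stabHomotopy_incl, stabProj_inl, relabel_var, stabHomotopy_inl, map_zero,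
        sub_self, add_zero]
    · rw [stab_dGen_left, stabProj_inr, map_zero, stabHomotopy_left, stabHomotopy_right, map_zero,
        zero_add, sub_zero]
    · rw [stab_dGen_right, stabProj_inr, map_zero, stabHomotopy_right, d_var, stab_dGen_left,
        map_zero, add_zero, sub_zero]
  | mul u v hu hv =>
    have hs : (S.stab K δ).sgn (stabIncl δ S (stabProj δ S ((S.stab K δ).d u))) =
        -(S.stab K δ).d ((S.stab K δ).sgn (stabIncl δ S (stabProj δ S u))) := by
      rw [stabProj_d, stabIncl_d, sgn_d hd]
    rw [stabHomotopy_mul, map_add, d_mul, d_mul, d_mul, map_add, stabHomotopy_mul, stabHomotopy_mul,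
      hs, stabHomotopy_sgn, stab_sgn_incl_proj_sgn, sgn_sgn, map_mul, map_mul]
    linear_combination (norm := noncomm_ring) hu * v + stabIncl δ S (stabProj δ S u) * hv
  | add u v hu hv =>
    simp only [map_add]
    linear_combination (norm := abel) hu + hv

theorem stab_homologyIso (h : ∀ x, S.dGen x ∈ S.homogeneous (S.deg x - 1)) :
    HomologyIso S (S.stab K δ) := by
  refine homologyIso_of_homotopy (stabIncl δ S) (stabProj δ S) (stabIncl_d δ) (stabProj_d δ)
    (fun x => stabIncl_mem_homogeneous δ (S.var_mem_homogeneous x)) (stabProj_deg δ)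
    (fun x _ => ⟨0, by rw [stabProj_incl, map_zero, sub_self]⟩) fun x hx => ?_
  -- The sign: on a cycle the homotopy formula gives `x - ιπ x`, while the opposite difference is
  -- asked for.
  refine ⟨-stabHomotopy δ S x, ?_⟩
  have := stabHomotopy_d δ h x
  rw [hx, map_zero, add_zero] at this
  rw [map_neg, this, neg_sub]

theorem IsDGA.dGen_mem (h : S.IsDGA) (x : S.gen) : S.dGen x ∈ S.homogeneous (S.deg x - 1) := by
  rw [← d_var]
  exact h.1 _ _ (S.var_mem_homogeneous x)

theorem StableTameIso.homologyIso (hS : S.IsDGA) (hT : T.IsDGA) (h : StableTameIso S T) :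
    HomologyIso S T := by
  obtain ⟨p, q, δ, ε, h⟩ := stableTameIso_iff.1 h
  exact (stab_homologyIso δ hS.dGen_mem).trans
    (h.homologyIso.trans (stab_homologyIso ε hT.dGen_mem).symm)

end HomologyMap

end PreDGA

end

end TransverseHomology
namespace TransverseHomology

noncomputable section

/-! ### Writhe, permutation and the two inclusions of braid groups. -/

section Braids

theorem braid_induction {m : ℕ} {p : BraidGroup m → Prop} (one : p 1)
    (sigma : ∀ k : Fin m, p (sigma k)) (mul : ∀ a b, p a → p b → p (a * b))
    (inv : ∀ a, p a → p a⁻¹) (B : BraidGroup m) : p B := by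
  let H : Subgroup (BraidGroup m) :=
    { carrier := {B | p B}
      one_mem' := one
      mul_mem' := fun {a b} ha hb => mul a b ha hb
      inv_mem' := fun {a} ha => inv a ha }
  exact PresentedGroup.generated_by _ H sigma B

theorem braid_hom_ext {m : ℕ} {G : Type} [Group G] {f g : BraidGroup m →* G}
    (h : ∀ k : Fin m, f (sigma k) = g (sigma k)) : f = g :=
  PresentedGroup.ext h

theorem addStrandRight_sigma {m : ℕ} (k : Fin m) :
    addStrandRight m (sigma k) = sigma k.castSucc := braidLift_sigma _ _ _ k

theorem addStrandLeft_sigma {m : ℕ} (k : Fin m) :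
    addStrandLeft m (sigma k) = sigma k.succ := braidLift_sigma _ _ _ k

theorem braidPerm_sigma {m : ℕ} (k : Fin m) :
    braidPerm m (sigma k) = Equiv.swap k.castSucc k.succ := braidLift_sigma _ _ _ k

theorem writhe_sigma {m : ℕ} (k : Fin m) : writhe (sigma k) = 1 := by
  simp only [writhe, writheHom, braidLift_sigma]; rfl

theorem writhe_mul {m : ℕ} (a b : BraidGroup m) : writhe (a * b) = writhe a + writhe b := by
  simp [writhe]

theorem writhe_inv {m : ℕ} (a : BraidGroup m) : writhe a⁻¹ = -writhe a := by
  simp [writhe]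

theorem writhe_addStrandLeft {m : ℕ} (B : BraidGroup m) : writhe (addStrandLeft m B) = writhe B := by
  have : (writheHom (m + 1)).comp (addStrandLeft m) = writheHom m := by
    apply braid_hom_ext
    intro k
    rw [MonoidHom.comp_apply, addStrandLeft_sigma, writheHom, braidLift_sigma, writheHom,
      braidLift_sigma]
  exact congrArg Multiplicative.toAdd (DFunLike.congr_fun this B)

theorem addStrandRight_addStrandLeft {m : ℕ} (B : BraidGroup m) :
    addStrandRight (m + 1) (addStrandLeft m B) = addStrandLeft (m + 1) (addStrandRight m B) := by
  have : (addStrandRight (m + 1)).comp (addStrandLeft m) =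
      (addStrandLeft (m + 1)).comp (addStrandRight m) := by
    apply braid_hom_ext
    intro k
    simp only [MonoidHom.comp_apply, addStrandLeft_sigma, addStrandRight_sigma, Fin.succ_castSucc]
  exact DFunLike.congr_fun this B

theorem braidPerm_addStrandRight_castSucc {m : ℕ} (B : BraidGroup m) (i : Fin (m + 1)) :
    braidPerm (m + 1) (addStrandRight m B) i.castSucc = (braidPerm m B i).castSucc := by
  induction B using braid_induction generalizing i with
  | one => simp
  | sigma k =>
    rw [addStrandRight_sigma, braidPerm_sigma, braidPerm_sigma, Equiv.swap_apply_def,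
      Equiv.swap_apply_def, Fin.succ_castSucc]
    simp only [Fin.castSucc_inj]
    split_ifs <;> rfl
  | mul a b ha hb => simp [hb, ha]
  | inv a ha =>
    rw [map_inv, map_inv, map_inv, Equiv.Perm.inv_eq_iff_eq, ha, ← Equiv.Perm.mul_apply, mul_inv_cancel, Equiv.Perm.one_apply]

theorem braidPerm_addStrandRight_last {m : ℕ} (B : BraidGroup m) :
    braidPerm (m + 1) (addStrandRight m B) (Fin.last (m + 1)) = Fin.last (m + 1) := by
  induction B using braid_induction with
  | one => simp
  | sigma k =>
    rw [addStrandRight_sigma, braidPerm_sigma, Equiv.swap_apply_of_ne_of_ne]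
    · exact (Fin.castSucc_lt_last _).ne'
    · rw [Fin.succ_castSucc]; exact (Fin.castSucc_lt_last _).ne'
  | mul a b ha hb => simp [hb, ha]
  | inv a ha => rw [map_inv, map_inv, Equiv.Perm.inv_eq_iff_eq, ha]

theorem braidPerm_addStrandLeft_succ {m : ℕ} (B : BraidGroup m) (i : Fin (m + 1)) :
    braidPerm (m + 1) (addStrandLeft m B) i.succ = (braidPerm m B i).succ := by
  induction B using braid_induction generalizing i with
  | one => simp
  | sigma k =>
    rw [addStrandLeft_sigma, braidPerm_sigma, braidPerm_sigma, Equiv.swap_apply_def,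
      Equiv.swap_apply_def, ← Fin.succ_castSucc]
    simp only [Fin.succ_inj]
    split_ifs <;> rfl
  | mul a b ha hb => simp [hb, ha]
  | inv a ha =>
    rw [map_inv, map_inv, map_inv, Equiv.Perm.inv_eq_iff_eq, ha, ← Equiv.Perm.mul_apply, mul_inv_cancel, Equiv.Perm.one_apply]

theorem braidPerm_addStrandLeft_zero {m : ℕ} (B : BraidGroup m) :
    braidPerm (m + 1) (addStrandLeft m B) 0 = 0 := by
  induction B using braid_induction with
  | one => simp
  | sigma k =>
    rw [addStrandLeft_sigma, braidPerm_sigma, Equiv.swap_apply_of_ne_of_ne]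
    · rw [← Fin.succ_castSucc]; exact (Fin.succ_ne_zero _).symm
    · exact (Fin.succ_ne_zero _).symm
  | mul a b ha hb => simp [hb, ha]
  | inv a ha => rw [map_inv, map_inv, Equiv.Perm.inv_eq_iff_eq, ha]

end Braids

/-! ### Renaming and rescaling of cord variables; words as paths. -/

section CordMaps

variable (𝓡 : Type) [CommRing 𝓡] {I J : Type} [DecidableEq I] [DecidableEq J]

theorem av_self (i : I) : av 𝓡 i i = -2 := by simp [av]

/-- The map of cord algebras induced by a map of indices. -/
def cordMap (f : I → J) : CordAlg 𝓡 I →ₐ[𝓡] CordAlg 𝓡 J :=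
  FreeAlgebra.lift 𝓡 fun x => av 𝓡 (f x.1.1) (f x.1.2)

theorem cordMap_av {f : I → J} (i j : I) :
    cordMap 𝓡 f (av 𝓡 i j) = av 𝓡 (f i) (f j) := by
  by_cases h : i = j
  · subst h; simp [av, map_ofNat]
  · rw [av, dif_pos h, cordMap, FreeAlgebra.lift_ι_apply]

/-- The rescaling `a_ij ↦ s_i s_j⁻¹ a_ij`. -/
def scaleHom (s : I → 𝓡ˣ) : CordAlg 𝓡 I →ₐ[𝓡] CordAlg 𝓡 I :=
  FreeAlgebra.lift 𝓡 fun x => ((s x.1.1 * (s x.1.2)⁻¹ : 𝓡ˣ) : 𝓡) • av 𝓡 x.1.1 x.1.2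

theorem scaleHom_av (s : I → 𝓡ˣ) (i j : I) :
    scaleHom 𝓡 s (av 𝓡 i j) = ((s i * (s j)⁻¹ : 𝓡ˣ) : 𝓡) • av 𝓡 i j := by
  by_cases h : i = j
  · subst h; simp [av, map_ofNat]
  · rw [av, dif_pos h, scaleHom, FreeAlgebra.lift_ι_apply]; simp [av, h]

theorem cordMap_crossHom {f : I → J} (hf : Function.Injective f) (p q : I) (x : CordAlg 𝓡 I) :
    crossHom 𝓡 (f p) (f q) (cordMap 𝓡 f x) = cordMap 𝓡 f (crossHom 𝓡 p q x) := by
  have : (crossHom 𝓡 (f p) (f q)).comp (cordMap 𝓡 f) = (cordMap 𝓡 f).comp (crossHom 𝓡 p q) := by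
    apply cordAlg_hom_ext
    intro i j hij
    rw [AlgHom.comp_apply, AlgHom.comp_apply, cordMap_av, crossHom_av _ _ _ hij,
      crossHom_av _ _ _ (hf.ne hij), crossVal, crossVal]
    simp only [hf.eq_iff]
    split_ifs <;> simp [cordMap_av]
  exact DFunLike.congr_fun this x

/-- `x` is a combination of words that lead from `i` to `j`. -/
def IsPath (s : I → 𝓡ˣ) (i j : I) (x : CordAlg 𝓡 I) : Prop :=
  scaleHom 𝓡 s x = ((s i * (s j)⁻¹ : 𝓡ˣ) : 𝓡) • x

theorem isPath_av (s : I → 𝓡ˣ) (i j : I) : IsPath 𝓡 s i j (av 𝓡 i j) := scaleHom_av 𝓡 s i j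

variable {𝓡} in
theorem IsPath.mul {s : I → 𝓡ˣ} {i k j : I} {x y : CordAlg 𝓡 I} (hx : IsPath 𝓡 s i k x)
    (hy : IsPath 𝓡 s k j y) : IsPath 𝓡 s i j (x * y) := by
  unfold IsPath at *
  rw [map_mul, hx, hy, smul_mul_smul_comm, ← Units.val_mul]
  congr 2
  group

variable {𝓡} in
theorem IsPath.neg {s : I → 𝓡ˣ} {i j : I} {x : CordAlg 𝓡 I} (hx : IsPath 𝓡 s i j x) :
    IsPath 𝓡 s i j (-x) := by
  unfold IsPath at *
  rw [map_neg, hx, smul_neg]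

variable {𝓡} in
theorem IsPath.sub {s : I → 𝓡ˣ} {i j : I} {x y : CordAlg 𝓡 I} (hx : IsPath 𝓡 s i j x)
    (hy : IsPath 𝓡 s i j y) : IsPath 𝓡 s i j (x - y) := by
  unfold IsPath at *
  rw [map_sub, hx, hy, smul_sub]

/-- In each word of the image of `a_ij` consecutive letters share an index, so the weights
telescope; the word starts at the transposed `i` and ends at the transposed `j`. Being an
eigenvector of the rescaling is the algebraic substitute for this statement about words. -/
theorem isPath_crossVal (s : I → 𝓡ˣ) {p q i j : I} (hpq : p ≠ q) (hij : i ≠ j) :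
    IsPath 𝓡 s (Equiv.swap p q i) (Equiv.swap p q j) (crossVal 𝓡 p q i j) := by
  unfold crossVal
  simp only [Equiv.swap_apply_def]
  split_ifs <;> subst_vars <;> first
    | exact isPath_av 𝓡 s _ _
    | exact (isPath_av 𝓡 s _ _).neg.sub ((isPath_av 𝓡 s _ _).mul (isPath_av 𝓡 s _ _))
    | contradiction

theorem scaleHom_crossHom (s : I → 𝓡ˣ) {p q : I} (hpq : p ≠ q) (x : CordAlg 𝓡 I) :
    crossHom 𝓡 p q (scaleHom 𝓡 (fun i => s (Equiv.swap p q i)) x) =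
      scaleHom 𝓡 s (crossHom 𝓡 p q x) := by
  have : (crossHom 𝓡 p q).comp (scaleHom 𝓡 (fun i => s (Equiv.swap p q i))) =
      (scaleHom 𝓡 s).comp (crossHom 𝓡 p q) := by
    apply cordAlg_hom_ext
    intro i j hij
    rw [AlgHom.comp_apply, AlgHom.comp_apply, scaleHom_av, map_smul, crossHom_av _ _ _ hij]
    exact (isPath_crossVal 𝓡 s hpq hij).symm
  exact DFunLike.congr_fun this x

end CordMaps

/-! ### The braid action, the chain rules for `Φ^L` and `Φ^R`, and the transformation of the
triangular parts of `𝐀`. -/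

section BraidAction

variable (𝓡 : Type) [CommRing 𝓡] {m : ℕ}

theorem braidAut_sigma (k : Fin m) (x : CordAlg 𝓡 (Fin (m + 1))) :
    braidAut 𝓡 m (sigma k) x = crossHom 𝓡 k.castSucc k.succ x := by
  rw [braidAut, braidLift_sigma]; rfl

theorem braidAut_one (x : CordAlg 𝓡 (Fin (m + 1))) : braidAut 𝓡 m 1 x = x := by
  rw [map_one]; rfl

theorem braidAut_mul (a b : BraidGroup m) (x : CordAlg 𝓡 (Fin (m + 1))) :
    braidAut 𝓡 m (a * b) x = braidAut 𝓡 m a (braidAut 𝓡 m b x) := by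
  rw [map_mul]; rfl

theorem braidAut_apply_inv (a : BraidGroup m) (x : CordAlg 𝓡 (Fin (m + 1))) :
    braidAut 𝓡 m a (braidAut 𝓡 m a⁻¹ x) = x := by
  rw [← braidAut_mul, mul_inv_cancel, braidAut_one]

theorem braidAut_inv_apply (a : BraidGroup m) (x : CordAlg 𝓡 (Fin (m + 1))) :
    braidAut 𝓡 m a⁻¹ (braidAut 𝓡 m a x) = x := by
  rw [← braidAut_mul, inv_mul_cancel, braidAut_one]

/-- The words of `φ_B(a_ij)` lead from `B(i)` to `B(j)`. Rescaling afterwards by `s` is therefore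
the same as rescaling beforehand by the weights pulled back along the permutation. -/
theorem braidAut_scaleHom (s : Fin (m + 1) → 𝓡ˣ) (B : BraidGroup m)
    (x : CordAlg 𝓡 (Fin (m + 1))) :
    braidAut 𝓡 m B (scaleHom 𝓡 (fun i => s (braidPerm m B i)) x) =
      scaleHom 𝓡 s (braidAut 𝓡 m B x) := by
  induction B using braid_induction generalizing s x with
  | one => simp
  | sigma k =>
    rw [braidAut_sigma, braidAut_sigma, braidPerm_sigma]
    exact scaleHom_crossHom 𝓡 s Fin.castSucc_lt_succ.ne x
  | mul a b ha hb =>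
    rw [braidAut_mul, braidAut_mul, ← ha, ← hb]
    simp
  | inv a ha =>
    have h := ha (fun i => s (braidPerm m a⁻¹ i)) (braidAut 𝓡 m a⁻¹ x)
    rw [braidAut_apply_inv] at h
    rw [← h, braidAut_inv_apply]
    simp

/-- Naturality of the braid action under a homomorphism induced by a map of strands. -/
theorem braidAut_cordMap {n : ℕ} (g : BraidGroup m →* BraidGroup n) (h : Fin m → Fin n)
    (hg : ∀ k, g (sigma k) = sigma (h k)) {f : Fin (m + 1) → Fin (n + 1)}
    (hf : Function.Injective f) (h₁ : ∀ k, f k.castSucc = (h k).castSucc)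
    (h₂ : ∀ k, f k.succ = (h k).succ) (B : BraidGroup m) (x : CordAlg 𝓡 (Fin (m + 1))) :
    braidAut 𝓡 n (g B) (cordMap 𝓡 f x) = cordMap 𝓡 f (braidAut 𝓡 m B x) := by
  induction B using braid_induction generalizing x with
  | one => rw [map_one, braidAut_one, braidAut_one]
  | sigma k => rw [hg, braidAut_sigma, braidAut_sigma, ← h₁, ← h₂, cordMap_crossHom 𝓡 hf]
  | mul a b ha hb => rw [map_mul, braidAut_mul, braidAut_mul, hb, ha]
  | inv a ha =>
    apply (braidAut 𝓡 n (g a)).injective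
    rw [map_inv, braidAut_apply_inv, ha, braidAut_apply_inv]

theorem braidAut_addStrandLeft_succ (B : BraidGroup m) (x : CordAlg 𝓡 (Fin (m + 1))) :
    braidAut 𝓡 (m + 1) (addStrandLeft m B) (cordMap 𝓡 Fin.succ x) =
      cordMap 𝓡 Fin.succ (braidAut 𝓡 m B x) :=
  braidAut_cordMap 𝓡 _ Fin.succ addStrandLeft_sigma (Fin.succ_injective _)
    (fun k => Fin.succ_castSucc k) (fun _ => rfl) B x

theorem braidAutExt_cordIncl (B : BraidGroup m) (x : CordAlg 𝓡 (Fin (m + 1))) :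
    braidAutExt 𝓡 B (cordIncl 𝓡 m x) = cordIncl 𝓡 m (braidAut 𝓡 m B x) :=
  braidAut_cordMap 𝓡 _ Fin.castSucc addStrandRight_sigma (Fin.castSucc_injective _)
    (fun _ => rfl) (fun k => (Fin.succ_castSucc k).symm) B x

theorem PhiL_spec (B : BraidGroup m) (i : Fin (m + 1)) :
    braidAutExt 𝓡 B (av 𝓡 i.castSucc (Fin.last (m + 1))) =
      ∑ l, cordIncl 𝓡 m (PhiL 𝓡 B i l) * av 𝓡 l.castSucc (Fin.last (m + 1)) :=
  (existsUnique_PhiL 𝓡 B).choose_spec.1 i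

theorem PhiR_spec (B : BraidGroup m) (i : Fin (m + 1)) :
    braidAutExt 𝓡 B (av 𝓡 (Fin.last (m + 1)) i.castSucc) =
      ∑ l, av 𝓡 (Fin.last (m + 1)) l.castSucc * cordIncl 𝓡 m (PhiR 𝓡 B l i) :=
  (existsUnique_PhiR 𝓡 B).choose_spec.1 i

theorem PhiL_eq (B : BraidGroup m)
    {M : Matrix (Fin (m + 1)) (Fin (m + 1)) (CordAlg 𝓡 (Fin (m + 1)))}
    (h : ∀ i, braidAutExt 𝓡 B (av 𝓡 i.castSucc (Fin.last (m + 1))) =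
        ∑ l, cordIncl 𝓡 m (M i l) * av 𝓡 l.castSucc (Fin.last (m + 1))) : PhiL 𝓡 B = M :=
  (existsUnique_PhiL 𝓡 B).unique (PhiL_spec 𝓡 B) h

theorem PhiR_eq (B : BraidGroup m)
    {M : Matrix (Fin (m + 1)) (Fin (m + 1)) (CordAlg 𝓡 (Fin (m + 1)))}
    (h : ∀ i, braidAutExt 𝓡 B (av 𝓡 (Fin.last (m + 1)) i.castSucc) =
        ∑ l, av 𝓡 (Fin.last (m + 1)) l.castSucc * cordIncl 𝓡 m (M l i)) : PhiR 𝓡 B = M :=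
  (existsUnique_PhiR 𝓡 B).unique (PhiR_spec 𝓡 B) h

theorem braidAutExt_mul (a b : BraidGroup m) (x : CordAlg 𝓡 (Fin (m + 2))) :
    braidAutExt 𝓡 (a * b) x = braidAutExt 𝓡 a (braidAutExt 𝓡 b x) := by
  rw [braidAutExt, map_mul, braidAut_mul]; rfl

/-- The chain rule for `Φ^L`. -/
theorem PhiL_mul (a b : BraidGroup m) :
    PhiL 𝓡 (a * b) = (PhiL 𝓡 b).map (braidAut 𝓡 m a) * PhiL 𝓡 a := by
  refine PhiL_eq 𝓡 _ fun i => ?_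
  rw [braidAutExt_mul, PhiL_spec, map_sum]
  simp only [map_mul, braidAutExt_cordIncl, PhiL_spec, Matrix.mul_apply, map_sum, Finset.sum_mul,
    Finset.mul_sum, mul_assoc, Matrix.map_apply]
  exact Finset.sum_comm

/-- The chain rule for `Φ^R`. -/
theorem PhiR_mul (a b : BraidGroup m) :
    PhiR 𝓡 (a * b) = PhiR 𝓡 a * (PhiR 𝓡 b).map (braidAut 𝓡 m a) := by
  refine PhiR_eq 𝓡 _ fun i => ?_
  rw [braidAutExt_mul, PhiR_spec, map_sum]
  simp only [map_mul, braidAutExt_cordIncl, PhiR_spec, Matrix.mul_apply, map_sum, Finset.sum_mul,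
    Finset.mul_sum, mul_assoc, Matrix.map_apply]
  exact Finset.sum_comm

theorem PhiL_one : PhiL 𝓡 (1 : BraidGroup m) = 1 := by
  refine PhiL_eq 𝓡 _ fun i => ?_
  rw [braidAutExt, map_one, braidAut_one]
  simp [Matrix.one_apply]

theorem PhiR_one : PhiR 𝓡 (1 : BraidGroup m) = 1 := by
  refine PhiR_eq 𝓡 _ fun i => ?_
  rw [braidAutExt, map_one, braidAut_one]
  simp [Matrix.one_apply]

/-- The matrix `Φ^L` of a crossing, with `g` in the place of `-a_{q,p}`. -/
def crossMat {A I : Type} [Ring A] [DecidableEq I] (p q : I) (g : A) : Matrix I I A :=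
  Matrix.of fun i l =>
    if i = p then (if l = p then g else if l = q then -1 else 0)
    else if i = q then (if l = p then 1 else 0) else if l = i then 1 else 0

section CrossMat

variable {A I : Type} [Ring A] [DecidableEq I] {p q : I}

theorem crossMat_map {A' F : Type} [Ring A'] [FunLike F A A'] [RingHomClass F A A'] (f : F)
    (p q : I) (g : A) : (crossMat p q g).map f = crossMat p q (f g) := by
  ext i l
  simp only [crossMat, Matrix.map_apply, Matrix.of_apply]
  split_ifs <;> simp

variable [Fintype I]

theorem sum_crossMat_mul (hpq : p ≠ q) (g : A) (v : I → A) (i : I) :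
    ∑ l, crossMat p q g i l * v l =
      if i = p then g * v p - v q else if i = q then v p else v i := by
  have h : ∀ l, crossMat p q g i l * v l =
      if i = p then ((if l = p then g * v l else 0) + (if l = q then -v l else 0))
      else if i = q then (if l = p then v l else 0) else if l = i then v l else 0 := by
    intro l
    simp only [crossMat, Matrix.of_apply]
    split_ifs <;> simp_all
  simp only [h]
  split_ifs <;> simp [Finset.sum_add_distrib, sub_eq_add_neg]

theorem sum_mul_crossMat (hpq : p ≠ q) (g : A) (v : I → A) (i : I) :
    ∑ l, v l * crossMat p q g i l =
      if i = p then v p * g - v q else if i = q then v p else v i := by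
  have h : ∀ l, v l * crossMat p q g i l =
      if i = p then ((if l = p then v l * g else 0) + (if l = q then -v l else 0))
      else if i = q then (if l = p then v l else 0) else if l = i then v l else 0 := by
    intro l
    simp only [crossMat, Matrix.of_apply]
    split_ifs <;> simp_all
  simp only [h]
  split_ifs <;> simp [Finset.sum_add_distrib, sub_eq_add_neg]

theorem crossMat_mul_apply (hpq : p ≠ q) (g : A) (X : Matrix I I A) (i j : I) :
    (crossMat p q g * X) i j = if i = p then g * X p j - X q j else if i = q then X p j else X i j :=
  sum_crossMat_mul hpq g (fun l => X l j) i

theorem mul_crossMat_apply (hpq : p ≠ q) (g : A) (X : Matrix I I A) (i j : I) :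
    (X * (crossMat p q g).transpose) i j =
      if j = p then X i p * g - X i q else if j = q then X i p else X i j :=
  sum_mul_crossMat hpq g (fun l => X i l) j

end CrossMat

theorem PhiL_sigma (k : Fin m) :
    PhiL 𝓡 (sigma k) = crossMat k.castSucc k.succ (-av 𝓡 k.succ k.castSucc) := by
  refine PhiL_eq 𝓡 _ fun i => ?_
  have h : ∀ l, cordIncl 𝓡 m (crossMat k.castSucc k.succ (-av 𝓡 k.succ k.castSucc) i l) =
      crossMat k.castSucc k.succ (cordIncl 𝓡 m (-av 𝓡 k.succ k.castSucc)) i l := fun l =>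
    congrFun (congrFun (crossMat_map (cordIncl 𝓡 m) _ _ _) i) l
  simp only [h]
  rw [sum_crossMat_mul Fin.castSucc_lt_succ.ne, braidAutExt, addStrandRight_sigma, braidAut_sigma,
    crossHom_av _ _ _ (Fin.castSucc_lt_last i).ne, crossVal]
  have h1 : ∀ j : Fin (m + 1), Fin.last (m + 1) ≠ j.castSucc := fun j => (Fin.castSucc_lt_last j).ne'
  simp only [Fin.succ_castSucc, Fin.castSucc_inj, h1, if_false, map_neg, cordIncl_av]
  split_ifs
  · noncomm_ring
  · rfl
  · rfl

theorem PhiR_sigma (k : Fin m) :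
    PhiR 𝓡 (sigma k) = (crossMat k.castSucc k.succ (-av 𝓡 k.castSucc k.succ)).transpose := by
  refine PhiR_eq 𝓡 _ fun i => ?_
  have h : ∀ l, cordIncl 𝓡 m ((crossMat k.castSucc k.succ
      (-av 𝓡 k.castSucc k.succ)).transpose l i) =
      crossMat k.castSucc k.succ (cordIncl 𝓡 m (-av 𝓡 k.castSucc k.succ)) i l := fun l =>
    congrFun (congrFun (crossMat_map (cordIncl 𝓡 m) _ _ _) i) l
  simp only [h]
  rw [sum_mul_crossMat Fin.castSucc_lt_succ.ne, braidAutExt, addStrandRight_sigma, braidAut_sigma,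
    crossHom_av _ _ _ (Fin.castSucc_lt_last i).ne', crossVal]
  have h1 : ∀ j : Fin (m + 1), Fin.last (m + 1) ≠ j.castSucc := fun j => (Fin.castSucc_lt_last j).ne'
  simp only [Fin.succ_castSucc, Fin.castSucc_inj, h1, if_false, map_neg, cordIncl_av]
  split_ifs
  · noncomm_ring
  · rfl
  · rfl

/-- The hypotheses `h₁` and `h₂` say that no index lies strictly between `p` and `q`, so a crossing
does not change on which side of the diagonal an entry with a third index lies. For the entries with
both indices in `{p, q}` the diagonal value `-1` is decisive: in the lower part, for example, the
entry `(p, q)` of the product is `-a_qp · (-1) - a_qp = 0`. -/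
theorem crossHom_triMatrix {p q : Fin (m + 1)} (hpq : p < q)
    (h₁ : ∀ i, i ≠ p → i ≠ q → (i < q ↔ i < p)) (h₂ : ∀ i, i ≠ p → i ≠ q → (q < i ↔ p < i))
    {x y : 𝓡} (h : x = 1 ∧ y = 0 ∨ x = 0 ∧ y = 1) :
    (triMatrix x (-1) y (cordMatrix 𝓡 m)).map (crossHom 𝓡 p q) =
      crossMat p q (-av 𝓡 q p) * triMatrix x (-1) y (cordMatrix 𝓡 m) *
        (crossMat p q (-av 𝓡 p q)).transpose := by
  have hne := hpq.ne
  have hne' := hpq.ne'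
  have hlt : (q < p) = False := eq_false hpq.not_gt
  ext i j
  rw [mul_crossMat_apply hne]
  simp only [crossMat_mul_apply hne, Matrix.map_apply, triMatrix, Matrix.of_apply, cordMatrix]
  have e : ∀ x : Fin (m + 1), x = p ∨ x = q ∨ (x ≠ p ∧ x ≠ q) := by
    intro x; tauto
  by_cases hij : i = j
  · subst hij
    rcases e i with rfl | rfl | ⟨hi, hi'⟩ <;> rcases h with ⟨rfl, rfl⟩ | ⟨rfl, rfl⟩ <;>
      simp_all <;> (try split_ifs) <;> first | (exfalso; order) | noncomm_ring
  · have hji : j ≠ i := Ne.symm hij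
    simp only [apply_ite (crossHom 𝓡 p q), map_smul, crossHom_av 𝓡 p q hij, if_neg hij, crossVal]
    rcases e i with rfl | rfl | ⟨hi, hi'⟩ <;> rcases e j with rfl | rfl | ⟨hj, hj'⟩ <;>
    rcases h with ⟨rfl, rfl⟩ | ⟨rfl, rfl⟩ <;>
      simp_all <;> (try split_ifs) <;> first | (exfalso; order) | noncomm_ring

theorem triMatrix_sigma (k : Fin m) {x y : 𝓡} (h : x = 1 ∧ y = 0 ∨ x = 0 ∧ y = 1) :
    (triMatrix x (-1) y (cordMatrix 𝓡 m)).map (braidAut 𝓡 m (sigma k)) =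
      PhiL 𝓡 (sigma k) * triMatrix x (-1) y (cordMatrix 𝓡 m) * PhiR 𝓡 (sigma k) := by
  rw [PhiL_sigma, PhiR_sigma, ← crossHom_triMatrix 𝓡 Fin.castSucc_lt_succ ?_ ?_ h]
  · ext i j
    exact braidAut_sigma 𝓡 k _
  · intro i; simp only [Fin.lt_def, Fin.ext_iff, ne_eq]; simp; omega
  · intro i; simp only [Fin.lt_def, Fin.ext_iff, ne_eq]; simp; omega

theorem map_matrix_mul {A A' F I : Type} [Fintype I] [Ring A] [Ring A'] [FunLike F A A']
    [RingHomClass F A A'] (f : F) (M N : Matrix I I A) : (M * N).map f = M.map f * N.map f :=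
  Matrix.map_mul (f := (f : A →+* A'))

theorem map_braidAut_inv (a : BraidGroup m) {I : Type} (M : Matrix I I (CordAlg 𝓡 (Fin (m + 1)))) :
    (M.map (braidAut 𝓡 m a)).map (braidAut 𝓡 m a⁻¹) = M := by
  ext i j
  exact braidAut_inv_apply 𝓡 a _

/-- The chain rule for `a a⁻¹ = 1`, transported by the automorphism of `a⁻¹`. -/
theorem PhiL_inv_mul (a : BraidGroup m) :
    PhiL 𝓡 a⁻¹ * (PhiL 𝓡 a).map (braidAut 𝓡 m a⁻¹) = 1 := by
  have h := congrArg (fun M => Matrix.map M (braidAut 𝓡 m a⁻¹)) (PhiL_mul 𝓡 a a⁻¹)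
  simp only [mul_inv_cancel, PhiL_one, map_matrix_mul, map_braidAut_inv] at h
  rw [← h]
  simp

theorem PhiR_mul_inv (a : BraidGroup m) :
    (PhiR 𝓡 a).map (braidAut 𝓡 m a⁻¹) * PhiR 𝓡 a⁻¹ = 1 := by
  have h := congrArg (fun M => Matrix.map M (braidAut 𝓡 m a⁻¹)) (PhiR_mul 𝓡 a a⁻¹)
  simp only [mul_inv_cancel, PhiR_one, map_matrix_mul, map_braidAut_inv] at h
  rw [← h]
  simp

theorem triMatrix_map_algEquiv {x δ y : 𝓡} {A A' : Type} [Ring A] [Ring A'] [Algebra 𝓡 A]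
    [Algebra 𝓡 A'] (f : A →ₐ[𝓡] A') (M : Matrix (Fin (m + 1)) (Fin (m + 1)) A) :
    (triMatrix x δ y M).map f = triMatrix x δ y (M.map f) := by
  ext i j
  simp only [triMatrix, Matrix.map_apply, Matrix.of_apply]
  split_ifs <;> simp

/-- The diagonal value `-x - y` is the one for which the matrix depends linearly on the weights. The
diagonals of `𝐀̂` and `𝐀̌` have this form, with weights `(1, μU)` and `(V, μ)`. -/
theorem triMatrix_add {A : Type} [Ring A] [Algebra 𝓡 A] (x y : 𝓡)
    (M : Matrix (Fin (m + 1)) (Fin (m + 1)) A) :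
    triMatrix x (-x - y) y M = x • triMatrix (1 : 𝓡) (-1) 0 M + y • triMatrix (0 : 𝓡) (-1) 1 M := by
  ext i j
  simp only [triMatrix, Matrix.of_apply, Matrix.add_apply, Matrix.smul_apply]
  split_ifs
  · simp
  · simp only [map_neg, map_one, map_sub, Algebra.algebraMap_eq_smul_one x,
      Algebra.algebraMap_eq_smul_one y, smul_neg]
    abel
  · simp

/-- For a product `ab`, the automorphism of `a` is applied to the identity for `b`, the identity for
`a` is substituted in the middle, and the outer factors combine by the chain rules. For an inverse,
the outer factors are removed with `PhiL_inv_mul` and `PhiR_mul_inv`. -/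
theorem map_braid_of_sigma {X : Matrix (Fin (m + 1)) (Fin (m + 1)) (CordAlg 𝓡 (Fin (m + 1)))}
    (h : ∀ k : Fin m, X.map (braidAut 𝓡 m (sigma k)) = PhiL 𝓡 (sigma k) * X * PhiR 𝓡 (sigma k))
    (B : BraidGroup m) : X.map (braidAut 𝓡 m B) = PhiL 𝓡 B * X * PhiR 𝓡 B := by
  induction B using braid_induction with
  | one => rw [PhiL_one, PhiR_one, one_mul, mul_one]; ext i j; exact braidAut_one 𝓡 _
  | sigma k => exact h k
  | mul a b ha hb =>
    have : X.map (braidAut 𝓡 m (a * b)) = (X.map (braidAut 𝓡 m b)).map (braidAut 𝓡 m a) := by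
      ext i j; exact braidAut_mul 𝓡 a b _
    rw [this, hb, map_matrix_mul, map_matrix_mul, ha, PhiL_mul, PhiR_mul]
    simp only [mul_assoc]
  | inv a ha =>
    have h1 := congrArg (fun M => Matrix.map M (braidAut 𝓡 m a⁻¹)) ha
    simp only [map_matrix_mul, map_braidAut_inv] at h1
    calc X.map (braidAut 𝓡 m a⁻¹)
        = (PhiL 𝓡 a⁻¹ * (PhiL 𝓡 a).map (braidAut 𝓡 m a⁻¹)) * X.map (braidAut 𝓡 m a⁻¹) *
          ((PhiR 𝓡 a).map (braidAut 𝓡 m a⁻¹) * PhiR 𝓡 a⁻¹) := by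
          rw [PhiL_inv_mul, PhiR_mul_inv, one_mul, mul_one]
      _ = PhiL 𝓡 a⁻¹ * ((PhiL 𝓡 a).map (braidAut 𝓡 m a⁻¹) * X.map (braidAut 𝓡 m a⁻¹) *
          (PhiR 𝓡 a).map (braidAut 𝓡 m a⁻¹)) * PhiR 𝓡 a⁻¹ := by simp only [mul_assoc]
      _ = PhiL 𝓡 a⁻¹ * X * PhiR 𝓡 a⁻¹ := by rw [← h1]

/-- The lower and upper triangular parts of `𝐀` transform like `𝐀`; here they are combined with
arbitrary coefficients. -/
theorem triMatrix_braid (B : BraidGroup m) (x y : 𝓡) :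
    (triMatrix x (-x - y) y (cordMatrix 𝓡 m)).map (braidAut 𝓡 m B) =
      PhiL 𝓡 B * triMatrix x (-x - y) y (cordMatrix 𝓡 m) * PhiR 𝓡 B := by
  refine map_braid_of_sigma 𝓡 (fun k => ?_) B
  rw [triMatrix_add]
  have h : ∀ M N : Matrix (Fin (m + 1)) (Fin (m + 1)) (CordAlg 𝓡 (Fin (m + 1))),
      (x • M + y • N).map (braidAut 𝓡 m (sigma k)) =
        x • M.map (braidAut 𝓡 m (sigma k)) + y • N.map (braidAut 𝓡 m (sigma k)) := by
    intro M N; ext i j; simp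
  rw [h, triMatrix_sigma 𝓡 k (Or.inl ⟨rfl, rfl⟩), triMatrix_sigma 𝓡 k (Or.inr ⟨rfl, rfl⟩)]
  simp only [mul_add, add_mul, mul_smul_comm, smul_mul_assoc]

theorem scaleHom_cordIncl (s : Fin (m + 1) → 𝓡ˣ) (x : CordAlg 𝓡 (Fin (m + 1))) :
    scaleHom 𝓡 (Fin.lastCases 1 s : Fin (m + 2) → 𝓡ˣ) (cordIncl 𝓡 m x) =
      cordIncl 𝓡 m (scaleHom 𝓡 s x) := by
  have : (scaleHom 𝓡 (Fin.lastCases 1 s : Fin (m + 2) → 𝓡ˣ)).comp (cordIncl 𝓡 m) =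
      (cordIncl 𝓡 m).comp (scaleHom 𝓡 s) := by
    apply cordAlg_hom_ext
    intro i j _
    simp [cordIncl_av, scaleHom_av]
  exact DFunLike.congr_fun this x

/-- The expansion that defines `Φ^L` is unique. Rescaling it produces a second matrix with the same
property, and the comparison of the two matrices is the eigenvector equation. -/
theorem PhiL_isPath (s : Fin (m + 1) → 𝓡ˣ) (B : BraidGroup m) (i j : Fin (m + 1)) :
    IsPath 𝓡 s (braidPerm m B i) j (PhiL 𝓡 B i j) := by
  have key : PhiL 𝓡 B = Matrix.of fun i j =>
      (((s (braidPerm m B i))⁻¹ * s j : 𝓡ˣ) : 𝓡) • scaleHom 𝓡 s (PhiL 𝓡 B i j) := by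
    refine PhiL_eq 𝓡 B fun i => ?_
    -- The added strand gets the weight `1`, so that only the weights of the old strands remain in
    -- the comparison.
    have h := braidAut_scaleHom 𝓡 (Fin.lastCases 1 s) (addStrandRight m B)
      (av 𝓡 i.castSucc (Fin.last (m + 1)))
    rw [scaleHom_av, map_smul, braidPerm_addStrandRight_castSucc, braidPerm_addStrandRight_last] at h
    change _ • braidAutExt 𝓡 B _ = scaleHom 𝓡 _ (braidAutExt 𝓡 B _) at h
    rw [PhiL_spec, map_sum] at h
    simp only [map_mul, scaleHom_cordIncl, scaleHom_av, Fin.lastCases_castSucc, Fin.lastCases_last,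
      inv_one, mul_one] at h
    rw [← Units.smul_def, ← eq_inv_smul_iff, Units.smul_def] at h
    rw [PhiL_spec, h, Finset.smul_sum]
    refine Finset.sum_congr rfl fun l _ => ?_
    simp [mul_smul]
  have h := congrFun (congrFun key i) j
  rw [Matrix.of_apply] at h
  rw [← Units.smul_def, ← inv_smul_eq_iff, eq_comm, Units.smul_def] at h
  rw [IsPath, h, mul_inv_rev, inv_inv, mul_comm]

theorem PhiR_isPath (s : Fin (m + 1) → 𝓡ˣ) (B : BraidGroup m) (i j : Fin (m + 1)) :
    IsPath 𝓡 s i (braidPerm m B j) (PhiR 𝓡 B i j) := by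
  have key : PhiR 𝓡 B = Matrix.of fun i j =>
      (((s i)⁻¹ * s (braidPerm m B j) : 𝓡ˣ) : 𝓡) • scaleHom 𝓡 s (PhiR 𝓡 B i j) := by
    refine PhiR_eq 𝓡 B fun i => ?_
    have h := braidAut_scaleHom 𝓡 (Fin.lastCases 1 s) (addStrandRight m B)
      (av 𝓡 (Fin.last (m + 1)) i.castSucc)
    rw [scaleHom_av, map_smul, braidPerm_addStrandRight_castSucc, braidPerm_addStrandRight_last] at h
    change _ • braidAutExt 𝓡 B _ = scaleHom 𝓡 _ (braidAutExt 𝓡 B _) at h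
    rw [PhiR_spec, map_sum] at h
    simp only [map_mul, scaleHom_cordIncl, scaleHom_av, Fin.lastCases_castSucc, Fin.lastCases_last,
      one_mul] at h
    rw [← Units.smul_def, ← eq_inv_smul_iff, inv_inv, Units.smul_def] at h
    rw [PhiR_spec, h, Finset.smul_sum]
    refine Finset.sum_congr rfl fun l _ => ?_
    rw [Matrix.of_apply, map_smul, mul_smul_comm, smul_mul_assoc, smul_smul, ← Units.val_mul, mul_comm]
  have h := congrFun (congrFun key i) j
  rw [Matrix.of_apply] at h
  rw [← Units.smul_def, ← inv_smul_eq_iff, eq_comm, Units.smul_def] at h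
  rw [IsPath, h, mul_inv_rev, inv_inv, mul_comm]

end BraidAction

end

end TransverseHomology
namespace TransverseHomology

noncomputable section

/-! ### The DGA attached to a triple `(φ, P, Q)`, and its differential on matrices. -/

section Twisted

variable {𝓡 : Type} [CommRing 𝓡] {m : ℕ} (mu : 𝓡ˣ) (U V : 𝓡)

/-- The matrix `𝐀̂`. -/
def hatCord (m : ℕ) : Matrix (Fin (m + 1)) (Fin (m + 1)) (CordAlg 𝓡 (Fin (m + 1))) :=
  triMatrix (1 : 𝓡) (-1 - mu * U) (mu * U) (cordMatrix 𝓡 m)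

/-- The matrix `𝐀̌`. -/
def checkCord (m : ℕ) : Matrix (Fin (m + 1)) (Fin (m + 1)) (CordAlg 𝓡 (Fin (m + 1))) :=
  triMatrix V (-V - mu) (mu : 𝓡) (cordMatrix 𝓡 m)

/-- The matrix `𝐁̂`. -/
def hatB (m : ℕ) : Matrix (Fin (m + 1)) (Fin (m + 1)) (TAlg 𝓡 m) :=
  triMatrix (1 : 𝓡) 0 (mu * U) (bMatrix 𝓡 m)

/-- The matrix `𝐁̌`. -/
def checkB (m : ℕ) : Matrix (Fin (m + 1)) (Fin (m + 1)) (TAlg 𝓡 m) :=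
  triMatrix V 0 (mu : 𝓡) (bMatrix 𝓡 m)

variable (φ : CordAlg 𝓡 (Fin (m + 1)) →ₐ[𝓡] CordAlg 𝓡 (Fin (m + 1)))
  (P Q : Matrix (Fin (m + 1)) (Fin (m + 1)) (CordAlg 𝓡 (Fin (m + 1))))

/-- The differential of the generators of `twistedDGA`. -/
def twistedDiff : TGen (Fin (m + 1)) → TAlg 𝓡 m
  | .a _ _ _ => 0
  | .b i j _ => cordToT 𝓡 m (av 𝓡 i j - φ (av 𝓡 i j))
  | .c i j => cordToT 𝓡 m ((hatCord mu U m - P * checkCord mu V m) i j)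
  | .d i j => cordToT 𝓡 m ((checkCord mu V m - hatCord mu U m * Q) i j)
  | .e i j => (hatB mu U m - cMatrix 𝓡 m - P.map (cordToT 𝓡 m) * dMatrix 𝓡 m) i j
  | .f i j => (checkB mu V m - dMatrix 𝓡 m - cMatrix 𝓡 m * Q.map (cordToT 𝓡 m)) i j

/-- The DGA with the generators of the transverse DGA and the differential
`∂𝐁 = 𝐀 - φ(𝐀)`, `∂𝐂 = 𝐀̂ - P𝐀̌`, `∂𝐃 = 𝐀̌ - 𝐀̂Q`, `∂𝐄 = 𝐁̂ - 𝐂 - P𝐃`, `∂𝐅 = 𝐁̌ - 𝐃 - 𝐂Q`. -/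
abbrev twistedDGA : PreDGA 𝓡 where
  gen := TGen (Fin (m + 1))
  finite := TGen.finite _
  deg := TGen.deg
  dGen := twistedDiff mu U V φ P Q

/-- The matrix `𝐄 = (e_ij)`. -/
def eMatrix (𝓡 : Type) [CommRing 𝓡] (m : ℕ) : Matrix (Fin (m + 1)) (Fin (m + 1)) (TAlg 𝓡 m) :=
  Matrix.of fun i j => FreeAlgebra.ι 𝓡 (TGen.e i j)

/-- The matrix `𝐅 = (f_ij)`. -/
def fMatrix (𝓡 : Type) [CommRing 𝓡] (m : ℕ) : Matrix (Fin (m + 1)) (Fin (m + 1)) (TAlg 𝓡 m) :=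
  Matrix.of fun i j => FreeAlgebra.ι 𝓡 (TGen.f i j)

section Calculus

local notation "𝓢" => twistedDGA mu U V φ P Q
local notation "ct" => cordToT 𝓡 m

theorem cordToT_av {i j : Fin (m + 1)} (h : i ≠ j) :
    ct (av 𝓡 i j) = FreeAlgebra.ι 𝓡 (TGen.a i j h) := by
  rw [av, dif_pos h, cordToT, FreeAlgebra.lift_ι_apply]

theorem bMatrix_apply {i j : Fin (m + 1)} (h : i ≠ j) :
    bMatrix 𝓡 m i j = FreeAlgebra.ι 𝓡 (TGen.b i j h) := by
  simp [bMatrix, h]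

theorem bMatrix_self (i : Fin (m + 1)) : bMatrix 𝓡 m i i = 0 := by
  simp [bMatrix]

theorem cordToT_mem_homogeneous (x : CordAlg 𝓡 (Fin (m + 1))) : ct x ∈ PreDGA.homogeneous 𝓢 0 := by
  induction x using FreeAlgebra.induction with
  | grade0 r => rw [AlgHom.commutes]; exact PreDGA.algebraMap_mem_homogeneous 𝓢 r
  | grade1 x =>
    rw [cordToT, FreeAlgebra.lift_ι_apply]
    exact PreDGA.var_mem_homogeneous 𝓢 (TGen.a x.1.1 x.1.2 x.2)
  | mul u v hu hv => rw [map_mul]; exact PreDGA.mul_mem_homogeneous' 𝓢 hu hv (by ring)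
  | add u v hu hv => rw [map_add]; exact add_mem hu hv

theorem d_cordToT (x : CordAlg 𝓡 (Fin (m + 1))) : PreDGA.d 𝓢 (ct x) = 0 := by
  induction x using FreeAlgebra.induction with
  | grade0 r => rw [AlgHom.commutes]; exact PreDGA.d_algebraMap 𝓢 r
  | grade1 x =>
    rw [cordToT, FreeAlgebra.lift_ι_apply]
    exact PreDGA.d_var 𝓢 (TGen.a x.1.1 x.1.2 x.2)
  | mul u v hu hv => rw [map_mul, PreDGA.d_mul, hu, hv, zero_mul, mul_zero, add_zero]
  | add u v hu hv => rw [map_add, map_add, hu, hv, add_zero]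

theorem d_cordToT_mul (x : CordAlg 𝓡 (Fin (m + 1))) (w : TAlg 𝓡 m) :
    PreDGA.d 𝓢 (ct x * w) = ct x * PreDGA.d 𝓢 w := by
  rw [PreDGA.d_mul_of_zero 𝓢 (cordToT_mem_homogeneous mu U V φ P Q x), d_cordToT, zero_mul, zero_add]

theorem d_mul_cordToT (x : CordAlg 𝓡 (Fin (m + 1))) (w : TAlg 𝓡 m) :
    PreDGA.d 𝓢 (w * ct x) = PreDGA.d 𝓢 w * ct x := by
  rw [PreDGA.d_mul, d_cordToT, mul_zero, add_zero]

/-- The differential, applied to all entries of a matrix. -/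
def dMat (M : Matrix (Fin (m + 1)) (Fin (m + 1)) (TAlg 𝓡 m)) :
    Matrix (Fin (m + 1)) (Fin (m + 1)) (TAlg 𝓡 m) := M.map (PreDGA.d 𝓢)

local notation "∂" => dMat mu U V φ P Q

theorem dMat_add (M N) : ∂ (M + N) = ∂ M + ∂ N := by ext; simp [dMat]

theorem dMat_sub (M N) : ∂ (M - N) = ∂ M - ∂ N := by ext; simp [dMat]

theorem dMat_cordToT_mul (X : Matrix _ _ _) (M) : ∂ (X.map ct * M) = X.map ct * ∂ M := by
  ext i j; simp [dMat, Matrix.mul_apply, d_cordToT_mul]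

theorem dMat_mul_cordToT (M) (X : Matrix _ _ _) : ∂ (M * X.map ct) = ∂ M * X.map ct := by
  ext i j; simp [dMat, Matrix.mul_apply, d_mul_cordToT]

theorem dMat_mul_of_one {M N} (hM : ∀ i j, M i j ∈ PreDGA.homogeneous 𝓢 1) :
    ∂ (M * N) = ∂ M * N - M * ∂ N := by
  ext i j; simp [dMat, Matrix.mul_apply, PreDGA.d_mul_of_one 𝓢 (hM _ _)]

theorem twistedDiff_c (i j : Fin (m + 1)) : twistedDiff mu U V φ P Q (TGen.c i j) =
    ((hatCord mu U m).map ct - P.map ct * (checkCord mu V m).map ct) i j := by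
  rw [← map_matrix_mul]
  simp only [twistedDiff, Matrix.sub_apply, Matrix.map_apply, map_sub]

theorem twistedDiff_d (i j : Fin (m + 1)) : twistedDiff mu U V φ P Q (TGen.d i j) =
    ((checkCord mu V m).map ct - (hatCord mu U m).map ct * Q.map ct) i j := by
  rw [← map_matrix_mul]
  simp only [twistedDiff, Matrix.sub_apply, Matrix.map_apply, map_sub]

theorem dMat_c : ∂ (cMatrix 𝓡 m) =
    (hatCord mu U m).map ct - P.map ct * (checkCord mu V m).map ct := by
  ext i j
  rw [dMat, Matrix.map_apply, cMatrix, Matrix.of_apply]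
  exact (PreDGA.d_var 𝓢 (TGen.c i j)).trans (twistedDiff_c mu U V φ P Q i j)

theorem dMat_d : ∂ (dMatrix 𝓡 m) =
    (checkCord mu V m).map ct - (hatCord mu U m).map ct * Q.map ct := by
  ext i j
  rw [dMat, Matrix.map_apply, dMatrix, Matrix.of_apply]
  exact (PreDGA.d_var 𝓢 (TGen.d i j)).trans (twistedDiff_d mu U V φ P Q i j)

theorem dMat_e : ∂ (eMatrix 𝓡 m) = hatB mu U m - cMatrix 𝓡 m - P.map ct * dMatrix 𝓡 m := by
  ext i j
  rw [dMat, Matrix.map_apply, eMatrix, Matrix.of_apply]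
  exact PreDGA.d_var 𝓢 (TGen.e i j)

theorem dMat_f : ∂ (fMatrix 𝓡 m) = checkB mu V m - dMatrix 𝓡 m - cMatrix 𝓡 m * Q.map ct := by
  ext i j
  rw [dMat, Matrix.map_apply, fMatrix, Matrix.of_apply]
  exact PreDGA.d_var 𝓢 (TGen.f i j)

theorem d_bMatrix (i j : Fin (m + 1)) :
    PreDGA.d 𝓢 (bMatrix 𝓡 m i j) = ct (av 𝓡 i j - φ (av 𝓡 i j)) := by
  by_cases h : i = j
  · subst h; simp [bMatrix, av, map_ofNat]
  · rw [bMatrix_apply h]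
    exact PreDGA.d_var 𝓢 (TGen.b i j h)

/-- The diagonal `δ` is a scalar, hence fixed by `φ`, and drops out of the difference. This is why
the diagonal of `𝐁` is zero while that of `𝐀̂` or `𝐀̌` is not. -/
theorem dMat_triMatrix (x δ y : 𝓡) : ∂ (triMatrix x 0 y (bMatrix 𝓡 m)) =
    (triMatrix x δ y (cordMatrix 𝓡 m)).map ct -
      ((triMatrix x δ y (cordMatrix 𝓡 m)).map φ).map ct := by
  ext i j
  simp only [dMat, Matrix.map_apply, triMatrix, Matrix.of_apply, Matrix.sub_apply]
  split_ifs
  · rw [map_smul, d_bMatrix, map_smul, map_smul, map_smul, map_sub, smul_sub]; rfl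
  · simp
  · rw [map_smul, d_bMatrix, map_smul, map_smul, map_smul, map_sub, smul_sub]; rfl

theorem dMat_hatB : ∂ (hatB mu U m) =
    (hatCord mu U m).map ct - ((hatCord mu U m).map φ).map ct := dMat_triMatrix ..

theorem dMat_checkB : ∂ (checkB mu V m) =
    (checkCord mu V m).map ct - ((checkCord mu V m).map φ).map ct := dMat_triMatrix ..

theorem bMatrix_mem (i j : Fin (m + 1)) : bMatrix 𝓡 m i j ∈ PreDGA.homogeneous 𝓢 1 := by
  by_cases h : i = j
  · subst h; simp [bMatrix]
  · rw [bMatrix_apply h]; exact PreDGA.var_mem_homogeneous 𝓢 (TGen.b i j h)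

theorem triMatrix_b_mem (x y : 𝓡) (i j : Fin (m + 1)) :
    triMatrix x 0 y (bMatrix 𝓡 m) i j ∈ PreDGA.homogeneous 𝓢 1 := by
  simp only [triMatrix, Matrix.of_apply]
  split_ifs
  · exact Submodule.smul_mem _ _ (bMatrix_mem mu U V φ P Q i j)
  · rw [map_zero]; exact Submodule.zero_mem _
  · exact Submodule.smul_mem _ _ (bMatrix_mem mu U V φ P Q i j)

theorem cMatrix_mem (i j : Fin (m + 1)) : cMatrix 𝓡 m i j ∈ PreDGA.homogeneous 𝓢 1 :=
  PreDGA.var_mem_homogeneous 𝓢 (TGen.c i j)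

theorem dMatrix_mem (i j : Fin (m + 1)) : dMatrix 𝓡 m i j ∈ PreDGA.homogeneous 𝓢 1 :=
  PreDGA.var_mem_homogeneous 𝓢 (TGen.d i j)

theorem twistedDiff_mem (x : TGen (Fin (m + 1))) :
    twistedDiff mu U V φ P Q x ∈ PreDGA.homogeneous 𝓢 (x.deg - 1) := by
  have hc := cordToT_mem_homogeneous mu U V φ P Q
  cases x with
  | a i j h => exact Submodule.zero_mem _
  | b i j h => exact hc _
  | c i j => exact hc _
  | d i j => exact hc _
  | e i j =>
    refine sub_mem (sub_mem (triMatrix_b_mem mu U V φ P Q _ _ i j) (cMatrix_mem mu U V φ P Q _ _)) ?_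
    rw [Matrix.mul_apply]
    exact sum_mem fun l _ => PreDGA.mul_mem_homogeneous' 𝓢 (hc _) (dMatrix_mem mu U V φ P Q _ _) rfl
  | f i j =>
    refine sub_mem (sub_mem (triMatrix_b_mem mu U V φ P Q _ _ i j) (dMatrix_mem mu U V φ P Q _ _)) ?_
    rw [Matrix.mul_apply]
    exact sum_mem fun l _ => PreDGA.mul_mem_homogeneous' 𝓢 (cMatrix_mem mu U V φ P Q _ _) (hc _) rfl

variable {φ P Q} in
-- The square of the differential vanishes trivially except on `𝐄` and `𝐅`. There, after
-- cancellation, `∂²𝐄 = P𝐀̂Q - φ(𝐀̂)` and `∂²𝐅 = P𝐀̌Q - φ(𝐀̌)`.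
theorem twistedDGA_isDGA (hhat : (hatCord mu U m).map φ = P * hatCord mu U m * Q)
    (hcheck : (checkCord mu V m).map φ = P * checkCord mu V m * Q) : PreDGA.IsDGA 𝓢 := by
  have hE : ∂ (hatB mu U m - cMatrix 𝓡 m - P.map ct * dMatrix 𝓡 m) = 0 := by
    rw [dMat_sub, dMat_sub, dMat_hatB, dMat_c, dMat_cordToT_mul, dMat_d, hhat, map_matrix_mul,
      map_matrix_mul]
    noncomm_ring
  have hF : ∂ (checkB mu V m - dMatrix 𝓡 m - cMatrix 𝓡 m * Q.map ct) = 0 := by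
    rw [dMat_sub, dMat_sub, dMat_checkB, dMat_d, dMat_mul_cordToT, dMat_c, hcheck, map_matrix_mul,
      map_matrix_mul]
    noncomm_ring
  refine PreDGA.isDGA_of_gen (twistedDiff_mem mu U V φ P Q) fun x => ?_
  cases x with
  | a i j h => exact map_zero _
  | b i j h => exact d_cordToT ..
  | c i j => exact d_cordToT ..
  | d i j => exact d_cordToT ..
  | e i j => exact congrFun (congrFun hE i) j
  | f i j => exact congrFun (congrFun hF i) j

end Calculus

end Twisted

end

end TransverseHomology
namespace TransverseHomology

noncomputable section

/-- An equivalence relation that contains every step of a permutation contains its cycles; the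
symmetry of the relation takes care of negative powers. -/
theorem sameCycle_induction {X : Type} {f : Equiv.Perm X} {r : X → X → Prop} (hr : Equivalence r)
    (h : ∀ x, r x (f x)) {x y : X} (hxy : f.SameCycle x y) : r x y := by
  obtain ⟨k, rfl⟩ := hxy
  induction k with
  | zero => exact hr.refl _
  | succ k ih =>
    rw [add_comm, zpow_add, zpow_one, Equiv.Perm.mul_apply]
    exact hr.trans ih (h _)
  | pred k ih =>
    refine hr.trans ih (hr.symm ?_)
    have := h ((f ^ (-(k : ℤ) - 1)) x)
    have e : f ((f ^ (-(k : ℤ) - 1)) x) = (f ^ (-(k : ℤ))) x := by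
      rw [← Equiv.Perm.mul_apply, ← zpow_one_add]
      congr 2
      ring
    rwa [e] at this

/-! ### Braid DGAs with an arbitrary diagonal matrix of units, and the sliding of units along
cycles. -/

section BraidTwist

variable {𝓡 : Type} [CommRing 𝓡] {m : ℕ} (mu : 𝓡ˣ) (U V : 𝓡)

theorem isPath_triMatrix (s : Fin (m + 1) → 𝓡ˣ) (x δ y : 𝓡) (i j : Fin (m + 1)) :
    IsPath 𝓡 s i j (triMatrix x δ y (cordMatrix 𝓡 m) i j) := by
  unfold IsPath
  simp only [triMatrix, Matrix.of_apply, cordMatrix]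
  split_ifs with h1 h2
  · rw [map_smul, scaleHom_av, smul_comm]
  · subst h2; simp
  · rw [map_smul, scaleHom_av, smul_comm]

/-- Multiply the rows of a matrix by units. -/
def rowScale {A : Type} [Ring A] [Algebra 𝓡 A] (Λ : Fin (m + 1) → 𝓡ˣ)
    (M : Matrix (Fin (m + 1)) (Fin (m + 1)) A) : Matrix (Fin (m + 1)) (Fin (m + 1)) A :=
  Matrix.of fun i j => (Λ i : 𝓡) • M i j

/-- Divide the columns of a matrix by units. -/
def colScale {A : Type} [Ring A] [Algebra 𝓡 A] (Λ : Fin (m + 1) → 𝓡ˣ)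
    (M : Matrix (Fin (m + 1)) (Fin (m + 1)) A) : Matrix (Fin (m + 1)) (Fin (m + 1)) A :=
  Matrix.of fun i j => (((Λ j)⁻¹ : 𝓡ˣ) : 𝓡) • M i j

section Scale

variable {A : Type} [Ring A] [Algebra 𝓡 A] (Λ : Fin (m + 1) → 𝓡ˣ)
  (M N : Matrix (Fin (m + 1)) (Fin (m + 1)) A)

theorem rowScale_mul : rowScale Λ M * N = rowScale Λ (M * N) := by
  ext i j
  simp [rowScale, Matrix.mul_apply, Finset.smul_sum]

theorem mul_colScale : M * colScale Λ N = colScale Λ (M * N) := by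
  ext i j
  simp [colScale, Matrix.mul_apply, Finset.smul_sum]

theorem rowScale_map {A' : Type} [Ring A'] [Algebra 𝓡 A'] (f : A →ₐ[𝓡] A') :
    (rowScale Λ M).map f = rowScale Λ (M.map f) := by
  ext i j
  simp [rowScale]

theorem colScale_map {A' : Type} [Ring A'] [Algebra 𝓡 A'] (f : A →ₐ[𝓡] A') :
    (colScale Λ M).map f = colScale Λ (M.map f) := by
  ext i j
  simp [colScale]

end Scale

/-- The DGA of a braid, with an arbitrary diagonal matrix of units in the place of `Λ_B`. -/
abbrev braidTwist (Λ : Fin (m + 1) → 𝓡ˣ) (B : BraidGroup m) : PreDGA 𝓡 :=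
  twistedDGA mu U V ((braidAut 𝓡 m B : _ →ₐ[𝓡] _).comp (scaleHom 𝓡 Λ))
    (rowScale Λ (PhiL 𝓡 B)) (colScale Λ (PhiR 𝓡 B))

/-- Rescaling before applying `φ_B` multiplies the entry `(i, j)` by `Λ_i Λ_j⁻¹`, and so does
conjugation by the diagonal matrix, whose two factors are absorbed into `Φ^L` and `Φ^R`. -/
theorem map_scale_triMatrix (Λ : Fin (m + 1) → 𝓡ˣ) (B : BraidGroup m) (x y : 𝓡) :
    (triMatrix x (-x - y) y (cordMatrix 𝓡 m)).map
        ((braidAut 𝓡 m B : _ →ₐ[𝓡] _).comp (scaleHom 𝓡 Λ)) =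
      rowScale Λ (PhiL 𝓡 B) * triMatrix x (-x - y) y (cordMatrix 𝓡 m) *
        colScale Λ (PhiR 𝓡 B) := by
  rw [mul_colScale, rowScale_mul, rowScale_mul, ← triMatrix_braid]
  ext i j
  simp only [Matrix.map_apply, AlgHom.comp_apply, colScale, rowScale, Matrix.of_apply]
  rw [isPath_triMatrix Λ, map_smul, Units.val_mul, mul_smul, smul_comm]
  rfl

theorem map_hatCord (Λ : Fin (m + 1) → 𝓡ˣ) (B : BraidGroup m) :
    (hatCord mu U m).map ((braidAut 𝓡 m B : _ →ₐ[𝓡] _).comp (scaleHom 𝓡 Λ)) =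
      rowScale Λ (PhiL 𝓡 B) * hatCord mu U m * colScale Λ (PhiR 𝓡 B) :=
  map_scale_triMatrix Λ B 1 _

theorem map_checkCord (Λ : Fin (m + 1) → 𝓡ˣ) (B : BraidGroup m) :
    (checkCord mu V m).map ((braidAut 𝓡 m B : _ →ₐ[𝓡] _).comp (scaleHom 𝓡 Λ)) =
      rowScale Λ (PhiL 𝓡 B) * checkCord mu V m * colScale Λ (PhiR 𝓡 B) :=
  map_scale_triMatrix Λ B V _

theorem braidTwist_isDGA (Λ : Fin (m + 1) → 𝓡ˣ) (B : BraidGroup m) :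
    (braidTwist mu U V Λ B).IsDGA :=
  twistedDGA_isDGA mu U V (map_hatCord mu U Λ B) (map_checkCord mu V Λ B)

/-- The actual `Λ_B` is concentrated at strand `0`. The conjugation of `φ_B(𝐀)` in the boundary of
`𝐁` becomes a rescaling inside the automorphism, and the two other occurrences of `Λ_B` become row
and column factors. -/
theorem transverseDGA_eq (lam : 𝓡ˣ) (B : BraidGroup m) :
    transverseDGA lam mu U V B =
      braidTwist mu U V (Pi.mulSingle 0 (lam * mu ^ (-writhe B))) B := by
  have hrow : ∀ (u : 𝓡ˣ) (M : Matrix (Fin (m + 1)) (Fin (m + 1)) (TAlg 𝓡 m)),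
      cornerMatrix m u * M = rowScale (Pi.mulSingle 0 u) M := by
    intro u M
    ext i j
    rw [cornerMatrix, Matrix.diagonal_mul, rowScale, Matrix.of_apply]
    by_cases h : i = 0
    · subst h; simp [Algebra.smul_def]
    · simp [h]
  have hcol : ∀ (u : 𝓡ˣ) (M : Matrix (Fin (m + 1)) (Fin (m + 1)) (TAlg 𝓡 m)),
      M * cornerMatrix m u⁻¹ = colScale (Pi.mulSingle 0 u) M := by
    intro u M
    ext i j
    rw [cornerMatrix, Matrix.mul_diagonal, colScale, Matrix.of_apply]
    by_cases h : j = 0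
    · subst h; simp [Algebra.smul_def, Algebra.commutes]
    · simp [h]
  have hct : ∀ (u : 𝓡ˣ) (M : Matrix (Fin (m + 1)) (Fin (m + 1)) (CordAlg 𝓡 (Fin (m + 1)))),
      rowScale (Pi.mulSingle 0 u) (M.map (cordToT 𝓡 m)) =
        (rowScale (Pi.mulSingle 0 u) M).map (cordToT 𝓡 m) := fun u M =>
    (rowScale_map _ _ _).symm
  have hct' : ∀ (u : 𝓡ˣ) (M : Matrix (Fin (m + 1)) (Fin (m + 1)) (CordAlg 𝓡 (Fin (m + 1)))),
      colScale (Pi.mulSingle 0 u) (M.map (cordToT 𝓡 m)) =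
        (colScale (Pi.mulSingle 0 u) M).map (cordToT 𝓡 m) := fun u M =>
    (colScale_map _ _ _).symm
  have htri : ∀ (x δ y : 𝓡), triMatrix x δ y ((cordMatrix 𝓡 m).map (cordToT 𝓡 m)) =
      (triMatrix x δ y (cordMatrix 𝓡 m)).map (cordToT 𝓡 m) := fun x δ y =>
    (triMatrix_map_algEquiv 𝓡 _ _).symm
  unfold transverseDGA braidTwist twistedDGA
  congr 1
  simp only [hrow, hcol]
  funext x
  cases x with
  | a i j h => rfl
  | b i j h =>
    simp only [twistedDiff, Matrix.sub_apply, Matrix.map_apply, colScale, rowScale, Matrix.of_apply,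
      cordMatrix, map_sub, AlgHom.comp_apply, scaleHom_av, map_smul, smul_smul]
    rw [mul_comm, ← Units.val_mul]
    rfl
  | c i j =>
    simp only [twistedDiff]
    rw [htri, htri, hct, ← map_matrix_mul]
    simp only [Matrix.sub_apply, Matrix.map_apply, map_sub]
    rfl
  | d i j =>
    simp only [twistedDiff]
    rw [htri, htri, ← mul_colScale, hct', ← map_matrix_mul]
    simp only [Matrix.sub_apply, Matrix.map_apply, map_sub]
    rfl
  | e i j =>
    simp only [twistedDiff]
    rw [hct]
    rfl
  | f i j =>
    simp only [twistedDiff]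
    rw [← mul_colScale, hct']
    rfl

/-- The generators are rescaled by `s_i s_j⁻¹`. -/
def tScale (s : Fin (m + 1) → 𝓡ˣ) : TAlg 𝓡 m →ₐ[𝓡] TAlg 𝓡 m :=
  FreeAlgebra.lift 𝓡 fun x => match x with
    | .a i j h => ((s i * (s j)⁻¹ : 𝓡ˣ) : 𝓡) • FreeAlgebra.ι 𝓡 (TGen.a i j h)
    | .b i j h => ((s i * (s j)⁻¹ : 𝓡ˣ) : 𝓡) • FreeAlgebra.ι 𝓡 (TGen.b i j h)
    | .c i j => ((s i * (s j)⁻¹ : 𝓡ˣ) : 𝓡) • FreeAlgebra.ι 𝓡 (TGen.c i j)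
    | .d i j => ((s i * (s j)⁻¹ : 𝓡ˣ) : 𝓡) • FreeAlgebra.ι 𝓡 (TGen.d i j)
    | .e i j => ((s i * (s j)⁻¹ : 𝓡ˣ) : 𝓡) • FreeAlgebra.ι 𝓡 (TGen.e i j)
    | .f i j => ((s i * (s j)⁻¹ : 𝓡ˣ) : 𝓡) • FreeAlgebra.ι 𝓡 (TGen.f i j)

theorem tScale_cordToT (s : Fin (m + 1) → 𝓡ˣ) (x : CordAlg 𝓡 (Fin (m + 1))) :
    tScale s (cordToT 𝓡 m x) = cordToT 𝓡 m (scaleHom 𝓡 s x) := by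
  have : (tScale s).comp (cordToT 𝓡 m) = (cordToT 𝓡 m).comp (scaleHom 𝓡 s) := by
    apply cordAlg_hom_ext
    intro i j h
    rw [AlgHom.comp_apply, AlgHom.comp_apply, scaleHom_av, map_smul, cordToT_av h]
    simp [tScale]
  exact DFunLike.congr_fun this x

/-- `w` is a combination of words that lead from `i` to `j`. -/
def IsTPath (s : Fin (m + 1) → 𝓡ˣ) (i j : Fin (m + 1)) (w : TAlg 𝓡 m) : Prop :=
  tScale s w = ((s i * (s j)⁻¹ : 𝓡ˣ) : 𝓡) • w

section TPath

variable {s : Fin (m + 1) → 𝓡ˣ} {i j k : Fin (m + 1)} {v w : TAlg 𝓡 m}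

theorem IsPath.cordToT {x : CordAlg 𝓡 (Fin (m + 1))} (hx : IsPath 𝓡 s i j x) :
    IsTPath s i j (cordToT 𝓡 m x) := by
  unfold IsTPath
  rw [tScale_cordToT, hx, map_smul]

theorem IsTPath.mul (hv : IsTPath s i k v) (hw : IsTPath s k j w) : IsTPath s i j (v * w) := by
  unfold IsTPath at *
  rw [map_mul, hv, hw, smul_mul_smul_comm, ← Units.val_mul]
  congr 2
  group

theorem isTPath_mul {M N : Matrix (Fin (m + 1)) (Fin (m + 1)) (TAlg 𝓡 m)}
    {f g : Fin (m + 1) → Fin (m + 1)} (hM : ∀ i j, IsTPath s (f i) j (M i j))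
    (hN : ∀ i j, IsTPath s i (g j) (N i j)) (i j : Fin (m + 1)) :
    IsTPath s (f i) (g j) ((M * N) i j) := by
  unfold IsTPath
  rw [Matrix.mul_apply, map_sum, Finset.smul_sum]
  exact Finset.sum_congr rfl fun k _ => (hM i k).mul (hN k j)

theorem isTPath_bMatrix (i j : Fin (m + 1)) : IsTPath s i j (bMatrix 𝓡 m i j) := by
  unfold IsTPath
  by_cases h : i = j
  · subst h; simp [bMatrix]
  · rw [bMatrix_apply h]; simp [tScale]

theorem isTPath_triMatrix (x y : 𝓡) (i j : Fin (m + 1)) :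
    IsTPath s i j (triMatrix x 0 y (bMatrix 𝓡 m) i j) := by
  have h := isTPath_bMatrix (s := s) i j
  unfold IsTPath at *
  simp only [triMatrix, Matrix.of_apply]
  split_ifs
  · rw [map_smul, h, smul_comm]
  · simp
  · rw [map_smul, h, smul_comm]

theorem isTPath_c (i j : Fin (m + 1)) : IsTPath s i j (cMatrix 𝓡 m i j) := by
  simp [IsTPath, cMatrix, tScale]

theorem isTPath_d (i j : Fin (m + 1)) : IsTPath s i j (dMatrix 𝓡 m i j) := by
  simp [IsTPath, dMatrix, tScale]

end TPath

/-- The rescaling factors of the generators. -/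
def tWeight (s : Fin (m + 1) → 𝓡ˣ) : TGen (Fin (m + 1)) → 𝓡ˣ
  | .a i j _ => s i * (s j)⁻¹
  | .b i j _ => s i * (s j)⁻¹
  | .c i j => s i * (s j)⁻¹
  | .d i j => s i * (s j)⁻¹
  | .e i j => s i * (s j)⁻¹
  | .f i j => s i * (s j)⁻¹

theorem tScale_var (s : Fin (m + 1) → 𝓡ˣ) (x : TGen (Fin (m + 1))) :
    tScale s (FreeAlgebra.ι 𝓡 x) = (tWeight s x : 𝓡) • FreeAlgebra.ι 𝓡 x := by
  cases x <;> simp [tScale, tWeight]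

/-- Rescaling of the generators. -/
theorem braidTwist_rescale (s Λ Λ' : Fin (m + 1) → 𝓡ˣ) (B : BraidGroup m)
    (h : ∀ i, s i * Λ' i = Λ i * s (braidPerm m B i)) :
    PreDGA.TameIso (braidTwist mu U V Λ B) (braidTwist mu U V Λ' B) := by
  -- An entry `(i, j)` of `Λ Φ^L X` leads from `B(i)` to `j`. The hypothesis on `s` is what turns
  -- its rescaling factor into `s_i s_j⁻¹` with `Λ` replaced by `Λ'`.
  have hrow : ∀ i j, Λ i * (s (braidPerm m B i) * (s j)⁻¹) = s i * (s j)⁻¹ * Λ' i := fun i j => by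
    rw [← mul_assoc, ← h, mul_right_comm]
  have hcol : ∀ i j, (Λ j)⁻¹ * (s i * (s (braidPerm m B j))⁻¹) = s i * (s j)⁻¹ * (Λ' j)⁻¹ :=
    fun i j => by
      rw [mul_left_comm, ← mul_inv, ← h, mul_inv, mul_assoc]
  have hrow' : ∀ i j (w : TAlg 𝓡 m), (Λ i : 𝓡) • ((s (braidPerm m B i) * (s j)⁻¹ : 𝓡ˣ) : 𝓡) • w =
      ((s i * (s j)⁻¹ : 𝓡ˣ) : 𝓡) • (Λ' i : 𝓡) • w := fun i j w => by
    rw [smul_smul, ← Units.val_mul, hrow, Units.val_mul, mul_smul]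
  have hcol' : ∀ i j (w : TAlg 𝓡 m),
      (((Λ j)⁻¹ : 𝓡ˣ) : 𝓡) • ((s i * (s (braidPerm m B j))⁻¹ : 𝓡ˣ) : 𝓡) • w =
        ((s i * (s j)⁻¹ : 𝓡ˣ) : 𝓡) • (((Λ' j)⁻¹ : 𝓡ˣ) : 𝓡) • w := fun i j w => by
    rw [smul_smul, ← Units.val_mul, hcol, Units.val_mul, mul_smul]
  have hP : ∀ i j, IsTPath s (braidPerm m B i) j ((PhiL 𝓡 B).map (cordToT 𝓡 m) i j) := fun i j =>
    (PhiL_isPath 𝓡 s B i j).cordToT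
  have hQ : ∀ i j, IsTPath s i (braidPerm m B j) ((PhiR 𝓡 B).map (cordToT 𝓡 m) i j) := fun i j =>
    (PhiR_isPath 𝓡 s B i j).cordToT
  have hhat : ∀ i j, IsTPath s i j ((hatCord mu U m).map (cordToT 𝓡 m) i j) := fun i j =>
    (isPath_triMatrix s _ _ _ i j).cordToT
  have hcheck : ∀ i j, IsTPath s i j ((checkCord mu V m).map (cordToT 𝓡 m) i j) := fun i j =>
    (isPath_triMatrix s _ _ _ i j).cordToT
  have hlift : FreeAlgebra.lift 𝓡 (fun x => tScale s (FreeAlgebra.ι 𝓡 x)) = tScale s := by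
    apply FreeAlgebra.hom_ext; funext x; simp
  refine PreDGA.tameIso_of_triangular (S := braidTwist mu U V Λ B) (T := braidTwist mu U V Λ' B)
    (Equiv.refl _) (fun _ => rfl) (fun _ => 0) (fun x => tScale s (FreeAlgebra.ι 𝓡 x)) (tWeight s)
    (fun x => ?_) (fun x => ?_)
  · rw [tScale_var, Equiv.refl_apply, sub_self]
    exact Submodule.zero_mem _
  · rw [hlift, tScale_var, map_smul]
    refine Eq.trans ?_ (congrArg _ (PreDGA.d_var (braidTwist mu U V Λ' B) x).symm)
    cases x with
    | a i j h => simp [twistedDiff]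
    | b i j hij =>
      change tScale s (cordToT 𝓡 m (av 𝓡 i j - braidAut 𝓡 m B (scaleHom 𝓡 Λ (av 𝓡 i j)))) =
        ((s i * (s j)⁻¹ : 𝓡ˣ) : 𝓡) •
          cordToT 𝓡 m (av 𝓡 i j - braidAut 𝓡 m B (scaleHom 𝓡 Λ' (av 𝓡 i j)))
      have e : Λ i * (Λ j)⁻¹ * (s (braidPerm m B i) * (s (braidPerm m B j))⁻¹) =
          s i * (s j)⁻¹ * (Λ' i * (Λ' j)⁻¹) := by
        rw [mul_mul_mul_comm, ← h, ← mul_inv, ← h, mul_inv, mul_mul_mul_comm]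
      rw [tScale_cordToT, map_sub, scaleHom_av, ← braidAut_scaleHom,
        scaleHom_av 𝓡 Λ, scaleHom_av 𝓡 Λ', map_smul (scaleHom 𝓡 _), scaleHom_av, map_smul,
        map_smul, map_smul, smul_smul, ← Units.val_mul, e, Units.val_mul (s i * (s j)⁻¹), mul_smul,
        ← smul_sub, map_smul]
    | c i j =>
      dsimp only [braidTwist, twistedDGA]
      rw [twistedDiff_c, twistedDiff_c]
      simp only [Matrix.sub_apply, rowScale_map, rowScale_mul]
      simp only [rowScale, Matrix.of_apply]
      rw [map_sub, map_smul, hhat, isTPath_mul hP hcheck, hrow', ← smul_sub]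
      rfl
    | d i j =>
      dsimp only [braidTwist, twistedDGA]
      rw [twistedDiff_d, twistedDiff_d]
      simp only [Matrix.sub_apply, colScale_map, mul_colScale]
      simp only [colScale, Matrix.of_apply]
      rw [map_sub, map_smul, hcheck,
        isTPath_mul (f := fun i => i) hhat hQ, hcol', ← smul_sub]
      rfl
    | e i j =>
      simp only [twistedDiff, hatB, Matrix.sub_apply, rowScale_map, rowScale_mul]
      simp only [rowScale, Matrix.of_apply]
      rw [map_sub, map_sub, map_smul, isTPath_triMatrix, isTPath_c, isTPath_mul hP isTPath_d,
        hrow', ← smul_sub, ← smul_sub]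
      rfl
    | f i j =>
      simp only [twistedDiff, checkB, Matrix.sub_apply, colScale_map, mul_colScale]
      simp only [colScale, Matrix.of_apply]
      rw [map_sub, map_sub, map_smul, isTPath_triMatrix, isTPath_d,
        isTPath_mul (f := fun i => i) isTPath_c hQ,
        hcol', ← smul_sub, ← smul_sub]
      rfl

/-- A factor of the matrix `Λ` can be moved along a cycle of the permutation of the strands. -/
theorem braidTwist_move (Λ : Fin (m + 1) → 𝓡ˣ) (u : 𝓡ˣ) (B : BraidGroup m) {i j : Fin (m + 1)}
    (h : (braidPerm m B).SameCycle i j) :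
    PreDGA.TameIso (braidTwist mu U V (Λ * Pi.mulSingle i u) B)
      (braidTwist mu U V (Λ * Pi.mulSingle j u) B) := by
  let r : Fin (m + 1) → Fin (m + 1) → Prop := fun i j =>
    PreDGA.TameIso (braidTwist mu U V (Λ * Pi.mulSingle i u) B)
      (braidTwist mu U V (Λ * Pi.mulSingle j u) B)
  have hr : Equivalence r := ⟨fun _ => PreDGA.TameIso.refl _, fun h => h.symm, fun h h' => h.trans h'⟩
  refine sameCycle_induction hr (fun i => ?_) h
  refine PreDGA.TameIso.symm ?_
  -- With `s` equal to `u` at `B(i)` only, the value of `s` at `B(k)` differs from `1` exactly when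
  -- `k = i`. The isomorphism obtained goes from `B(i)` back to `i`, hence the symmetry applied
  -- before.
  refine braidTwist_rescale mu U V (Pi.mulSingle (braidPerm m B i) u) _ _ B fun k => ?_
  have : (Pi.mulSingle (braidPerm m B i) u : Fin (m + 1) → 𝓡ˣ) (braidPerm m B k) =
      (Pi.mulSingle i u : Fin (m + 1) → 𝓡ˣ) k := by
    simp [Pi.mulSingle_apply]
  rw [this, Pi.mul_apply, Pi.mul_apply, mul_left_comm, mul_assoc]

end BraidTwist

end

end TransverseHomology
namespace TransverseHomology

noncomputable section

/-! ### The twisted derivation from cord variables to the generators `b_ij`. -/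

section Derivation

variable {𝓡 : Type} [CommRing 𝓡] {m : ℕ} (mu : 𝓡ˣ) (U V : 𝓡)
  (φ : CordAlg 𝓡 (Fin (m + 1)) →ₐ[𝓡] CordAlg 𝓡 (Fin (m + 1)))

local notation "ct" => cordToT 𝓡 m

/-- The algebra map `x ↦ [[φ x, h x], [0, x]]`, where `h` is the `φ`-derivation `a_ij ↦ b_ij`. -/
def bDerAux : CordAlg 𝓡 (Fin (m + 1)) →ₐ[𝓡] Matrix (Fin 2) (Fin 2) (TAlg 𝓡 m) :=
  FreeAlgebra.lift 𝓡 fun x =>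
    !![ct (φ (av 𝓡 x.1.1 x.1.2)), bMatrix 𝓡 m x.1.1 x.1.2; 0, ct (av 𝓡 x.1.1 x.1.2)]

/-- The `φ`-derivation with `a_ij ↦ b_ij`. -/
def bDer : CordAlg 𝓡 (Fin (m + 1)) →ₗ[𝓡] TAlg 𝓡 m :=
  Matrix.entryLinearMap 𝓡 (TAlg 𝓡 m) 0 1 ∘ₗ (bDerAux φ).toLinearMap

theorem bDerAux_entries (x : CordAlg 𝓡 (Fin (m + 1))) :
    bDerAux φ x 0 0 = ct (φ x) ∧ bDerAux φ x 1 0 = 0 ∧ bDerAux φ x 1 1 = ct x := by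
  induction x using FreeAlgebra.induction with
  | grade0 r => simp [Matrix.algebraMap_matrix_apply]
  | grade1 x =>
    have : av 𝓡 x.1.1 x.1.2 = FreeAlgebra.ι 𝓡 x := by rw [av, dif_pos x.2]
    simp [bDerAux, this]
  | mul u v hu hv => simp [Matrix.mul_apply, Fin.sum_univ_two, hu, hv]
  | add u v hu hv => simp [hu, hv]

theorem bDer_mul (x y : CordAlg 𝓡 (Fin (m + 1))) :
    bDer φ (x * y) = bDer φ x * ct y + ct (φ x) * bDer φ y := by
  have hx := bDerAux_entries φ x
  have hy := bDerAux_entries φ y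
  simp [bDer, Matrix.mul_apply, Fin.sum_univ_two, hx, hy, add_comm]

theorem bDer_algebraMap (r : 𝓡) : bDer φ (algebraMap 𝓡 _ r) = 0 := by
  simp [bDer, Matrix.algebraMap_matrix_apply]

theorem bDer_av (i j : Fin (m + 1)) : bDer φ (av 𝓡 i j) = bMatrix 𝓡 m i j := by
  by_cases h : i = j
  · subst h
    rw [av_self, bMatrix_self]
    have : (-2 : CordAlg 𝓡 (Fin (m + 1))) = algebraMap 𝓡 _ (-2) := by simp [map_ofNat]
    rw [this, bDer_algebraMap]
  · have : av 𝓡 i j = FreeAlgebra.ι 𝓡 ⟨(i, j), h⟩ := by rw [av, dif_pos h]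
    rw [this]
    simp [bDer, bDerAux]

theorem bDer_matrix_mul (M N : Matrix (Fin (m + 1)) (Fin (m + 1)) (CordAlg 𝓡 (Fin (m + 1)))) :
    (M * N).map (bDer φ) = M.map (bDer φ) * N.map ct + (M.map φ).map ct * N.map (bDer φ) := by
  ext i j
  simp [Matrix.mul_apply, bDer_mul, Finset.sum_add_distrib]

theorem bDer_triMatrix (x δ y : 𝓡) : (triMatrix x δ y (cordMatrix 𝓡 m)).map (bDer φ) =
    triMatrix x 0 y (bMatrix 𝓡 m) := by
  ext i j
  simp only [Matrix.map_apply, triMatrix, Matrix.of_apply, cordMatrix]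
  split_ifs
  · rw [map_smul, bDer_av]
  · rw [bDer_algebraMap, map_zero]
  · rw [map_smul, bDer_av]

theorem bDer_hatCord (mu : 𝓡ˣ) (U : 𝓡) : (hatCord mu U m).map (bDer φ) = hatB mu U m :=
  bDer_triMatrix ..

theorem bDer_checkCord (mu : 𝓡ˣ) (V : 𝓡) : (checkCord mu V m).map (bDer φ) = checkB mu V m :=
  bDer_triMatrix ..

variable (P Q : Matrix (Fin (m + 1)) (Fin (m + 1)) (CordAlg 𝓡 (Fin (m + 1))))

local notation "𝓣" => twistedDGA mu U V φ P Q

theorem bDer_mem (x : CordAlg 𝓡 (Fin (m + 1))) : bDer φ x ∈ PreDGA.homogeneous 𝓣 1 := by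
  have hc := cordToT_mem_homogeneous mu U V φ P Q
  induction x using FreeAlgebra.induction with
  | grade0 r => rw [bDer_algebraMap]; exact Submodule.zero_mem _
  | grade1 x =>
    have : av 𝓡 x.1.1 x.1.2 = FreeAlgebra.ι 𝓡 x := by rw [av, dif_pos x.2]
    rw [← this, bDer_av]
    exact bMatrix_mem mu U V φ P Q _ _
  | mul u v hu hv =>
    rw [bDer_mul]
    exact add_mem (PreDGA.mul_mem_homogeneous' 𝓣 hu (hc _) rfl)
      (PreDGA.mul_mem_homogeneous' 𝓣 (hc _) hv rfl)
  | add u v hu hv => rw [map_add]; exact add_mem hu hv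

/-- Both sides are derivations twisted by `φ` on the left, and they agree on the variables. So `x`
and `φ x` are homologous for every `x`, in a way that is compatible with products. -/
theorem d_bDer (x : CordAlg 𝓡 (Fin (m + 1))) : PreDGA.d 𝓣 (bDer φ x) = ct (x - φ x) := by
  induction x using FreeAlgebra.induction with
  | grade0 r => rw [bDer_algebraMap, AlgHom.commutes]; simp
  | grade1 x =>
    have : av 𝓡 x.1.1 x.1.2 = FreeAlgebra.ι 𝓡 x := by rw [av, dif_pos x.2]
    rw [← this, bDer_av, d_bMatrix]
  | mul u v hu hv =>
    rw [bDer_mul, map_add, d_mul_cordToT, d_cordToT_mul, hu, hv]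
    simp only [map_mul, map_sub]
    noncomm_ring
  | add u v hu hv => rw [map_add, map_add, hu, hv, ← map_add, map_add φ]; congr 1; abel

theorem dMat_bDer (M : Matrix (Fin (m + 1)) (Fin (m + 1)) (CordAlg 𝓡 (Fin (m + 1)))) :
    dMat mu U V φ P Q (M.map (bDer φ)) = M.map ct - (M.map φ).map ct := by
  ext i j
  simp only [dMat, Matrix.map_apply, d_bDer, map_sub, Matrix.sub_apply]

end Derivation

/-! ### A chain map between two twisted DGAs that lifts an algebra map `ψ`. -/

section ChainMap

variable {𝓡 : Type} [CommRing 𝓡] {m : ℕ} (mu : 𝓡ˣ) (U V : 𝓡)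
  (φ φ' ψ : CordAlg 𝓡 (Fin (m + 1)) →ₐ[𝓡] CordAlg 𝓡 (Fin (m + 1)))
  (P Q P' Q' G H : Matrix (Fin (m + 1)) (Fin (m + 1)) (CordAlg 𝓡 (Fin (m + 1))))

local notation "ct" => cordToT 𝓡 m

/-- The images of the generators under the chain map induced by `ψ`. -/
def conjVal : TGen (Fin (m + 1)) → TAlg 𝓡 m
  | .a i j _ => ct (ψ (av 𝓡 i j))
  | .b i j _ => bDer φ' (ψ (av 𝓡 i j))
  | .c i j => ((G.map φ').map ct * cMatrix 𝓡 m * H.map ct +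
      G.map (bDer φ') * (hatCord mu U m).map ct * H.map ct) i j
  | .d i j => (G.map ct * dMatrix 𝓡 m * (H.map φ').map ct +
      G.map ct * (checkCord mu V m).map ct * H.map (bDer φ')) i j
  | .e i j => ((G.map φ').map ct * eMatrix 𝓡 m * H.map ct -
      (G.map φ').map ct * P'.map ct * dMatrix 𝓡 m * H.map (bDer φ')) i j
  | .f i j => ((G.map φ').map ct * fMatrix 𝓡 m * H.map ct -
      (G.map (bDer φ') * dMatrix 𝓡 m * H.map ct + G.map ct * dMatrix 𝓡 m * H.map (bDer φ') +
        (G.map φ').map ct * cMatrix 𝓡 m * Q'.map ct * H.map (bDer φ') +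
        G.map (bDer φ') * (hatCord mu U m).map ct * Q'.map ct * H.map (bDer φ'))) i j

local notation "𝓕" => FreeAlgebra.lift 𝓡 (conjVal mu U V φ' ψ P' Q' G H)

theorem conjVal_cordToT (x : CordAlg 𝓡 (Fin (m + 1))) : 𝓕 (ct x) = ct (ψ x) := by
  have : (𝓕).comp ct = AlgHom.comp ct ψ := by
    apply cordAlg_hom_ext
    intro i j h
    rw [AlgHom.comp_apply, cordToT_av h, FreeAlgebra.lift_ι_apply]
    rfl
  exact DFunLike.congr_fun this x

theorem conjVal_cordToT_map (M : Matrix (Fin (m + 1)) (Fin (m + 1)) (CordAlg 𝓡 (Fin (m + 1)))) :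
    (M.map ct).map 𝓕 = (M.map ψ).map ct := by
  ext i j
  exact conjVal_cordToT ..

theorem conjVal_bMatrix (i j : Fin (m + 1)) : 𝓕 (bMatrix 𝓡 m i j) = bDer φ' (ψ (av 𝓡 i j)) := by
  by_cases h : i = j
  · subst h
    have : (-2 : CordAlg 𝓡 (Fin (m + 1))) = algebraMap 𝓡 _ (-2) := by simp [map_ofNat]
    rw [av_self, bMatrix_self, map_zero, this, AlgHom.commutes, bDer_algebraMap]
  · rw [bMatrix_apply h, FreeAlgebra.lift_ι_apply]; rfl

theorem conjVal_triMatrix (x δ y : 𝓡) : (triMatrix x 0 y (bMatrix 𝓡 m)).map 𝓕 =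
    ((triMatrix x δ y (cordMatrix 𝓡 m)).map ψ).map (bDer φ') := by
  ext i j
  simp only [Matrix.map_apply, triMatrix, Matrix.of_apply, cordMatrix]
  split_ifs
  · rw [map_smul, conjVal_bMatrix, map_smul, map_smul]
  · rw [AlgHom.commutes, AlgHom.commutes, bDer_algebraMap, map_zero]
  · rw [map_smul, conjVal_bMatrix, map_smul, map_smul]

local notation "∂" => dMat mu U V φ' P' Q'

variable {φ φ' ψ P Q P' Q' G H}

/-- The leading terms alone do not commute with the differential, since `φ'(G)` stands where `G` is
needed, or the reverse. The terms with the derivation correct this, because its boundary on `G` is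
`G - φ'(G)`. For example, the image of `𝐂` has boundary `φ'(G)(𝐀̂ - P'𝐀̌)H + (G - φ'(G))𝐀̂H = G𝐀̂H -
φ'(G)P'𝐀̌H`, which by `hG` is `ψ(𝐀̂) - ψ(P)ψ(𝐀̌)`. -/
theorem conjVal_d (hψ : ∀ x, φ' (ψ x) = ψ (φ x)) (hG : G.map φ' * P' = P.map ψ * G)
    (hH : Q' * H.map φ' = H * Q.map ψ)
    (hhat : (hatCord mu U m).map ψ = G * hatCord mu U m * H)
    (hcheck : (checkCord mu V m).map ψ = G * checkCord mu V m * H)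
    (hhat' : (hatCord mu U m).map φ' = P' * hatCord mu U m * Q')
    (hcheck' : (checkCord mu V m).map φ' = P' * checkCord mu V m * Q')
    (x : TGen (Fin (m + 1))) :
    𝓕 (twistedDiff mu U V φ P Q x) =
      (twistedDGA mu U V φ' P' Q').d (conjVal mu U V φ' ψ P' Q' G H x) := by
  have hG' := congrArg (fun M => M.map ct) hG
  have hH' := congrArg (fun M => M.map ct) hH
  have hhatE := congrArg (fun M => M.map ct) hhat
  have hcheckE := congrArg (fun M => M.map ct) hcheck
  have hhatE' := congrArg (fun M => M.map ct) hhat'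
  have hcheckE' := congrArg (fun M => M.map ct) hcheck'
  simp only [map_matrix_mul] at hG' hH' hhatE hcheckE hhatE' hcheckE'
  have tmem : ∀ i j, G.map (bDer φ') i j ∈ (twistedDGA mu U V φ' P' Q').homogeneous 1 :=
    fun i j => bDer_mem mu U V φ' P' Q' _
  -- The image of `𝐁̂` is the derivation applied to `ψ(𝐀̂) = G𝐀̂H`, expanded by the twisted product
  -- rule; the last factor meets `φ'(𝐀̂) = P'𝐀̂Q'`.
  have hB : (hatB mu U m).map 𝓕 = G.map (bDer φ') * (hatCord mu U m).map ct * H.map ct +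
      (G.map φ').map ct * (hatB mu U m * H.map ct +
        P'.map ct * (hatCord mu U m).map ct * Q'.map ct * H.map (bDer φ')) := by
    refine (conjVal_triMatrix mu U V φ' ψ P' Q' G H 1 (-1 - mu * U) (mu * U)).trans ?_
    change ((hatCord mu U m).map ψ).map _ = _
    rw [hhat, Matrix.mul_assoc, bDer_matrix_mul, bDer_matrix_mul, bDer_hatCord, hhatE',
      map_matrix_mul]
    simp only [Matrix.mul_assoc]
  have hBc : (checkB mu V m).map 𝓕 = G.map (bDer φ') * (checkCord mu V m).map ct * H.map ct +
      (G.map φ').map ct * (checkB mu V m * H.map ct +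
        P'.map ct * (checkCord mu V m).map ct * Q'.map ct * H.map (bDer φ')) := by
    refine (conjVal_triMatrix mu U V φ' ψ P' Q' G H V (-V - mu) mu).trans ?_
    change ((checkCord mu V m).map ψ).map _ = _
    rw [hcheck, Matrix.mul_assoc, bDer_matrix_mul, bDer_matrix_mul, bDer_checkCord, hcheckE',
      map_matrix_mul]
    simp only [Matrix.mul_assoc]
  have hC : (cMatrix 𝓡 m).map 𝓕 = (G.map φ').map ct * cMatrix 𝓡 m * H.map ct +
      G.map (bDer φ') * (hatCord mu U m).map ct * H.map ct := by
    ext i j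
    exact FreeAlgebra.lift_ι_apply ..
  have hD : (dMatrix 𝓡 m).map 𝓕 = G.map ct * dMatrix 𝓡 m * (H.map φ').map ct +
      G.map ct * (checkCord mu V m).map ct * H.map (bDer φ') := by
    ext i j
    exact FreeAlgebra.lift_ι_apply ..
  have hCd : ∀ M : Matrix (Fin (m + 1)) (Fin (m + 1)) (TAlg 𝓡 m),
      ∂ (cMatrix 𝓡 m * M) = ∂ (cMatrix 𝓡 m) * M - cMatrix 𝓡 m * ∂ M := fun M =>
    dMat_mul_of_one mu U V φ' P' Q' (cMatrix_mem mu U V φ' P' Q')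
  have hDd : ∀ M : Matrix (Fin (m + 1)) (Fin (m + 1)) (TAlg 𝓡 m),
      ∂ (dMatrix 𝓡 m * M) = ∂ (dMatrix 𝓡 m) * M - dMatrix 𝓡 m * ∂ M := fun M =>
    dMat_mul_of_one mu U V φ' P' Q' (dMatrix_mem mu U V φ' P' Q')
  have htd : ∀ M : Matrix (Fin (m + 1)) (Fin (m + 1)) (TAlg 𝓡 m),
      ∂ (G.map (bDer φ') * M) = ∂ (G.map (bDer φ')) * M - G.map (bDer φ') * ∂ M := fun M =>
    dMat_mul_of_one mu U V φ' P' Q' tmem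
  have hz : ∀ M : Matrix (Fin (m + 1)) (Fin (m + 1)) (CordAlg 𝓡 (Fin (m + 1))),
      ∂ (M.map ct) = 0 := fun M => by
    ext i j; exact d_cordToT mu U V φ' P' Q' _
  cases x with
  | a i j h =>
    change 𝓕 0 = PreDGA.d (twistedDGA mu U V φ' P' Q') (ct _)
    rw [map_zero, d_cordToT]
  | b i j h =>
    change 𝓕 (ct _) = PreDGA.d (twistedDGA mu U V φ' P' Q') (bDer φ' _)
    rw [conjVal_cordToT, d_bDer, hψ, map_sub]
  | c i j =>
    rw [twistedDiff_c]
    have key : ((hatCord mu U m).map ct - P.map ct * (checkCord mu V m).map ct).map 𝓕 =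
        ∂ ((G.map φ').map ct * cMatrix 𝓡 m * H.map ct +
          G.map (bDer φ') * (hatCord mu U m).map ct * H.map ct) := by
      simp only [Matrix.mul_assoc, dMat_add, dMat_cordToT_mul, dMat_mul_cordToT, hCd,
        htd, hz, dMat_bDer, dMat_c]
      rw [Matrix.map_sub _ (map_sub _), map_matrix_mul, conjVal_cordToT_map, conjVal_cordToT_map,
        conjVal_cordToT_map, hhatE, hcheckE]
      linear_combination (norm := noncomm_ring) hG' * ((checkCord mu V m).map ct * H.map ct)
    exact congrFun (congrFun key i) j
  | d i j =>
    rw [twistedDiff_d]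
    have key : ((checkCord mu V m).map ct - (hatCord mu U m).map ct * Q.map ct).map 𝓕 =
        ∂ (G.map ct * dMatrix 𝓡 m * (H.map φ').map ct +
      G.map ct * (checkCord mu V m).map ct * H.map (bDer φ')) := by
      simp only [Matrix.mul_assoc, dMat_add, dMat_cordToT_mul, hDd,
        hz, dMat_bDer, dMat_d]
      rw [Matrix.map_sub _ (map_sub _), map_matrix_mul, conjVal_cordToT_map, conjVal_cordToT_map,
        conjVal_cordToT_map, hhatE, hcheckE]
      linear_combination (norm := noncomm_ring) G.map ct * (hatCord mu U m).map ct * hH'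
    exact congrFun (congrFun key i) j
  | e i j =>
    have key : (hatB mu U m - cMatrix 𝓡 m - P.map ct * dMatrix 𝓡 m).map 𝓕 =
        ∂ ((G.map φ').map ct * eMatrix 𝓡 m * H.map ct -
      (G.map φ').map ct * P'.map ct * dMatrix 𝓡 m * H.map (bDer φ')) := by
      simp only [Matrix.mul_assoc, dMat_sub, dMat_cordToT_mul, dMat_mul_cordToT, hDd,
        dMat_bDer, dMat_d, dMat_e]
      rw [Matrix.map_sub _ (map_sub _), Matrix.map_sub _ (map_sub _), map_matrix_mul,
        conjVal_cordToT_map, hB, hC, hD]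
      linear_combination (norm := noncomm_ring) hG' * (dMatrix 𝓡 m * (H.map φ').map ct +
        (checkCord mu V m).map ct * H.map (bDer φ'))
    exact congrFun (congrFun key i) j
  | f i j =>
    have key : (checkB mu V m - dMatrix 𝓡 m - cMatrix 𝓡 m * Q.map ct).map 𝓕 =
        ∂ ((G.map φ').map ct * fMatrix 𝓡 m * H.map ct -
      (G.map (bDer φ') * dMatrix 𝓡 m * H.map ct + G.map ct * dMatrix 𝓡 m * H.map (bDer φ') +
        (G.map φ').map ct * cMatrix 𝓡 m * Q'.map ct * H.map (bDer φ') +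
        G.map (bDer φ') * (hatCord mu U m).map ct * Q'.map ct * H.map (bDer φ'))) := by
      simp only [Matrix.mul_assoc, dMat_add, dMat_sub, dMat_cordToT_mul, dMat_mul_cordToT, hCd, hDd,
        htd, hz, dMat_bDer, dMat_c, dMat_d, dMat_f]
      rw [Matrix.map_sub _ (map_sub _), Matrix.map_sub _ (map_sub _), map_matrix_mul,
        conjVal_cordToT_map, hBc, hC, hD]
      linear_combination (norm := noncomm_ring) ((G.map φ').map ct * cMatrix 𝓡 m +
        G.map (bDer φ') * (hatCord mu U m).map ct) * hH'
    exact congrFun (congrFun key i) j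

end ChainMap

end

end TransverseHomology
namespace TransverseHomology

noncomputable section

/-- Renaming of the strands. -/
def TGen.congr {I J : Type} (e : I ≃ J) : TGen I ≃ TGen J where
  toFun
    | .a i j h => .a (e i) (e j) (e.injective.ne h)
    | .b i j h => .b (e i) (e j) (e.injective.ne h)
    | .c i j => .c (e i) (e j)
    | .d i j => .d (e i) (e j)
    | .e i j => .e (e i) (e j)
    | .f i j => .f (e i) (e j)
  invFun
    | .a i j h => .a (e.symm i) (e.symm j) (e.symm.injective.ne h)
    | .b i j h => .b (e.symm i) (e.symm j) (e.symm.injective.ne h)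
    | .c i j => .c (e.symm i) (e.symm j)
    | .d i j => .d (e.symm i) (e.symm j)
    | .e i j => .e (e.symm i) (e.symm j)
    | .f i j => .f (e.symm i) (e.symm j)
  left_inv := by rintro (_ | _ | _ | _ | _ | _) <;> simp
  right_inv := by rintro (_ | _ | _ | _ | _ | _) <;> simp

/-! ### Conjugate braids satisfy the hypotheses of the lifting. -/

section BraidConj

variable {𝓡 : Type} [CommRing 𝓡] {m : ℕ} (Λ : Fin (m + 1) → 𝓡ˣ) (B g : BraidGroup m)

/-- The twisted braid automorphism as an algebra map. -/
abbrev twistedAut : CordAlg 𝓡 (Fin (m + 1)) →ₐ[𝓡] CordAlg 𝓡 (Fin (m + 1)) :=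
  (braidAut 𝓡 m B : _ →ₐ[𝓡] _).comp (scaleHom 𝓡 Λ)

/-- Moving the rescaling past `φ_g` replaces `Λ` by its pullback along the permutation of `g`; the
rest is `(g B g⁻¹) g = g B`. -/
theorem twistedAut_braidAut (x : CordAlg 𝓡 (Fin (m + 1))) :
    twistedAut Λ (g * B * g⁻¹) (braidAut 𝓡 m g x) =
      braidAut 𝓡 m g (twistedAut (fun i => Λ (braidPerm m g i)) B x) := by
  change braidAut 𝓡 m _ (scaleHom 𝓡 Λ (braidAut 𝓡 m g x)) =
    braidAut 𝓡 m g (braidAut 𝓡 m B (scaleHom 𝓡 _ x))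
  rw [← braidAut_scaleHom, braidAut_mul, braidAut_inv_apply, braidAut_mul]

/-- Both sides are the row rescaling of `Φ^L` of the braid `gB`, by the chain rule for `(g B g⁻¹) g`
and for `g B`. The rescaling multiplies the entry `(i, l)` of `Φ^L_g` by `Λ_{g(i)} Λ_l⁻¹`, and the
second factor cancels against the row factor of the other matrix. -/
theorem PhiL_map_twistedAut : (PhiL 𝓡 g).map (twistedAut Λ (g * B * g⁻¹)) *
      rowScale Λ (PhiL 𝓡 (g * B * g⁻¹)) =
    (rowScale (fun i => Λ (braidPerm m g i)) (PhiL 𝓡 B)).map (braidAut 𝓡 m g) * PhiL 𝓡 g := by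
  have e : (PhiL 𝓡 g).map (twistedAut Λ (g * B * g⁻¹)) * rowScale Λ (PhiL 𝓡 (g * B * g⁻¹)) =
      rowScale (fun i => Λ (braidPerm m g i))
        ((PhiL 𝓡 g).map (braidAut 𝓡 m (g * B * g⁻¹)) * PhiL 𝓡 (g * B * g⁻¹)) := by
    ext i j
    simp only [Matrix.mul_apply, rowScale, Matrix.of_apply, Matrix.map_apply, Finset.smul_sum]
    refine Finset.sum_congr rfl fun l _ => ?_
    change braidAut 𝓡 m _ (scaleHom 𝓡 Λ _) * _ = _
    rw [PhiL_isPath 𝓡 Λ g i l, map_smul, mul_smul_comm, smul_mul_assoc, smul_smul, Units.val_mul,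
      mul_left_comm, Units.mul_inv, mul_one]
  have e' : (rowScale (fun i => Λ (braidPerm m g i)) (PhiL 𝓡 B)).map (braidAut 𝓡 m g) =
      rowScale (fun i => Λ (braidPerm m g i)) ((PhiL 𝓡 B).map (braidAut 𝓡 m g)) :=
    rowScale_map _ _ (braidAut 𝓡 m g : CordAlg 𝓡 (Fin (m + 1)) →ₐ[𝓡] CordAlg 𝓡 (Fin (m + 1)))
  rw [e, e', rowScale_mul, ← PhiL_mul, ← PhiL_mul, inv_mul_cancel_right]

theorem PhiR_map_twistedAut : colScale Λ (PhiR 𝓡 (g * B * g⁻¹)) *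
      (PhiR 𝓡 g).map (twistedAut Λ (g * B * g⁻¹)) =
    PhiR 𝓡 g * (colScale (fun i => Λ (braidPerm m g i)) (PhiR 𝓡 B)).map (braidAut 𝓡 m g) := by
  have e : colScale Λ (PhiR 𝓡 (g * B * g⁻¹)) * (PhiR 𝓡 g).map (twistedAut Λ (g * B * g⁻¹)) =
      colScale (fun i => Λ (braidPerm m g i))
        (PhiR 𝓡 (g * B * g⁻¹) * (PhiR 𝓡 g).map (braidAut 𝓡 m (g * B * g⁻¹))) := by
    ext i j
    simp only [Matrix.mul_apply, colScale, Matrix.of_apply, Matrix.map_apply, Finset.smul_sum]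
    refine Finset.sum_congr rfl fun l _ => ?_
    change _ * braidAut 𝓡 m _ (scaleHom 𝓡 Λ _) = _
    rw [PhiR_isPath 𝓡 Λ g l j, map_smul, mul_smul_comm, smul_mul_assoc, smul_smul, Units.val_mul,
      mul_right_comm, Units.mul_inv, one_mul]
  have e' : (colScale (fun i => Λ (braidPerm m g i)) (PhiR 𝓡 B)).map (braidAut 𝓡 m g) =
      colScale (fun i => Λ (braidPerm m g i)) ((PhiR 𝓡 B).map (braidAut 𝓡 m g)) :=
    colScale_map _ _ (braidAut 𝓡 m g : CordAlg 𝓡 (Fin (m + 1)) →ₐ[𝓡] CordAlg 𝓡 (Fin (m + 1)))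
  rw [e, e', mul_colScale, ← PhiR_mul, ← PhiR_mul, inv_mul_cancel_right]

/-- The chain map induced by conjugation. -/
theorem braidTwist_conj_d (mu : 𝓡ˣ) (U V : 𝓡) (x : TGen (Fin (m + 1))) :
    FreeAlgebra.lift 𝓡 (conjVal mu U V (twistedAut Λ (g * B * g⁻¹))
        (braidAut 𝓡 m g : _ →ₐ[𝓡] _) (rowScale Λ (PhiL 𝓡 (g * B * g⁻¹)))
        (colScale Λ (PhiR 𝓡 (g * B * g⁻¹))) (PhiL 𝓡 g) (PhiR 𝓡 g))
      ((braidTwist mu U V (fun i => Λ (braidPerm m g i)) B).dGen x) =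
    (braidTwist mu U V Λ (g * B * g⁻¹)).d (conjVal mu U V (twistedAut Λ (g * B * g⁻¹))
      (braidAut 𝓡 m g : _ →ₐ[𝓡] _) (rowScale Λ (PhiL 𝓡 (g * B * g⁻¹)))
      (colScale Λ (PhiR 𝓡 (g * B * g⁻¹))) (PhiL 𝓡 g) (PhiR 𝓡 g) x) :=
  conjVal_d (ψ := (braidAut 𝓡 m g : CordAlg 𝓡 (Fin (m + 1)) →ₐ[𝓡] CordAlg 𝓡 (Fin (m + 1)))) mu U V
    (twistedAut_braidAut Λ B g) (PhiL_map_twistedAut Λ B g)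
    (PhiR_map_twistedAut Λ B g) (triMatrix_braid 𝓡 g 1 (mu * U)) (triMatrix_braid 𝓡 g V mu)
    (map_hatCord mu U Λ _) (map_checkCord mu V Λ _) x

end BraidConj

/-! ### Conjugation by one crossing is triangular. -/

section Triangular

variable {𝓡 : Type} [CommRing 𝓡]

open Classical in
/-- The number of indices equal to `q`. -/
def indexCount {I : Type} (q i j : I) : ℕ := (if i = q then 1 else 0) + if j = q then 1 else 0

variable {m : ℕ}

/-- The order of the generators in which conjugation is triangular. -/
def conjRank (p q : Fin (m + 1)) : TGen (Fin (m + 1)) → ℕ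
  | .a i j _ => if (i = q ∧ j ≠ p) ∨ (j = q ∧ i ≠ p) then 1 else 0
  | .b i j _ => 2 + if (i = q ∧ j ≠ p) ∨ (j = q ∧ i ≠ p) then 1 else 0
  | .c i j => 4 + indexCount q i j
  | .d i j => 7 + indexCount q i j
  | .e i j => 10 + indexCount q i j
  | .f i j => 13 + indexCount q i j

/-- The sign `-1` at `p`. -/
def signAt (𝓡 : Type) [CommRing 𝓡] (p i : Fin (m + 1)) : 𝓡ˣ := if i = p then -1 else 1

/-- The leading coefficients of conjugation. -/
def conjUnit (𝓡 : Type) [CommRing 𝓡] (p q : Fin (m + 1)) : TGen (Fin (m + 1)) → 𝓡ˣ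
  | .a i j _ => if (i = p ∧ j ≠ q) ∨ (j = p ∧ i ≠ q) then -1 else 1
  | .b i j _ => if (i = p ∧ j ≠ q) ∨ (j = p ∧ i ≠ q) then -1 else 1
  | .c i j => signAt 𝓡 p i * signAt 𝓡 p j
  | .d i j => signAt 𝓡 p i * signAt 𝓡 p j
  | .e i j => signAt 𝓡 p i * signAt 𝓡 p j
  | .f i j => signAt 𝓡 p i * signAt 𝓡 p j

/-- The image is separated into its leading linear term, with transposed indices, and the quadratic
correction that occurs when one index is `p` and the other is not `q`. -/
theorem crossVal_eq {p q i j : Fin (m + 1)} (hpq : p ≠ q) (hij : i ≠ j) :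
    crossVal 𝓡 p q i j =
      ((if (i = p ∧ j ≠ q) ∨ (j = p ∧ i ≠ q) then -1 else 1 : 𝓡ˣ) : 𝓡) •
        av 𝓡 (Equiv.swap p q i) (Equiv.swap p q j) -
      (if i = p ∧ j ≠ q then av 𝓡 q p * av 𝓡 p j else
        if j = p ∧ i ≠ q then av 𝓡 i p * av 𝓡 p q else 0) := by
  have hqp := hpq.symm
  unfold crossVal
  by_cases h1 : i = p
  · subst h1
    by_cases h2 : j = q
    · subst h2; simp [hqp]
    · simp [h2, Equiv.swap_apply_of_ne_of_ne hij.symm h2]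
  · by_cases h2 : i = q
    · subst h2
      by_cases h3 : j = p
      · subst h3; simp [hqp]
      · simp [h1, h3, Equiv.swap_apply_of_ne_of_ne h3 hij.symm]
    · by_cases h3 : j = p
      · subst h3; simp [h1, h2, Equiv.swap_apply_of_ne_of_ne h1 h2]
      · by_cases h4 : j = q
        · subst h4; simp [h1, h2, h3, Equiv.swap_apply_of_ne_of_ne h1 h2]
        · simp [h1, h2, h3, h4, Equiv.swap_apply_of_ne_of_ne h1 h2,
            Equiv.swap_apply_of_ne_of_ne h3 h4]

theorem crossMat_mul_swap {A : Type} [Ring A] [Algebra 𝓡 A] {p q : Fin (m + 1)} (hpq : p ≠ q)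
    (g : A) (X : Matrix (Fin (m + 1)) (Fin (m + 1)) A) (i j : Fin (m + 1)) :
    (crossMat p q g * X) i j = (signAt 𝓡 p i : 𝓡) • X (Equiv.swap p q i) j +
      if i = p then g * X p j else 0 := by
  rw [crossMat_mul_apply hpq]
  by_cases h1 : i = p
  · subst h1; simp [signAt]; abel
  · by_cases h2 : i = q
    · subst h2; simp [signAt, h1]
    · simp [signAt, h1, h2, Equiv.swap_apply_of_ne_of_ne h1 h2]

theorem mul_crossMat_swap {A : Type} [Ring A] [Algebra 𝓡 A] {p q : Fin (m + 1)} (hpq : p ≠ q)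
    (g : A) (X : Matrix (Fin (m + 1)) (Fin (m + 1)) A) (i j : Fin (m + 1)) :
    (X * (crossMat p q g).transpose) i j = (signAt 𝓡 p j : 𝓡) • X i (Equiv.swap p q j) +
      if j = p then X i p * g else 0 := by
  rw [mul_crossMat_apply hpq]
  by_cases h1 : j = p
  · subst h1; simp [signAt]; abel
  · by_cases h2 : j = q
    · subst h2; simp [signAt, h1]
    · simp [signAt, h1, h2, Equiv.swap_apply_of_ne_of_ne h1 h2]

/-- Row `p` of a crossing matrix contains `-1` in column `q` and the element `g` in column `p`.
Relative to the transposed leading entry, each remaining term has an index `p` in the place of `q`,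
so it contains the index `q` fewer times. -/
theorem PreDGA.cross_leading (S : PreDGA 𝓡) (ρ : S.gen → ℕ) {p q : Fin (m + 1)} (hpq : p ≠ q)
    {N : ℕ} {k : ℤ} {X : Matrix (Fin (m + 1)) (Fin (m + 1)) S.Alg}
    (hX : ∀ i j, X i j ∈ S.low ρ (N + indexCount q i j + 1) k) {g g' : S.Alg}
    (hg : g ∈ S.low ρ N 0) (hg' : g' ∈ S.low ρ N 0) (i j : Fin (m + 1)) :
    (crossMat p q g * X * (crossMat p q g').transpose) i j -
        ((signAt 𝓡 p i * signAt 𝓡 p j : 𝓡ˣ) : 𝓡) • X (Equiv.swap p q i) (Equiv.swap p q j) ∈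
      S.low ρ (N + indexCount q (Equiv.swap p q i) (Equiv.swap p q j)) k := by
  have hl : ∀ {M : ℕ} {w : S.Alg}, N ≤ M → w ∈ S.low ρ M k → g * w ∈ S.low ρ M k := fun hM hw =>
    S.mul_mem_low (S.low_mono hM hg) hw (zero_add k)
  have hr : ∀ {M : ℕ} {w : S.Alg}, N ≤ M → w ∈ S.low ρ M k → w * g' ∈ S.low ρ M k := fun hM hw =>
    S.mul_mem_low hw (S.low_mono hM hg') (add_zero k)
  rw [mul_crossMat_swap (𝓡 := 𝓡) hpq, crossMat_mul_swap (𝓡 := 𝓡) hpq,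
    crossMat_mul_swap (𝓡 := 𝓡) hpq, smul_add, smul_smul, Units.val_mul, mul_comm, add_assoc,
    add_sub_cancel_left]
  refine add_mem (Submodule.smul_mem _ _ ?_) ?_
  · split_ifs with h
    · refine hl (by omega) (S.low_mono ?_ (hX _ _))
      subst h
      simp [indexCount, hpq]
    · exact Submodule.zero_mem _
  · split_ifs with h h'
    · refine hr (by omega) (add_mem (Submodule.smul_mem _ _ (S.low_mono ?_ (hX _ _)))
        (hl (by omega) (S.low_mono ?_ (hX _ _))))
      · subst h; simp [indexCount, hpq]
      · subst h; subst h'; simp [indexCount, hpq]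
    · refine hr (by omega) (add_mem (Submodule.smul_mem _ _ (S.low_mono ?_ (hX _ _)))
        (Submodule.zero_mem _))
      subst h; simp [indexCount, hpq]
    · exact Submodule.zero_mem _

/-- All entries of the matrix lie in `S.low ρ N k`. -/
def PreDGA.MatLow (S : PreDGA 𝓡) (ρ : S.gen → ℕ) (N : ℕ) (k : ℤ)
    (M : Matrix (Fin (m + 1)) (Fin (m + 1)) S.Alg) : Prop := ∀ i j, M i j ∈ S.low ρ N k

theorem PreDGA.MatLow.mul {S : PreDGA 𝓡} {ρ : S.gen → ℕ} {N : ℕ} {k l n : ℤ}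
    {X Y : Matrix (Fin (m + 1)) (Fin (m + 1)) S.Alg} (hX : S.MatLow ρ N k X)
    (hY : S.MatLow ρ N l Y) (h : k + l = n) : S.MatLow ρ N n (X * Y) := fun i j => by
  rw [Matrix.mul_apply]
  exact sum_mem fun t _ => S.mul_mem_low (hX i t) (hY t j) h

variable (mu : 𝓡ˣ) (U V : 𝓡) (φ : CordAlg 𝓡 (Fin (m + 1)) →ₐ[𝓡] CordAlg 𝓡 (Fin (m + 1)))
  (P Q : Matrix (Fin (m + 1)) (Fin (m + 1)) (CordAlg 𝓡 (Fin (m + 1))))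

local notation "𝓣" => twistedDGA mu U V φ P Q

theorem cordToT_mem_low {ρ : TGen (Fin (m + 1)) → ℕ} {N : ℕ}
    (h : ∀ i j hij, ρ (.a i j hij) < N) (x : CordAlg 𝓡 (Fin (m + 1))) :
    cordToT 𝓡 m x ∈ PreDGA.low 𝓣 ρ N 0 := by
  induction x using FreeAlgebra.induction with
  | grade0 r => rw [AlgHom.commutes]; exact PreDGA.algebraMap_mem_low (S := 𝓣) r
  | grade1 x =>
    rw [cordToT, FreeAlgebra.lift_ι_apply]
    exact PreDGA.var_mem_low (S := 𝓣) (TGen.a x.1.1 x.1.2 x.2) (h _ _ _) rfl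
  | mul u v hu hv => rw [map_mul]; exact PreDGA.mul_mem_low (S := 𝓣) hu hv (zero_add 0)
  | add u v hu hv => rw [map_add]; exact add_mem hu hv

theorem bMatrix_mem_low {ρ : TGen (Fin (m + 1)) → ℕ} {N : ℕ} {i j : Fin (m + 1)}
    (hb : ∀ hij, ρ (.b i j hij) < N) : bMatrix 𝓡 m i j ∈ PreDGA.low 𝓣 ρ N 1 := by
  by_cases hij : i = j
  · subst hij; rw [bMatrix_self]; exact Submodule.zero_mem _
  · rw [bMatrix_apply hij]
    exact PreDGA.var_mem_low (S := 𝓣) (TGen.b _ _ hij) (hb _) rfl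

theorem bDer_mem_low {ρ : TGen (Fin (m + 1)) → ℕ} {N : ℕ} (h : ∀ i j hij, ρ (.a i j hij) < N)
    (hb : ∀ i j hij, ρ (.b i j hij) < N) (x : CordAlg 𝓡 (Fin (m + 1))) :
    bDer φ x ∈ PreDGA.low 𝓣 ρ N 1 := by
  have hc := cordToT_mem_low mu U V φ P Q h
  induction x using FreeAlgebra.induction with
  | grade0 r => rw [bDer_algebraMap]; exact Submodule.zero_mem _
  | grade1 x =>
    have : av 𝓡 x.1.1 x.1.2 = FreeAlgebra.ι 𝓡 x := by rw [av, dif_pos x.2]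
    rw [← this, bDer_av]
    exact bMatrix_mem_low mu U V φ P Q (hb _ _)
  | mul u v hu hv =>
    rw [bDer_mul]
    exact add_mem (PreDGA.mul_mem_low (S := 𝓣) hu (hc _) rfl) (PreDGA.mul_mem_low (S := 𝓣) (hc _) hv rfl)
  | add u v hu hv => rw [map_add]; exact add_mem hu hv

theorem indexCount_le {I : Type} (q i j : I) : indexCount q i j ≤ 2 := by
  unfold indexCount; split_ifs <;> omega

/-- The six types of generators occupy disjoint intervals of ranks, in the order `a, b, c, d, e, f`,
and the derivation terms in an image involve only earlier types. Within one type, the rank grows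
with the occurrences of `q`, the index to which the crossing moves `p`; for `a` and `b` the pairs
`{p, q}` are exempt, as their images are single generators. -/
theorem conjVal_leading {p q : Fin (m + 1)} (hpq : p ≠ q)
    {ψ : CordAlg 𝓡 (Fin (m + 1)) →ₐ[𝓡] CordAlg 𝓡 (Fin (m + 1))}
    {G H : Matrix (Fin (m + 1)) (Fin (m + 1)) (CordAlg 𝓡 (Fin (m + 1)))}
    {g h : CordAlg 𝓡 (Fin (m + 1))}
    (hψ : ∀ i j, i ≠ j → ψ (av 𝓡 i j) = crossVal 𝓡 p q i j)
    (hG : G = crossMat p q g) (hH : H = (crossMat p q h).transpose) (x : TGen (Fin (m + 1))) :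
    conjVal mu U V φ ψ P Q G H x - (conjUnit 𝓡 p q x : 𝓡) •
        FreeAlgebra.ι 𝓡 (TGen.congr (Equiv.swap p q) x) ∈
      PreDGA.low 𝓣 (conjRank p q) (conjRank p q (TGen.congr (Equiv.swap p q) x)) x.deg := by
  have hqp := hpq.symm
  have hc : ∀ {N}, 2 ≤ N → ∀ x, cordToT 𝓡 m x ∈ PreDGA.low 𝓣 (conjRank p q) N 0 := fun hN =>
    cordToT_mem_low mu U V φ P Q fun i j hij => by simp only [conjRank]; split_ifs <;> omega
  have hr : ∀ {N}, 4 ≤ N → ∀ x, bDer φ x ∈ PreDGA.low 𝓣 (conjRank p q) N 1 := fun hN =>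
    bDer_mem_low mu U V φ P Q
      (fun i j hij => by simp only [conjRank]; split_ifs <;> omega)
      (fun i j hij => by simp only [conjRank]; split_ifs <;> omega)
  have hcm : ∀ {N}, 2 ≤ N → ∀ M : Matrix (Fin (m + 1)) (Fin (m + 1)) (CordAlg 𝓡 (Fin (m + 1))),
      PreDGA.MatLow 𝓣 (conjRank p q) N 0 (M.map (cordToT 𝓡 m)) := fun hN M i j => hc hN _
  have hrm : ∀ {N}, 4 ≤ N → ∀ M : Matrix (Fin (m + 1)) (Fin (m + 1)) (CordAlg 𝓡 (Fin (m + 1))),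
      PreDGA.MatLow 𝓣 (conjRank p q) N 1 (M.map (bDer φ)) := fun hN M i j => hr hN _
  have hC : ∀ {N}, 7 ≤ N → PreDGA.MatLow 𝓣 (conjRank p q) N 1 (cMatrix 𝓡 m) := fun hN i j =>
    PreDGA.var_mem_low (S := 𝓣) (TGen.c i j)
      (by have := indexCount_le q i j; simp only [conjRank]; omega) rfl
  have hD : ∀ {N}, 10 ≤ N → PreDGA.MatLow 𝓣 (conjRank p q) N 1 (dMatrix 𝓡 m) := fun hN i j =>
    PreDGA.var_mem_low (S := 𝓣) (TGen.d i j)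
      (by have := indexCount_le q i j; simp only [conjRank]; omega) rfl
  have hGct : ∀ f : CordAlg 𝓡 (Fin (m + 1)) →ₐ[𝓡] CordAlg 𝓡 (Fin (m + 1)),
      (G.map f).map (cordToT 𝓡 m) = crossMat p q (cordToT 𝓡 m (f g)) := fun f => by
    rw [hG, crossMat_map, crossMat_map]
  have hHct : ∀ f : CordAlg 𝓡 (Fin (m + 1)) →ₐ[𝓡] CordAlg 𝓡 (Fin (m + 1)),
      (H.map f).map (cordToT 𝓡 m) = (crossMat p q (cordToT 𝓡 m (f h))).transpose := fun f => by
    rw [hH, Matrix.transpose_map, Matrix.transpose_map, crossMat_map, crossMat_map]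
  have hGct0 : G.map (cordToT 𝓡 m) = crossMat p q (cordToT 𝓡 m g) := by rw [hG, crossMat_map]
  have hHct0 : H.map (cordToT 𝓡 m) = (crossMat p q (cordToT 𝓡 m h)).transpose := by
    rw [hH, Matrix.transpose_map, crossMat_map]
  cases x with
  | a i j hij =>
    change cordToT 𝓡 m (ψ (av 𝓡 i j)) - _ • FreeAlgebra.ι 𝓡 (TGen.a _ _ _) ∈ PreDGA.low 𝓣 _ _ 0
    rw [hψ i j hij, crossVal_eq hpq hij, map_sub, map_smul,
      cordToT_av ((Equiv.swap p q).injective.ne hij), conjUnit, sub_sub_cancel_left]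
    refine neg_mem ?_
    split_ifs with h1 h2
    · obtain ⟨rfl, h2⟩ := h1
      rw [map_mul, cordToT_av hqp, cordToT_av hij]
      refine PreDGA.mul_mem_low (S := 𝓣) (PreDGA.var_mem_low (S := 𝓣) (TGen.a _ _ _) ?_ rfl)
        (PreDGA.var_mem_low (S := 𝓣) (TGen.a _ _ _) ?_ rfl) (zero_add 0) <;>
      simp [conjRank, TGen.congr, hpq, h2, hij.symm, Equiv.swap_apply_of_ne_of_ne hij.symm h2]
    · obtain ⟨rfl, h2⟩ := h2
      rw [map_mul, cordToT_av hij, cordToT_av hpq]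
      refine PreDGA.mul_mem_low (S := 𝓣) (PreDGA.var_mem_low (S := 𝓣) (TGen.a _ _ _) ?_ rfl)
        (PreDGA.var_mem_low (S := 𝓣) (TGen.a _ _ _) ?_ rfl) (zero_add 0) <;>
      simp [conjRank, TGen.congr, hpq, h2, hij, Equiv.swap_apply_of_ne_of_ne hij h2]
    · rw [map_zero]; exact Submodule.zero_mem _
  | b i j hij =>
    change bDer φ (ψ (av 𝓡 i j)) - _ • FreeAlgebra.ι 𝓡 (TGen.b _ _ _) ∈ PreDGA.low 𝓣 _ _ 1
    rw [hψ i j hij, crossVal_eq hpq hij, map_sub, map_smul, bDer_av,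
      bMatrix_apply ((Equiv.swap p q).injective.ne hij), conjUnit, sub_sub_cancel_left]
    refine neg_mem ?_
    split_ifs with h1 h2
    · obtain ⟨rfl, h2⟩ := h1
      rw [bDer_mul, bDer_av, bDer_av]
      refine add_mem (PreDGA.mul_mem_low (S := 𝓣) (bMatrix_mem_low mu U V φ P Q fun hne => ?_)
        (hc ?_ _) (add_zero 1))
        (PreDGA.mul_mem_low (S := 𝓣) (hc ?_ _) (bMatrix_mem_low mu U V φ P Q fun hne => ?_) (zero_add 1)) <;>
      simp [conjRank, TGen.congr, hpq, h2, hij.symm, Equiv.swap_apply_of_ne_of_ne hij.symm h2]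
    · obtain ⟨rfl, h2⟩ := h2
      rw [bDer_mul, bDer_av, bDer_av]
      refine add_mem (PreDGA.mul_mem_low (S := 𝓣) (bMatrix_mem_low mu U V φ P Q fun hne => ?_)
        (hc ?_ _) (add_zero 1))
        (PreDGA.mul_mem_low (S := 𝓣) (hc ?_ _) (bMatrix_mem_low mu U V φ P Q fun hne => ?_) (zero_add 1)) <;>
      simp [conjRank, TGen.congr, hpq, h2, hij, Equiv.swap_apply_of_ne_of_ne hij h2]
    · rw [map_zero]; exact Submodule.zero_mem _
  | c i j =>
    have hl := PreDGA.cross_leading 𝓣 (conjRank p q) hpq (N := 4) (k := 1) (X := cMatrix 𝓡 m)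
      (fun i j => PreDGA.var_mem_low (S := 𝓣) (TGen.c i j) (Nat.lt_succ_self _) rfl)
      (hc (by omega) (φ g)) (hc (by omega) h) i j
    rw [← hGct, ← hHct0] at hl
    have hlow := ((hrm le_rfl G).mul (hcm (by omega) (hatCord mu U m)) (add_zero 1)).mul
      (hcm (by omega) H) (add_zero 1) i j
    have := add_mem hl (PreDGA.low_mono (S := 𝓣) (Nat.le_add_right _ _) hlow)
    rwa [sub_add_eq_add_sub] at this
  | d i j =>
    have hl := PreDGA.cross_leading 𝓣 (conjRank p q) hpq (N := 7) (k := 1) (X := dMatrix 𝓡 m)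
      (fun i j => PreDGA.var_mem_low (S := 𝓣) (TGen.d i j) (Nat.lt_succ_self _) rfl)
      (hc (by omega) g) (hc (by omega) (φ h)) i j
    rw [← hGct0, ← hHct] at hl
    have hlow := ((hcm (N := 7) (by omega) G).mul (hcm (by omega) (checkCord mu V m)) (add_zero 0)).mul
      (hrm (by omega) H) (zero_add 1) i j
    have := add_mem hl (PreDGA.low_mono (S := 𝓣) (Nat.le_add_right _ _) hlow)
    rwa [sub_add_eq_add_sub] at this
  | e i j =>
    have hl := PreDGA.cross_leading 𝓣 (conjRank p q) hpq (N := 10) (k := 2) (X := eMatrix 𝓡 m)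
      (fun i j => PreDGA.var_mem_low (S := 𝓣) (TGen.e i j) (Nat.lt_succ_self _) rfl)
      (hc (by omega) (φ g)) (hc (by omega) h) i j
    rw [← hGct, ← hHct0] at hl
    have hlow := (((hcm (N := 10) (by omega) (G.map φ)).mul (hcm (by omega) P) (add_zero 0)).mul
      (hD le_rfl) (zero_add 1)).mul (hrm (by omega) H) one_add_one_eq_two i j
    have := sub_mem hl (PreDGA.low_mono (S := 𝓣) (Nat.le_add_right _ _) hlow)
    rwa [sub_right_comm] at this
  | f i j =>
    have hl := PreDGA.cross_leading 𝓣 (conjRank p q) hpq (N := 13) (k := 2) (X := fMatrix 𝓡 m)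
      (fun i j => PreDGA.var_mem_low (S := 𝓣) (TGen.f i j) (Nat.lt_succ_self _) rfl)
      (hc (by omega) (φ g)) (hc (by omega) h) i j
    rw [← hGct, ← hHct0] at hl
    have h1 := ((hrm (N := 13) (by omega) G).mul (hD (by omega)) one_add_one_eq_two).mul
      (hcm (by omega) H) (add_zero 2) i j
    have h2 := ((hcm (N := 13) (by omega) G).mul (hD (by omega)) (zero_add 1)).mul
      (hrm (by omega) H) one_add_one_eq_two i j
    have h3 := (((hcm (N := 13) (by omega) (G.map φ)).mul (hC (by omega)) (zero_add 1)).mul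
      (hcm (by omega) Q) (add_zero 1)).mul (hrm (by omega) H) one_add_one_eq_two i j
    have h4 := (((hrm (N := 13) (by omega) G).mul (hcm (by omega) (hatCord mu U m)) (add_zero 1)).mul
      (hcm (by omega) Q) (add_zero 1)).mul (hrm (by omega) H) one_add_one_eq_two i j
    have := sub_mem hl (PreDGA.low_mono (S := 𝓣) (Nat.le_add_right _ _)
      (add_mem (add_mem (add_mem h1 h2) h3) h4))
    rwa [sub_right_comm] at this

end Triangular

/-! ### Invariance under conjugation. -/

section Conj

variable {𝓡 : Type} [CommRing 𝓡] {m : ℕ} (mu : 𝓡ˣ) (U V : 𝓡)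

theorem braidTwist_conj_sigma (Λ : Fin (m + 1) → 𝓡ˣ) (B : BraidGroup m) (k : Fin m) :
    PreDGA.TameIso (braidTwist mu U V (fun i => Λ (braidPerm m (sigma k) i)) B)
      (braidTwist mu U V Λ (sigma k * B * (sigma k)⁻¹)) := by
  refine PreDGA.tameIso_of_triangular (T := braidTwist mu U V Λ (sigma k * B * (sigma k)⁻¹))
    (TGen.congr (Equiv.swap k.castSucc k.succ))
    (by rintro (_ | _ | _ | _ | _ | _) <;> rfl) (conjRank k.castSucc k.succ)
    (conjVal mu U V _ (braidAut 𝓡 m (sigma k) : _ →ₐ[𝓡] _) _ _ (PhiL 𝓡 (sigma k))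
      (PhiR 𝓡 (sigma k))) (conjUnit 𝓡 k.castSucc k.succ)
    (fun x => conjVal_leading mu U V _ _ _ Fin.castSucc_lt_succ.ne ?_ (PhiL_sigma 𝓡 k)
      (PhiR_sigma 𝓡 k) x)
    (braidTwist_conj_d Λ B (sigma k) mu U V)
  intro i j hij
  exact (braidAut_sigma 𝓡 k _).trans (crossHom_av 𝓡 _ _ hij)

/-- Triangularity is available for a single crossing only; general `g` are reached by composition.
For this `Λ` must be arbitrary, because each conjugation permutes its entries. -/
theorem braidTwist_conj (B g : BraidGroup m) (Λ : Fin (m + 1) → 𝓡ˣ) :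
    PreDGA.TameIso (braidTwist mu U V (fun i => Λ (braidPerm m g i)) B)
      (braidTwist mu U V Λ (g * B * g⁻¹)) := by
  induction g using braid_induction generalizing B Λ with
  | one => simpa using PreDGA.TameIso.refl _
  | sigma k => exact braidTwist_conj_sigma mu U V Λ B k
  | mul a b ha hb =>
    have := (hb B fun i => Λ (braidPerm m a i)).trans (ha (b * B * b⁻¹) Λ)
    simpa [mul_assoc] using this
  | inv a ha =>
    have := (ha (a⁻¹ * B * a) fun i => Λ (braidPerm m a⁻¹ i)).symm
    simpa [mul_assoc] using this

/-- Conjugation relates the unit at strand `0` to the same unit at the strand `g⁻¹(0)`. On a knot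
both strands lie on one cycle of the permutation of `B`, and the unit can be slid between them. -/
theorem transverseDGA_conj (lam : 𝓡ˣ) (B g : BraidGroup m) (hB : ClosureIsKnot B) :
    PreDGA.TameIso (transverseDGA lam mu U V B) (transverseDGA lam mu U V (g * B * g⁻¹)) := by
  have hw : writhe (g * B * g⁻¹) = writhe B := by
    rw [writhe_mul, writhe_mul, writhe_inv]; ring
  rw [transverseDGA_eq, transverseDGA_eq, hw]
  refine PreDGA.TameIso.trans ?_ (braidTwist_conj mu U V B g _)
  have e : (fun i => (Pi.mulSingle 0 (lam * mu ^ (-writhe B)) : Fin (m + 1) → 𝓡ˣ)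
      (braidPerm m g i)) = Pi.mulSingle ((braidPerm m g)⁻¹ 0) (lam * mu ^ (-writhe B)) := by
    funext i
    simp only [Pi.mulSingle_apply, Equiv.Perm.eq_inv_iff_eq]
  rw [e]
  simpa using braidTwist_move mu U V 1 (lam * mu ^ (-writhe B)) B (hB 0 ((braidPerm m g)⁻¹ 0))

end Conj

end

end TransverseHomology
namespace TransverseHomology

noncomputable section

/-! ### The differential of the stabilized braid; the new strand is `0` and the old strands are
shifted by one. -/

section StabCalculus

variable {𝓡 : Type} [CommRing 𝓡] {m : ℕ} (mu : 𝓡ˣ) (U V : 𝓡)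

/-- The coefficients of `φ_B` on the variables that end at a new strand `0`. -/
def leftPath (P : Matrix (Fin (m + 1)) (Fin (m + 1)) (CordAlg 𝓡 (Fin (m + 1)))) (i : Fin (m + 1)) :
    CordAlg 𝓡 (Fin (m + 2)) :=
  ∑ k, cordMap 𝓡 Fin.succ (P i k) * av 𝓡 k.succ 0

/-- The coefficients of `φ_B` on the variables that start at a new strand `0`. -/
def rightPath (Q : Matrix (Fin (m + 1)) (Fin (m + 1)) (CordAlg 𝓡 (Fin (m + 1)))) (j : Fin (m + 1)) :
    CordAlg 𝓡 (Fin (m + 2)) :=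
  ∑ k, av 𝓡 0 k.succ * cordMap 𝓡 Fin.succ (Q k j)

/-- The relation between the data of a braid and of its left stabilization. -/
structure StabData (φ : CordAlg 𝓡 (Fin (m + 1)) →ₐ[𝓡] CordAlg 𝓡 (Fin (m + 1)))
    (P Q : Matrix (Fin (m + 1)) (Fin (m + 1)) (CordAlg 𝓡 (Fin (m + 1))))
    (φ' : CordAlg 𝓡 (Fin (m + 2)) →ₐ[𝓡] CordAlg 𝓡 (Fin (m + 2)))
    (P' Q' : Matrix (Fin (m + 2)) (Fin (m + 2)) (CordAlg 𝓡 (Fin (m + 2)))) : Prop where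
  old_old : ∀ i j, i ≠ 0 → j ≠ 0 →
    φ' (av 𝓡 i.succ j.succ) = cordMap 𝓡 Fin.succ (φ (av 𝓡 i j))
  one_old : ∀ j, j ≠ 0 → φ' (av 𝓡 (Fin.succ 0) j.succ) = ((mu⁻¹ : 𝓡ˣ) : 𝓡) • rightPath Q j
  old_one : ∀ i : Fin (m + 1), i ≠ 0 → φ' (av 𝓡 i.succ (Fin.succ 0)) = (mu : 𝓡) • leftPath P i
  zero_old : ∀ j, j ≠ 0 → φ' (av 𝓡 0 j.succ) =
    -cordMap 𝓡 Fin.succ (φ (av 𝓡 0 j)) - leftPath P 0 * rightPath Q j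
  old_zero : ∀ i : Fin (m + 1), i ≠ 0 → φ' (av 𝓡 i.succ 0) =
    -cordMap 𝓡 Fin.succ (φ (av 𝓡 i 0)) - leftPath P i * rightPath Q 0
  zero_one : φ' (av 𝓡 0 (Fin.succ 0)) = (mu : 𝓡) • leftPath P 0
  one_zero : φ' (av 𝓡 (Fin.succ 0) 0) = ((mu⁻¹ : 𝓡ˣ) : 𝓡) • rightPath Q 0
  P_zero_zero : P' 0 0 = -leftPath P 0
  P_zero_succ : ∀ k, P' 0 k.succ = -cordMap 𝓡 Fin.succ (P 0 k)
  P_one_zero : P' (Fin.succ 0) 0 = ((mu⁻¹ : 𝓡ˣ) : 𝓡) • 1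
  P_one_succ : ∀ k : Fin (m + 1), P' (Fin.succ 0) (Fin.succ k) = 0
  P_succ_zero : ∀ i : Fin (m + 1), i ≠ 0 → P' i.succ 0 = 0
  P_succ_succ : ∀ i k, i ≠ 0 → P' i.succ k.succ = cordMap 𝓡 Fin.succ (P i k)
  Q_zero_zero : Q' 0 0 = -rightPath Q 0
  Q_succ_zero : ∀ k, Q' k.succ 0 = -cordMap 𝓡 Fin.succ (Q k 0)
  Q_zero_one : Q' 0 (Fin.succ 0) = (mu : 𝓡) • 1
  Q_succ_one : ∀ k : Fin (m + 1), Q' (Fin.succ k) (Fin.succ 0) = 0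
  Q_zero_succ : ∀ j : Fin (m + 1), j ≠ 0 → Q' 0 j.succ = 0
  Q_succ_succ : ∀ k j, j ≠ 0 → Q' k.succ j.succ = cordMap 𝓡 Fin.succ (Q k j)

/-- The inclusion of `𝓐_n` for a strand added before the first one. -/
def leftIncl (𝓡 : Type) [CommRing 𝓡] (m : ℕ) : CordAlg 𝓡 (Fin (m + 1)) →ₐ[𝓡] TAlg 𝓡 (m + 1) :=
  (cordToT 𝓡 (m + 1)).comp (cordMap 𝓡 Fin.succ)

section TriMatrix

variable {A : Type} [Ring A] [Algebra 𝓡 A] (x δ y : 𝓡) (M : Matrix (Fin (m + 1)) (Fin (m + 1)) A)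

theorem triMatrix_self (i : Fin (m + 1)) : triMatrix x δ y M i i = δ • (1 : A) := by
  simp [triMatrix, Algebra.algebraMap_eq_smul_one]

theorem triMatrix_of_lt {i j : Fin (m + 1)} (h : j < i) : triMatrix x δ y M i j = x • M i j := by
  simp [triMatrix, h]

theorem triMatrix_of_gt {i j : Fin (m + 1)} (h : i < j) : triMatrix x δ y M i j = y • M i j := by
  simp [triMatrix, h.not_gt, h.ne]

end TriMatrix

local notation "κ" => leftIncl 𝓡 m
local notation "ct" => cordToT 𝓡 (m + 1)

theorem cordToT_triMatrix_succ (x δ y : 𝓡) (i j : Fin (m + 1)) :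
    ct (triMatrix x δ y (cordMatrix 𝓡 (m + 1)) i.succ j.succ) =
      κ (triMatrix x δ y (cordMatrix 𝓡 m) i j) := by
  simp only [leftIncl, AlgHom.comp_apply, triMatrix, Matrix.of_apply, cordMatrix,
    Fin.succ_lt_succ_iff, Fin.succ_inj]
  split_ifs
  · rw [map_smul, map_smul, map_smul, cordMap_av]
  · simp
  · rw [map_smul, map_smul, map_smul, cordMap_av]

theorem hatCord_succ (i j : Fin (m + 1)) :
    ct (hatCord mu U (m + 1) i.succ j.succ) = κ (hatCord mu U m i j) := cordToT_triMatrix_succ ..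

theorem checkCord_succ (i j : Fin (m + 1)) :
    ct (checkCord mu V (m + 1) i.succ j.succ) = κ (checkCord mu V m i j) :=
  cordToT_triMatrix_succ ..

theorem hatCord_zero_succ (j : Fin (m + 1)) :
    hatCord mu U (m + 1) 0 j.succ = ((mu : 𝓡) * U) • av 𝓡 0 j.succ :=
  triMatrix_of_gt _ _ _ _ (Fin.succ_pos j)

theorem hatCord_succ_zero (i : Fin (m + 1)) :
    hatCord mu U (m + 1) i.succ 0 = av 𝓡 i.succ 0 :=
  (triMatrix_of_lt _ _ _ _ (Fin.succ_pos i)).trans (one_smul _ _)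

theorem checkCord_zero_succ (j : Fin (m + 1)) :
    checkCord mu V (m + 1) 0 j.succ = (mu : 𝓡) • av 𝓡 0 j.succ :=
  triMatrix_of_gt _ _ _ _ (Fin.succ_pos j)

theorem checkCord_succ_zero (i : Fin (m + 1)) :
    checkCord mu V (m + 1) i.succ 0 = V • av 𝓡 i.succ 0 :=
  triMatrix_of_lt _ _ _ _ (Fin.succ_pos i)

variable {mu U V}
  {φ : CordAlg 𝓡 (Fin (m + 1)) →ₐ[𝓡] CordAlg 𝓡 (Fin (m + 1))}
  {P Q : Matrix (Fin (m + 1)) (Fin (m + 1)) (CordAlg 𝓡 (Fin (m + 1)))}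
  {φ' : CordAlg 𝓡 (Fin (m + 2)) →ₐ[𝓡] CordAlg 𝓡 (Fin (m + 2))}
  {P' Q' : Matrix (Fin (m + 2)) (Fin (m + 2)) (CordAlg 𝓡 (Fin (m + 2)))}

local notation "δ" => twistedDiff mu U V φ' P' Q'
local notation "u" => fun j : Fin (m + 1) => ct (av 𝓡 0 (Fin.succ j))
local notation "v" => fun i : Fin (m + 1) => ct (av 𝓡 (Fin.succ i) 0)
local notation "Pv" => fun i : Fin (m + 1) => ct (leftPath P i)
local notation "uQ" => fun j : Fin (m + 1) => ct (rightPath Q j)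
local notation "ν" => ((mu⁻¹ : 𝓡ˣ) : 𝓡)
local notation "⟪" x "⟫" => FreeAlgebra.ι 𝓡 x

theorem cordToT_leftPath (i : Fin (m + 1)) : ∑ k, κ (P i k) * v k = Pv i := by
  simp [leftPath, leftIncl]

theorem cordToT_rightPath (j : Fin (m + 1)) : ∑ k, u k * κ (Q k j) = uQ j := by
  simp [rightPath, leftIncl]

namespace StabData



theorem diff_b (H : StabData mu φ P Q φ' P' Q') {i j : Fin (m + 1)} (hi : i ≠ 0) (hj : j ≠ 0) (h) :
    δ (.b i.succ j.succ h) = κ (av 𝓡 i j - φ (av 𝓡 i j)) := by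
  simp only [twistedDiff, H.old_old i j hi hj, leftIncl, AlgHom.comp_apply, map_sub, cordMap_av]

theorem diff_b_one (H : StabData mu φ P Q φ' P' Q') {j : Fin (m + 1)} (hj : j ≠ 0) (h) :
    δ (.b (Fin.succ 0) j.succ h) = κ (av 𝓡 0 j) - ν • uQ j := by
  simp only [twistedDiff, H.one_old j hj, leftIncl, AlgHom.comp_apply, map_sub, map_smul, cordMap_av]

theorem diff_b_to_one (H : StabData mu φ P Q φ' P' Q') {i : Fin (m + 1)} (hi : i ≠ 0) (h) :
    δ (.b i.succ (Fin.succ 0) h) = κ (av 𝓡 i 0) - (mu : 𝓡) • Pv i := by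
  simp only [twistedDiff, H.old_one i hi, leftIncl, AlgHom.comp_apply, map_sub, map_smul, cordMap_av]

theorem diff_b_zero (H : StabData mu φ P Q φ' P' Q') {j : Fin (m + 1)} (hj : j ≠ 0) (h) :
    δ (.b 0 j.succ h) = u j + κ (φ (av 𝓡 0 j)) + Pv 0 * uQ j := by
  simp only [twistedDiff, H.zero_old j hj, leftIncl, AlgHom.comp_apply, map_sub, map_neg, map_mul]
  abel

theorem diff_b_to_zero (H : StabData mu φ P Q φ' P' Q') {i : Fin (m + 1)} (hi : i ≠ 0) (h) :
    δ (.b i.succ 0 h) = v i + κ (φ (av 𝓡 i 0)) + Pv i * uQ 0 := by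
  simp only [twistedDiff, H.old_zero i hi, leftIncl, AlgHom.comp_apply, map_sub, map_neg, map_mul]
  abel

theorem diff_b_zero_one (H : StabData mu φ P Q φ' P' Q') (h) : δ (.b 0 (Fin.succ 0) h) = u 0 - (mu : 𝓡) • Pv 0 := by
  simp only [twistedDiff, H.zero_one, map_sub, map_smul]

theorem diff_b_one_zero (H : StabData mu φ P Q φ' P' Q') (h) : δ (.b (Fin.succ 0) 0 h) = v 0 - ν • uQ 0 := by
  simp only [twistedDiff, H.one_zero, map_sub, map_smul]

theorem diff_c (H : StabData mu φ P Q φ' P' Q') {i : Fin (m + 1)} (hi : i ≠ 0) (j : Fin (m + 1)) :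
    δ (.c i.succ j.succ) =
      κ (hatCord mu U m i j) - ∑ k, κ (P i k) * κ (checkCord mu V m k j) := by
  simp only [twistedDiff, Matrix.sub_apply, Matrix.mul_apply, Fin.sum_univ_succ (n := m + 1), map_sub,
    map_mul, map_sum, H.P_succ_zero i hi, H.P_succ_succ i _ hi, hatCord_succ,
    checkCord_succ, zero_mul, zero_add]
  rfl

/-- The row of the old first strand in `P'` has a single nonzero entry `μ⁻¹`, and the corresponding
entry of `𝐀̌` is `μ` times the new variable. So the new variable occurs linearly with coefficient
`-1`, and it can be cancelled against this generator. -/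
theorem diff_c_one (H : StabData mu φ P Q φ' P' Q') (j : Fin (m + 1)) :
    δ (.c (Fin.succ 0) j.succ) = κ (hatCord mu U m 0 j) - u j := by
  simp only [twistedDiff, Matrix.sub_apply, Matrix.mul_apply, Fin.sum_univ_succ (n := m + 1), map_sub,
    H.P_one_zero, H.P_one_succ, hatCord_succ, checkCord_zero_succ, zero_mul,
    Finset.sum_const_zero, add_zero, smul_mul_smul_comm, Units.inv_mul, one_mul, one_smul]

theorem diff_c_zero (H : StabData mu φ P Q φ' P' Q') (j : Fin (m + 1)) :
    δ (.c 0 j.succ) = ((mu : 𝓡) * U) • u j + (mu : 𝓡) • (Pv 0 * u j) +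
      ∑ k, κ (P 0 k) * κ (checkCord mu V m k j) := by
  simp only [twistedDiff, Matrix.sub_apply, Matrix.mul_apply, Fin.sum_univ_succ (n := m + 1), map_sub,
    map_add, map_mul, map_sum, map_neg, map_smul, H.P_zero_zero, H.P_zero_succ, hatCord_zero_succ,
    checkCord_zero_succ, checkCord_succ, neg_mul, Finset.sum_neg_distrib, mul_smul_comm, smul_neg]
  simp only [leftIncl, AlgHom.comp_apply]
  abel

theorem diff_d (H : StabData mu φ P Q φ' P' Q') (i : Fin (m + 1)) {j : Fin (m + 1)} (hj : j ≠ 0) :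
    δ (.d i.succ j.succ) =
      κ (checkCord mu V m i j) - ∑ k, κ (hatCord mu U m i k) * κ (Q k j) := by
  simp only [twistedDiff, Matrix.sub_apply, Matrix.mul_apply, Fin.sum_univ_succ (n := m + 1), map_sub,
    map_mul, map_sum, H.Q_zero_succ j hj, H.Q_succ_succ _ j hj, hatCord_succ,
    checkCord_succ, mul_zero, zero_add]
  rfl

/-- The mirror image of `diff_c_one`: the variables that end at the new strand occur linearly with
the unit coefficient `-μ`. -/
theorem diff_d_one (H : StabData mu φ P Q φ' P' Q') (i : Fin (m + 1)) :
    δ (.d i.succ (Fin.succ 0)) = κ (checkCord mu V m i 0) - (mu : 𝓡) • v i := by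
  simp only [twistedDiff, Matrix.sub_apply, Matrix.mul_apply, Fin.sum_univ_succ (n := m + 1), map_sub,
    H.Q_zero_one, H.Q_succ_one, checkCord_succ, hatCord_succ_zero, mul_zero,
    Finset.sum_const_zero, add_zero, mul_smul_comm, mul_one, map_smul]

theorem diff_d_zero (H : StabData mu φ P Q φ' P' Q') (i : Fin (m + 1)) :
    δ (.d i.succ 0) = V • v i + v i * uQ 0 + ∑ k, κ (hatCord mu U m i k) * κ (Q k 0) := by
  simp only [twistedDiff, Matrix.sub_apply, Matrix.mul_apply, Fin.sum_univ_succ (n := m + 1), map_sub,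
    map_add, map_mul, map_sum, map_neg, map_smul, H.Q_zero_zero, H.Q_succ_zero, hatCord_succ_zero,
    checkCord_succ_zero, hatCord_succ, mul_neg, Finset.sum_neg_distrib]
  simp only [leftIncl, AlgHom.comp_apply]
  abel

theorem diff_e (H : StabData mu φ P Q φ' P' Q') {i : Fin (m + 1)} (hi : i ≠ 0) (j : Fin (m + 2)) :
    δ (.e i.succ j) = hatB mu U (m + 1) i.succ j - ⟪.c i.succ j⟫ - ∑ k, κ (P i k) * ⟪.d k.succ j⟫ := by
  simp only [twistedDiff, Matrix.sub_apply, Matrix.mul_apply, Fin.sum_univ_succ (n := m + 1),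
    Matrix.map_apply, H.P_succ_zero i hi, H.P_succ_succ i _ hi, map_zero, zero_mul, zero_add]
  rfl

theorem diff_e_one (H : StabData mu φ P Q φ' P' Q') (j : Fin (m + 2)) :
    δ (.e (Fin.succ 0) j) = hatB mu U (m + 1) (Fin.succ 0) j - ⟪.c (Fin.succ 0) j⟫ - ν • ⟪.d 0 j⟫ := by
  simp only [twistedDiff, Matrix.sub_apply, Matrix.mul_apply, Fin.sum_univ_succ (n := m + 1),
    Matrix.map_apply, H.P_one_zero, H.P_one_succ, map_zero, zero_mul, Finset.sum_const_zero,
    add_zero, map_smul, map_one, smul_mul_assoc, one_mul]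
  rfl

theorem diff_e_zero (H : StabData mu φ P Q φ' P' Q') (j : Fin (m + 2)) :
    δ (.e 0 j) = hatB mu U (m + 1) 0 j - ⟪.c 0 j⟫ + Pv 0 * ⟪.d 0 j⟫ +
      ∑ k, κ (P 0 k) * ⟪.d k.succ j⟫ := by
  simp only [twistedDiff, Matrix.sub_apply, Matrix.mul_apply, Fin.sum_univ_succ (n := m + 1),
    Matrix.map_apply, H.P_zero_zero, H.P_zero_succ, map_neg, neg_mul, Finset.sum_neg_distrib]
  rw [← neg_add, sub_neg_eq_add, ← add_assoc]
  rfl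

theorem diff_f (H : StabData mu φ P Q φ' P' Q') (i : Fin (m + 2)) {j : Fin (m + 1)} (hj : j ≠ 0) :
    δ (.f i j.succ) = checkB mu V (m + 1) i j.succ - ⟪.d i j.succ⟫ - ∑ k, ⟪.c i k.succ⟫ * κ (Q k j) := by
  simp only [twistedDiff, Matrix.sub_apply, Matrix.mul_apply, Fin.sum_univ_succ (n := m + 1),
    Matrix.map_apply, H.Q_zero_succ j hj, H.Q_succ_succ _ j hj, map_zero, mul_zero, zero_add]
  rfl

theorem diff_f_one (H : StabData mu φ P Q φ' P' Q') (i : Fin (m + 2)) :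
    δ (.f i (Fin.succ 0)) =
      checkB mu V (m + 1) i (Fin.succ 0) - ⟪.d i (Fin.succ 0)⟫ - (mu : 𝓡) • ⟪.c i 0⟫ := by
  simp only [twistedDiff, Matrix.sub_apply, Matrix.mul_apply, Fin.sum_univ_succ (n := m + 1),
    Matrix.map_apply, H.Q_zero_one, H.Q_succ_one, map_zero, mul_zero, Finset.sum_const_zero,
    add_zero, map_smul, map_one, mul_smul_comm, mul_one]
  rfl

theorem diff_f_zero (H : StabData mu φ P Q φ' P' Q') (i : Fin (m + 2)) :
    δ (.f i 0) = checkB mu V (m + 1) i 0 - ⟪.d i 0⟫ + ⟪.c i 0⟫ * uQ 0 +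
      ∑ k, ⟪.c i k.succ⟫ * κ (Q k 0) := by
  simp only [twistedDiff, Matrix.sub_apply, Matrix.mul_apply, Fin.sum_univ_succ (n := m + 1),
    Matrix.map_apply, H.Q_zero_zero, H.Q_succ_zero, map_neg, mul_neg, Finset.sum_neg_distrib]
  rw [← neg_add, sub_neg_eq_add, ← add_assoc]
  rfl

end StabData

end StabCalculus

end

end TransverseHomology
namespace TransverseHomology

noncomputable section

/-! ### The chain map from the DGA of a braid to that of its left stabilization. -/

section StabImage

/-- A chain with differential `-1 - μU - μ∑_k P_{1k} a_{k0}` in the stabilization. -/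
def stabW (𝓡 : Type) [CommRing 𝓡] (m : ℕ) : TAlg 𝓡 (m + 1) :=
  FreeAlgebra.ι 𝓡 (.c (Fin.succ 0) (Fin.succ 0)) + bMatrix 𝓡 (m + 1) 0 (Fin.succ 0)

/-- A chain with differential `-V - μ - ∑_k a_{0k} Q_{k1}` in the stabilization. -/
def stabW' {𝓡 : Type} [CommRing 𝓡] (mu : 𝓡ˣ) (m : ℕ) : TAlg 𝓡 (m + 1) :=
  FreeAlgebra.ι 𝓡 (.d (Fin.succ 0) (Fin.succ 0)) + (mu : 𝓡) • bMatrix 𝓡 (m + 1) (Fin.succ 0) 0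

variable {𝓡 : Type} [CommRing 𝓡] {m : ℕ} (mu : 𝓡ˣ) (U V : 𝓡)
  (P Q : Matrix (Fin (m + 1)) (Fin (m + 1)) (CordAlg 𝓡 (Fin (m + 1))))

local notation "κ" => leftIncl 𝓡 m
local notation "ct" => cordToT 𝓡 (m + 1)
local notation "𝐁" => bMatrix 𝓡 (m + 1)
local notation "o" => (Fin.succ 0 : Fin (m + 2))
local notation "u" => fun j : Fin (m + 1) => ct (av 𝓡 0 (Fin.succ j))
local notation "v" => fun i : Fin (m + 1) => ct (av 𝓡 (Fin.succ i) 0)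
local notation "Pv" => fun i : Fin (m + 1) => ct (leftPath P i)
local notation "uQ" => fun j : Fin (m + 1) => ct (rightPath Q j)
local notation "ν" => ((mu⁻¹ : 𝓡ˣ) : 𝓡)
local notation "⟪" x "⟫" => (FreeAlgebra.ι 𝓡 (x : TGen (Fin (m + 2))) : TAlg 𝓡 (m + 1))

/-- The correction term in the images of the generators `e_i1`. -/
def stabXi : TAlg 𝓡 (m + 1) :=
  ⟪.f o 0⟫ + ν • (⟪.d o o⟫ * stabW' mu m) + ν • (⟪.f o o⟫ * uQ 0)

/-- The correction term in the images of the generators `f_1j`. -/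
def stabXi' : TAlg 𝓡 (m + 1) :=
  ⟪.e 0 o⟫ - stabW 𝓡 m * ⟪.c o o⟫ + (mu : 𝓡) • (Pv 0 * ⟪.e o o⟫)

/-- The images of the entries of the matrix `𝐁`. -/
def stabB (i j : Fin (m + 1)) : TAlg 𝓡 (m + 1) :=
  if i = 0 then
    if j = 0 then 0 else
      -(𝐁 0 j.succ + (mu : 𝓡) • (Pv 0 * 𝐁 o j.succ) + stabW 𝓡 m * κ (av 𝓡 0 j) + ⟪.c o j.succ⟫)
  else if j = 0 then
    -(𝐁 i.succ 0 + ν • (𝐁 i.succ o * uQ 0) + ν • (κ (av 𝓡 i 0) * stabW' mu m) + ν • ⟪.d i.succ o⟫)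
  else 𝐁 i.succ j.succ

/-- The images of the generators of the DGA of a braid in the DGA of its stabilization. -/
def stabOld : TGen (Fin (m + 1)) → TAlg 𝓡 (m + 1)
  | .a i j _ => κ (av 𝓡 i j)
  | .b i j _ => stabB mu P Q i j
  | .c i j =>
    if i = 0 then
      if j = 0 then stabW 𝓡 m - ∑ k, κ (P 0 k) * ⟪.d k.succ o⟫
      else ⟪.c o j.succ⟫ - ⟪.c 0 j.succ⟫ - stabW 𝓡 m * u j
    else ⟪.c i.succ j.succ⟫
  | .d i j =>
    if j = 0 then
      if i = 0 then stabW' mu m - ∑ k, ⟪.c o k.succ⟫ * κ (Q k 0)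
      else ⟪.d i.succ o⟫ - ⟪.d i.succ 0⟫ - v i * stabW' mu m
    else ⟪.d i.succ j.succ⟫
  | .e i j =>
    if i = 0 then
      if j = 0 then
        ⟪.e 0 0⟫ + ⟪.e o o⟫ - ν • ⟪.f 0 o⟫ + Pv 0 * ((mu : 𝓡) • ⟪.e o 0⟫ - ⟪.f o o⟫) +
          κ (P 0 0) * stabXi mu Q
      else -⟪.e 0 j.succ⟫ + stabW 𝓡 m * ⟪.c o j.succ⟫ - (mu : 𝓡) • (Pv 0 * ⟪.e o j.succ⟫)
    else if j = 0 then
      ⟪.e i.succ o⟫ - ⟪.e i.succ 0⟫ + ν • ⟪.f i.succ o⟫ - ν • (𝐁 i.succ o * stabW' mu m) +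
        κ (P i 0) * stabXi mu Q
    else ⟪.e i.succ j.succ⟫
  | .f i j =>
    if j = 0 then
      if i = 0 then
        ⟪.f 0 0⟫ + ⟪.f o o⟫ - (mu : 𝓡) • ⟪.e o 0⟫ + (ν • ⟪.f 0 o⟫ - ⟪.e o o⟫) * uQ 0 +
          stabXi' mu P * κ (Q 0 0)
      else -⟪.f i.succ 0⟫ - ν • (⟪.d i.succ o⟫ * stabW' mu m) - ν • (⟪.f i.succ o⟫ * uQ 0)
    else if i = 0 then
      ⟪.f o j.succ⟫ - ⟪.f 0 j.succ⟫ + (mu : 𝓡) • ⟪.e o j.succ⟫ + (mu : 𝓡) • (stabW 𝓡 m * 𝐁 o j.succ) +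
        stabXi' mu P * κ (Q 0 j)
    else ⟪.f i.succ j.succ⟫

variable {mu U V P Q}
  {φ : CordAlg 𝓡 (Fin (m + 1)) →ₐ[𝓡] CordAlg 𝓡 (Fin (m + 1))}
  {φ' : CordAlg 𝓡 (Fin (m + 2)) →ₐ[𝓡] CordAlg 𝓡 (Fin (m + 2))}
  {P' Q' : Matrix (Fin (m + 2)) (Fin (m + 2)) (CordAlg 𝓡 (Fin (m + 2)))}

local notation "∂" => PreDGA.d (twistedDGA mu U V φ' P' Q')
local notation "𝓕" => FreeAlgebra.lift 𝓡 (stabOld mu P Q)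

theorem d_gen (x : TGen (Fin (m + 2))) : ∂ ⟪x⟫ = twistedDiff mu U V φ' P' Q' x :=
  PreDGA.d_var (twistedDGA mu U V φ' P' Q') x

theorem d_mul_leftIncl (w : TAlg 𝓡 (m + 1)) (x : CordAlg 𝓡 (Fin (m + 1))) :
    ∂ (w * κ x) = ∂ w * κ x := d_mul_cordToT ..

theorem d_leftIncl_mul (x : CordAlg 𝓡 (Fin (m + 1))) (w : TAlg 𝓡 (m + 1)) :
    ∂ (κ x * w) = κ x * ∂ w := d_cordToT_mul ..

theorem stabOld_cordToT (x : CordAlg 𝓡 (Fin (m + 1))) : 𝓕 (cordToT 𝓡 m x) = κ x := by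
  have : (𝓕).comp (cordToT 𝓡 m) = κ := by
    apply cordAlg_hom_ext
    intro i j h
    rw [AlgHom.comp_apply, cordToT_av h, FreeAlgebra.lift_ι_apply]
    rfl
  exact DFunLike.congr_fun this x

theorem stabOld_bMatrix (i j : Fin (m + 1)) : 𝓕 (bMatrix 𝓡 m i j) = stabB mu P Q i j := by
  by_cases h : i = j
  · subst h
    rw [bMatrix_self, map_zero, stabB]
    split_ifs
    · rfl
    · rw [bMatrix_self]
  · rw [bMatrix_apply h, FreeAlgebra.lift_ι_apply]; rfl

theorem stabOld_triMatrix (x y : 𝓡) (i j : Fin (m + 1)) :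
    𝓕 (triMatrix x 0 y (bMatrix 𝓡 m) i j) =
      triMatrix x 0 y (Matrix.of (stabB mu P Q)) i j := by
  simp only [triMatrix, Matrix.of_apply]
  split_ifs
  · rw [map_smul, stabOld_bMatrix]
  · simp
  · rw [map_smul, stabOld_bMatrix]

theorem triMatrix_stabB (x y : 𝓡) {i j : Fin (m + 1)} (hi : i ≠ 0) (hj : j ≠ 0) :
    triMatrix x 0 y (Matrix.of (stabB mu P Q)) i j = triMatrix x 0 y 𝐁 i.succ j.succ := by
  simp only [triMatrix, Matrix.of_apply, stabB, hi, hj, if_false, Fin.succ_lt_succ_iff, Fin.succ_inj]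

theorem triMatrix_stabB_zero (x y : 𝓡) {j : Fin (m + 1)} (hj : j ≠ 0) :
    triMatrix x 0 y (Matrix.of (stabB mu P Q)) 0 j = y • stabB mu P Q 0 j :=
  triMatrix_of_gt _ _ _ _ (Fin.pos_of_ne_zero hj)

theorem triMatrix_stabB_to_zero (x y : 𝓡) {i : Fin (m + 1)} (hi : i ≠ 0) :
    triMatrix x 0 y (Matrix.of (stabB mu P Q)) i 0 = x • stabB mu P Q i 0 :=
  triMatrix_of_lt _ _ _ _ (Fin.pos_of_ne_zero hi)

theorem triMatrix_zero_self {A : Type} [Ring A] [Algebra 𝓡 A] {n : ℕ} (x y : 𝓡)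
    (M : Matrix (Fin (n + 1)) (Fin (n + 1)) A) (i : Fin (n + 1)) : triMatrix x 0 y M i i = 0 := by
  rw [triMatrix_self, zero_smul]

theorem triMatrix_b_one (x y : 𝓡) {j : Fin (m + 1)} (hj : j ≠ 0) :
    triMatrix x 0 y 𝐁 o j.succ = y • 𝐁 o j.succ :=
  triMatrix_of_gt _ _ _ _ (Fin.succ_lt_succ_iff.2 (Fin.pos_of_ne_zero hj))

theorem triMatrix_b_to_one (x y : 𝓡) {i : Fin (m + 1)} (hi : i ≠ 0) :
    triMatrix x 0 y 𝐁 i.succ o = x • 𝐁 i.succ o :=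
  triMatrix_of_lt _ _ _ _ (Fin.succ_lt_succ_iff.2 (Fin.pos_of_ne_zero hi))

theorem triMatrix_b_zero (x y : 𝓡) (j : Fin (m + 1)) :
    triMatrix x 0 y 𝐁 0 j.succ = y • 𝐁 0 j.succ :=
  triMatrix_of_gt _ _ _ _ (Fin.succ_pos j)

theorem triMatrix_b_to_zero (x y : 𝓡) (i : Fin (m + 1)) :
    triMatrix x 0 y 𝐁 i.succ 0 = x • 𝐁 i.succ 0 :=
  triMatrix_of_lt _ _ _ _ (Fin.succ_pos i)

theorem leftIncl_hatCord_zero (j : Fin (m + 1)) (hj : j ≠ 0) :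
    κ (hatCord mu U m 0 j) = ((mu : 𝓡) * U) • κ (av 𝓡 0 j) := by
  rw [hatCord, triMatrix_of_gt _ _ _ _ (Fin.pos_of_ne_zero hj), map_smul]; rfl

theorem leftIncl_hatCord_zero_zero : κ (hatCord mu U m 0 0) = (-1 - (mu : 𝓡) * U) • 1 := by
  rw [hatCord, triMatrix_self, map_smul, map_one]

theorem leftIncl_checkCord_to_zero (i : Fin (m + 1)) (hi : i ≠ 0) :
    κ (checkCord mu V m i 0) = V • κ (av 𝓡 i 0) := by
  rw [checkCord, triMatrix_of_lt _ _ _ _ (Fin.pos_of_ne_zero hi), map_smul]; rfl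

theorem leftIncl_checkCord_zero_zero : κ (checkCord mu V m 0 0) = (-V - (mu : 𝓡)) • 1 := by
  rw [checkCord, triMatrix_self, map_smul, map_one]

namespace StabData

theorem d_bMatrix_gen {i j : Fin (m + 2)} (h : i ≠ j) :
    ∂ (𝐁 i j) = twistedDiff mu U V φ' P' Q' (.b i j h) := by
  rw [bMatrix_apply h]
  exact d_gen _


theorem d_b_one (H : StabData mu φ P Q φ' P' Q') {j : Fin (m + 1)} (hj : j ≠ 0) : ∂ (𝐁 o j.succ) = κ (av 𝓡 0 j) - ν • uQ j :=
  (d_bMatrix_gen ((Fin.succ_injective _).ne hj.symm)).trans (H.diff_b_one hj _)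

theorem d_b_to_one (H : StabData mu φ P Q φ' P' Q') {i : Fin (m + 1)} (hi : i ≠ 0) :
    ∂ (𝐁 i.succ o) = κ (av 𝓡 i 0) - (mu : 𝓡) • Pv i :=
  (d_bMatrix_gen ((Fin.succ_injective _).ne hi)).trans (H.diff_b_to_one hi _)

theorem d_b_zero (H : StabData mu φ P Q φ' P' Q') {j : Fin (m + 1)} (hj : j ≠ 0) :
    ∂ (𝐁 0 j.succ) = u j + κ (φ (av 𝓡 0 j)) + Pv 0 * uQ j :=
  (d_bMatrix_gen (Fin.succ_ne_zero _).symm).trans (H.diff_b_zero hj _)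

theorem d_b_to_zero (H : StabData mu φ P Q φ' P' Q') {i : Fin (m + 1)} (hi : i ≠ 0) :
    ∂ (𝐁 i.succ 0) = v i + κ (φ (av 𝓡 i 0)) + Pv i * uQ 0 :=
  (d_bMatrix_gen (Fin.succ_ne_zero _)).trans (H.diff_b_to_zero hi _)

theorem d_b_zero_one (H : StabData mu φ P Q φ' P' Q') : ∂ (𝐁 0 o) = u 0 - (mu : 𝓡) • Pv 0 :=
  (d_bMatrix_gen (Fin.succ_ne_zero _).symm).trans (H.diff_b_zero_one _)

theorem d_b_one_zero (H : StabData mu φ P Q φ' P' Q') : ∂ (𝐁 o 0) = v 0 - ν • uQ 0 :=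
  (d_bMatrix_gen (Fin.succ_ne_zero _)).trans (H.diff_b_one_zero _)

/-- Adding the generator `b_01` to `c_11` exchanges the new variable `a_01` in the boundary for a
multiple of the path from the first row of `P`. Multiplying by this chain absorbs unwanted terms in
the images below. -/
theorem d_stabW (H : StabData mu φ P Q φ' P' Q') : ∂ (stabW 𝓡 m) = (-1 - (mu : 𝓡) * U) • 1 - (mu : 𝓡) • Pv 0 := by
  rw [stabW, map_add, d_gen, H.diff_c_one, H.d_b_zero_one, leftIncl_hatCord_zero_zero]
  abel

theorem d_stabW' (H : StabData mu φ P Q φ' P' Q') : ∂ (stabW' mu m) = (-V - (mu : 𝓡)) • 1 - uQ 0 := by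
  rw [stabW', map_add, map_smul, d_gen, H.diff_d_one, H.d_b_one_zero, leftIncl_checkCord_zero_zero,
    smul_sub, smul_smul, Units.mul_inv, one_smul]
  abel

theorem d_sum_left (H : StabData mu φ P Q φ' P' Q') (i : Fin (m + 1)) : ∂ (∑ k, κ (P i k) * ⟪.d k.succ o⟫) =
    ∑ k, κ (P i k) * κ (checkCord mu V m k 0) - (mu : 𝓡) • Pv i := by
  simp only [map_sum, d_leftIncl_mul, d_gen, H.diff_d_one, mul_sub, Finset.sum_sub_distrib,
    mul_smul_comm, ← Finset.smul_sum, ← cordToT_leftPath]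

theorem d_sum_right (H : StabData mu φ P Q φ' P' Q') (j : Fin (m + 1)) : ∂ (∑ k, ⟪.c o k.succ⟫ * κ (Q k j)) =
    ∑ k, κ (hatCord mu U m 0 k) * κ (Q k j) - uQ j := by
  simp only [map_sum, d_mul_leftIncl, d_gen, H.diff_c_one, sub_mul, Finset.sum_sub_distrib,
    ← cordToT_rightPath]

theorem d_stabW_mul (x : TAlg 𝓡 (m + 1)) :
    ∂ (stabW 𝓡 m * x) = ∂ (stabW 𝓡 m) * x - stabW 𝓡 m * ∂ x :=
  PreDGA.d_mul_of_one (twistedDGA mu U V φ' P' Q') (add_mem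
    (PreDGA.var_mem_homogeneous (twistedDGA mu U V φ' P' Q') (TGen.c o o))
    (bMatrix_mem mu U V φ' P' Q' 0 o))

theorem d_d_mul (i j : Fin (m + 2)) (x : TAlg 𝓡 (m + 1)) :
    ∂ (⟪.d i j⟫ * x) = ∂ ⟪.d i j⟫ * x - ⟪.d i j⟫ * ∂ x :=
  PreDGA.d_mul_of_one (twistedDGA mu U V φ' P' Q')
    (PreDGA.var_mem_homogeneous (twistedDGA mu U V φ' P' Q') (.d i j))

theorem d_b_mul (i j : Fin (m + 2)) (x : TAlg 𝓡 (m + 1)) :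
    ∂ (𝐁 i j * x) = ∂ (𝐁 i j) * x - 𝐁 i j * ∂ x :=
  PreDGA.d_mul_of_one (twistedDGA mu U V φ' P' Q') (bMatrix_mem mu U V φ' P' Q' _ _)

/-- The chain is built to have exactly this boundary: it is the difference between the regular
expression for the images of the `d_k0`, evaluated at `k = 0`, and the actual image of `d_00`. -/
theorem d_stabXi (H : StabData mu φ P Q φ' P' Q') : ∂ (stabXi mu Q) =
    ∑ k, ⟪.c o k.succ⟫ * κ (Q k 0) - ⟪.d o 0⟫ - (mu : 𝓡) • 𝐁 o 0 - v 0 * stabW' mu m := by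
  have hν : ν * mu = 1 := Units.inv_mul mu
  simp only [stabXi, map_add, map_smul, d_d_mul, d_mul_cordToT, d_gen, H.diff_f_zero, H.diff_f_one,
    H.diff_d_one, H.d_stabW', checkB, triMatrix_b_to_zero, triMatrix_zero_self,
    leftIncl_checkCord_zero_zero]
  simp only [stabW', mul_add, mul_sub, sub_mul, smul_add, smul_sub, smul_mul_assoc,
    mul_smul_comm, mul_one, one_mul, zero_mul, smul_zero]
  -- The noncommutative monomials are compared one by one; what remains are identities between their
  -- coefficients in `𝓡`, where `ν` is the inverse of `μ`.
  match_scalars <;> grind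

theorem d_stabXi' (H : StabData mu φ P Q φ' P' Q') : ∂ (stabXi' mu P) =
    ∑ k, κ (P 0 k) * ⟪.d k.succ o⟫ - ⟪.c 0 o⟫ - 𝐁 0 o - stabW 𝓡 m * u 0 := by
  have hν : ν * mu = 1 := Units.inv_mul mu
  simp only [stabXi', map_add, map_sub, map_smul, d_stabW_mul, d_cordToT_mul, d_gen, H.diff_e_zero,
    H.diff_e_one, H.diff_c_one, H.d_stabW, hatB, triMatrix_b_zero, triMatrix_zero_self,
    leftIncl_hatCord_zero_zero]
  simp only [stabW, add_mul, mul_sub, sub_mul, smul_add, smul_sub, smul_mul_assoc,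
    mul_smul_comm, mul_one, one_mul, mul_zero, smul_zero]
  match_scalars <;> grind

/-- The exceptional image of `d_00` agrees with the regular formula up to a boundary. The product
`P𝐃` therefore produces a term `P_i0 ∂Ξ`, and this is the reason for the summand `P_i0 Ξ` in the
images of the generators `e_i0`. -/
theorem stabOld_d_zero (H : StabData mu φ P Q φ' P' Q') (k : Fin (m + 1)) :
    stabOld mu P Q (.d k 0) = ⟪.d k.succ o⟫ - ⟪.d k.succ 0⟫ - v k * stabW' mu m -
      if k = 0 then ∂ (stabXi mu Q) else 0 := by
  by_cases hk : k = 0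
  · subst hk
    simp only [stabOld, if_true, H.d_stabXi]
    simp only [stabW', mul_add]
    abel
  · simp only [stabOld, hk, if_true, if_false, sub_zero]

theorem stabOld_c_zero (H : StabData mu φ P Q φ' P' Q') (k : Fin (m + 1)) :
    stabOld mu P Q (.c 0 k) = ⟪.c o k.succ⟫ - ⟪.c 0 k.succ⟫ - stabW 𝓡 m * u k -
      if k = 0 then ∂ (stabXi' mu P) else 0 := by
  by_cases hk : k = 0
  · subst hk
    simp only [stabOld, if_true, H.d_stabXi']
    simp only [stabW, add_mul]
    abel
  · simp only [stabOld, hk, if_true, if_false, sub_zero]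

theorem sum_stabOld_d_zero (H : StabData mu φ P Q φ' P' Q') (i : Fin (m + 1)) :
    ∑ k, κ (P i k) * stabOld mu P Q (.d k 0) = ∑ k, κ (P i k) * ⟪.d k.succ o⟫ -
      ∑ k, κ (P i k) * ⟪.d k.succ 0⟫ - Pv i * stabW' mu m - κ (P i 0) * ∂ (stabXi mu Q) := by
  simp only [H.stabOld_d_zero (U := U) (V := V), mul_sub, Finset.sum_sub_distrib, ← mul_assoc, ← Finset.sum_mul,
    ← cordToT_leftPath, mul_ite, mul_zero, Finset.sum_ite_eq', Finset.mem_univ, if_true]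

theorem sum_stabOld_c_zero (H : StabData mu φ P Q φ' P' Q') (j : Fin (m + 1)) :
    ∑ k, stabOld mu P Q (.c 0 k) * κ (Q k j) = ∑ k, ⟪.c o k.succ⟫ * κ (Q k j) -
      ∑ k, ⟪.c 0 k.succ⟫ * κ (Q k j) - stabW 𝓡 m * uQ j - ∂ (stabXi' mu P) * κ (Q 0 j) := by
  simp only [H.stabOld_c_zero (U := U) (V := V), sub_mul, Finset.sum_sub_distrib, mul_assoc, ← Finset.mul_sum,
    ← cordToT_rightPath, ite_mul, zero_mul, Finset.sum_ite_eq', Finset.mem_univ, if_true]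

/-- Stabilization sends `a_0j` to `-φ(a_0j)` minus a product of two paths, which explains the sign
in front of `b_0,j+1` in the image of `b_0j`. Of the remaining terms there, `c_1,j+1` removes the
new variable, `b_1,j+1` removes the product of paths, and `stabW` together with these supplies
`a_0j`. Column `0` is treated in the mirrored way. -/
theorem d_stabOld_b (H : StabData mu φ P Q φ' P' Q') (i j : Fin (m + 1)) (h : i ≠ j) :
    ∂ (stabOld mu P Q (.b i j h)) = κ (av 𝓡 i j) - κ (φ (av 𝓡 i j)) := by
  have hν : ν * mu = 1 := Units.inv_mul mu
  rw [← map_sub]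
  by_cases hi : i = 0
  · subst hi
    simp only [stabOld, stabB, if_true, h.symm, if_false, map_neg, map_add, map_smul,
      d_cordToT_mul, d_stabW_mul, d_gen, H.d_b_zero h.symm, H.d_b_one h.symm, H.d_stabW,
      H.diff_c_one, leftIncl_hatCord_zero j h.symm, map_sub]
    simp only [leftIncl, AlgHom.comp_apply, d_cordToT, mul_zero, mul_sub, sub_mul, smul_mul_assoc, mul_smul_comm, one_mul]
    match_scalars <;> grind
  · by_cases hj : j = 0
    · subst hj
      simp only [stabOld, stabB, if_true, hi, if_false, map_neg, map_add, map_smul,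
        d_mul_cordToT, d_leftIncl_mul, d_gen, H.d_b_to_zero hi, H.d_b_to_one hi, H.d_stabW',
        H.diff_d_one, leftIncl_checkCord_to_zero i hi, map_sub]
      simp only [mul_sub, sub_mul, smul_mul_assoc, mul_smul_comm, mul_one]
      match_scalars <;> grind
    · simp only [stabOld, stabB, hi, hj, if_false]
      rw [d_bMatrix_gen ((Fin.succ_injective _).ne h), H.diff_b hi hj]

/-- In row `0`, the difference `c_1 - c_0` has the right boundary up to multiples of the new
variable; subtracting `stabW` times that variable removes all of them at once. -/
theorem d_stabOld_c (H : StabData mu φ P Q φ' P' Q') (i j : Fin (m + 1)) :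
    ∂ (stabOld mu P Q (.c i j)) =
      κ (hatCord mu U m i j) - ∑ k, κ (P i k) * κ (checkCord mu V m k j) := by
  by_cases hi : i = 0
  · subst hi
    by_cases hj : j = 0
    · subst hj
      simp only [stabOld, if_true, map_sub, H.d_stabW, H.d_sum_left, leftIncl_hatCord_zero_zero]
      abel
    · simp only [stabOld, if_true, hj, if_false, map_sub, d_stabW_mul, d_cordToT, d_gen, H.d_stabW,
        H.diff_c_one, H.diff_c_zero, sub_mul, smul_mul_assoc, one_mul, mul_zero]
      match_scalars <;> grind
  · simp only [stabOld, hi, if_false, d_gen, H.diff_c hi]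

theorem d_stabOld_d (H : StabData mu φ P Q φ' P' Q') (i j : Fin (m + 1)) :
    ∂ (stabOld mu P Q (.d i j)) =
      κ (checkCord mu V m i j) - ∑ k, κ (hatCord mu U m i k) * κ (Q k j) := by
  by_cases hj : j = 0
  · subst hj
    by_cases hi : i = 0
    · subst hi
      simp only [stabOld, if_true, map_sub, H.d_stabW', H.d_sum_right, leftIncl_checkCord_zero_zero]
      abel
    · simp only [stabOld, if_true, hi, if_false, map_sub, d_cordToT_mul, d_gen, H.d_stabW',
        H.diff_d_one, H.diff_d_zero, mul_sub, mul_smul_comm, mul_one]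
      match_scalars <;> grind
  · simp only [stabOld, hj, if_false, d_gen, H.diff_d i hj]

theorem d_stabOld_e (H : StabData mu φ P Q φ' P' Q') (i j : Fin (m + 1)) :
    ∂ (stabOld mu P Q (.e i j)) = triMatrix 1 0 ((mu : 𝓡) * U) (Matrix.of (stabB mu P Q)) i j -
      stabOld mu P Q (.c i j) - ∑ k, κ (P i k) * stabOld mu P Q (.d k j) := by
  have hν : ν * mu = 1 := Units.inv_mul mu
  by_cases hj : j = 0
  · subst hj
    -- In column `0` the sum over `d_k0` is first brought to the regular form; the exact term left
    -- over is matched by the boundary of the summand with `stabXi`.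
    rw [H.sum_stabOld_d_zero (U := U) (V := V)]
    by_cases hi : i = 0
    · subst hi
      -- The corner needs the regular form of the image of `c_00` as well, so that both sides are
      -- expressed in the same generators.
      rw [H.stabOld_c_zero (U := U) (V := V), H.d_stabXi']
      simp only [stabOld, if_true, map_add, map_sub, map_smul, d_cordToT_mul, d_leftIncl_mul, d_gen,
        H.diff_e_zero, H.diff_e_one, H.diff_f_one, hatB, checkB, triMatrix_zero_self,
        triMatrix_b_zero, triMatrix_b_to_zero]
      simp only [stabW, stabW', mul_add, add_mul, mul_sub, smul_sub,
        mul_smul_comm, mul_zero]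
      match_scalars <;> grind
    · simp only [stabOld, if_true, hi, if_false, map_add, map_sub, map_smul, d_b_mul, d_leftIncl_mul,
        d_gen, H.diff_e hi, H.diff_f_one, H.d_stabW', H.d_b_to_one hi, hatB, checkB,
        triMatrix_stabB_to_zero _ _ hi, stabB, triMatrix_b_to_one _ _ hi, triMatrix_b_to_zero]
      simp only [mul_sub, sub_mul, smul_sub,
        smul_mul_assoc, mul_smul_comm, mul_one]
      match_scalars <;> grind
  · by_cases hi : i = 0
    · subst hi
      simp only [stabOld, if_true, hj, if_false, map_add, map_sub, map_neg, map_smul, d_cordToT_mul,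
        d_stabW_mul, d_gen, H.diff_e_zero, H.diff_e_one, H.diff_c_one, H.d_stabW, hatB,
        triMatrix_stabB_zero _ _ hj, stabB, triMatrix_b_one _ _ hj, triMatrix_b_zero,
        leftIncl_hatCord_zero j hj]
      simp only [mul_sub, sub_mul, smul_add, smul_sub, smul_neg,
        smul_mul_assoc, mul_smul_comm, one_mul]
      match_scalars <;> grind
    · simp only [stabOld, hi, hj, if_false, d_gen, H.diff_e hi, triMatrix_stabB _ _ hi hj]
      rfl

theorem d_stabOld_f (H : StabData mu φ P Q φ' P' Q') (i j : Fin (m + 1)) :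
    ∂ (stabOld mu P Q (.f i j)) = triMatrix V 0 (mu : 𝓡) (Matrix.of (stabB mu P Q)) i j -
      stabOld mu P Q (.d i j) - ∑ k, stabOld mu P Q (.c i k) * κ (Q k j) := by
  have hν : ν * mu = 1 := Units.inv_mul mu
  by_cases hi : i = 0
  · subst hi
    -- The mirrored situation: row `0` of `𝐂Q` is regularized, with the chain `stabXi'` in the role
    -- of `stabXi`.
    rw [H.sum_stabOld_c_zero (U := U) (V := V)]
    by_cases hj : j = 0
    · subst hj
      rw [H.stabOld_d_zero (U := U) (V := V), H.d_stabXi]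
      simp only [stabOld, if_true, map_add, map_sub, map_smul, d_mul_cordToT, d_mul_leftIncl, d_gen,
        H.diff_e_one, H.diff_f_zero, H.diff_f_one, hatB, checkB, triMatrix_zero_self,
        triMatrix_b_zero, triMatrix_b_to_zero]
      simp only [stabW, stabW', mul_add, add_mul, sub_mul, smul_sub,
        smul_mul_assoc, mul_smul_comm, zero_mul]
      match_scalars <;> grind
    · simp only [stabOld, if_true, hj, if_false, map_add, map_sub, map_smul, d_stabW_mul,
        d_mul_leftIncl, d_gen, H.diff_f _ hj, H.diff_e_one, H.d_stabW, H.d_b_one hj,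
        hatB, checkB, triMatrix_stabB_zero _ _ hj, stabB, triMatrix_b_one _ _ hj, triMatrix_b_zero]
      simp only [mul_sub, sub_mul, smul_add, smul_sub, smul_neg,
        smul_mul_assoc, mul_smul_comm, one_mul]
      match_scalars <;> grind
  · by_cases hj : j = 0
    · subst hj
      simp only [stabOld, if_true, hi, if_false, map_sub, map_neg, map_smul, d_mul_cordToT,
        d_d_mul, d_gen, H.diff_f_zero, H.diff_f_one, H.diff_d_one, H.d_stabW', checkB,
        triMatrix_stabB_to_zero _ _ hi, stabB, triMatrix_b_to_one _ _ hi, triMatrix_b_to_zero,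
        leftIncl_checkCord_to_zero i hi]
      simp only [mul_sub, sub_mul, smul_add, smul_sub, smul_neg,
        smul_mul_assoc, mul_smul_comm, mul_one]
      match_scalars <;> grind
    · simp only [stabOld, hi, hj, if_false, d_gen, H.diff_f _ hj, triMatrix_stabB _ _ hi hj]
      rfl

theorem d_stabOld (H : StabData mu φ P Q φ' P' Q') (x : TGen (Fin (m + 1))) :
    𝓕 (twistedDiff mu U V φ P Q x) = ∂ (stabOld mu P Q x) := by
  rcases x with ⟨i, j, h⟩ | ⟨i, j, h⟩ | ⟨i, j⟩ | ⟨i, j⟩ | ⟨i, j⟩ | ⟨i, j⟩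
  · exact (map_zero _).trans (d_cordToT ..).symm
  · simp only [twistedDiff, stabOld_cordToT, map_sub, H.d_stabOld_b]
  · simp only [twistedDiff, stabOld_cordToT, map_sub, map_sum, map_mul, Matrix.sub_apply,
      Matrix.mul_apply, H.d_stabOld_c]
  · simp only [twistedDiff, stabOld_cordToT, map_sub, map_sum, map_mul, Matrix.sub_apply,
      Matrix.mul_apply, H.d_stabOld_d]
  · simp only [twistedDiff, stabOld_cordToT, map_sub, map_sum, map_mul, Matrix.sub_apply,
      Matrix.mul_apply, Matrix.map_apply, hatB, cMatrix, dMatrix, Matrix.of_apply,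
      FreeAlgebra.lift_ι_apply, stabOld_triMatrix, H.d_stabOld_e]
  · simp only [twistedDiff, stabOld_cordToT, map_sub, map_sum, map_mul, Matrix.sub_apply,
      Matrix.mul_apply, Matrix.map_apply, checkB, cMatrix, dMatrix, Matrix.of_apply,
      FreeAlgebra.lift_ι_apply, stabOld_triMatrix, H.d_stabOld_f]

end StabData

end StabImage

end

end TransverseHomology
-- The cancelling pairs of the stabilization and the bijection of leading generators.
namespace TransverseHomology

noncomputable section

/-- The indices of the cancelling pairs of generators in the stabilization of a braid. -/
inductive StabGen (m : ℕ) : Type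
  | gam (j : Fin (m + 1))
  | del (i : Fin (m + 1))
  | ec (i : Fin (m + 1))
  | fr (j : Fin (m + 1))
  | eo (j : Fin (m + 2))
  | fo (i : Fin (m + 2))

namespace StabGen

variable {m : ℕ}

instance : Finite (StabGen m) := by
  let g : StabGen m → Fin 6 × Fin (m + 2) := fun x =>
    match x with
    | gam j => (0, j.castSucc)
    | del i => (1, i.castSucc)
    | ec i => (2, i.castSucc)
    | fr j => (3, j.castSucc)
    | eo j => (4, j)
    | fo i => (5, i)
  refine Finite.of_injective g ?_
  rintro (_ | _ | _ | _ | _ | _) (_ | _ | _ | _ | _ | _) <;> simp [g]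

/-- The degree of the lower generator of a cancelling pair. -/
def lowDeg : StabGen m → ℤ
  | gam _ | del _ => 0
  | _ => 1

/-- The inclusion of the indices that omits the second one. -/
def skip (i : Fin (m + 1)) : Fin (m + 2) := if i = 0 then 0 else i.succ

/-- The left inverse of both `Fin.succ` and `StabGen.skip`. -/
def unskip (i : Fin (m + 2)) : Fin (m + 1) := Fin.cases 0 id i

@[simp] theorem unskip_zero : unskip (0 : Fin (m + 2)) = 0 := rfl

@[simp] theorem unskip_succ (i : Fin (m + 1)) : unskip i.succ = i := rfl

theorem skip_zero : skip (0 : Fin (m + 1)) = 0 := if_pos rfl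

theorem skip_of_ne {i : Fin (m + 1)} (h : i ≠ 0) : skip i = i.succ := if_neg h

@[simp] theorem unskip_skip (i : Fin (m + 1)) : unskip (skip i) = i := by
  by_cases h : i = 0
  · subst h; rfl
  · rw [skip_of_ne h, unskip_succ]

theorem skip_ne_one (i : Fin (m + 1)) : skip i ≠ Fin.succ 0 := by
  by_cases h : i = 0
  · subst h; exact (Fin.succ_ne_zero _).symm
  · rw [skip_of_ne h]; exact (Fin.succ_injective _).ne h

@[simp] theorem skip_eq_one_iff (i : Fin (m + 1)) : skip i = 1 ↔ False :=
  iff_false_intro (skip_ne_one i)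

@[simp] theorem skip_eq_zero_iff {i : Fin (m + 1)} : skip i = 0 ↔ i = 0 := by
  by_cases h : i = 0
  · simp [h, skip_zero]
  · simp [skip_of_ne h, h]

theorem skip_unskip {i : Fin (m + 2)} (h : i ≠ Fin.succ 0) : skip (unskip i) = i := by
  induction i using Fin.cases with
  | zero => rfl
  | succ i => exact skip_of_ne fun h' => h (congrArg _ h')

theorem succ_unskip {i : Fin (m + 2)} (h : i ≠ 0) : (unskip i).succ = i := by
  induction i using Fin.cases with
  | zero => exact absurd rfl h
  | succ i => rfl

theorem skip_injective : Function.Injective (skip (m := m)) :=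
  Function.LeftInverse.injective unskip_skip

theorem unskip_ne {i j : Fin (m + 2)} (hi : i ≠ Fin.succ 0) (hj : j ≠ Fin.succ 0) (h : i ≠ j) :
    unskip i ≠ unskip j := fun h' => h (by rw [← skip_unskip hi, h', skip_unskip hj])

theorem unskip_ne' {i j : Fin (m + 2)} (hi : i ≠ 0) (hj : j ≠ 0) (h : i ≠ j) :
    unskip i ≠ unskip j := fun h' => h (by rw [← succ_unskip hi, h', succ_unskip hj])

/-- The leading generator of the image of a generator of the stabilized DGA. -/
def lead : TGen (Fin (m + 1)) ⊕ (StabGen m ⊕ StabGen m) → TGen (Fin (m + 2))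
  | .inl (.a i j h) => .a i.succ j.succ ((Fin.succ_injective _).ne h)
  | .inl (.b i j h) => .b (skip i) (skip j) (skip_injective.ne h)
  | .inl (.c i j) =>
    if i = 0 then if j = 0 then .b 0 (Fin.succ 0) (Fin.succ_ne_zero _).symm else .c 0 j.succ
    else .c i.succ j.succ
  | .inl (.d i j) =>
    if j = 0 then if i = 0 then .b (Fin.succ 0) 0 (Fin.succ_ne_zero _) else .d i.succ 0
    else .d i.succ j.succ
  | .inl (.e i j) => .e (skip i) (skip j)
  | .inl (.f i j) => .f (skip i) (skip j)
  | .inr (.inl (gam j)) => .c (Fin.succ 0) j.succ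
  | .inr (.inl (del i)) => .d i.succ (Fin.succ 0)
  | .inr (.inl (ec i)) => .e (skip i) (Fin.succ 0)
  | .inr (.inl (fr j)) => .f (Fin.succ 0) (skip j)
  | .inr (.inl (eo j)) => .e (Fin.succ 0) j
  | .inr (.inl (fo i)) => .f i (Fin.succ 0)
  | .inr (.inr (gam j)) => .a 0 j.succ (Fin.succ_ne_zero _).symm
  | .inr (.inr (del i)) => .a i.succ 0 (Fin.succ_ne_zero _)
  | .inr (.inr (ec i)) =>
    if h : i = 0 then .c 0 (Fin.succ 0) else .b i.succ (Fin.succ 0) ((Fin.succ_injective _).ne h)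
  | .inr (.inr (fr j)) =>
    if h : j = 0 then .d (Fin.succ 0) 0
    else .b (Fin.succ 0) j.succ ((Fin.succ_injective _).ne fun h' => h h'.symm)
  | .inr (.inr (eo j)) => .d 0 j
  | .inr (.inr (fo i)) => .c i 0

/-- The inverse of `StabGen.lead`. -/
def unlead : TGen (Fin (m + 2)) → TGen (Fin (m + 1)) ⊕ (StabGen m ⊕ StabGen m)
  | .a i j h =>
    if hi : i = 0 then .inr (.inr (gam (unskip j)))
    else if hj : j = 0 then .inr (.inr (del (unskip i)))
    else .inl (.a (unskip i) (unskip j) (unskip_ne' hi hj h))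
  | .b i j h =>
    if hi : i = Fin.succ 0 then if j = 0 then .inl (.d 0 0) else .inr (.inr (fr (unskip j)))
    else if hj : j = Fin.succ 0 then if i = 0 then .inl (.c 0 0) else .inr (.inr (ec (unskip i)))
    else .inl (.b (unskip i) (unskip j) (unskip_ne hi hj h))
  | .c i j =>
    if j = 0 then .inr (.inr (fo i))
    else if i = 0 then if j = Fin.succ 0 then .inr (.inr (ec 0)) else .inl (.c 0 (unskip j))
    else if i = Fin.succ 0 then .inr (.inl (gam (unskip j))) else .inl (.c (unskip i) (unskip j))
  | .d i j =>
    if i = 0 then .inr (.inr (eo j))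
    else if j = 0 then if i = Fin.succ 0 then .inr (.inr (fr 0)) else .inl (.d (unskip i) 0)
    else if j = Fin.succ 0 then .inr (.inl (del (unskip i))) else .inl (.d (unskip i) (unskip j))
  | .e i j =>
    if i = Fin.succ 0 then .inr (.inl (eo j))
    else if j = Fin.succ 0 then .inr (.inl (ec (unskip i))) else .inl (.e (unskip i) (unskip j))
  | .f i j =>
    if j = Fin.succ 0 then .inr (.inl (fo i))
    else if i = Fin.succ 0 then .inr (.inl (fr (unskip j))) else .inl (.f (unskip i) (unskip j))

theorem succ_eq_one_iff {i : Fin (m + 1)} : i.succ = 1 ↔ i = 0 :=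
  Fin.succ_inj (a := i) (b := 0)

theorem unlead_lead (x : TGen (Fin (m + 1)) ⊕ (StabGen m ⊕ StabGen m)) : unlead (lead x) = x := by
  have h01 : (0 : Fin (m + 2)) ≠ Fin.succ 0 := (Fin.succ_ne_zero _).symm
  have h10 : (Fin.succ 0 : Fin (m + 2)) ≠ 0 := Fin.succ_ne_zero _
  rcases x with (⟨i, j, h⟩ | ⟨i, j, h⟩ | ⟨i, j⟩ | ⟨i, j⟩ | ⟨i, j⟩ | ⟨i, j⟩) | (j | i | i | j | j | i) |
    (j | i | i | j | j | i) <;> simp only [lead]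
  · simp [unlead]
  · simp [unlead]
  · split_ifs with hi hj <;> simp_all [unlead, succ_eq_one_iff]
  · split_ifs with hi hj <;> simp_all [unlead, succ_eq_one_iff]
  · simp [unlead]
  · simp [unlead]
  · simp [unlead]
  · simp [unlead]
  · simp [unlead]
  · simp [unlead]
  · simp [unlead]
  · simp [unlead]
  · simp [unlead]
  · simp [unlead]
  · split_ifs with hi <;> simp_all [unlead, succ_eq_one_iff]
  · split_ifs with hi <;> simp_all [unlead]
  · simp [unlead]
  · simp [unlead]

/-- `unskip` merges the indices `0` and `1`; away from `1` it is inverse to `skip`. -/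
theorem unskip_eq_zero {i : Fin (m + 2)} (h : i ≠ Fin.succ 0) : unskip i = 0 ↔ i = 0 := by
  rw [← skip_eq_zero_iff, skip_unskip h]

theorem lead_unlead (x : TGen (Fin (m + 2))) : lead (unlead x) = x := by
  have h01 : (0 : Fin (m + 2)) ≠ Fin.succ 0 := (Fin.succ_ne_zero _).symm
  have h10 : (Fin.succ 0 : Fin (m + 2)) ≠ 0 := Fin.succ_ne_zero _
  rcases x with ⟨i, j, h⟩ | ⟨i, j, h⟩ | ⟨i, j⟩ | ⟨i, j⟩ | ⟨i, j⟩ | ⟨i, j⟩ <;> simp only [unlead] <;>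
    split_ifs <;>
    simp_all [lead, unskip_eq_zero, succ_unskip, skip_unskip, -Fin.succ_zero_eq_one]
  · rename_i hi
    subst hi
    exact succ_unskip h.symm
  · rename_i hi hj _ _
    subst hi
    have : unskip j ≠ 0 := fun h' => hj ((unskip_eq_zero h.symm).1 h')
    simp only [this, dif_neg, not_false_eq_true]
  · rename_i hi hj
    exact ⟨skip_unskip hi, skip_unskip hj⟩

/-- The bijection of generators underlying the invariance under stabilization. -/
def leadEquiv (m : ℕ) : TGen (Fin (m + 1)) ⊕ (StabGen m ⊕ StabGen m) ≃ TGen (Fin (m + 2)) :=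
  ⟨lead, unlead, unlead_lead, lead_unlead⟩

/-- The rank with respect to which the invariance map is triangular. -/
def rank : TGen (Fin (m + 2)) → ℕ
  | .a i j _ => if i = 0 ∨ j = 0 then 1 else 0
  | .b i j _ => if i = Fin.succ 0 ∨ j = Fin.succ 0 then 3 else if i = 0 ∨ j = 0 then 4 else 2
  | .c i j => if i = 0 then if j = 0 ∨ j = Fin.succ 0 then 5 else 4 else if j = 0 then 4 else 2
  | .d i j => if j = 0 then if i = 0 ∨ i = Fin.succ 0 then 5 else 4 else if i = 0 then 4 else 2
  | .e i j | .f i j => if i = 0 ∧ j ≠ Fin.succ 0 ∨ j = 0 ∧ i ≠ Fin.succ 0 then 8 else 7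

/-- The leading coefficients of the invariance map. -/
def unit {𝓡 : Type} [CommRing 𝓡] (mu : 𝓡ˣ) : TGen (Fin (m + 1)) ⊕ (StabGen m ⊕ StabGen m) → 𝓡ˣ
  | .inl (.a _ _ _) => 1
  | .inl (.b i j _) => if i = 0 ∨ j = 0 then -1 else 1
  | .inl (.c i j) => if i = 0 ∧ j ≠ 0 then -1 else 1
  | .inl (.d i j) => if j = 0 then if i = 0 then mu else -1 else 1
  | .inl (.e i j) | .inl (.f i j) => if i = 0 ∧ j ≠ 0 ∨ j = 0 ∧ i ≠ 0 then -1 else 1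
  | .inr (.inl _) => 1
  | .inr (.inr (gam _)) => -1
  | .inr (.inr (del _)) => -mu
  | .inr (.inr (ec i)) => if i = 0 then -1 else 1
  | .inr (.inr (fr j)) => if j = 0 then -1 else mu
  | .inr (.inr (eo _)) => -mu⁻¹
  | .inr (.inr (fo _)) => -mu

end StabGen

/-! ### Triangularity of the images of the old generators. -/

section Triangular

variable {𝓡 : Type} [CommRing 𝓡] {m : ℕ} (mu : 𝓡ˣ) (U V : 𝓡)
  (φ : CordAlg 𝓡 (Fin (m + 1)) →ₐ[𝓡] CordAlg 𝓡 (Fin (m + 1)))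
  (P Q : Matrix (Fin (m + 1)) (Fin (m + 1)) (CordAlg 𝓡 (Fin (m + 1))))
  (φ' : CordAlg 𝓡 (Fin (m + 2)) →ₐ[𝓡] CordAlg 𝓡 (Fin (m + 2)))
  (P' Q' : Matrix (Fin (m + 2)) (Fin (m + 2)) (CordAlg 𝓡 (Fin (m + 2))))

local notation "κ" => leftIncl 𝓡 m
local notation "ct" => cordToT 𝓡 (m + 1)
local notation "𝐁" => bMatrix 𝓡 (m + 1)
local notation "o" => (Fin.succ 0 : Fin (m + 2))
local notation "⟪" x "⟫" => (FreeAlgebra.ι 𝓡 (x : TGen (Fin (m + 2))) : TAlg 𝓡 (m + 1))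
local notation "𝓛" => PreDGA.low (twistedDGA mu U V φ' P' Q') StabGen.rank

/-- The variables between two old strands are the only generators of rank `0`. -/
theorem leftIncl_mem_low {N : ℕ} (hN : 1 ≤ N) (x : CordAlg 𝓡 (Fin (m + 1))) :
    κ x ∈ 𝓛 N 0 := by
  induction x using FreeAlgebra.induction with
  | grade0 r =>
    rw [AlgHom.commutes]
    exact PreDGA.algebraMap_mem_low (S := twistedDGA mu U V φ' P' Q') r
  | grade1 x =>
    have : FreeAlgebra.ι 𝓡 x = av 𝓡 x.1.1 x.1.2 := by rw [av, dif_pos x.2]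
    rw [this, leftIncl, AlgHom.comp_apply, cordMap_av,
      cordToT_av ((Fin.succ_injective _).ne x.2)]
    refine PreDGA.var_mem_low (S := twistedDGA mu U V φ' P' Q') (TGen.a _ _ _) ?_ rfl
    simpa [StabGen.rank] using Nat.lt_of_succ_le hN
  | mul u v hu hv =>
    rw [map_mul]
    exact PreDGA.mul_mem_low (S := twistedDGA mu U V φ' P' Q') hu hv (zero_add 0)
  | add u v hu hv => rw [map_add]; exact add_mem hu hv

theorem cordToT_mem_rank {N : ℕ} (hN : 2 ≤ N) (x : CordAlg 𝓡 (Fin (m + 2))) : ct x ∈ 𝓛 N 0 :=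
  cordToT_mem_low mu U V φ' P' Q' (fun i j h => by simp only [StabGen.rank]; split_ifs <;> omega) x

theorem gen_mem_rank {N : ℕ} {x : TGen (Fin (m + 2))} {k : ℤ} (hN : StabGen.rank x < N)
    (hk : x.deg = k) : ⟪x⟫ ∈ 𝓛 N k :=
  PreDGA.var_mem_low (S := twistedDGA mu U V φ' P' Q') x hN hk

theorem b_one_mem_rank {N : ℕ} (hN : 4 ≤ N) (j : Fin (m + 2)) : 𝐁 o j ∈ 𝓛 N 1 :=
  bMatrix_mem_low mu U V φ' P' Q' fun h => by simpa [StabGen.rank] using Nat.lt_of_succ_le hN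

theorem b_to_one_mem_rank {N : ℕ} (hN : 4 ≤ N) (i : Fin (m + 2)) : 𝐁 i o ∈ 𝓛 N 1 :=
  bMatrix_mem_low mu U V φ' P' Q' fun h => by simpa [StabGen.rank] using Nat.lt_of_succ_le hN

theorem c_one_mem_rank {N : ℕ} (hN : 3 ≤ N) (j : Fin (m + 1)) : ⟪.c o j.succ⟫ ∈ 𝓛 N 1 :=
  gen_mem_rank mu U V φ' P' Q' (by simpa [StabGen.rank] using Nat.lt_of_succ_le hN) rfl

theorem d_one_mem_rank {N : ℕ} (hN : 3 ≤ N) (i : Fin (m + 1)) : ⟪.d i.succ o⟫ ∈ 𝓛 N 1 :=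
  gen_mem_rank mu U V φ' P' Q' (by simpa [StabGen.rank] using Nat.lt_of_succ_le hN) rfl

theorem stabW_mem_rank {N : ℕ} (hN : 4 ≤ N) : stabW 𝓡 m ∈ 𝓛 N 1 :=
  add_mem (c_one_mem_rank mu U V φ' P' Q' (by omega) 0) (b_to_one_mem_rank mu U V φ' P' Q' hN 0)

theorem stabW'_mem_rank {N : ℕ} (hN : 4 ≤ N) : stabW' mu m ∈ 𝓛 N 1 :=
  add_mem (d_one_mem_rank mu U V φ' P' Q' (by omega) 0)
    (Submodule.smul_mem _ _ (b_one_mem_rank mu U V φ' P' Q' hN 0))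

theorem e_mem_rank {N : ℕ} (hN : 8 ≤ N) (i j : Fin (m + 2)) (h : i = o ∨ j = o) :
    ⟪.e i j⟫ ∈ 𝓛 N 2 :=
  gen_mem_rank mu U V φ' P' Q' (by
    have : StabGen.rank (.e i j) = 7 := if_neg (by
      have := (Fin.succ_ne_zero (0 : Fin (m + 1))); aesop)
    omega) rfl

theorem f_mem_rank {N : ℕ} (hN : 8 ≤ N) (i j : Fin (m + 2)) (h : i = o ∨ j = o) :
    ⟪.f i j⟫ ∈ 𝓛 N 2 :=
  gen_mem_rank mu U V φ' P' Q' (by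
    have : StabGen.rank (.f i j) = 7 := if_neg (by
      have := (Fin.succ_ne_zero (0 : Fin (m + 1))); aesop)
    omega) rfl

variable {mu U V φ' P' Q'} in
theorem mul_mem_rank {N : ℕ} {k l n : ℤ} {x y : TAlg 𝓡 (m + 1)} (h : k + l = n) (hx : x ∈ 𝓛 N k)
    (hy : y ∈ 𝓛 N l) : x * y ∈ 𝓛 N n :=
  PreDGA.mul_mem_low (S := twistedDGA mu U V φ' P' Q') hx hy h

theorem stabXi_mem_rank : stabXi mu Q ∈ 𝓛 8 2 :=
  add_mem (add_mem (f_mem_rank mu U V φ' P' Q' le_rfl _ _ (.inl rfl))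
    (Submodule.smul_mem _ _ (mul_mem_rank one_add_one_eq_two
      (d_one_mem_rank mu U V φ' P' Q' (by omega) 0) (stabW'_mem_rank mu U V φ' P' Q' (by omega)))))
    (Submodule.smul_mem _ _ (mul_mem_rank (add_zero 2)
      (f_mem_rank mu U V φ' P' Q' le_rfl _ _ (.inl rfl))
      (cordToT_mem_rank mu U V φ' P' Q' (by omega) _)))

theorem stabXi'_mem_rank : stabXi' mu P ∈ 𝓛 8 2 :=
  add_mem (sub_mem (e_mem_rank mu U V φ' P' Q' le_rfl _ _ (.inr rfl))
    (mul_mem_rank one_add_one_eq_two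
      (stabW_mem_rank mu U V φ' P' Q' (by omega)) (c_one_mem_rank mu U V φ' P' Q' (by omega) 0)))
    (Submodule.smul_mem _ _ (mul_mem_rank (zero_add 2)
      (cordToT_mem_rank mu U V φ' P' Q' (by omega) _)
      (e_mem_rank mu U V φ' P' Q' le_rfl _ _ (.inl rfl))))

/-- The leading generators avoid those reserved for the cancelling pairs, and the ranks are arranged
so that every other summand of an image lies strictly below its leading generator. The bounds needed
in all cases are collected first; each case then groups the remainder into products of bounded
factors. -/
theorem stabOld_leading (x : TGen (Fin (m + 1))) :
    stabOld mu P Q x - (StabGen.unit mu (.inl x) : 𝓡) • ⟪StabGen.lead (.inl x)⟫ ∈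
      𝓛 (StabGen.rank (StabGen.lead (.inl x))) x.deg := by
  have hκ : ∀ {N}, 1 ≤ N → ∀ x, κ x ∈ 𝓛 N 0 := leftIncl_mem_low mu U V φ' P' Q'
  have hct : ∀ {N}, 2 ≤ N → ∀ x, ct x ∈ 𝓛 N 0 := cordToT_mem_rank mu U V φ' P' Q'
  have hbo : ∀ {N}, 4 ≤ N → ∀ j, 𝐁 o j ∈ 𝓛 N 1 := b_one_mem_rank mu U V φ' P' Q'
  have hob : ∀ {N}, 4 ≤ N → ∀ i, 𝐁 i o ∈ 𝓛 N 1 := b_to_one_mem_rank mu U V φ' P' Q'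
  have hc : ∀ {N}, 3 ≤ N → ∀ j : Fin (m + 1), ⟪.c o j.succ⟫ ∈ 𝓛 N 1 :=
    c_one_mem_rank mu U V φ' P' Q'
  have hd : ∀ {N}, 3 ≤ N → ∀ i : Fin (m + 1), ⟪.d i.succ o⟫ ∈ 𝓛 N 1 :=
    d_one_mem_rank mu U V φ' P' Q'
  have hw : ∀ {N}, 4 ≤ N → stabW 𝓡 m ∈ 𝓛 N 1 := stabW_mem_rank mu U V φ' P' Q'
  have hw' : ∀ {N}, 4 ≤ N → stabW' mu m ∈ 𝓛 N 1 := stabW'_mem_rank mu U V φ' P' Q'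
  have he : ∀ i j, i = o ∨ j = o → ⟪.e i j⟫ ∈ 𝓛 8 2 := e_mem_rank mu U V φ' P' Q' le_rfl
  have hf : ∀ i j, i = o ∨ j = o → ⟪.f i j⟫ ∈ 𝓛 8 2 := f_mem_rank mu U V φ' P' Q' le_rfl
  have hξ : stabXi mu Q ∈ 𝓛 8 2 := stabXi_mem_rank mu U V Q φ' P' Q'
  have hξ' : stabXi' mu P ∈ 𝓛 8 2 := stabXi'_mem_rank mu U V P φ' P' Q'
  have hs : ∀ {N k} (r : 𝓡) {x}, x ∈ 𝓛 N k → r • x ∈ 𝓛 N k := fun r _ h =>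
    Submodule.smul_mem _ r h
  have h84 : 4 ≤ 8 := by omega
  have h82 : 2 ≤ 8 := by omega
  have h81 : 1 ≤ 8 := by omega
  have h83 : 3 ≤ 8 := by omega
  have h42 : 2 ≤ 4 := by omega
  have h41 : 1 ≤ 4 := by omega
  have h43 : 3 ≤ 4 := by omega
  have h31 : 1 ≤ 3 := by omega
  have hr1 : ∀ j : Fin (m + 1), StabGen.rank (.b 0 j.succ (Fin.succ_ne_zero _).symm) =
      if j = 0 then 3 else 4 := fun j => by
    by_cases h : j = 0 <;> simp [StabGen.rank, StabGen.succ_eq_one_iff, h]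
  have hr2 : ∀ j : Fin (m + 1), StabGen.rank (.b j.succ 0 (Fin.succ_ne_zero _)) =
      if j = 0 then 3 else 4 := fun j => by
    by_cases h : j = 0 <;> simp [StabGen.rank, StabGen.succ_eq_one_iff, h]
  have hr3 : ∀ j : Fin (m + 1), StabGen.rank (.c 0 j.succ) = if j = 0 then 5 else 4 := fun j => by
    by_cases h : j = 0 <;> simp [StabGen.rank, StabGen.succ_eq_one_iff, h]
  have hr4 : ∀ j : Fin (m + 1), StabGen.rank (.d j.succ 0) = if j = 0 then 5 else 4 := fun j => by
    by_cases h : j = 0 <;> simp [StabGen.rank, StabGen.succ_eq_one_iff, h]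
  have hr5 : ∀ j : Fin (m + 1), j ≠ 0 → StabGen.rank (.e 0 j.succ) = 8 := fun j h => by
    simp [StabGen.rank, StabGen.succ_eq_one_iff, h]
  have hr6 : ∀ j : Fin (m + 1), j ≠ 0 → StabGen.rank (.e j.succ 0) = 8 := fun j h => by
    simp [StabGen.rank, StabGen.succ_eq_one_iff, h]
  have hr7 : ∀ j : Fin (m + 1), j ≠ 0 → StabGen.rank (.f 0 j.succ) = 8 := fun j h => by
    simp [StabGen.rank, StabGen.succ_eq_one_iff, h]
  have hr8 : ∀ j : Fin (m + 1), j ≠ 0 → StabGen.rank (.f j.succ 0) = 8 := fun j h => by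
    simp [StabGen.rank, StabGen.succ_eq_one_iff, h]
  have hr9 : StabGen.rank (.e (0 : Fin (m + 2)) 0) = 8 := by simp [StabGen.rank]
  have hr10 : StabGen.rank (.f (0 : Fin (m + 2)) 0) = 8 := by simp [StabGen.rank]
  rcases x with ⟨i, j, h⟩ | ⟨i, j, h⟩ | ⟨i, j⟩ | ⟨i, j⟩ | ⟨i, j⟩ | ⟨i, j⟩
  · simp only [stabOld, StabGen.lead, StabGen.unit, Units.val_one, one_smul, leftIncl,
      AlgHom.comp_apply, cordMap_av, cordToT_av ((Fin.succ_injective _).ne h), sub_self]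
    exact Submodule.zero_mem _
  · change _ ∈ 𝓛 _ 1
    by_cases hi : i = 0
    · subst hi
      have hj := h.symm
      simp only [stabOld, stabB, StabGen.lead, StabGen.unit, StabGen.skip_zero,
        StabGen.skip_of_ne hj, hj, true_or, if_true, if_false, Units.val_neg, Units.val_one,
        hr1, ← bMatrix_apply]
      have := neg_mem (add_mem (add_mem (hs (mu : 𝓡) (mul_mem_rank (zero_add 1)
        (hct h42 (leftPath P 0)) (hbo le_rfl j.succ)))
        (mul_mem_rank (add_zero 1) (hw le_rfl) (hκ h41 (av 𝓡 0 j)))) (hc h43 j))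
      convert this using 1
      module
    · by_cases hj : j = 0
      · subst hj
        simp only [stabOld, stabB, StabGen.lead, StabGen.unit, StabGen.skip_zero,
          StabGen.skip_of_ne hi, hi, or_true, if_true, if_false, Units.val_neg, Units.val_one,
          hr2, ← bMatrix_apply]
        have := neg_mem (add_mem (add_mem (hs ((mu⁻¹ : 𝓡ˣ) : 𝓡) (mul_mem_rank (add_zero 1)
          (hob le_rfl i.succ) (hct h42 (rightPath Q 0))))
          (hs ((mu⁻¹ : 𝓡ˣ) : 𝓡) (mul_mem_rank (zero_add 1) (hκ h41 (av 𝓡 i 0)) (hw' le_rfl))))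
          (hs ((mu⁻¹ : 𝓡ˣ) : 𝓡) (hd h43 i)))
        convert this using 1
        module
      · simp only [stabOld, stabB, StabGen.lead, StabGen.unit, StabGen.skip_of_ne hi,
          StabGen.skip_of_ne hj, hi, hj, or_self, if_false, Units.val_one, one_smul,
          bMatrix_apply ((Fin.succ_injective _).ne h), sub_self]
        exact Submodule.zero_mem _
  · change _ ∈ 𝓛 _ 1
    by_cases hi : i = 0
    · subst hi
      by_cases hj : j = 0
      · subst hj
        -- The leading term is the generator `b_01` inside `stabW`, because `c_11` is the upper
        -- member of a cancelling pair.
        simp only [stabOld, stabW, StabGen.lead, StabGen.unit, if_true, ne_eq, not_true, and_false,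
          if_false, Units.val_one, hr1, ← bMatrix_apply]
        have := sub_mem (hc le_rfl 0) (sum_mem (t := Finset.univ) fun k _ =>
          mul_mem_rank (zero_add 1) (hκ h31 (P 0 k)) (hd le_rfl k))
        convert this using 1
        module
      · simp only [stabOld, StabGen.lead, StabGen.unit, if_true, hj, ne_eq, not_false_eq_true,
          and_self, if_false, Units.val_neg, Units.val_one, hr3]
        have := sub_mem (hc h43 j) (mul_mem_rank (add_zero 1) (hw le_rfl)
          (hct h42 (av 𝓡 0 j.succ)))
        convert this using 1
        module
    · simp only [stabOld, StabGen.lead, StabGen.unit, hi, false_and, if_false, Units.val_one,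
        one_smul, sub_self]
      exact Submodule.zero_mem _
  · change _ ∈ 𝓛 _ 1
    by_cases hj : j = 0
    · subst hj
      by_cases hi : i = 0
      · subst hi
        -- Likewise `b_10` leads here, with coefficient `μ`, as `d_11` belongs to a cancelling pair.
        simp only [stabOld, stabW', StabGen.lead, StabGen.unit, if_true, hr2, ← bMatrix_apply]
        have := sub_mem (hd le_rfl 0) (sum_mem (t := Finset.univ) fun k _ =>
          mul_mem_rank (add_zero 1) (hc le_rfl k) (hκ h31 (Q k 0)))
        convert this using 1
        module
      · simp only [stabOld, StabGen.lead, StabGen.unit, if_true, hi, if_false, Units.val_neg,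
          Units.val_one, hr4]
        have := sub_mem (hd h43 i) (mul_mem_rank (zero_add 1) (hct h42 (av 𝓡 i.succ 0))
          (hw' le_rfl))
        convert this using 1
        module
    · simp only [stabOld, StabGen.lead, StabGen.unit, hj, if_false, Units.val_one,
        one_smul, sub_self]
      exact Submodule.zero_mem _
  · change _ ∈ 𝓛 _ 2
    by_cases hj : j = 0
    · subst hj
      by_cases hi : i = 0
      · subst hi
        simp only [stabOld, StabGen.lead, StabGen.unit, StabGen.skip_zero, if_true, ne_eq, not_true,
          and_false, or_self, if_false, Units.val_one, hr9]
        have := add_mem (add_mem (sub_mem (he o o (.inl rfl))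
          (hs ((mu⁻¹ : 𝓡ˣ) : 𝓡) (hf 0 o (.inr rfl))))
          (mul_mem_rank (zero_add 2) (hct h82 (leftPath P 0))
            (sub_mem (hs (mu : 𝓡) (he o 0 (.inl rfl))) (hf o o (.inl rfl)))))
          (mul_mem_rank (zero_add 2) (hκ h81 (P 0 0)) hξ)
        convert this using 1
        module
      · simp only [stabOld, StabGen.lead, StabGen.unit, StabGen.skip_zero, StabGen.skip_of_ne hi,
          hi, if_true, if_false, ne_eq, not_false_eq_true, and_self, or_true, Units.val_neg,
          Units.val_one, hr6 i hi]
        have := add_mem (sub_mem (add_mem (he i.succ o (.inr rfl))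
          (hs ((mu⁻¹ : 𝓡ˣ) : 𝓡) (hf i.succ o (.inr rfl))))
          (hs ((mu⁻¹ : 𝓡ˣ) : 𝓡) (mul_mem_rank one_add_one_eq_two (hob h84 i.succ) (hw' h84))))
          (mul_mem_rank (zero_add 2) (hκ h81 (P i 0)) hξ)
        convert this using 1
        module
    · by_cases hi : i = 0
      · subst hi
        simp only [stabOld, StabGen.lead, StabGen.unit, StabGen.skip_zero, StabGen.skip_of_ne hj,
          hj, if_true, if_false, ne_eq, not_false_eq_true, and_self, true_or, Units.val_neg,
          Units.val_one, hr5 j hj]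
        have := sub_mem (mul_mem_rank one_add_one_eq_two (hw h84) (hc h83 j))
          (hs (mu : 𝓡) (mul_mem_rank (zero_add 2) (hct h82 (leftPath P 0))
            (he o j.succ (.inl rfl))))
        convert this using 1
        module
      · simp only [stabOld, StabGen.lead, StabGen.unit, StabGen.skip_of_ne hi,
          StabGen.skip_of_ne hj, hi, hj, false_and, or_self, if_false, Units.val_one, one_smul,
          sub_self]
        exact Submodule.zero_mem _
  · change _ ∈ 𝓛 _ 2
    by_cases hj : j = 0
    · subst hj
      by_cases hi : i = 0
      · subst hi
        simp only [stabOld, StabGen.lead, StabGen.unit, StabGen.skip_zero, if_true, ne_eq, not_true,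
          and_false, or_self, if_false, Units.val_one, hr10]
        have := add_mem (add_mem (sub_mem (hf o o (.inl rfl)) (hs (mu : 𝓡) (he o 0 (.inl rfl))))
          (mul_mem_rank (add_zero 2)
            (sub_mem (hs ((mu⁻¹ : 𝓡ˣ) : 𝓡) (hf 0 o (.inr rfl))) (he o o (.inl rfl)))
            (hct h82 (rightPath Q 0))))
          (mul_mem_rank (add_zero 2) hξ' (hκ h81 (Q 0 0)))
        convert this using 1
        module
      · simp only [stabOld, StabGen.lead, StabGen.unit, StabGen.skip_zero, StabGen.skip_of_ne hi,
          hi, if_true, if_false, ne_eq, not_false_eq_true, and_self, or_true, Units.val_neg,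
          Units.val_one, hr8 i hi]
        have := neg_mem (add_mem (hs ((mu⁻¹ : 𝓡ˣ) : 𝓡) (mul_mem_rank one_add_one_eq_two
          (hd h83 i) (hw' h84))) (hs ((mu⁻¹ : 𝓡ˣ) : 𝓡) (mul_mem_rank (add_zero 2)
            (hf i.succ o (.inr rfl)) (hct h82 (rightPath Q 0)))))
        convert this using 1
        module
    · by_cases hi : i = 0
      · subst hi
        simp only [stabOld, StabGen.lead, StabGen.unit, StabGen.skip_zero, StabGen.skip_of_ne hj,
          hj, if_true, if_false, ne_eq, not_false_eq_true, and_self, true_or, Units.val_neg,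
          Units.val_one, hr7 j hj]
        have := add_mem (add_mem (add_mem (hf o j.succ (.inl rfl))
          (hs (mu : 𝓡) (he o j.succ (.inl rfl))))
          (hs (mu : 𝓡) (mul_mem_rank one_add_one_eq_two (hw h84) (hbo h84 j.succ))))
          (mul_mem_rank (add_zero 2) hξ' (hκ h81 (Q 0 j)))
        convert this using 1
        module
      · simp only [stabOld, StabGen.lead, StabGen.unit, StabGen.skip_of_ne hi,
          StabGen.skip_of_ne hj, hi, hj, false_and, or_self, if_false, Units.val_one, one_smul,
          sub_self]
        exact Submodule.zero_mem _

end Triangular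

end

end TransverseHomology
namespace TransverseHomology

noncomputable section

/-! ### Splitting off the cancelling pairs. -/

section Stabilization

variable {𝓡 : Type} [CommRing 𝓡] {m : ℕ} {mu : 𝓡ˣ} {U V : 𝓡}
  {φ : CordAlg 𝓡 (Fin (m + 1)) →ₐ[𝓡] CordAlg 𝓡 (Fin (m + 1))}
  {P Q : Matrix (Fin (m + 1)) (Fin (m + 1)) (CordAlg 𝓡 (Fin (m + 1)))}
  {φ' : CordAlg 𝓡 (Fin (m + 2)) →ₐ[𝓡] CordAlg 𝓡 (Fin (m + 2))}
  {P' Q' : Matrix (Fin (m + 2)) (Fin (m + 2)) (CordAlg 𝓡 (Fin (m + 2)))}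

local notation "κ" => leftIncl 𝓡 m
local notation "ct" => cordToT 𝓡 (m + 1)
local notation "𝐁" => bMatrix 𝓡 (m + 1)
local notation "o" => (Fin.succ 0 : Fin (m + 2))
local notation "⟪" x "⟫" => (FreeAlgebra.ι 𝓡 (x : TGen (Fin (m + 2))) : TAlg 𝓡 (m + 1))
local notation "𝓛" => PreDGA.low (twistedDGA mu U V φ' P' Q') StabGen.rank

/-- The pairs are chosen so that the lower generator occurs with a unit coefficient. For the
generators `b` this requires `𝐄` below the diagonal, where `𝐁̂` has the coefficient `1`, and `𝐅`
above the diagonal, where `𝐁̌` has `μ`; the other two coefficients are `μU` and `V`, which need not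
be units. The remaining units come from the isolated entries `μ⁻¹` of `P'` and `μ` of `Q'` and from
the summands `-𝐂` and `-𝐃`. -/
theorem StabData.pair_leading (H : StabData mu φ P Q φ' P' Q') (k : StabGen m) :
    twistedDiff mu U V φ' P' Q' (StabGen.lead (.inr (.inl k))) -
        (StabGen.unit mu (.inr (.inr k)) : 𝓡) • ⟪StabGen.lead (.inr (.inr k))⟫ ∈
      𝓛 (StabGen.rank (StabGen.lead (.inr (.inr k)))) k.lowDeg := by
  have hκ : ∀ {N}, 1 ≤ N → ∀ x, κ x ∈ 𝓛 N 0 := leftIncl_mem_low mu U V φ' P' Q'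
  have hct : ∀ {N}, 2 ≤ N → ∀ x, ct x ∈ 𝓛 N 0 := cordToT_mem_rank mu U V φ' P' Q'
  have hbo : ∀ {N}, 4 ≤ N → ∀ j, 𝐁 o j ∈ 𝓛 N 1 := b_one_mem_rank mu U V φ' P' Q'
  have hob : ∀ {N}, 4 ≤ N → ∀ i, 𝐁 i o ∈ 𝓛 N 1 := b_to_one_mem_rank mu U V φ' P' Q'
  have hc : ∀ {N}, 3 ≤ N → ∀ j : Fin (m + 1), ⟪.c o j.succ⟫ ∈ 𝓛 N 1 :=
    c_one_mem_rank mu U V φ' P' Q'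
  have hd : ∀ {N}, 3 ≤ N → ∀ i : Fin (m + 1), ⟪.d i.succ o⟫ ∈ 𝓛 N 1 :=
    d_one_mem_rank mu U V φ' P' Q'
  have hc0 : ⟪.c o 0⟫ ∈ 𝓛 5 1 := gen_mem_rank mu U V φ' P' Q' (by simp [StabGen.rank]) rfl
  have hd0 : ⟪.d 0 o⟫ ∈ 𝓛 5 1 := gen_mem_rank mu U V φ' P' Q' (by simp [StabGen.rank]) rfl
  have hs : ∀ {N k} (r : 𝓡) {x}, x ∈ 𝓛 N k → r • x ∈ 𝓛 N k := fun r _ h =>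
    Submodule.smul_mem _ r h
  have h54 : 4 ≤ 5 := by omega
  have h53 : 3 ≤ 5 := by omega
  have h52 : 2 ≤ 5 := by omega
  have h51 : 1 ≤ 5 := by omega
  have h43 : 3 ≤ 4 := by omega
  have h31 : 1 ≤ 3 := by omega
  have tri : ∀ {N} (x y : 𝓡) (i j : Fin (m + 2)), 𝐁 i j ∈ 𝓛 N 1 →
      triMatrix x 0 y 𝐁 i j ∈ 𝓛 N 1 := fun x y i j h => by
    simp only [triMatrix, Matrix.of_apply]
    split_ifs
    · exact hs _ h
    · rw [map_zero]; exact Submodule.zero_mem _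
    · exact hs _ h
  have hν : ((mu⁻¹ : 𝓡ˣ) : 𝓡) * mu = 1 := Units.inv_mul mu
  rcases k with j | i | i | j | j | i
  · change _ ∈ 𝓛 _ 0
    have hr : StabGen.rank (.a 0 j.succ (Fin.succ_ne_zero _).symm) = 1 := by simp [StabGen.rank]
    simp only [StabGen.lead, StabGen.unit, H.diff_c_one, Units.val_neg, Units.val_one, hr,
      cordToT_av (Fin.succ_ne_zero j).symm]
    convert hκ le_rfl (hatCord mu U m 0 j) using 1
    module
  · change _ ∈ 𝓛 _ 0
    have hr : StabGen.rank (.a i.succ 0 (Fin.succ_ne_zero _)) = 1 := by simp [StabGen.rank]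
    simp only [StabGen.lead, StabGen.unit, H.diff_d_one, Units.val_neg, hr,
      cordToT_av (Fin.succ_ne_zero i)]
    convert hκ le_rfl (checkCord mu V m i 0) using 1
    module
  · change _ ∈ 𝓛 _ 1
    by_cases hi : i = 0
    · subst hi
      have hr : StabGen.rank (.c 0 o) = 5 := by simp [StabGen.rank]
      simp only [StabGen.lead, StabGen.unit, StabGen.skip_zero, dif_pos, if_true, H.diff_e_zero,
        Units.val_neg, Units.val_one, hr]
      have := add_mem (add_mem (tri 1 ((mu : 𝓡) * U) 0 o (hob h54 0))
        (mul_mem_rank (zero_add 1) (hct h52 (leftPath P 0)) hd0))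
        (sum_mem (t := Finset.univ) fun k _ =>
          mul_mem_rank (zero_add 1) (hκ h51 (P 0 k)) (hd h53 k))
      convert this using 1
      simp only [hatB]
      module
    · have hr : StabGen.rank (.b i.succ o ((Fin.succ_injective _).ne hi)) = 3 := by
        simp [StabGen.rank]
      simp only [StabGen.lead, StabGen.unit, StabGen.skip_of_ne hi, hi, dif_neg, not_false_eq_true,
        if_false, H.diff_e hi, Units.val_one, hr, hatB, triMatrix_b_to_one _ _ hi,
        bMatrix_apply ((Fin.succ_injective _).ne hi)]
      have hci : ⟪.c i.succ o⟫ ∈ 𝓛 3 1 :=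
        gen_mem_rank mu U V φ' P' Q' (by simp [StabGen.rank]) rfl
      have := neg_mem (add_mem hci (sum_mem (t := Finset.univ) fun k _ =>
          mul_mem_rank (zero_add 1) (hκ h31 (P i k)) (hd le_rfl k)))
      convert this using 1
      module
  · change _ ∈ 𝓛 _ 1
    by_cases hj : j = 0
    · subst hj
      have hr : StabGen.rank (.d o 0) = 5 := by simp [StabGen.rank]
      simp only [StabGen.lead, StabGen.unit, StabGen.skip_zero, dif_pos, if_true, H.diff_f_zero,
        Units.val_neg, Units.val_one, hr]
      have := add_mem (add_mem (tri V (mu : 𝓡) o 0 (hbo h54 0))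
        (mul_mem_rank (add_zero 1) hc0 (hct h52 (rightPath Q 0))))
        (sum_mem (t := Finset.univ) fun k _ =>
          mul_mem_rank (add_zero 1) (hc h53 k) (hκ h51 (Q k 0)))
      convert this using 1
      simp only [checkB]
      module
    · have hj' : o ≠ j.succ := (Fin.succ_injective _).ne (Ne.symm hj)
      have hr : StabGen.rank (.b o j.succ hj') = 3 := by
        simp [StabGen.rank]
      simp only [StabGen.lead, StabGen.unit, StabGen.skip_of_ne hj, hj, dif_neg, not_false_eq_true,
        if_false, H.diff_f _ hj, hr, checkB, triMatrix_b_one _ _ hj, bMatrix_apply hj']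
      have hdj : ⟪.d o j.succ⟫ ∈ 𝓛 3 1 :=
        gen_mem_rank mu U V φ' P' Q' (by simp [StabGen.rank]) rfl
      have := neg_mem (add_mem hdj (sum_mem (t := Finset.univ) fun k _ =>
          mul_mem_rank (add_zero 1) (hc le_rfl k) (hκ h31 (Q k j))))
      convert this using 1
      module
  · change _ ∈ 𝓛 _ 1
    simp only [StabGen.lead, StabGen.unit, H.diff_e_one, Units.val_neg, hatB]
    have key : ∀ N, 4 ≤ N → ⟪.c o j⟫ ∈ 𝓛 N 1 →
        triMatrix 1 0 ((mu : 𝓡) * U) 𝐁 o j - ⟪.c o j⟫ ∈ 𝓛 N 1 := fun N hN h =>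
      sub_mem (tri _ _ _ _ (hbo hN j)) h
    convert key (StabGen.rank (.d 0 j)) ?_ ?_ using 1
    · module
    · simp only [StabGen.rank, true_or, if_true]; split_ifs <;> omega
    · refine gen_mem_rank mu U V φ' P' Q' ?_ rfl
      simp only [StabGen.rank, true_or, if_true, Fin.succ_ne_zero, if_false]
      split_ifs <;> omega
  · change _ ∈ 𝓛 _ 1
    simp only [StabGen.lead, StabGen.unit, H.diff_f_one, Units.val_neg, checkB]
    have key : ∀ N, 4 ≤ N → ⟪.d i o⟫ ∈ 𝓛 N 1 →
        triMatrix V 0 (mu : 𝓡) 𝐁 i o - ⟪.d i o⟫ ∈ 𝓛 N 1 := fun N hN h =>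
      sub_mem (tri _ _ _ _ (hob hN i)) h
    convert key (StabGen.rank (.c i 0)) ?_ ?_ using 1
    · module
    · simp only [StabGen.rank, true_or, if_true]; split_ifs <;> omega
    · refine gen_mem_rank mu U V φ' P' Q' ?_ rfl
      simp only [StabGen.rank, true_or, if_true, Fin.succ_ne_zero, if_false]
      split_ifs <;> omega

/-- The upper member of a pair goes to a generator and the lower member to the boundary of that
generator, which makes the map a chain map on the pairs; the leading terms found above make it
triangular. -/
theorem StabData.tameIso (H : StabData mu φ P Q φ' P' Q')
    (hT : (twistedDGA mu U V φ' P' Q').IsDGA) :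
    PreDGA.TameIso ((twistedDGA mu U V φ P Q).stab (StabGen m) StabGen.lowDeg)
      (twistedDGA mu U V φ' P' Q') := by
  refine PreDGA.tameIso_of_triangular (S := (twistedDGA mu U V φ P Q).stab (StabGen m) StabGen.lowDeg)
    (T := twistedDGA mu U V φ' P' Q') (StabGen.leadEquiv m)
    ?_ StabGen.rank (Sum.elim (stabOld mu P Q) (Sum.elim
      (fun k => FreeAlgebra.ι 𝓡 (StabGen.lead (.inr (.inl k))))
      fun k => twistedDiff mu U V φ' P' Q' (StabGen.lead (.inr (.inl k)))))
    (StabGen.unit mu) ?_ ?_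
  · rintro ((_ | _ | ⟨i, j⟩ | ⟨i, j⟩ | _ | _) | (j | i | i | j | j | i) | (j | i | i | j | j | i)) <;>
      simp only [StabGen.leadEquiv, StabGen.lead, Equiv.coe_fn_mk] <;> (try split_ifs) <;> rfl
  · rintro (x | k | k)
    · exact stabOld_leading mu U V P Q φ' P' Q' x
    · have : StabGen.unit mu (.inr (.inl k)) = 1 := rfl
      rw [this, Units.val_one, one_smul]
      change FreeAlgebra.ι 𝓡 _ - FreeAlgebra.ι 𝓡 _ ∈ _
      rw [StabGen.leadEquiv, Equiv.coe_fn_mk, sub_self]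
      exact Submodule.zero_mem _
    · exact H.pair_leading k
  · rintro (x | k | k)
    · rw [PreDGA.stab_dGen_inl]
      refine Eq.trans ?_ (H.d_stabOld x)
      change ((FreeAlgebra.lift 𝓡 _).comp (PreDGA.stabIncl StabGen.lowDeg _)) _ = _
      congr 1
      apply FreeAlgebra.hom_ext
      funext y
      simp [PreDGA.relabel]
    · rw [PreDGA.stab_dGen_left]
      change FreeAlgebra.lift 𝓡 _ (FreeAlgebra.ι 𝓡 _) = _
      rw [FreeAlgebra.lift_ι_apply]
      exact (d_gen _).symm
    · rw [PreDGA.stab_dGen_right, map_zero]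
      change _ = PreDGA.d (twistedDGA mu U V φ' P' Q') (twistedDiff mu U V φ' P' Q' _)
      rw [← d_gen]
      exact (hT.2 _).symm

end Stabilization

end

end TransverseHomology
namespace TransverseHomology

noncomputable section

/-! ### A strand added before the first one. -/

section LeftStrand

variable (𝓡 : Type) [CommRing 𝓡] {m : ℕ}

theorem braidAut_fixed_of_sigma {n : ℕ} (g : BraidGroup m →* BraidGroup n)
    {x : CordAlg 𝓡 (Fin (n + 1))} (h : ∀ k, braidAut 𝓡 n (g (sigma k)) x = x) (B : BraidGroup m) :
    braidAut 𝓡 n (g B) x = x := by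
  induction B using braid_induction with
  | one => rw [map_one, braidAut_one]
  | sigma k => exact h k
  | mul a b ha hb => rw [map_mul, braidAut_mul, hb, ha]
  | inv a ha =>
    conv_lhs => rw [← ha]
    rw [map_inv, braidAut_inv_apply]

theorem braidAut_equivariant {n n' : ℕ} (g : BraidGroup m →* BraidGroup n)
    (g' : BraidGroup m →* BraidGroup n')
    (f : CordAlg 𝓡 (Fin (n + 1)) →ₐ[𝓡] CordAlg 𝓡 (Fin (n' + 1)))
    (h : ∀ k x, braidAut 𝓡 n' (g' (sigma k)) (f x) = f (braidAut 𝓡 n (g (sigma k)) x))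
    (B : BraidGroup m) (x : CordAlg 𝓡 (Fin (n + 1))) :
    braidAut 𝓡 n' (g' B) (f x) = f (braidAut 𝓡 n (g B) x) := by
  induction B using braid_induction generalizing x with
  | one => rw [map_one g, map_one g', braidAut_one, braidAut_one]
  | sigma k => exact h k x
  | mul a b ha hb => rw [map_mul g, map_mul g', braidAut_mul, braidAut_mul, hb, ha]
  | inv a ha =>
    have := ha (braidAut 𝓡 n (g a⁻¹) x)
    rw [map_inv g, braidAut_apply_inv] at this
    rw [map_inv g', ← this, braidAut_inv_apply, map_inv g]

theorem finRotate_castSucc (i : Fin (m + 1)) : finRotate (m + 2) i.castSucc = i.succ := by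
  rw [finRotate_apply, Fin.coeSucc_eq_succ]

/-- A strand added before the first one is acted on like a strand added after the last one. -/
theorem braidAut_addStrandLeft_rotate (B : BraidGroup m) (x : CordAlg 𝓡 (Fin (m + 2))) :
    braidAut 𝓡 (m + 1) (addStrandLeft m B) (cordMap 𝓡 (finRotate (m + 2)) x) =
      cordMap 𝓡 (finRotate (m + 2)) (braidAutExt 𝓡 B x) := by
  refine braidAut_equivariant 𝓡 (addStrandRight m) (addStrandLeft m) _ (fun k x => ?_) B x
  rw [addStrandLeft_sigma, addStrandRight_sigma, braidAut_sigma, braidAut_sigma,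
    ← cordMap_crossHom 𝓡 (finRotate (m + 2)).injective, finRotate_castSucc, Fin.succ_castSucc,
    finRotate_castSucc]

theorem cordMap_rotate_cordIncl (x : CordAlg 𝓡 (Fin (m + 1))) :
    cordMap 𝓡 (finRotate (m + 2)) (cordIncl 𝓡 m x) = cordMap 𝓡 Fin.succ x := by
  have : (cordMap 𝓡 (finRotate (m + 2))).comp (cordIncl 𝓡 m) = cordMap 𝓡 Fin.succ := by
    apply cordAlg_hom_ext
    intro i j _
    rw [AlgHom.comp_apply, cordIncl_av, cordMap_av, cordMap_av, finRotate_castSucc,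
      finRotate_castSucc]
  exact DFunLike.congr_fun this x

/-- The strands of `B` pass neither in front of nor behind an added strand by a crossing, so the
place of that strand is irrelevant. The cyclic rotation of the indices takes the last strand to `0`,
and the defining expansion of `Φ^L` is carried over. -/
theorem braidAut_addStrandLeft_to_zero (B : BraidGroup m) (i : Fin (m + 1)) :
    braidAut 𝓡 (m + 1) (addStrandLeft m B) (av 𝓡 i.succ 0) = leftPath (PhiL 𝓡 B) i := by
  have := braidAut_addStrandLeft_rotate 𝓡 B (av 𝓡 i.castSucc (Fin.last (m + 1)))
  rw [PhiL_spec, cordMap_av, finRotate_castSucc, finRotate_last] at this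
  rw [this, map_sum, leftPath]
  simp only [map_mul, cordMap_rotate_cordIncl, cordMap_av, finRotate_castSucc, finRotate_last]

theorem braidAut_addStrandLeft_zero (B : BraidGroup m) (j : Fin (m + 1)) :
    braidAut 𝓡 (m + 1) (addStrandLeft m B) (av 𝓡 0 j.succ) = rightPath (PhiR 𝓡 B) j := by
  have := braidAut_addStrandLeft_rotate 𝓡 B (av 𝓡 (Fin.last (m + 1)) j.castSucc)
  rw [PhiR_spec, cordMap_av, finRotate_castSucc, finRotate_last] at this
  rw [this, map_sum, rightPath]
  simp only [map_mul, cordMap_rotate_cordIncl, cordMap_av, finRotate_castSucc, finRotate_last]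

theorem cordMap_succ_cordIncl (x : CordAlg 𝓡 (Fin (m + 1))) :
    cordMap 𝓡 Fin.succ (cordIncl 𝓡 m x) = cordIncl 𝓡 (m + 1) (cordMap 𝓡 Fin.succ x) := by
  have : (cordMap 𝓡 Fin.succ).comp (cordIncl 𝓡 m) =
      (cordIncl 𝓡 (m + 1)).comp (cordMap 𝓡 Fin.succ) := by
    apply cordAlg_hom_ext
    intro i j _
    rw [AlgHom.comp_apply, AlgHom.comp_apply, cordIncl_av, cordMap_av, cordMap_av, cordIncl_av]
    rfl
  exact DFunLike.congr_fun this x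

theorem braidAutExt_addStrandLeft_zero_last (B : BraidGroup m) :
    braidAutExt 𝓡 (addStrandLeft m B) (av 𝓡 (0 : Fin (m + 2)).castSucc (Fin.last (m + 2))) =
      av 𝓡 (0 : Fin (m + 2)).castSucc (Fin.last (m + 2)) := by
  refine braidAut_fixed_of_sigma 𝓡 ((addStrandRight (m + 1)).comp (addStrandLeft m)) (fun k => ?_) B
  rw [MonoidHom.comp_apply, addStrandLeft_sigma, addStrandRight_sigma, braidAut_sigma,
    crossHom_av _ _ _ (Fin.castSucc_lt_last _).ne, crossVal]
  have h₁ : (0 : Fin (m + 2)).castSucc ≠ k.succ.castSucc.castSucc := by simp [Fin.ext_iff]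
  have h₂ : (0 : Fin (m + 2)).castSucc ≠ k.succ.castSucc.succ := by simp [Fin.ext_iff]
  have h₃ : Fin.last (m + 2) ≠ k.succ.castSucc.castSucc := (Fin.castSucc_lt_last _).ne'
  have h₄ : Fin.last (m + 2) ≠ k.succ.castSucc.succ := by
    rw [Fin.succ_castSucc]; exact (Fin.castSucc_lt_last _).ne'
  simp only [h₁, h₂, h₃, h₄, if_false]

theorem braidAutExt_addStrandLeft_last_zero (B : BraidGroup m) :
    braidAutExt 𝓡 (addStrandLeft m B) (av 𝓡 (Fin.last (m + 2)) (0 : Fin (m + 2)).castSucc) =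
      av 𝓡 (Fin.last (m + 2)) (0 : Fin (m + 2)).castSucc := by
  refine braidAut_fixed_of_sigma 𝓡 ((addStrandRight (m + 1)).comp (addStrandLeft m)) (fun k => ?_) B
  rw [MonoidHom.comp_apply, addStrandLeft_sigma, addStrandRight_sigma, braidAut_sigma,
    crossHom_av _ _ _ (Fin.castSucc_lt_last _).ne', crossVal]
  have h₁ : (0 : Fin (m + 2)).castSucc ≠ k.succ.castSucc.castSucc := by simp [Fin.ext_iff]
  have h₂ : (0 : Fin (m + 2)).castSucc ≠ k.succ.castSucc.succ := by simp [Fin.ext_iff]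
  have h₃ : Fin.last (m + 2) ≠ k.succ.castSucc.castSucc := (Fin.castSucc_lt_last _).ne'
  have h₄ : Fin.last (m + 2) ≠ k.succ.castSucc.succ := by
    rw [Fin.succ_castSucc]; exact (Fin.castSucc_lt_last _).ne'
  simp only [h₁, h₂, h₃, h₄, if_false]

/-- The block diagonal matrix `diag(1, M)`. -/
def succBlock (M : Matrix (Fin (m + 1)) (Fin (m + 1)) (CordAlg 𝓡 (Fin (m + 1)))) :
    Matrix (Fin (m + 2)) (Fin (m + 2)) (CordAlg 𝓡 (Fin (m + 2))) :=
  Matrix.of (Fin.cons (Fin.cons 1 fun _ => 0) fun i => Fin.cons 0 fun j => cordMap 𝓡 Fin.succ (M i j))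

section SuccBlock

variable (M : Matrix (Fin (m + 1)) (Fin (m + 1)) (CordAlg 𝓡 (Fin (m + 1)))) (i j : Fin (m + 1))

theorem succBlock_zero_zero : succBlock 𝓡 M 0 0 = 1 := rfl
theorem succBlock_zero_succ : succBlock 𝓡 M 0 j.succ = 0 := rfl
theorem succBlock_succ_zero : succBlock 𝓡 M i.succ 0 = 0 := rfl
theorem succBlock_succ_succ : succBlock 𝓡 M i.succ j.succ = cordMap 𝓡 Fin.succ (M i j) := rfl

end SuccBlock

/-- The new strand takes part in no crossing, which gives the block `1`. On the old strands, adding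
a strand on the left commutes with the auxiliary strand on the right, so the old expansion is
shifted by one. -/
theorem PhiL_addStrandLeft (B : BraidGroup m) :
    PhiL 𝓡 (addStrandLeft m B) = succBlock 𝓡 (PhiL 𝓡 B) := by
  refine PhiL_eq 𝓡 _ fun i => ?_
  rw [Fin.sum_univ_succ]
  induction i using Fin.cases with
  | zero =>
    simp only [braidAutExt_addStrandLeft_zero_last, succBlock_zero_zero, succBlock_zero_succ, map_one,
      map_zero, one_mul, zero_mul, Finset.sum_const_zero, add_zero]
  | succ i =>
    have h : (av 𝓡 i.succ.castSucc (Fin.last (m + 2)) : CordAlg 𝓡 (Fin (m + 3))) =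
      cordMap 𝓡 Fin.succ (av 𝓡 i.castSucc (Fin.last (m + 1))) := by rw [cordMap_av]; rfl
    rw [h, braidAutExt, addStrandRight_addStrandLeft, braidAut_addStrandLeft_succ,
      ← braidAutExt, PhiL_spec, map_sum, succBlock_succ_zero, map_zero, zero_mul, zero_add]
    simp only [map_mul, cordMap_succ_cordIncl, succBlock_succ_succ, cordMap_av]
    rfl

theorem PhiR_addStrandLeft (B : BraidGroup m) :
    PhiR 𝓡 (addStrandLeft m B) = succBlock 𝓡 (PhiR 𝓡 B) := by
  refine PhiR_eq 𝓡 _ fun i => ?_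
  rw [Fin.sum_univ_succ]
  induction i using Fin.cases with
  | zero =>
    simp only [braidAutExt_addStrandLeft_last_zero, succBlock_zero_zero, succBlock_succ_zero, map_one,
      map_zero, mul_one, mul_zero, Finset.sum_const_zero, add_zero]
  | succ i =>
    have h : (av 𝓡 (Fin.last (m + 2)) i.succ.castSucc : CordAlg 𝓡 (Fin (m + 3))) =
      cordMap 𝓡 Fin.succ (av 𝓡 (Fin.last (m + 1)) i.castSucc) := by rw [cordMap_av]; rfl
    rw [h, braidAutExt, addStrandRight_addStrandLeft, braidAut_addStrandLeft_succ,
      ← braidAutExt, PhiR_spec, map_sum, succBlock_zero_succ, map_zero, mul_zero, zero_add]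
    simp only [map_mul, cordMap_succ_cordIncl, succBlock_succ_succ, cordMap_av]
    rfl

end LeftStrand

/-! ### Invariance under left stabilization. -/

section Braid

variable {𝓡 : Type} [CommRing 𝓡] {m : ℕ} (mu : 𝓡ˣ) (U V : 𝓡)

/-- The diagonal matrix of the stabilization of a braid: a factor `μ⁻¹` replaces the entry of the
first strand, which is moved to the new strand. -/
def stabTwist (Λ : Fin (m + 1) → 𝓡ˣ) : Fin (m + 2) → 𝓡ˣ :=
  Fin.cons (Λ 0) (Fin.cons mu⁻¹ fun i => Λ i.succ)

theorem stabTwist_zero (Λ : Fin (m + 1) → 𝓡ˣ) : stabTwist mu Λ 0 = Λ 0 := rfl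

theorem stabTwist_one (Λ : Fin (m + 1) → 𝓡ˣ) : stabTwist mu Λ (Fin.succ 0) = mu⁻¹ := rfl

theorem stabTwist_succ (Λ : Fin (m + 1) → 𝓡ˣ) {i : Fin (m + 1)} (h : i ≠ 0) :
    stabTwist mu Λ i.succ = Λ i := by
  obtain ⟨i, rfl⟩ := Fin.exists_succ_eq.2 h
  rfl

theorem leftPath_rowScale (Λ : Fin (m + 1) → 𝓡ˣ)
    (P : Matrix (Fin (m + 1)) (Fin (m + 1)) (CordAlg 𝓡 (Fin (m + 1)))) (i : Fin (m + 1)) :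
    leftPath (rowScale Λ P) i = (Λ i : 𝓡) • leftPath P i := by
  simp only [leftPath, rowScale, Matrix.of_apply, map_smul, smul_mul_assoc, Finset.smul_sum]

theorem rightPath_colScale (Λ : Fin (m + 1) → 𝓡ˣ)
    (Q : Matrix (Fin (m + 1)) (Fin (m + 1)) (CordAlg 𝓡 (Fin (m + 1)))) (j : Fin (m + 1)) :
    rightPath (colScale Λ Q) j = (((Λ j)⁻¹ : 𝓡ˣ) : 𝓡) • rightPath Q j := by
  simp only [rightPath, colScale, Matrix.of_apply, map_smul, mul_smul_comm, Finset.smul_sum]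

theorem braidAut_posStabLeft (B : BraidGroup m) {i j : Fin (m + 2)} (h : i ≠ j) :
    braidAut 𝓡 (m + 1) (posStabLeft B) (av 𝓡 i j) =
      braidAut 𝓡 (m + 1) (addStrandLeft m B) (crossVal 𝓡 0 (Fin.succ 0) i j) := by
  rw [posStabLeft, braidAut_mul, braidAut_sigma]
  exact congrArg _ (crossHom_av 𝓡 _ _ h)

/-- By the chain rule, the matrix of the crossing enters after the automorphism of `B` is applied to
it; its only variable, `a_10`, becomes the path from the first row of `Φ^L_B`. -/
theorem PhiL_posStabLeft (B : BraidGroup m) : PhiL 𝓡 (posStabLeft B) =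
    crossMat 0 (Fin.succ 0) (-leftPath (PhiL 𝓡 B) 0) * succBlock 𝓡 (PhiL 𝓡 B) := by
  rw [posStabLeft, PhiL_mul, PhiL_sigma, PhiL_addStrandLeft, crossMat_map, map_neg]
  congr 3
  exact braidAut_addStrandLeft_to_zero 𝓡 B 0

theorem PhiR_posStabLeft (B : BraidGroup m) : PhiR 𝓡 (posStabLeft B) =
    succBlock 𝓡 (PhiR 𝓡 B) * (crossMat 0 (Fin.succ 0) (-rightPath (PhiR 𝓡 B) 0)).transpose := by
  rw [posStabLeft, PhiR_mul, PhiR_sigma, PhiR_addStrandLeft, Matrix.transpose_map, crossMat_map,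
    map_neg]
  congr 4
  exact braidAut_addStrandLeft_zero 𝓡 B 0

/-- The isolated units in `StabData` are the effect of the factor `μ⁻¹` on the old first strand. The
entry `Λ_0` sits on the new strand, whose row of `Φ^L` is, up to sign, the old first row followed
back through the crossing. -/
theorem stabData (Λ : Fin (m + 1) → 𝓡ˣ) (B : BraidGroup m) :
    StabData mu ((braidAut 𝓡 m B : _ →ₐ[𝓡] _).comp (scaleHom 𝓡 Λ))
      (rowScale Λ (PhiL 𝓡 B)) (colScale Λ (PhiR 𝓡 B))
      ((braidAut 𝓡 (m + 1) (posStabLeft B) : _ →ₐ[𝓡] _).comp (scaleHom 𝓡 (stabTwist mu Λ)))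
      (rowScale (stabTwist mu Λ) (PhiL 𝓡 (posStabLeft B)))
      (colScale (stabTwist mu Λ) (PhiR 𝓡 (posStabLeft B))) := by
  have h01 : (0 : Fin (m + 2)) ≠ Fin.succ 0 := (Fin.succ_ne_zero _).symm
  have hφ : ∀ i j : Fin (m + 2), i ≠ j →
      ((braidAut 𝓡 (m + 1) (posStabLeft B) : _ →ₐ[𝓡] _).comp (scaleHom 𝓡 (stabTwist mu Λ)))
        (av 𝓡 i j) = ((stabTwist mu Λ i * (stabTwist mu Λ j)⁻¹ : 𝓡ˣ) : 𝓡) •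
          braidAut 𝓡 (m + 1) (addStrandLeft m B) (crossVal 𝓡 0 (Fin.succ 0) i j) := fun i j h => by
    rw [AlgHom.comp_apply, scaleHom_av, map_smul]
    exact congrArg _ (braidAut_posStabLeft B h)
  have hψ : ∀ i j, ((braidAut 𝓡 m B : _ →ₐ[𝓡] _).comp (scaleHom 𝓡 Λ)) (av 𝓡 i j) =
      ((Λ i * (Λ j)⁻¹ : 𝓡ˣ) : 𝓡) • braidAut 𝓡 m B (av 𝓡 i j) := fun i j => by
    rw [AlgHom.comp_apply, scaleHom_av, map_smul]; rfl
  have hβ : ∀ i j : Fin (m + 1),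
      braidAut 𝓡 (m + 1) (addStrandLeft m B) (av 𝓡 i.succ j.succ) =
        cordMap 𝓡 Fin.succ (braidAut 𝓡 m B (av 𝓡 i j)) := fun i j => by
    rw [← cordMap_av, braidAut_addStrandLeft_succ]
  have hs : ∀ {i : Fin (m + 1)}, i ≠ 0 → i.succ ≠ (Fin.succ 0 : Fin (m + 2)) := fun h =>
    (Fin.succ_injective _).ne h
  have hP : ∀ i j, rowScale (stabTwist mu Λ) (PhiL 𝓡 (posStabLeft B)) i j =
      (stabTwist mu Λ i : 𝓡) • if i = 0 then -leftPath (PhiL 𝓡 B) 0 * succBlock 𝓡 (PhiL 𝓡 B) 0 j -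
        succBlock 𝓡 (PhiL 𝓡 B) (Fin.succ 0) j else if i = Fin.succ 0 then
          succBlock 𝓡 (PhiL 𝓡 B) 0 j else succBlock 𝓡 (PhiL 𝓡 B) i j := fun i j => by
    rw [rowScale, Matrix.of_apply, PhiL_posStabLeft, crossMat_mul_apply h01]
  have hQ : ∀ i j, colScale (stabTwist mu Λ) (PhiR 𝓡 (posStabLeft B)) i j =
      (((stabTwist mu Λ j)⁻¹ : 𝓡ˣ) : 𝓡) • if j = 0 then
        succBlock 𝓡 (PhiR 𝓡 B) i 0 * -rightPath (PhiR 𝓡 B) 0 -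
        succBlock 𝓡 (PhiR 𝓡 B) i (Fin.succ 0) else if j = Fin.succ 0 then
          succBlock 𝓡 (PhiR 𝓡 B) i 0 else succBlock 𝓡 (PhiR 𝓡 B) i j := fun i j => by
    rw [colScale, Matrix.of_apply, PhiR_posStabLeft, mul_crossMat_apply h01]
  constructor
  case old_old =>
    intro i j hi hj
    by_cases hij : i = j
    · subst hij; rw [av_self, av_self]; simp [map_ofNat]
    rw [hφ _ _ ((Fin.succ_injective _).ne hij), hψ, crossVal]
    simp only [Fin.succ_ne_zero, hs hi, hs hj, if_false, stabTwist_succ mu Λ hi,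
      stabTwist_succ mu Λ hj, hβ, map_smul]
  case one_old =>
    intro j hj
    rw [hφ _ _ (hs hj).symm, crossVal]
    simp only [Fin.succ_ne_zero, hs hj, if_false, if_true, stabTwist_one, stabTwist_succ mu Λ hj,
      braidAut_addStrandLeft_zero, rightPath_colScale, smul_smul, Units.val_mul]
  case old_one =>
    intro i hi
    rw [hφ _ _ (hs hi), crossVal]
    simp only [Fin.succ_ne_zero, hs hi, if_false, if_true, stabTwist_one, stabTwist_succ mu Λ hi,
      braidAut_addStrandLeft_to_zero, leftPath_rowScale, smul_smul, Units.val_mul, inv_inv, mul_comm]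
  case zero_old =>
    intro j hj
    rw [hφ _ _ (Fin.succ_ne_zero _).symm, hψ, crossVal]
    simp only [hs hj, if_false, if_true, stabTwist_zero, stabTwist_succ mu Λ hj, map_sub, map_neg,
      map_mul, hβ, map_smul, braidAut_addStrandLeft_to_zero, braidAut_addStrandLeft_zero,
      leftPath_rowScale, rightPath_colScale, smul_sub, smul_neg, smul_mul_smul_comm, Units.val_mul]
  case old_zero =>
    intro i hi
    rw [hφ _ _ (Fin.succ_ne_zero _), hψ, crossVal]
    simp only [hs hi, Fin.succ_ne_zero, if_false, if_true, stabTwist_zero, stabTwist_succ mu Λ hi,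
      map_sub, map_neg, map_mul, hβ, map_smul, braidAut_addStrandLeft_to_zero,
      braidAut_addStrandLeft_zero, leftPath_rowScale, rightPath_colScale, smul_sub, smul_neg,
      smul_mul_smul_comm, Units.val_mul]
  case zero_one =>
    rw [hφ _ _ h01, crossVal]
    simp only [if_true, stabTwist_zero, stabTwist_one, braidAut_addStrandLeft_to_zero,
      leftPath_rowScale, smul_smul, Units.val_mul, inv_inv, mul_comm]
  case one_zero =>
    rw [hφ _ _ h01.symm, crossVal]
    simp only [h01.symm, if_false, if_true, stabTwist_zero, stabTwist_one,
      braidAut_addStrandLeft_zero, rightPath_colScale, smul_smul, Units.val_mul]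
  case P_zero_zero =>
    rw [hP]
    simp only [if_true, succBlock_zero_zero, succBlock_succ_zero, mul_one, sub_zero, stabTwist_zero,
      leftPath_rowScale, smul_neg]
  case P_zero_succ =>
    intro k
    rw [hP]
    simp only [if_true, succBlock_zero_succ, succBlock_succ_succ, mul_zero, zero_sub, stabTwist_zero,
      rowScale, Matrix.of_apply, map_smul, smul_neg]
  case P_one_zero =>
    rw [hP]
    simp only [h01.symm, if_false, if_true, succBlock_zero_zero, stabTwist_one]
  case P_one_succ =>
    intro k
    rw [hP]
    simp only [h01.symm, if_false, if_true, succBlock_zero_succ, smul_zero]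
  case P_succ_zero =>
    intro i hi
    rw [hP]
    simp only [Fin.succ_ne_zero, hs hi, if_false, succBlock_succ_zero, smul_zero]
  case P_succ_succ =>
    intro i k hi
    rw [hP]
    simp only [Fin.succ_ne_zero, hs hi, if_false, succBlock_succ_succ, stabTwist_succ mu Λ hi,
      rowScale, Matrix.of_apply, map_smul]
  case Q_zero_zero =>
    rw [hQ]
    simp only [if_true, succBlock_zero_zero, succBlock_zero_succ, one_mul, sub_zero, stabTwist_zero,
      rightPath_colScale, smul_neg]
  case Q_succ_zero =>
    intro k
    rw [hQ]
    simp only [if_true, succBlock_succ_zero, succBlock_succ_succ, zero_mul, zero_sub, stabTwist_zero,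
      colScale, Matrix.of_apply, map_smul, smul_neg]
  case Q_zero_one =>
    rw [hQ]
    simp only [h01.symm, if_false, if_true, succBlock_zero_zero, stabTwist_one, inv_inv]
  case Q_succ_one =>
    intro k
    rw [hQ]
    simp only [h01.symm, if_false, if_true, succBlock_succ_zero, smul_zero]
  case Q_zero_succ =>
    intro j hj
    rw [hQ]
    simp only [Fin.succ_ne_zero, hs hj, if_false, succBlock_zero_succ, smul_zero]
  case Q_succ_succ =>
    intro k j hj
    rw [hQ]
    simp only [Fin.succ_ne_zero, hs hj, if_false, succBlock_succ_succ, stabTwist_succ mu Λ hj,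
      colScale, Matrix.of_apply, map_smul]

theorem stableTameIso_braidTwist_posStabLeft (Λ : Fin (m + 1) → 𝓡ˣ) (B : BraidGroup m) :
    PreDGA.StableTameIso (braidTwist mu U V Λ B)
      (braidTwist mu U V (stabTwist mu Λ) (posStabLeft B)) :=
  PreDGA.stableTameIso_of_stab_left _
    ((stabData mu Λ B).tameIso (braidTwist_isDGA mu U V (stabTwist mu Λ) (posStabLeft B)))

theorem writhe_posStabLeft (B : BraidGroup m) : writhe (posStabLeft B) = writhe B + 1 := by
  rw [posStabLeft, writhe_mul, writhe_addStrandLeft, writhe_sigma]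

theorem braidPerm_posStabLeft (B : BraidGroup m) (i : Fin (m + 2)) :
    braidPerm (m + 1) (posStabLeft B) i =
      braidPerm (m + 1) (addStrandLeft m B) (Equiv.swap 0 (Fin.succ 0) i) := by
  rw [posStabLeft, map_mul, Equiv.Perm.mul_apply, braidPerm_sigma]
  rfl

/-- The stabilized DGA carries `λμ^{-w}` on the new strand and `μ⁻¹` on the old first strand.
Sliding the latter onto the new strand gives `λμ^{-w-1}`, as the larger writhe demands. -/
theorem stableTameIso_posStabLeft (lam : 𝓡ˣ) (B : BraidGroup m) :
    PreDGA.StableTameIso (transverseDGA lam mu U V B)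
      (transverseDGA lam mu U V (posStabLeft B)) := by
  rw [transverseDGA_eq, transverseDGA_eq, writhe_posStabLeft]
  refine (stableTameIso_braidTwist_posStabLeft mu U V _ B).trans (PreDGA.TameIso.stableTameIso ?_)
  have e : stabTwist mu (Pi.mulSingle 0 (lam * mu ^ (-writhe B)) : Fin (m + 1) → 𝓡ˣ) =
      Pi.mulSingle 0 (lam * mu ^ (-writhe B)) * Pi.mulSingle (Fin.succ 0) mu⁻¹ := by
    funext i
    induction i using Fin.cases with
    | zero => simp [stabTwist_zero]
    | succ i =>
      by_cases h : i = 0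
      · subst h; rw [stabTwist_one]; simp
      · rw [stabTwist_succ mu _ h]
        have : i.succ ≠ Fin.succ 0 := (Fin.succ_injective _).ne h
        simp only [Pi.mul_apply, Pi.mulSingle_eq_of_ne h, Pi.mulSingle_eq_of_ne (Fin.succ_ne_zero i),
          Pi.mulSingle_eq_of_ne this, one_mul]
  have e' : (Pi.mulSingle 0 (lam * mu ^ (-(writhe B + 1))) : Fin (m + 2) → 𝓡ˣ) =
      Pi.mulSingle 0 (lam * mu ^ (-writhe B)) * Pi.mulSingle 0 mu⁻¹ := by
    rw [← Pi.mulSingle_mul, neg_add, zpow_add, zpow_neg_one, mul_assoc]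
  rw [e, e']
  -- The permutation of the stabilization takes the strand `1` to the strand `0` in a single step.
  refine braidTwist_move mu U V _ mu⁻¹ (posStabLeft B) ⟨1, ?_⟩
  rw [zpow_one, braidPerm_posStabLeft, Equiv.swap_apply_right, braidPerm_addStrandLeft_zero]

end Braid

end

end TransverseHomology
namespace TransverseHomology

noncomputable section

/-! ### The half twist exchanges the two ends of a braid. -/

section HalfTwist

theorem addStrandRight_addStrandRight_comm {m : ℕ} (B : BraidGroup m) :
    Commute (addStrandRight (m + 1) (addStrandRight m B)) (sigma (Fin.last (m + 1))) := by
  induction B using braid_induction with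
  | one => rw [map_one, map_one]; exact Commute.one_left _
  | sigma k =>
    rw [addStrandRight_sigma, addStrandRight_sigma]
    exact sigma_comm _ _ (by simp)
  | mul a b ha hb => rw [map_mul, map_mul]; exact ha.mul_left hb
  | inv a ha => rw [map_inv, map_inv]; exact ha.inv_left

/-- The braid `σ_1 ⋯ σ_m`, in which the last strand crosses all the other ones. -/
def sweep : ∀ m : ℕ, BraidGroup m
  | 0 => 1
  | m + 1 => addStrandRight m (sweep m) * sigma (Fin.last m)

theorem sweep_succ (m : ℕ) : sweep (m + 1) = sigma 0 * addStrandLeft m (sweep m) := by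
  induction m with
  | zero => simp [sweep]
  | succ m ih =>
    have h : sweep (m + 2) = addStrandRight (m + 1) (sweep (m + 1)) * sigma (Fin.last (m + 1)) := rfl
    have h' : sweep (m + 1) = addStrandRight m (sweep m) * sigma (Fin.last m) := rfl
    rw [h, ih, map_mul, addStrandRight_addStrandLeft, ← ih, h', map_mul, addStrandLeft_sigma,
      addStrandRight_sigma, mul_assoc]
    rfl

/-- Moving a generator through the sweep raises its index by one: it commutes with all factors
except two neighbouring ones, and there the braid relation shifts it. -/
theorem sweep_sigma (m : ℕ) (k : Fin m) :
    sweep (m + 1) * sigma k.castSucc = sigma k.succ * sweep (m + 1) := by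
  induction m with
  | zero => exact k.elim0
  | succ m ih =>
    have h : sweep (m + 2) = addStrandRight (m + 1) (sweep (m + 1)) * sigma (Fin.last (m + 1)) := rfl
    induction k using Fin.lastCases with
    | last =>
      have h' : sweep (m + 1) = addStrandRight m (sweep m) * sigma (Fin.last m) := rfl
      have hb := sigma_braid (Fin.last m).castSucc (Fin.last (m + 1)) (by simp)
      have hc := addStrandRight_addStrandRight_comm (sweep m)
      rw [h, h', map_mul, addStrandRight_sigma, Fin.succ_last, mul_assoc, mul_assoc, ← mul_assoc (sigma _),
        hb, ← mul_assoc, ← mul_assoc, hc.eq]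
      simp only [mul_assoc]
    | cast k =>
      have hc : sigma (Fin.last (m + 1)) * sigma k.castSucc.castSucc =
        sigma k.castSucc.castSucc * sigma (Fin.last (m + 1)) := (sigma_comm _ _ (by simp)).symm
      rw [h, mul_assoc, hc, ← mul_assoc, ← addStrandRight_sigma, ← map_mul, ih, map_mul,
        addStrandRight_sigma, mul_assoc, Fin.succ_castSucc]

theorem sweep_addStrandRight {m : ℕ} (B : BraidGroup m) :
    sweep (m + 1) * addStrandRight m B = addStrandLeft m B * sweep (m + 1) := by
  induction B using braid_induction with
  | one => rw [map_one, map_one, one_mul, mul_one]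
  | sigma k => rw [addStrandRight_sigma, addStrandLeft_sigma, sweep_sigma]
  | mul a b ha hb => rw [map_mul, map_mul, ← mul_assoc, ha, mul_assoc, hb, mul_assoc]
  | inv a ha =>
    rw [map_inv, map_inv, eq_inv_mul_iff_mul_eq, ← mul_assoc, ← ha, mul_inv_cancel_right]

/-- The half twist. -/
def halfTwist : ∀ m : ℕ, BraidGroup m
  | 0 => 1
  | m + 1 => sweep (m + 1) * addStrandRight m (halfTwist m)

/-- The inner half twist, on two strands fewer, commutes with the last generator, which completes
the shorter sweep to a full one. The resulting product of two sweeps is rewritten by extracting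
`σ_0` from the first and moving the rest through the second. -/
theorem halfTwist_last (m : ℕ) :
    halfTwist (m + 1) * sigma (Fin.last m) = sigma 0 * halfTwist (m + 1) := by
  cases m with
  | zero => simp [halfTwist, sweep]
  | succ m =>
    have h : halfTwist (m + 2) = sweep (m + 2) * (addStrandRight (m + 1) (sweep (m + 1)) *
      addStrandRight (m + 1) (addStrandRight m (halfTwist m))) := by
        rw [← map_mul]; rfl
    have h' : addStrandRight (m + 1) (sweep (m + 1)) * sigma (Fin.last (m + 1)) = sweep (m + 2) := rfl
    rw [h, mul_assoc, mul_assoc, (addStrandRight_addStrandRight_comm _).eq,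
      ← mul_assoc (addStrandRight _ _) (sigma _), h', ← mul_assoc, ← mul_assoc, ← mul_assoc,
      mul_assoc (sigma 0), sweep_addStrandRight, ← mul_assoc, ← sweep_succ]

/-- The half twist is a sweep after the half twist on one strand fewer; the latter conjugates `B`,
and the sweep then moves the spare strand from the right end to the left end. -/
theorem halfTwist_addStrandRight {m : ℕ} (B : BraidGroup m) :
    halfTwist (m + 1) * addStrandRight m B * (halfTwist (m + 1))⁻¹ =
      addStrandLeft m (halfTwist m * B * (halfTwist m)⁻¹) := by
  have h : halfTwist (m + 1) = sweep (m + 1) * addStrandRight m (halfTwist m) := rfl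
  have e : halfTwist (m + 1) * addStrandRight m B =
      addStrandLeft m (halfTwist m * B * (halfTwist m)⁻¹) * halfTwist (m + 1) := by
    rw [h, ← mul_assoc _ (sweep (m + 1)), ← sweep_addStrandRight, mul_assoc, mul_assoc, ← map_mul,
      ← map_mul, inv_mul_cancel_right]
  rw [e, mul_inv_cancel_right]

/-- The two positive stabilizations are conjugate, up to conjugation of the braid. -/
theorem halfTwist_posStabRight {m : ℕ} (B : BraidGroup m) :
    halfTwist (m + 1) * posStabRight B * (halfTwist (m + 1))⁻¹ =
      posStabLeft (halfTwist m * B * (halfTwist m)⁻¹) := by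
  have h : halfTwist (m + 1) * sigma (Fin.last m) * (halfTwist (m + 1))⁻¹ = sigma 0 := by
    rw [halfTwist_last, mul_inv_cancel_right]
  rw [posStabRight, posStabLeft, ← halfTwist_addStrandRight, ← h]
  group

end HalfTwist

/-! ### The number of components under the moves. -/

section Knot

variable {m : ℕ}

theorem closureIsKnot_conj (B g : BraidGroup m) :
    ClosureIsKnot (g * B * g⁻¹) ↔ ClosureIsKnot B := by
  unfold ClosureIsKnot
  simp only [map_mul, map_inv, Equiv.Perm.sameCycle_conj]
  refine ⟨fun h i j => ?_, fun h i j => h _ _⟩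
  simpa using h (braidPerm m g i) (braidPerm m g j)

theorem braidPerm_posStabLeft_zero (B : BraidGroup m) :
    braidPerm (m + 1) (posStabLeft B) 0 = (braidPerm m B 0).succ := by
  rw [braidPerm_posStabLeft, Equiv.swap_apply_left, braidPerm_addStrandLeft_succ]

theorem braidPerm_posStabLeft_one (B : BraidGroup m) :
    braidPerm (m + 1) (posStabLeft B) (Fin.succ 0) = 0 := by
  rw [braidPerm_posStabLeft, Equiv.swap_apply_right, braidPerm_addStrandLeft_zero]

theorem braidPerm_posStabLeft_succ (B : BraidGroup m) {i : Fin (m + 1)} (h : i ≠ 0) :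
    braidPerm (m + 1) (posStabLeft B) i.succ = (braidPerm m B i).succ := by
  rw [braidPerm_posStabLeft, Equiv.swap_apply_of_ne_of_ne (Fin.succ_ne_zero _)
    ((Fin.succ_injective _).ne h), braidPerm_addStrandLeft_succ]

theorem sameCycle_equivalence {X : Type} (f : Equiv.Perm X) : Equivalence f.SameCycle :=
  ⟨fun _ => Equiv.Perm.SameCycle.refl _ _, fun h => h.symm, fun h h' => h.trans h'⟩

theorem sameCycle_apply {X : Type} (f : Equiv.Perm X) (x : X) : f.SameCycle x (f x) :=
  ⟨1, by simp⟩

/-- The permutation of the stabilization arises by inserting the new strand `0` into a cycle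
directly after the old first strand; collapsing the two strands to one recovers the old cycles. -/
theorem closureIsKnot_posStabLeft (B : BraidGroup m) :
    ClosureIsKnot (posStabLeft B) ↔ ClosureIsKnot B := by
  have e := sameCycle_equivalence (braidPerm (m + 1) (posStabLeft B))
  have e' := sameCycle_equivalence (braidPerm m B)
  constructor
  · intro h i j
    -- `unskip` identifies the strands `0` and `1`, so a step of the new permutation becomes a step
    -- of the old one or no step at all.
    refine sameCycle_induction (r := fun x y =>
      (braidPerm m B).SameCycle (StabGen.unskip x) (StabGen.unskip y)) ⟨fun _ => e'.refl _,
        fun h => e'.symm h, fun h h' => e'.trans h h'⟩ (fun x => ?_) (h i.succ j.succ)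
    induction x using Fin.cases with
    | zero => rw [braidPerm_posStabLeft_zero]; exact sameCycle_apply _ _
    | succ x =>
      by_cases hx : x = 0
      · subst hx
        rw [braidPerm_posStabLeft_one]; exact e'.refl _
      · rw [braidPerm_posStabLeft_succ B hx]; exact sameCycle_apply _ _
  · intro h
    have h1 : (braidPerm (m + 1) (posStabLeft B)).SameCycle (Fin.succ 0) 0 := by
      have := sameCycle_apply (braidPerm (m + 1) (posStabLeft B)) (Fin.succ 0)
      rwa [braidPerm_posStabLeft_one] at this
    have hs : ∀ i j : Fin (m + 1),
        (braidPerm (m + 1) (posStabLeft B)).SameCycle i.succ j.succ := fun i j => by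
      refine sameCycle_induction (r := fun x y : Fin (m + 1) =>
        (braidPerm (m + 1) (posStabLeft B)).SameCycle x.succ y.succ) ⟨fun _ => e.refl _,
          fun h => e.symm h, fun h h' => e.trans h h'⟩ (fun x => ?_) (h i j)
      by_cases hx : x = 0
      · subst hx
        refine e.trans h1 ?_
        rw [← braidPerm_posStabLeft_zero]
        exact sameCycle_apply _ _
      · rw [← braidPerm_posStabLeft_succ B hx]; exact sameCycle_apply _ _
    have h0 : ∀ x, (braidPerm (m + 1) (posStabLeft B)).SameCycle x (Fin.succ 0) := fun x => by
      induction x using Fin.cases with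
      | zero => exact h1.symm
      | succ x => exact hs x 0
    exact fun x y => (h0 x).trans (h0 y).symm

theorem closureIsKnot_posStabRight (B : BraidGroup m) :
    ClosureIsKnot (posStabRight B) ↔ ClosureIsKnot B := by
  rw [← closureIsKnot_conj _ (halfTwist (m + 1)), halfTwist_posStabRight, closureIsKnot_posStabLeft,
    closureIsKnot_conj]

end Knot

/-! ### Invariance for arbitrary sequences of moves. -/

section Moves

variable {𝓡 : Type} [CommRing 𝓡] (mu : 𝓡ˣ) (U V : 𝓡) (lam : 𝓡ˣ)

/-- The half twist is applied to `B`, the result is stabilized on the left, and the half twist on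
one strand more identifies this with a conjugate of the right stabilization. -/
theorem stableTameIso_posStabRight {m : ℕ} (B : BraidGroup m) (hB : ClosureIsKnot B) :
    PreDGA.StableTameIso (transverseDGA lam mu U V B)
      (transverseDGA lam mu U V (posStabRight B)) := by
  have h1 := (transverseDGA_conj mu U V lam B (halfTwist m) hB).stableTameIso
  have h2 := stableTameIso_posStabLeft mu U V lam (halfTwist m * B * (halfTwist m)⁻¹)
  have h3 := (transverseDGA_conj mu U V lam (posStabRight B) (halfTwist (m + 1))
    ((closureIsKnot_posStabRight B).2 hB)).stableTameIso
  rw [halfTwist_posStabRight] at h3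
  exact (h1.trans h2).trans h3.symm

/-- The knot condition is carried along in both directions: a chain of moves may run backwards, and
conjugation invariance is used for each intermediate braid. -/
theorem transverseMove_invariance {x y : Σ m, BraidGroup m} (h : TransverseMove x y) :
    (ClosureIsKnot x.2 ↔ ClosureIsKnot y.2) ∧ (ClosureIsKnot x.2 →
      PreDGA.StableTameIso (transverseDGA lam mu U V x.2) (transverseDGA lam mu U V y.2)) := by
  cases h with
  | conj B g => exact ⟨(closureIsKnot_conj B g).symm, fun hB =>
      (transverseDGA_conj mu U V lam B g hB).stableTameIso⟩
  | stabRight B => exact ⟨(closureIsKnot_posStabRight B).symm, fun hB =>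
      stableTameIso_posStabRight mu U V lam B hB⟩
  | stabLeft B => exact ⟨(closureIsKnot_posStabLeft B).symm, fun _ =>
      stableTameIso_posStabLeft mu U V lam B⟩

theorem transverseLink_invariance {m m' : ℕ} {B : BraidGroup m} {B' : BraidGroup m'}
    (h : transverseLink B = transverseLink B') (hB : ClosureIsKnot B) :
    PreDGA.StableTameIso (transverseDGA lam mu U V B) (transverseDGA lam mu U V B') := by
  have key : ∀ x y, Relation.EqvGen TransverseMove x y →
      (ClosureIsKnot x.2 ↔ ClosureIsKnot y.2) ∧ (ClosureIsKnot x.2 →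
        PreDGA.StableTameIso (transverseDGA lam mu U V x.2) (transverseDGA lam mu U V y.2)) := by
    intro x y h
    induction h with
    | rel x y h => exact transverseMove_invariance mu U V lam h
    | refl x => exact ⟨Iff.rfl, fun _ => PreDGA.StableTameIso.refl _⟩
    | symm x y _ ih => exact ⟨ih.1.symm, fun hy => (ih.2 (ih.1.2 hy)).symm⟩
    | trans x y z _ _ ih ih' =>
      exact ⟨ih.1.trans ih'.1, fun hx => (ih.2 hx).trans (ih'.2 (ih.1.1 hx))⟩
  exact (key _ _ (Quot.eqvGen_exact h)).2 hB

end Moves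

end

end TransverseHomology
namespace TransverseHomology

noncomputable section

/-! ### Change of the coefficient ring and the specialization `U = V = 1`. -/

section CoeffMap

variable {𝓡 𝓢 : Type} [CommRing 𝓡] [CommRing 𝓢] (f : 𝓡 →+* 𝓢)

/-- Extension of scalars of a free algebra. -/
def coeffMap (X : Type) : FreeAlgebra 𝓡 X →+* FreeAlgebra 𝓢 X :=
  letI : Algebra 𝓡 𝓢 := f.toAlgebra
  (FreeAlgebra.lift 𝓡 fun y => FreeAlgebra.ι 𝓢 y : FreeAlgebra 𝓡 X →ₐ[𝓡] FreeAlgebra 𝓢 X)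

theorem coeffMap_ι {X : Type} (x : X) : coeffMap f X (FreeAlgebra.ι 𝓡 x) = FreeAlgebra.ι 𝓢 x := by
  let : Algebra 𝓡 𝓢 := f.toAlgebra
  exact FreeAlgebra.lift_ι_apply _ x

theorem coeffMap_algebraMap {X : Type} (r : 𝓡) :
    coeffMap f X (algebraMap 𝓡 _ r) = algebraMap 𝓢 _ (f r) := by
  let : Algebra 𝓡 𝓢 := f.toAlgebra
  exact (FreeAlgebra.lift 𝓡 fun y => FreeAlgebra.ι 𝓢 y :
    FreeAlgebra 𝓡 X →ₐ[𝓡] FreeAlgebra 𝓢 X).commutes r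

theorem coeffMap_comm {X Y : Type} {g : FreeAlgebra 𝓡 X →ₐ[𝓡] FreeAlgebra 𝓡 Y}
    {g' : FreeAlgebra 𝓢 X →ₐ[𝓢] FreeAlgebra 𝓢 Y}
    (h : ∀ x, coeffMap f Y (g (FreeAlgebra.ι 𝓡 x)) = g' (FreeAlgebra.ι 𝓢 x))
    (w : FreeAlgebra 𝓡 X) : coeffMap f Y (g w) = g' (coeffMap f X w) := by
  induction w using FreeAlgebra.induction with
  | grade0 r => rw [AlgHom.commutes, coeffMap_algebraMap, coeffMap_algebraMap, AlgHom.commutes]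
  | grade1 x => rw [h, coeffMap_ι]
  | mul u v hu hv => rw [map_mul, map_mul, map_mul, map_mul, hu, hv]
  | add u v hu hv => rw [map_add, map_add, map_add, map_add, hu, hv]

section

variable {I : Type} [DecidableEq I]

theorem coeffMap_av (i j : I) : coeffMap f _ (av 𝓡 i j) = av 𝓢 i j := by
  unfold av
  split_ifs
  · exact coeffMap_ι f _
  · rw [map_neg, map_ofNat]

theorem coeffMap_crossHom (p q : I) (x : CordAlg 𝓡 I) :
    coeffMap f _ (crossHom 𝓡 p q x) = crossHom 𝓢 p q (coeffMap f _ x) := by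
  refine coeffMap_comm f (fun x => ?_) x
  rw [crossHom, crossHom, FreeAlgebra.lift_ι_apply, FreeAlgebra.lift_ι_apply, crossVal, crossVal]
  split_ifs <;> simp only [map_sub, map_neg, map_mul, coeffMap_av]

end

variable {m : ℕ}

theorem coeffMap_braidAut (B : BraidGroup m) (x : CordAlg 𝓡 (Fin (m + 1))) :
    coeffMap f _ (braidAut 𝓡 m B x) = braidAut 𝓢 m B (coeffMap f _ x) := by
  induction B using braid_induction generalizing x with
  | one => rw [braidAut_one, braidAut_one]
  | sigma k => rw [braidAut_sigma, braidAut_sigma, coeffMap_crossHom]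
  | mul a b ha hb => rw [braidAut_mul, braidAut_mul, ha, hb]
  | inv a ha =>
    have := ha (braidAut 𝓡 m a⁻¹ x)
    rw [braidAut_apply_inv] at this
    rw [this, braidAut_inv_apply]

theorem coeffMap_cordIncl (x : CordAlg 𝓡 (Fin (m + 1))) :
    coeffMap f _ (cordIncl 𝓡 m x) = cordIncl 𝓢 m (coeffMap f _ x) := by
  refine coeffMap_comm f (fun x => ?_) x
  rw [cordIncl, cordIncl, FreeAlgebra.lift_ι_apply, FreeAlgebra.lift_ι_apply, coeffMap_av]

/-- The braid action has integral coefficients, so extension of scalars takes the defining expansion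
to an expansion over the new ring, and that expansion is unique. -/
theorem PhiL_coeffMap (B : BraidGroup m) : PhiL 𝓢 B = (PhiL 𝓡 B).map (coeffMap f _) := by
  refine PhiL_eq 𝓢 B fun i => ?_
  rw [braidAutExt, ← coeffMap_av f, ← coeffMap_braidAut, ← braidAutExt, PhiL_spec, map_sum]
  simp only [map_mul, coeffMap_cordIncl, coeffMap_av, Matrix.map_apply]

theorem PhiR_coeffMap (B : BraidGroup m) : PhiR 𝓢 B = (PhiR 𝓡 B).map (coeffMap f _) := by
  refine PhiR_eq 𝓢 B fun i => ?_
  rw [braidAutExt, ← coeffMap_av f, ← coeffMap_braidAut, ← braidAutExt, PhiR_spec, map_sum]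
  simp only [map_mul, coeffMap_cordIncl, coeffMap_av, Matrix.map_apply]

/-- Extension of scalars followed by the exchange of the generators `e_ij` and `f_ij`. -/
def coeffSwap (m : ℕ) : TAlg 𝓡 m →+* TAlg 𝓢 m :=
  ((FreeAlgebra.lift 𝓢 fun x => FreeAlgebra.ι 𝓢 (TGen.swapEF (Fin (m + 1)) x) :
    TAlg 𝓢 m →ₐ[𝓢] TAlg 𝓢 m) : TAlg 𝓢 m →+* TAlg 𝓢 m).comp (coeffMap f _)

theorem coeffSwap_ι (x : TGen (Fin (m + 1))) :
    coeffSwap f m (FreeAlgebra.ι 𝓡 x) = FreeAlgebra.ι 𝓢 (TGen.swapEF (Fin (m + 1)) x) := by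
  rw [coeffSwap, RingHom.comp_apply, coeffMap_ι]
  exact FreeAlgebra.lift_ι_apply _ x

theorem coeffSwap_algebraMap (r : 𝓡) :
    coeffSwap f m (algebraMap 𝓡 _ r) = algebraMap 𝓢 _ (f r) := by
  rw [coeffSwap, RingHom.comp_apply, coeffMap_algebraMap]
  exact AlgHom.commutes _ _

theorem coeffSwap_smul (r : 𝓡) (w : TAlg 𝓡 m) :
    coeffSwap f m (r • w) = f r • coeffSwap f m w := by
  rw [Algebra.smul_def, Algebra.smul_def, map_mul, coeffSwap_algebraMap]

theorem coeffSwap_cordToT (x : CordAlg 𝓡 (Fin (m + 1))) :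
    coeffSwap f m (cordToT 𝓡 m x) = cordToT 𝓢 m (coeffMap f _ x) := by
  induction x using FreeAlgebra.induction with
  | grade0 r => rw [AlgHom.commutes, coeffSwap_algebraMap, coeffMap_algebraMap, AlgHom.commutes]
  | grade1 x =>
    rw [coeffMap_ι, cordToT, cordToT, FreeAlgebra.lift_ι_apply, FreeAlgebra.lift_ι_apply, coeffSwap_ι]
    rfl
  | mul u v hu hv => rw [map_mul, map_mul, map_mul, map_mul, hu, hv]
  | add u v hu hv => rw [map_add, map_add, map_add, map_add, hu, hv]

theorem coeffSwap_cordToT_map (M : Matrix (Fin (m + 1)) (Fin (m + 1)) (CordAlg 𝓡 (Fin (m + 1)))) :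
    (M.map (cordToT 𝓡 m)).map (coeffSwap f m) = (M.map (coeffMap f _)).map (cordToT 𝓢 m) := by
  ext i j
  exact coeffSwap_cordToT f _

theorem coeffSwap_triMatrix (x δ y : 𝓡) (M : Matrix (Fin (m + 1)) (Fin (m + 1)) (TAlg 𝓡 m)) :
    (triMatrix x δ y M).map (coeffSwap f m) =
      triMatrix (f x) (f δ) (f y) (M.map (coeffSwap f m)) := by
  ext i j
  simp only [triMatrix, Matrix.map_apply, Matrix.of_apply]
  split_ifs
  · exact coeffSwap_smul f _ _
  · exact coeffSwap_algebraMap f _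
  · exact coeffSwap_smul f _ _

theorem cordToT_triMatrix {𝓡 : Type} [CommRing 𝓡] (x δ y : 𝓡) :
    (triMatrix x δ y (cordMatrix 𝓡 m)).map (cordToT 𝓡 m) =
      triMatrix x δ y ((cordMatrix 𝓡 m).map (cordToT 𝓡 m)) := by
  ext i j
  simp only [triMatrix, Matrix.map_apply, Matrix.of_apply]
  split_ifs
  · exact map_smul _ _ _
  · exact AlgHom.commutes _ _
  · exact map_smul _ _ _

theorem coeffSwap_cornerMatrix (u : 𝓡ˣ) :
    (cornerMatrix m u).map (coeffSwap f m) = cornerMatrix m (Units.map (f : 𝓡 →* 𝓢) u) := by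
  ext i j
  simp only [cornerMatrix, Matrix.map_apply, Matrix.diagonal_apply]
  split_ifs
  · exact coeffSwap_algebraMap f _
  · exact map_one _
  · exact map_zero _

theorem coeffSwap_bMatrix : (bMatrix 𝓡 m).map (coeffSwap f m) = bMatrix 𝓢 m := by
  ext i j
  simp only [bMatrix, Matrix.map_apply, Matrix.of_apply]
  split_ifs
  · exact coeffSwap_ι f _
  · exact map_zero _

theorem coeffSwap_cMatrix : (cMatrix 𝓡 m).map (coeffSwap f m) = cMatrix 𝓢 m := by
  ext i j
  exact coeffSwap_ι f _

theorem coeffSwap_dMatrix : (dMatrix 𝓡 m).map (coeffSwap f m) = dMatrix 𝓢 m := by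
  ext i j
  exact coeffSwap_ι f _

theorem coeffMap_cordMatrix : (cordMatrix 𝓡 m).map (coeffMap f _) = cordMatrix 𝓢 m := by
  ext i j
  exact coeffMap_av f _ _

theorem corner_conj_apply (u v : 𝓡ˣ) (M : Matrix (Fin (m + 1)) (Fin (m + 1)) (TAlg 𝓡 m))
    (i j : Fin (m + 1)) : (cornerMatrix m u * M * cornerMatrix m v) i j =
      (if i = 0 then algebraMap 𝓡 _ (u : 𝓡) else 1) * M i j *
        (if j = 0 then algebraMap 𝓡 _ (v : 𝓡) else 1) := by
  rw [cornerMatrix, cornerMatrix, Matrix.mul_diagonal, Matrix.diagonal_mul]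

/-- At `U = V = 1` the transverse DGA becomes the framed knot DGA. -/
theorem baseChange_transverseDGA {lam mu : 𝓡ˣ} {U V : 𝓡} {lam' mu' : 𝓢ˣ}
    (hlam : Units.map (f : 𝓡 →* 𝓢) lam = lam') (hmu : Units.map (f : 𝓡 →* 𝓢) mu = mu')
    (hU : f U = 1) (hV : f V = 1) (B : BraidGroup m) :
    ((transverseDGA lam mu U V B).baseChange f).IsRelabelling (framedDGA lam' mu' B)
      (TGen.swapEF (Fin (m + 1))) := by
  have hmu' : f (mu : 𝓡) = mu' := by rw [← hmu]; rfl
  have hL : ∀ k : ℤ, Units.map (f : 𝓡 →* 𝓢) (lam * mu ^ k) = lam' * mu' ^ k := fun k => by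
    rw [map_mul, map_zpow, hlam, hmu]
  have hmul : ∀ M N : Matrix (Fin (m + 1)) (Fin (m + 1)) (TAlg 𝓡 m),
      (M * N).map (coeffSwap f m) = M.map (coeffSwap f m) * N.map (coeffSwap f m) :=
    fun M N => Matrix.map_mul
  have happ : ∀ (M : Matrix (Fin (m + 1)) (Fin (m + 1)) (TAlg 𝓡 m)) i j,
      coeffSwap f m (M i j) = M.map (coeffSwap f m) i j := fun _ _ _ => rfl
  have hsub : ∀ M N : Matrix (Fin (m + 1)) (Fin (m + 1)) (TAlg 𝓡 m),
      (M - N).map (coeffSwap f m) = M.map (coeffSwap f m) - N.map (coeffSwap f m) :=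
    fun M N => Matrix.map_sub _ (map_sub _) M N
  have hφ : ((cordMatrix 𝓡 m).map (braidAut 𝓡 m B)).map (coeffMap f _) =
      (cordMatrix 𝓢 m).map (braidAut 𝓢 m B) := by
    ext i j
    simp only [Matrix.map_apply, coeffMap_braidAut]
    rw [cordMatrix, cordMatrix, Matrix.of_apply, Matrix.of_apply, coeffMap_av]
  refine PreDGA.isRelabelling_of_gen _ (by rintro (_ | _ | _ | _ | _ | _) <;> rfl) fun x => ?_
  -- Relabelling after extension of scalars is `coeffSwap` by definition, so both sides can be
  -- computed with ring homomorphisms entry by entry.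
  have hx : ∀ w : TAlg 𝓡 m, PreDGA.relabel (S := (transverseDGA lam mu U V B).baseChange f)
      (T := framedDGA lam' mu' B) (TGen.swapEF (Fin (m + 1))) (coeffMap f _ w) =
        coeffSwap f m w := fun _ => rfl
  refine (hx _).trans ?_
  rcases x with ⟨i, j, h⟩ | ⟨i, j, h⟩ | ⟨i, j⟩ | ⟨i, j⟩ | ⟨i, j⟩ | ⟨i, j⟩
  · exact map_zero _
  · change coeffSwap f m (((cordMatrix 𝓡 m).map (cordToT 𝓡 m) -
        cornerMatrix m (lam * mu ^ (-writhe B)) *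
          ((cordMatrix 𝓡 m).map (braidAut 𝓡 m B)).map (cordToT 𝓡 m) *
          cornerMatrix m (lam * mu ^ (-writhe B))⁻¹) i j) =
      if j < i then
        ((triMatrix (1 : 𝓢) (-1 - mu') (mu' : 𝓢) (cordMatrix 𝓢 m)).map (cordToT 𝓢 m) -
          cornerMatrix m (lam' * mu' ^ (-writhe B)) *
            ((triMatrix (1 : 𝓢) (-1 - mu') (mu' : 𝓢) (cordMatrix 𝓢 m)).map
              (braidAut 𝓢 m B)).map (cordToT 𝓢 m) *
            cornerMatrix m (lam' * mu' ^ (-writhe B))⁻¹) i j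
      else ((mu'⁻¹ : 𝓢ˣ) : 𝓢) •
        ((triMatrix (1 : 𝓢) (-1 - mu') (mu' : 𝓢) (cordMatrix 𝓢 m)).map (cordToT 𝓢 m) -
          cornerMatrix m (lam' * mu' ^ (-writhe B)) *
            ((triMatrix (1 : 𝓢) (-1 - mu') (mu' : 𝓢) (cordMatrix 𝓢 m)).map
              (braidAut 𝓢 m B)).map (cordToT 𝓢 m) *
            cornerMatrix m (lam' * mu' ^ (-writhe B))⁻¹) i j
    rw [happ, hsub, hmul, hmul, coeffSwap_cordToT_map, coeffSwap_cordToT_map, coeffMap_cordMatrix,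
      coeffSwap_cornerMatrix, coeffSwap_cornerMatrix, map_inv, hL, hφ]
    -- The generators `b_ij` have `i ≠ j`, where the framed matrix differs from `𝐀` only by the
    -- factor `1` or `μ`; above the diagonal this `μ` cancels against the `μ⁻¹` in the framed
    -- differential.
    have e : ∀ x δ y : 𝓢, triMatrix x δ y (cordMatrix 𝓢 m) i j =
        (if j < i then x else y) • cordMatrix 𝓢 m i j := fun x δ y => by
      rw [triMatrix, Matrix.of_apply, if_neg h]; split_ifs <;> rfl
    simp only [Matrix.sub_apply, corner_conj_apply, Matrix.map_apply, e, map_smul, mul_smul_comm,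
      smul_mul_assoc, ← smul_sub]
    by_cases hij : j < i
    · rw [if_pos hij, if_pos hij, one_smul]
    · rw [if_neg hij, if_neg hij, smul_smul, Units.inv_mul, one_smul]
  · dsimp only [transverseDGA, framedDGA, TGen.swapEF, Equiv.coe_fn_mk]
    rw [happ, hsub, hmul, hmul, coeffSwap_triMatrix, coeffSwap_triMatrix, coeffSwap_cordToT_map,
      coeffSwap_cordToT_map, coeffMap_cordMatrix, coeffSwap_cornerMatrix, hL, ← PhiL_coeffMap,
      cordToT_triMatrix]
    simp only [map_one, map_sub, map_neg, map_mul, hU, hV, hmu', mul_one]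
    rfl
  · dsimp only [transverseDGA, framedDGA, TGen.swapEF, Equiv.coe_fn_mk]
    rw [happ, hsub, hmul, hmul, coeffSwap_triMatrix, coeffSwap_triMatrix, coeffSwap_cordToT_map,
      coeffSwap_cordToT_map, coeffMap_cordMatrix, coeffSwap_cornerMatrix, map_inv, hL,
      ← PhiR_coeffMap, cordToT_triMatrix]
    simp only [map_one, map_sub, map_neg, map_mul, hU, hV, hmu', mul_one]
    rfl
  -- The boundary of `𝐄` contains `Φ^L`, as does the framed boundary of `𝐅`; the same holds with the
  -- names exchanged and `Φ^R` in the last case.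
  · dsimp only [transverseDGA, framedDGA, TGen.swapEF, Equiv.coe_fn_mk]
    rw [happ, hsub, hsub, hmul, hmul, coeffSwap_triMatrix, coeffSwap_bMatrix, coeffSwap_cMatrix,
      coeffSwap_dMatrix, coeffSwap_cordToT_map, coeffSwap_cornerMatrix, hL, ← PhiL_coeffMap]
    simp only [map_one, map_zero, map_mul, hU, hmu', mul_one]
    rfl
  · dsimp only [transverseDGA, framedDGA, TGen.swapEF, Equiv.coe_fn_mk]
    rw [happ, hsub, hsub, hmul, hmul, coeffSwap_triMatrix, coeffSwap_bMatrix, coeffSwap_cMatrix,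
      coeffSwap_dMatrix, coeffSwap_cordToT_map, coeffSwap_cornerMatrix, map_inv, hL,
      ← PhiR_coeffMap]
    simp only [map_zero, hV, hmu']
    rfl

end CoeffMap

theorem map_evalUVOne_lamUV :
    Units.map (evalUVOne : BaseRingUV →* BaseRing) lamUV = lamR :=
  Units.ext (MvPolynomial.eval_C _)

theorem map_evalUVOne_muUV :
    Units.map (evalUVOne : BaseRingUV →* BaseRing) muUV = muR :=
  Units.ext (MvPolynomial.eval_C _)

theorem evalUVOne_X (i : Fin 2) : evalUVOne (MvPolynomial.X i) = 1 := by
  rw [evalUVOne, MvPolynomial.eval_X]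

theorem CTminus_isDGA {m : ℕ} (B : BraidGroup m) : (CTminus B).IsDGA := by
  unfold CTminus
  rw [transverseDGA_eq]
  exact braidTwist_isDGA _ _ _ _ B

theorem CTminus_conj {m : ℕ} (B g : BraidGroup m) (hB : ClosureIsKnot B) :
    (CTminus B).StableTameIso (CTminus (g * B * g⁻¹)) := by
  unfold CTminus
  exact (transverseDGA_conj _ _ _ _ B g hB).stableTameIso

theorem CTminus_posStabRight {m : ℕ} (B : BraidGroup m) (hB : ClosureIsKnot B) :
    (CTminus B).StableTameIso (CTminus (posStabRight B)) := by
  unfold CTminus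
  exact stableTameIso_posStabRight _ _ _ _ B hB

theorem CTminus_posStabLeft {m : ℕ} (B : BraidGroup m) :
    (CTminus B).StableTameIso (CTminus (posStabLeft B)) := by
  unfold CTminus
  exact stableTameIso_posStabLeft _ _ _ _ B

theorem CTminus_invariance {m m' : ℕ} {B : BraidGroup m} {B' : BraidGroup m'}
    (h : transverseLink B = transverseLink B') (hB : ClosureIsKnot B) :
    (CTminus B).StableTameIso (CTminus B') := by
  unfold CTminus
  exact transverseLink_invariance _ _ _ _ h hB

theorem baseChange_CTminus {m : ℕ} (B : BraidGroup m) :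
    ((CTminus B).baseChange evalUVOne).IsRelabelling (CCframed B) (TGen.swapEF (Fin (m + 1))) := by
  have h := baseChange_transverseDGA (𝓡 := BaseRingUV) (𝓢 := BaseRing) (m := m) (lam := lamUV)
    (mu := muUV) (U := MvPolynomial.X 0) (V := MvPolynomial.X 1) (lam' := lamR) (mu' := muR)
    evalUVOne map_evalUVOne_lamUV map_evalUVOne_muUV (evalUVOne_X 0) (evalUVOne_X 1) B
  unfold CTminus CCframed
  exact h

end

end TransverseHomology

theorem theorem1p2 {m : ℕ} (B : TransverseHomology.BraidGroup m)
    (hB : TransverseHomology.ClosureIsKnot B) :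
    (TransverseHomology.CTminus B).IsDGA ∧
    (∀ g : TransverseHomology.BraidGroup m,
      (TransverseHomology.CTminus B).StableTameIso
        (TransverseHomology.CTminus (g * B * g⁻¹))) ∧
    (TransverseHomology.CTminus B).StableTameIso
      (TransverseHomology.CTminus (TransverseHomology.posStabRight B)) ∧
    (TransverseHomology.CTminus B).StableTameIso
      (TransverseHomology.CTminus (TransverseHomology.posStabLeft B)) ∧
    (∀ (m' : ℕ) (B' : TransverseHomology.BraidGroup m'),
      TransverseHomology.transverseLink B = TransverseHomology.transverseLink B' →
        (TransverseHomology.CTminus B).StableTameIso (TransverseHomology.CTminus B') ∧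
        (TransverseHomology.CTminus B).HomologyIso (TransverseHomology.CTminus B')) ∧
    ((TransverseHomology.CTminus B).baseChange TransverseHomology.evalUVOne).IsRelabelling
      (TransverseHomology.CCframed B) (TransverseHomology.TGen.swapEF (Fin (m + 1))) := by
  exact ⟨TransverseHomology.CTminus_isDGA B,
    fun g => TransverseHomology.CTminus_conj B g hB,
    TransverseHomology.CTminus_posStabRight B hB, TransverseHomology.CTminus_posStabLeft B,
    fun _ B' h => ⟨TransverseHomology.CTminus_invariance h hB,
      (TransverseHomology.CTminus_invariance h hB).homologyIso
        (TransverseHomology.CTminus_isDGA B) (TransverseHomology.CTminus_isDGA B')⟩,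
    TransverseHomology.baseChange_CTminus B⟩
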